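/- Let $\mathfrak a>0$, let $\chi\in C_c^\infty(\mathbb R^3)$ be real-valued with $\chi(x)=1$ for $|x|\le 2$ and $\chi(x)=0$ for $|x|>4$, and let $\varphi\in C^\infty_c(\mathbb R^3)$ be real-valued with $\varphi(x)=1/2$ for $|x|\le 1$, $\varphi(x)=0$ for $|x|>2$ and $\int\varphi=1$. Write $\chi_r(x)=\chi(x/r)$. For $\rho,\varepsilon,\delta>0$ put $\ell=\mathfrak a(\rho\mathfrak a^3)^{-\delta}$ and $\ell_0=(\rho\mathfrak a)^{-1/2}(\rho\mathfrak a^3)^{-\varepsilon}$. Let $f(x)=1-\mathfrak a/|x|$ for $|x|\ge\mathfrak a$, $f(x)=0$ for $|x|<\mathfrak a$, and $f_\ell=\chi_\ell f+(1-\chi_\ell)$, $\omega_\ell=1-f_\ell$. Let $\Lambda=[-L/2,L/2]^3$ with periodic boundary conditions, $\Lambda^*=\frac{2\pi}{L}\mathbb Z^3$, and let $\widehat h_p=\int_\Lambda h(x)e^{-ip\cdot x}dx$ for $p\in\Lambda^*$; all norms, integrals and convolutions below are on $\Lambda$. For $0<\rho_0<\rho$ and $0\ne p\in\Lambda^*$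 set $\widehat V(p)=8\pi\sin(|p|\mathfrak a)/|p|$, $D_p=p^2+\rho_0\widehat V(p)-\sqrt{|p|^4+2p^2\rho_0\widehat V(p)}$ and $$\widehat s_p=-\,\mathrm{sgn}\big(\widehat V(p)\big)\,\frac{D_p}{\sqrt{\rho_0^2\widehat V(p)^2-D_p^2}},\qquad \widehat s_0=0$$ (with $\widehat s_p=0$ if $\widehat V(p)=0$). Let $s$ be the function on $\Lambda$ with Fourier coefficients $\widehat s_p$, and $g-\mathbb 1$ the one with Fourier coefficients $\sqrt{1+\widehat s_p^{\,2}}-1$. Define $$\tilde\sigma(x)=\frac{\chi_{\ell_0}(2x)(1-\chi_\ell(2x))}{f_\ell(x)}\big[\rho_0\omega_\ell(x)+s(x)\big],\qquad \sigma(x)=\tilde\sigma(x)-\ell_0^{-3}\Big(\int\tilde\sigma\Big)\varphi(x/\ell_0),$$ $$\theta=-\rho_0\omega_\ell+f_\ell\tilde\sigma,\qquad \widetilde E_\rho=\|\nabla\theta\|_2^2+16\pi\mathfrak a\rho_0\|s\|_2^2+8\pi\mathfrak a\rho_0\big((g-\mathbb 1)*s\big)(0).$$ Then for all sufficiently small $\varepsilon,\delta>0$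 and all constants $0<C_1<C_2$ there is a constant $C>0$ (depending only on $\mathfrak a,\chi,\varphi,\varepsilon,\delta,C_1,C_2$) such that, for all sufficiently small $\rho>0$, all sufficiently large $L$ (depending on $\rho$), and every $0<\rho_0<\rho$ with $$\rho+C_1\rho^{7/4-11\varepsilon-\delta}\le\rho_0+\|\sigma\|_2^2\le\rho+C_2\rho^{7/4-11\varepsilon-\delta},$$ the function $\theta$ lies in $H^1(\Lambda)$ and $$\widetilde E_\rho\le 4\pi\mathfrak a\rho^2\Big[1+\frac{128}{15\sqrt\pi}(\rho\mathfrak a^3)^{1/2}\Big]+C\rho^{5/2+\varepsilon}.$$ -/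

import Mathlib

open MeasureTheory
open scoped ENNReal ContDiff

noncomputable section

namespace HardSphere

/-- Three-dimensional Euclidean space. -/
abbrev E3 := EuclideanSpace ℝ (Fin 3)

/-- The box `[-L/2, L/2]³`. Functions on the torus `Λ` of side `L` are represented by functions on
`ℝ³`, of which only the values on this box are used (unless the function is `L`-periodic). -/
def box (L : ℝ) : Set E3 := {x | ∀ i, x i ∈ Set.Icc (-(L / 2)) (L / 2)}

/-- The momentum `p = 2π n / L` of the dual lattice `Λ* = 2π ℤ³ / L`. -/
def momentum (L : ℝ) (n : Fin 3 → ℤ) : E3 := WithLp.toLp 2 fun i => 2 * Real.pi * (n i : ℝ) / L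

/-- The `L`-periodic real function on `ℝ³` whose Fourier coefficients
`∫_Λ h(x) exp(-i p · x) dx`, at `p = 2π n / L`, are `c n`, for real, square-summable `c` with
`c (-n) = c n`. It is `L⁻³ ∑ₙ c n exp(i p · x)`, with convergence in `L²`; the sum is real almost
everywhere because `c` is real and even. -/
def ofCoeff (L : ℝ) (c : (Fin 3 → ℤ) → ℝ) (x : E3) : ℝ :=
  (L ^ 3)⁻¹ *
    ((∑' n : Fin 3 → ℤ, (c n : ℂ) • UnitAddTorus.mFourierLp 2 n)
      (fun i => ((x i / L : ℝ) : UnitAddCircle))).re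

/-- Squared `L²(Λ)` norm. -/
def normSq (L : ℝ) (u : E3 → ℝ) : ℝ := ∫ x in box L, u x ^ 2

/-- Convolution on the torus (`u` is `L`-periodic). -/
def conv (L : ℝ) (u v : E3 → ℝ) (x : E3) : ℝ := ∫ y in box L, u (x - y) * v y

/-- `G` is the weak gradient of `u` on the torus of side `L`, both being square integrable: the test
functions are the smooth `L`-periodic functions. -/
structure IsWeakGradient (L : ℝ) (u : E3 → ℝ) (G : E3 → E3) : Prop where
  memLp : MemLp u 2 (volume.restrict (box L))
  memLp_grad : MemLp G 2 (volume.restrict (box L))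
  integral_eq : ∀ ψ : E3 → ℝ, ContDiff ℝ ∞ ψ →
    (∀ (x : E3) (i : Fin 3), ψ (x + EuclideanSpace.single i L) = ψ x) →
    ∫ x in box L, u x • gradient ψ x = -∫ x in box L, ψ x • G x

/-- `‖∇u‖₂²` on the torus, as an extended number. Weak gradients are unique almost everywhere, so
that the infimum is over one value if `u ∈ H¹(Λ)`; it is `∞` otherwise. -/
def gradNormSq (L : ℝ) (u : E3 → ℝ) : ℝ≥0∞ :=
  ⨅ (G : E3 → E3) (_ : IsWeakGradient L u G), ∫⁻ x in box L, ‖G x‖ₑ ^ 2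

/-- The length `ℓ = 𝔞 (ρ𝔞³)^(-δ)`. -/
def ell (a ρ δ : ℝ) : ℝ := a * (ρ * a ^ 3) ^ (-δ)

/-- The length `ℓ₀ = (ρ𝔞)^(-1/2) (ρ𝔞³)^(-ε)`. -/
def ell0 (a ρ ε : ℝ) : ℝ := (ρ * a) ^ (-(1 / 2) : ℝ) * (ρ * a ^ 3) ^ (-ε)

/-- The rescaled cutoff `χ_r (x) = χ (x / r)`. -/
def cutoff (χ : E3 → ℝ) (r : ℝ) (x : E3) : ℝ := χ (r⁻¹ • x)

/-- The zero-energy scattering solution of the hard-sphere potential of radius `𝔞`. -/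
def scat (a : ℝ) (x : E3) : ℝ := if a ≤ ‖x‖ then 1 - a / ‖x‖ else 0

/-- `f_ℓ = χ_ℓ f + (1 - χ_ℓ)`. -/
def fCut (a : ℝ) (χ : E3 → ℝ) (l : ℝ) (x : E3) : ℝ :=
  cutoff χ l x * scat a x + (1 - cutoff χ l x)

/-- `ω_ℓ = 1 - f_ℓ`. -/
def omegaCut (a : ℝ) (χ : E3 → ℝ) (l : ℝ) (x : E3) : ℝ := 1 - fCut a χ l x

/-- `V̂_eff (p) = 8π sin(|p|𝔞) / |p|` (used for `p ≠ 0` only). -/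
def VeffHat (a : ℝ) (p : E3) : ℝ := 8 * Real.pi * Real.sin (‖p‖ * a) / ‖p‖

/-- The Bogoliubov dispersion `√(|p|⁴ + 2 p² ρ₀ V̂_eff(p))`. -/
def dispersion (a ρ₀ : ℝ) (p : E3) : ℝ := √(‖p‖ ^ 4 + 2 * ‖p‖ ^ 2 * (ρ₀ * VeffHat a p))

/-- The coefficients `ŝ_p`, for `p = 2π n / L`, with `ŝ_0 = 0`. The factor `sgn V̂_eff(p)` makes `ŝ_p`
equal to `sinh η` for the solution `η` of `tanh (2η) = -ρ₀ V̂_eff(p) / (p² + ρ₀ V̂_eff(p))` also where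
`V̂_eff(p)` is negative; `ŝ_p = 0` where `V̂_eff(p) = 0`. -/
def sHat (a ρ₀ L : ℝ) (n : Fin 3 → ℤ) : ℝ :=
  if n = 0 then 0 else
    let p := momentum L n
    let V := ρ₀ * VeffHat a p
    let D := (‖p‖ ^ 2 + V - dispersion a ρ₀ p);
    (-Real.sign V) * D / √(V ^ 2 - D ^ 2)

/-- The function `s` on the torus. -/
def sFun (a ρ₀ L : ℝ) : E3 → ℝ := ofCoeff L (sHat a ρ₀ L)

/-- The function `g - 𝟙` on the torus, where `ĝ = √(1 + ŝ²)` and `𝟙` is the unit of the convolution,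
all of whose Fourier coefficients are `1`. -/
def gSubOne (a ρ₀ L : ℝ) : E3 → ℝ := ofCoeff L fun n => √(1 + sHat a ρ₀ L n ^ 2) - 1

/-- The kernel `σ̃`. -/
def sigmaTilde (a : ℝ) (χ : E3 → ℝ) (l l₀ ρ₀ L : ℝ) (x : E3) : ℝ :=
  cutoff χ l₀ ((2 : ℝ) • x) * (1 - cutoff χ l ((2 : ℝ) • x)) / fCut a χ l x *
    (ρ₀ * omegaCut a χ l x + sFun a ρ₀ L x)

/-- The kernel `σ`, with vanishing integral. -/
def sigma (a : ℝ) (χ φ : E3 → ℝ) (l l₀ ρ₀ L : ℝ) (x : E3) : ℝ :=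
  sigmaTilde a χ l l₀ ρ₀ L x -
    (l₀ ^ 3)⁻¹ * (∫ z in box L, sigmaTilde a χ l l₀ ρ₀ L z) * φ (l₀⁻¹ • x)

/-- The function `θ = -ρ₀ ω_ℓ + f_ℓ σ̃`. -/
def theta (a : ℝ) (χ : E3 → ℝ) (l l₀ ρ₀ L : ℝ) (x : E3) : ℝ :=
  -ρ₀ * omegaCut a χ l x + fCut a χ l x * sigmaTilde a χ l l₀ ρ₀ L x

/-- The reduced energy `Ẽ_ρ` (meaningful if `gradNormSq L θ ≠ ∞`). -/
def reducedEnergy (a : ℝ) (χ : E3 → ℝ) (l l₀ ρ₀ L : ℝ) : ℝ :=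
  (gradNormSq L (theta a χ l l₀ ρ₀ L)).toReal
    + 16 * Real.pi * a * ρ₀ * normSq L (sFun a ρ₀ L)
    + 8 * Real.pi * a * ρ₀ * conv L (gSubOne a ρ₀ L) (sFun a ρ₀ L) 0

/-- The cutoff `χ`: smooth, equal to `1` on `|x| ≤ 2` and to `0` on `|x| > 4`. -/
structure IsCutoff (χ : E3 → ℝ) : Prop where
  smooth : ContDiff ℝ ∞ χ
  eq_one : ∀ x, ‖x‖ ≤ 2 → χ x = 1
  eq_zero : ∀ x, 4 < ‖x‖ → χ x = 0

/-- The profile `φ`: smooth, equal to `1/2` on `|x| ≤ 1` and to `0` on `|x| > 2`, with integral `1`. -/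
structure IsProfile (φ : E3 → ℝ) : Prop where
  smooth : ContDiff ℝ ∞ φ
  eq_half : ∀ x, ‖x‖ ≤ 1 → φ x = 1 / 2
  eq_zero : ∀ x, 2 < ‖x‖ → φ x = 0
  integral_eq_one : ∫ x, φ x = 1

end HardSphere

end

/-! Notation: w = √(8π𝔞ρ) is the inverse healing length, ω = 1 - f = 𝔞/max(𝔞,|x|) is `om`, t =
ρ₀V̂/p² and y = (1+2t)^(1/4). In these terms ŝ = (1/y - y)/2 and √(1+ŝ²) = (1/y + y)/2, and all
estimates on the symbol are elementary inequalities in y. They come in two regimes, |p| below and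
above w.

The distribution -Δω is the uniform measure of total mass 4π𝔞 on the sphere |x| = 𝔞. By the
spherical average of plane waves, its Fourier transform is V̂/2, so ω has transform V̂/(2p²), and
ρ₀ω cancels the leading part -t/2 of ŝ. What is left, u = s + ρ₀ω, has coefficients O(t²) at large
momenta. It is O(w³) near the origin, and its gradient is small in the mean square
(`IsCutoff.exists_sFun_add_om_le`, `IsCutoff.exists_dFun_add_gradOm_le`). Since ω is not periodic,
it is truncated at the scale of the box; the resulting commutator terms vanish as L → ∞.

The denominator f_ℓ cancels in θ, which becomes η₀s - η₁u with η₀ = χ(2x/ℓ₀) and η₁ = χ(2x/ℓ)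
(`IsCutoff.theta_eq`). In |∇s - ∇(η₁u)|² the cross term -2∇s·∇(η₁u) equals 2ρ₀∇ω·∇(η₁u) up to terms
quadratic in u, and the integral of ∇ω·∇(η₁u) is a flux through the sphere: L⁻³ ∑ ŝV̂/2 + 4π𝔞ρ₀.
Hence ‖∇θ‖² is at most ‖∇s‖² + ρ₀L⁻³ ∑ ŝV̂ + 8π𝔞ρ₀², up to errors w⁶ℓ³ and w³/ℓ₀²
(`IsCutoff.exists_energy_le`). The second error is the tail of ∇s beyond ℓ₀; tails are bounded
through differences of Fourier coefficients (`integral_tail_fser_le`).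

Together with the other two terms of the reduced energy this is a sum over modes. By an algebraic
identity in y each mode contributes at most h(p) - ρ₀²V̂²/(4p²) + 8π𝔞ρ₀ŝ², plus a small defect from
V̂(p) ≠ 8π𝔞 (`mode_le`). Here h = ½(√(p⁴+2vp²) - p² - v + v²/(2p²)) with v = 8π𝔞ρ₀. By Parseval L⁻³
∑ V̂²/(4p²) tends to ‖∇ω‖² = 4π𝔞, which turns 8π𝔞ρ₀² into 4π𝔞ρ₀². The sum of h is a Riemann sum for
the Lee-Huang-Yang integral, whose primitive is explicit (`eventually_sum_hMode_le`).

Finally ‖s‖² ≤ ‖σ‖² up to small errors, by the pointwise inequality σ² ≥ 2σs - s² and bounds on the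
tail and the averages of s (`IsCutoff.exists_normSq_sFun_le`). With N = ‖σ‖² the leading terms are
4π𝔞(ρ₀² + 2ρ₀N) ≤ 4π𝔞(ρ₀+N)², and the constraint on ρ₀ + N concludes. Throughout, only 8π𝔞ρ₀ ≤ w² is
used to relate w to ρ₀, so that thresholds on L are uniform in ρ₀. -/

noncomputable section

/-! ### Fourier series on the box -/

namespace HardSphere

open scoped ComplexConjugate

/-- The normalised Haar measure on the circle, the measure used for multivariate Fourier series. -/
local instance : MeasureSpace UnitAddCircle := ⟨AddCircle.haarAddCircle⟩

/-- The covering map of the unit torus by the torus of side `L`. -/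
def toTorus (L : ℝ) (x : E3) : UnitAddTorus (Fin 3) := fun i => ((x i / L : ℝ) : UnitAddCircle)

/-- Normalised Lebesgue measure on the box. -/
def boxMeasure (L : ℝ) : Measure E3 := (ENNReal.ofReal (L ^ 3))⁻¹ • volume.restrict (box L)

/-- The box without the lower faces. -/
def boxIoc (L : ℝ) : Set E3 := {x | ∀ i, x i ∈ Set.Ioc (-(L / 2)) (L / 2)}

lemma measurableSet_box (L : ℝ) : MeasurableSet (box L) := by
  have : box L = ⋂ i, (fun x : E3 => x i) ⁻¹' Set.Icc (-(L / 2)) (L / 2) := by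
    ext x; simp [box]
  rw [this]
  exact MeasurableSet.iInter fun i => measurableSet_Icc.preimage (by fun_prop)

lemma measurableSet_boxIoc (L : ℝ) : MeasurableSet (boxIoc L) := by
  have : boxIoc L = ⋂ i, (fun x : E3 => x i) ⁻¹' Set.Ioc (-(L / 2)) (L / 2) := by
    ext x; simp [boxIoc]
  rw [this]
  exact MeasurableSet.iInter fun i => measurableSet_Ioc.preimage (by fun_prop)

lemma boxIoc_ae_eq_box (L : ℝ) : boxIoc L =ᵐ[volume] box L := by
  have h := (PiLp.volume_preserving_ofLp (Fin 3)).quasiMeasurePreserving.preimage_ae_eq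
    (Measure.univ_pi_Ioc_ae_eq_Icc (μ := fun _ : Fin 3 => (volume : Measure ℝ))
      (f := fun _ => -(L / 2)) (g := fun _ => L / 2))
  have h1 : (WithLp.ofLp (p := 2)) ⁻¹' (Set.univ.pi fun _ : Fin 3 => Set.Ioc (-(L / 2)) (L / 2))
      = boxIoc L := by ext x; simp [boxIoc]
  have h2 : (WithLp.ofLp (p := 2)) ⁻¹' (Set.Icc (fun _ : Fin 3 => (-(L / 2))) (fun _ => L / 2))
      = box L := by ext x; simp [box, Pi.le_def, forall_and]
  rwa [h1, h2] at h

lemma box_subset_closedBall (L : ℝ) : box L ⊆ Metric.closedBall 0 (2 * |L|) := by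
  intro x hx
  rw [mem_closedBall_zero_iff, EuclideanSpace.norm_eq]
  apply Real.sqrt_le_iff.mpr
  refine ⟨by positivity, ?_⟩
  have : ∀ i, ‖x i‖ ^ 2 ≤ L ^ 2 := by
    intro i
    have := hx i
    rw [Real.norm_eq_abs, sq_abs]
    nlinarith [this.1, this.2]
  calc ∑ i, ‖x i‖ ^ 2 ≤ ∑ i : Fin 3, L ^ 2 := Finset.sum_le_sum fun i _ => this i
    _ ≤ (2 * |L|) ^ 2 := by simp [mul_pow]; nlinarith [sq_nonneg L]

instance isFiniteMeasure_restrict_box (L : ℝ) :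
    IsFiniteMeasure ((volume : Measure E3).restrict (box L)) := by
  refine ⟨?_⟩
  rw [Measure.restrict_apply_univ]
  exact (measure_mono (box_subset_closedBall L)).trans_lt measure_closedBall_lt_top

/-- Rescaling by 1/L sends the normalised box measure to Lebesgue measure on the unit cell, and the
quotient map sends that to Haar measure. The lower faces are a null set, so the closed box may be
replaced by a fundamental domain. This carries the L² theory of Fourier series on the unit torus
over to the box. -/
lemma measurePreserving_toTorus {L : ℝ} (hL : 0 < L) :
    MeasurePreserving (toTorus L) (boxMeasure L) volume := by
  have h1 : MeasurePreserving (fun (y : Fin 3 → ℝ) i => (y i : UnitAddCircle))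
      (volume.restrict (Set.univ.pi fun _ => Set.Ioc (-(1 / 2) : ℝ) (-(1 / 2) + 1))) volume := by
    convert! measurePreserving_pi _ _ (fun _ : Fin 3 => AddCircle.measurePreserving_mk 1 (-(1 / 2) : ℝ))
    · exact Measure.restrict_pi_pi _ _
    · simp [volume, AddCircle.haarAddCircle]
  have h2 := (PiLp.volume_preserving_ofLp (Fin 3)).restrict_preimage
    (s := (Set.univ.pi fun _ => Set.Ioc (-(1 / 2) : ℝ) (-(1 / 2) + 1)))
    (MeasurableSet.univ_pi fun _ => measurableSet_Ioc)
  have e1 : (WithLp.ofLp (p := 2)) ⁻¹' (Set.univ.pi fun _ : Fin 3 =>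
      Set.Ioc (-(1 / 2) : ℝ) (-(1 / 2) + 1)) = boxIoc 1 := by
    ext x
    simp only [Set.mem_preimage, Set.mem_univ_pi, boxIoc, Set.mem_ofPred_eq]
    norm_num
  rw [e1] at h2
  have h3 : MeasurePreserving (fun x : E3 => L⁻¹ • x) (boxMeasure L)
      (volume.restrict (boxIoc 1)) := by
    refine ⟨by fun_prop, ?_⟩
    have hm := Measure.map_addHaar_smul (volume : Measure E3) (r := L⁻¹) (by positivity)
    have e2 : (fun x : E3 => L⁻¹ • x) ⁻¹' (boxIoc 1) = boxIoc L := by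
      ext x
      simp only [boxIoc, Set.mem_preimage, Set.mem_ofPred_eq, PiLp.smul_apply, smul_eq_mul,
        Set.mem_Ioc]
      refine forall_congr' fun i => ?_
      rw [← div_eq_inv_mul, lt_div_iff₀ hL, div_le_iff₀ hL]
      constructor <;> rintro ⟨h, h'⟩ <;> constructor <;> linarith
    have e3 : boxMeasure L = (ENNReal.ofReal (L ^ 3))⁻¹ • volume.restrict (boxIoc L) := by
      rw [boxMeasure, Measure.restrict_congr_set (boxIoc_ae_eq_box L)]
    rw [e3, Measure.map_smul, ← e2, ← Measure.restrict_map (by fun_prop) (measurableSet_boxIoc 1)]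
    have : (fun x : E3 => L⁻¹ • x) = (L⁻¹ • ·) := rfl
    rw [this, hm]
    simp only [finrank_euclideanSpace, Fintype.card_fin, inv_pow, inv_inv, Measure.restrict_smul]
    rw [smul_smul, abs_of_pos (by positivity), ENNReal.inv_mul_cancel, one_smul]
    · simp; positivity
    · simp
  have := (h1.comp h2).comp h3
  convert! this using 1
  ext x i
  simp [toTorus, div_eq_inv_mul]

/-- The plane wave `exp(i p · x)` with `p = 2π n / L`. -/
def expo (L : ℝ) (n : Fin 3 → ℤ) (x : E3) : ℂ :=
  Complex.exp (Complex.I * (inner ℝ (momentum L n) x : ℝ))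

lemma mFourier_toTorus (L : ℝ) (n : Fin 3 → ℤ) (x : E3) :
    UnitAddTorus.mFourier n (toTorus L x) = expo L n x := by
  simp only [UnitAddTorus.mFourier, toTorus, ContinuousMap.coe_mk, expo, momentum,
    PiLp.inner_apply, RCLike.inner_apply, conj_trivial]
  simp only [fourier_coe_apply]
  rw [← Complex.exp_sum]
  congr 1
  push_cast
  rw [Finset.mul_sum]
  refine Finset.sum_congr rfl fun i _ => ?_
  ring

/-- The Fourier series `L⁻³ ∑ₙ c n exp(i p · x)` with complex coefficients. -/
def fser (L : ℝ) (c : (Fin 3 → ℤ) → ℂ) (x : E3) : ℂ :=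
  ((L ^ 3)⁻¹ : ℝ) * (∑' n : Fin 3 → ℤ, c n • UnitAddTorus.mFourierLp 2 n) (toTorus L x)

lemma ofCoeff_eq_re (L : ℝ) (c : (Fin 3 → ℤ) → ℝ) (x : E3) :
    ofCoeff L c x = (fser L (fun n => (c n : ℂ)) x).re := by
  rw [fser, Complex.re_ofReal_mul]; rfl

lemma summable_smul_mFourierLp {c : (Fin 3 → ℤ) → ℂ} (hc : Summable fun n => ‖c n‖ ^ 2) :
    Summable fun n => c n • UnitAddTorus.mFourierLp (d := Fin 3) 2 n := by
  have hm : Memℓp c 2 := by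
    rw [memℓp_gen_iff (by simp)]
    simpa using hc
  have := (UnitAddTorus.mFourierBasis (d := Fin 3)).hasSum_repr_symm ⟨c, hm⟩
  rw [UnitAddTorus.coe_mFourierBasis] at this
  exact this.summable

lemma continuous_expo (L : ℝ) (n : Fin 3 → ℤ) : Continuous (expo L n) := by
  unfold expo; fun_prop

@[simp] lemma norm_expo (L : ℝ) (n : Fin 3 → ℤ) (x : E3) : ‖expo L n x‖ = 1 := by
  rw [expo, mul_comm, Complex.norm_exp_ofReal_mul_I]

lemma momentum_add (L : ℝ) (m n : Fin 3 → ℤ) :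
    momentum L (m + n) = momentum L m + momentum L n := by
  ext i; simp [momentum]; ring

lemma momentum_neg (L : ℝ) (n : Fin 3 → ℤ) : momentum L (-n) = -momentum L n := by
  ext i; simp [momentum]; ring

@[simp] lemma momentum_zero (L : ℝ) : momentum L 0 = 0 := by
  ext i; simp [momentum]

lemma expo_add (L : ℝ) (m n : Fin 3 → ℤ) (x : E3) :
    expo L (m + n) x = expo L m x * expo L n x := by
  simp only [expo, momentum_add, inner_add_left, ← Complex.exp_add]
  push_cast
  congr 1; ring

@[simp] lemma expo_zero (L : ℝ) (x : E3) : expo L 0 x = 1 := by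
  simp [expo]

lemma expo_neg (L : ℝ) (n : Fin 3 → ℤ) (x : E3) : expo L (-n) x = conj (expo L n x) := by
  simp only [expo, momentum_neg, inner_neg_left, ← Complex.exp_conj]
  congr 1
  simp

lemma expo_neg_apply (L : ℝ) (n : Fin 3 → ℤ) (x : E3) : expo L n (-x) = expo L (-n) x := by
  simp only [expo, momentum_neg, inner_neg_left, inner_neg_right]

lemma integral_box_eq {L : ℝ} (hL : 0 < L) {F : Type*} [NormedAddCommGroup F] [NormedSpace ℝ F]
    (f : E3 → F) : ∫ x, f x ∂(boxMeasure L) = (L ^ 3)⁻¹ • ∫ x in box L, f x := by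
  rw [boxMeasure, integral_smul_measure, ENNReal.toReal_inv, ENNReal.toReal_ofReal (by positivity)]

lemma memLp_boxMeasure_iff {L : ℝ} (hL : 0 < L) {F : Type*} [NormedAddCommGroup F]
    {f : E3 → F} {p : ℝ≥0∞} :
    MemLp f p (boxMeasure L) ↔ MemLp f p (volume.restrict (box L)) := by
  have h0 : ENNReal.ofReal (L ^ 3) ≠ 0 := by simp; positivity
  constructor
  · intro h
    have := h.smul_measure (c := ENNReal.ofReal (L ^ 3)) (by simp)
    rwa [boxMeasure, smul_smul, ENNReal.mul_inv_cancel h0 (by simp), one_smul] at this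
  · intro h
    exact h.smul_measure (by simp; positivity)

lemma memLp_fser {L : ℝ} (hL : 0 < L) (c : (Fin 3 → ℤ) → ℂ) :
    MemLp (fser L c) 2 (volume.restrict (box L)) := by
  rw [← memLp_boxMeasure_iff hL]
  exact ((Lp.memLp _).comp_measurePreserving (measurePreserving_toTorus hL)).const_mul _

/-- The series converges in L², where integration against k is a continuous functional and may be
applied term by term. The pairing is bilinear: the conjugate taken of k undoes the one in the inner
product. Most integrals of s or ∇s against explicit functions are evaluated in this way. -/
lemma hasSum_integral_mul_fser {L : ℝ} (hL : 0 < L) {c : (Fin 3 → ℤ) → ℂ}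
    (hc : Summable fun n => ‖c n‖ ^ 2) {k : E3 → ℂ}
    (hk : MemLp k 2 (volume.restrict (box L))) :
    HasSum (fun n => (((L ^ 3)⁻¹ : ℝ) : ℂ) * (c n * ∫ x in box L, k x * expo L n x))
      (∫ x in box L, k x * fser L c x) := by
  have hq := measurePreserving_toTorus hL
  have hk' : MemLp (fun x => conj (k x)) 2 (boxMeasure L) :=
    ((memLp_boxMeasure_iff hL).2 hk).star
  let Φ := Lp.compMeasurePreservingₗᵢ (E := ℂ) (p := 2) ℂ (toTorus L) hq
  let T : Lp ℂ 2 (volume : Measure (UnitAddTorus (Fin 3))) →L[ℂ] ℂ :=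
    (innerSL ℂ (hk'.toLp _)).comp Φ.toContinuousLinearMap
  have hT : ∀ F, T F = ∫ x, k x * F (toTorus L x) ∂(boxMeasure L) := by
    intro F
    change inner ℂ (hk'.toLp _) (Φ F) = _
    rw [L2.inner_def]
    refine integral_congr_ae ?_
    filter_upwards [hk'.coeFn_toLp, Lp.coeFn_compMeasurePreserving F hq] with x h1 h2
    have h2' : (Φ F : E3 → ℂ) x = F (toTorus L x) := h2
    rw [h1, h2', RCLike.inner_apply, Complex.conj_conj, mul_comm]
  have hs := (summable_smul_mFourierLp hc).hasSum.mapL T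
  rw [hT, integral_box_eq hL] at hs
  have e1 : ∫ x in box L, k x * fser L c x = (L ^ 3)⁻¹ • ∫ x in box L, k x *
      (∑' n : Fin 3 → ℤ, c n • UnitAddTorus.mFourierLp (d := Fin 3) 2 n) (toTorus L x) := by
    rw [← integral_smul]
    refine integral_congr_ae (Filter.Eventually.of_forall fun x => ?_)
    simp only [fser, Complex.real_smul]; ring
  rw [e1]
  refine hs.congr_fun fun n => ?_
  rw [map_smul, hT, integral_box_eq hL, smul_eq_mul, Complex.real_smul]
  have : ∫ x in box L, k x * (UnitAddTorus.mFourierLp (d := Fin 3) 2 n) (toTorus L x) =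
      ∫ x in box L, k x * expo L n x := by
    have hae : (fun x => (UnitAddTorus.mFourierLp (d := Fin 3) 2 n) (toTorus L x))
        =ᵐ[boxMeasure L] fun x => expo L n x := by
      filter_upwards [hq.quasiMeasurePreserving.ae_eq_comp
        (UnitAddTorus.coeFn_mFourierLp (d := Fin 3) 2 n)] with x hx
      simpa [mFourier_toTorus] using hx
    rw [boxMeasure, Filter.EventuallyEq, Measure.ae_ennreal_smul_measure_eq (by simp)] at hae
    refine integral_congr_ae ?_
    filter_upwards [hae] with x hx
    rw [hx]
  rw [this]; ring

lemma memLp_expo (L : ℝ) (n : Fin 3 → ℤ) : MemLp (expo L n) 2 (volume.restrict (box L)) :=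
  MemLp.of_bound (continuous_expo L n).aestronglyMeasurable 1 (by simp)

lemma integral_expo {L : ℝ} (hL : 0 < L) (n : Fin 3 → ℤ) :
    ∫ x in box L, expo L n x = if n = 0 then ((L ^ 3 : ℝ) : ℂ) else 0 := by
  have hq := measurePreserving_toTorus hL
  have h1 : ∫ x, expo L n x ∂(boxMeasure L) = ∫ y, UnitAddTorus.mFourier (d := Fin 3) n y := by
    rw [← hq.map_eq, integral_map hq.measurable.aemeasurable]
    · simp_rw [mFourier_toTorus]
    · exact (UnitAddTorus.mFourier (d := Fin 3) n).continuous.aestronglyMeasurable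
  have h2 := (orthonormal_iff_ite.mp (UnitAddTorus.orthonormal_mFourier (d := Fin 3))) 0 n
  rw [ContinuousMap.inner_toLp] at h2
  simp only [UnitAddTorus.mFourier_zero, ContinuousMap.one_apply, map_one, mul_one] at h2
  rw [h2, integral_box_eq hL, Complex.real_smul] at h1
  have h3 : ((L ^ 3 : ℝ) : ℂ) ≠ 0 := by exact_mod_cast (by positivity : L ^ 3 ≠ 0)
  have : ∫ x in box L, expo L n x = ((L ^ 3 : ℝ) : ℂ) *
      ((((L ^ 3)⁻¹ : ℝ) : ℂ) * ∫ x in box L, expo L n x) := by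
    rw [← mul_assoc, ← Complex.ofReal_mul, mul_inv_cancel₀ (by positivity), Complex.ofReal_one,
      one_mul]
  rw [this, h1]
  by_cases hn : n = 0
  · simp [hn]
  · simp [hn, Ne.symm hn]

lemma integral_fser_mul_expo {L : ℝ} (hL : 0 < L) {c : (Fin 3 → ℤ) → ℂ}
    (hc : Summable fun n => ‖c n‖ ^ 2) (m : Fin 3 → ℤ) :
    ∫ x in box L, fser L c x * expo L (-m) x = c m := by
  have h := hasSum_integral_mul_fser hL hc (memLp_expo L (-m))
  have h3 : ((L ^ 3 : ℝ) : ℂ) ≠ 0 := by exact_mod_cast (by positivity : L ^ 3 ≠ 0)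
  have h' : HasSum (fun n => if n = m then c m else 0) (∫ x in box L, expo L (-m) x * fser L c x) := by
    refine h.congr_fun fun n => ?_
    simp_rw [← expo_add]
    rw [integral_expo hL]
    by_cases hn : n = m
    · subst hn
      simp only [neg_add_cancel, if_true]
      rw [Complex.ofReal_inv]
      field_simp
    · have : -m + n ≠ 0 := fun h => hn (by rw [neg_add_eq_zero] at h; exact h.symm)
      simp [this, hn]
  have := h'.unique (hasSum_ite_eq m (c m))
  rw [← this]
  simp_rw [mul_comm]

lemma integral_norm_sq_fser {L : ℝ} (hL : 0 < L) {c : (Fin 3 → ℤ) → ℂ}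
    (hc : Summable fun n => ‖c n‖ ^ 2) :
    ∫ x in box L, ‖fser L c x‖ ^ 2 = (L ^ 3)⁻¹ * ∑' n, ‖c n‖ ^ 2 := by
  have h := hasSum_integral_mul_fser hL hc (memLp_fser hL c).star
  have e : ∀ n, ∫ x in box L, (star (fser L c)) x * expo L n x = conj (c n) := by
    intro n
    rw [← integral_fser_mul_expo hL hc n, ← integral_conj]
    simp [expo_neg]
  simp_rw [e] at h
  have e2 : ∫ x in box L, (star (fser L c)) x * fser L c x
      = ((∫ x in box L, ‖fser L c x‖ ^ 2 : ℝ) : ℂ) := by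
    rw [← integral_complex_ofReal]
    refine integral_congr_ae (Filter.Eventually.of_forall fun x => ?_)
    simp only [Pi.star_apply, RCLike.star_def, Complex.conj_mul']
    push_cast; rfl
  rw [e2] at h
  have h' : HasSum (fun n => (((L ^ 3)⁻¹ * ‖c n‖ ^ 2 : ℝ) : ℂ))
      ((∫ x in box L, ‖fser L c x‖ ^ 2 : ℝ) : ℂ) := by
    refine h.congr_fun fun n => ?_
    rw [Complex.mul_conj']; push_cast; rfl
  rw [Complex.hasSum_ofReal] at h'
  rw [← h'.tsum_eq, tsum_mul_left]

/-- Parseval's identity on the box. -/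
lemma hasSum_norm_sq_integral_mul_expo {L : ℝ} (hL : 0 < L) {k : E3 → ℂ}
    (hk : MemLp k 2 (volume.restrict (box L))) :
    HasSum (fun n => ‖∫ x in box L, k x * expo L (-n) x‖ ^ 2)
      (L ^ 3 * ∫ x in box L, ‖k x‖ ^ 2) := by
  have hq := measurePreserving_toTorus hL
  -- A measurable section of the covering map with values in the half-open cell. Composing with it
  -- makes a function on the torus out of any function on the box, periodic or not, and reduces the
  -- claim to Parseval's identity on the torus.
  let r : UnitAddTorus (Fin 3) → E3 := fun θ =>
    WithLp.toLp 2 fun i => L * (AddCircle.measurableEquivIoc 1 (-(1 / 2) : ℝ) (θ i) : ℝ)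
  have hrm : Measurable r := by
    refine (WithLp.measurable_toLp 2 _).comp (measurable_pi_lambda _ fun i => ?_)
    exact (measurable_subtype_coe.comp ((AddCircle.measurableEquivIoc 1 (-(1 / 2) : ℝ)).measurable.comp
      (measurable_pi_apply i))).const_mul L
  have hqr : ∀ θ, toTorus L (r θ) = θ := by
    intro θ
    ext i
    simp only [toTorus, r]
    rw [mul_div_cancel_left₀ _ hL.ne']
    exact (AddCircle.measurableEquivIoc 1 (-(1 / 2) : ℝ)).symm_apply_apply (θ i)
  have hrq : ∀ x ∈ boxIoc L, r (toTorus L x) = x := by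
    intro x hx
    ext i
    simp only [toTorus, r]
    have hm : x i / L ∈ Set.Ioc (-(1 / 2) : ℝ) (-(1 / 2) + 1) := by
      have := hx i
      rw [Set.mem_Ioc, lt_div_iff₀ hL, div_le_iff₀ hL]
      constructor <;> linarith [this.1, this.2]
    have : AddCircle.measurableEquivIoc 1 (-(1 / 2) : ℝ) ((x i / L : ℝ) : UnitAddCircle)
        = ⟨x i / L, hm⟩ :=
      (AddCircle.measurableEquivIoc 1 (-(1 / 2) : ℝ)).apply_symm_apply ⟨x i / L, hm⟩
    rw [this]
    field_simp
  have hae : ae (boxMeasure L) = ae ((volume : Measure E3).restrict (box L)) := by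
    rw [boxMeasure, Measure.ae_ennreal_smul_measure_eq (by simp)]
  have hrq' : ∀ᵐ x ∂(boxMeasure L), r (toTorus L x) = x := by
    rw [hae, ← Measure.restrict_congr_set (boxIoc_ae_eq_box L)]
    filter_upwards [ae_restrict_mem (measurableSet_boxIoc L)] with x hx using hrq x hx
  have hr : MeasurePreserving r volume (boxMeasure L) := by
    refine ⟨hrm, ?_⟩
    rw [← hq.map_eq, Measure.map_map hrm hq.measurable]
    conv_rhs => rw [← Measure.map_id (μ := boxMeasure L)]
    exact Measure.map_congr hrq'
  have hkr := ((memLp_boxMeasure_iff hL).2 hk).comp_measurePreserving hr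
  have hs := UnitAddTorus.hasSum_sq_mFourierCoeff (d := Fin 3) (hkr.toLp _)
  have hc : ∀ n, UnitAddTorus.mFourierCoeff (d := Fin 3) (hkr.toLp _) n
      = (((L ^ 3)⁻¹ : ℝ) : ℂ) * ∫ x in box L, k x * expo L (-n) x := by
    intro n
    rw [UnitAddTorus.mFourierCoeff, ← Complex.real_smul, ← integral_box_eq hL, ← hr.map_eq,
      integral_map hrm.aemeasurable]
    · refine integral_congr_ae ?_
      filter_upwards [hkr.coeFn_toLp] with θ hθ
      rw [hθ, smul_eq_mul, mul_comm, Function.comp_apply, ← mFourier_toTorus, hqr]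
    · rw [hr.map_eq]
      exact ((memLp_boxMeasure_iff hL).2 hk).aestronglyMeasurable.mul
        (continuous_expo L _).aestronglyMeasurable
  have hi : ∫ t, ‖(hkr.toLp _) t‖ ^ 2 = (L ^ 3)⁻¹ * ∫ x in box L, ‖k x‖ ^ 2 := by
    rw [← smul_eq_mul, ← integral_box_eq hL, ← hr.map_eq, integral_map hrm.aemeasurable]
    · refine integral_congr_ae ?_
      filter_upwards [hkr.coeFn_toLp] with θ hθ
      rw [hθ, Function.comp_apply]
    · rw [hr.map_eq]
      exact ((memLp_boxMeasure_iff hL).2 hk).aestronglyMeasurable.norm.pow 2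
  rw [hi] at hs
  have := hs.mul_left ((L ^ 3) ^ 2)
  have e : (L ^ 3) ^ 2 * ((L ^ 3)⁻¹ * ∫ x in box L, ‖k x‖ ^ 2) = L ^ 3 * ∫ x in box L, ‖k x‖ ^ 2 := by
    field_simp
  rw [e] at this
  refine this.congr_fun fun n => ?_
  rw [hc, norm_mul, mul_pow, Complex.norm_real, Real.norm_of_nonneg (by positivity)]
  field_simp

/-- Square integrable functions on the box with the same Fourier coefficients agree. -/
lemma ae_eq_of_integral_mul_expo_eq {L : ℝ} (hL : 0 < L) {f g : E3 → ℂ}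
    (hf : MemLp f 2 (volume.restrict (box L))) (hg : MemLp g 2 (volume.restrict (box L)))
    (h : ∀ n, ∫ x in box L, f x * expo L (-n) x = ∫ x in box L, g x * expo L (-n) x) :
    f =ᵐ[volume.restrict (box L)] g := by
  have hs := hasSum_norm_sq_integral_mul_expo hL (hf.sub hg)
  have hz : ∀ n, ∫ x in box L, (f - g) x * expo L (-n) x = 0 := by
    intro n
    simp_rw [Pi.sub_apply, sub_mul]
    rw [integral_sub, h n, sub_self]
    · exact hf.integrable_mul (memLp_expo L _)
    · exact hg.integrable_mul (memLp_expo L _)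
  simp only [hz, norm_zero, ne_eq, OfNat.ofNat_ne_zero, not_false_eq_true, zero_pow] at hs
  have h0 := hs.unique hasSum_zero
  have h1 : ∫ x in box L, ‖(f - g) x‖ ^ 2 = 0 := by
    have : L ^ 3 ≠ 0 := by positivity
    simpa [this] using h0
  rw [integral_eq_zero_iff_of_nonneg (fun x => by positivity)] at h1
  · filter_upwards [h1] with x hx
    simpa [sub_eq_zero] using hx
  · exact (hf.sub hg).integrable_norm_pow (by simp)

lemma ae_eq_fser {L : ℝ} (hL : 0 < L) {f : E3 → ℂ} {c : (Fin 3 → ℤ) → ℂ}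
    (hf : MemLp f 2 (volume.restrict (box L))) (hc : Summable fun n => ‖c n‖ ^ 2)
    (h : ∀ n, ∫ x in box L, f x * expo L (-n) x = c n) :
    f =ᵐ[volume.restrict (box L)] fser L c :=
  ae_eq_of_integral_mul_expo_eq hL hf (memLp_fser hL c) fun n => by
    rw [h, integral_fser_mul_expo hL hc]

lemma summable_norm_sq_integral_mul_expo {L : ℝ} (hL : 0 < L) {k : E3 → ℂ}
    (hk : MemLp k 2 (volume.restrict (box L))) :
    Summable fun n => ‖∫ x in box L, k x * expo L (-n) x‖ ^ 2 :=
  (hasSum_norm_sq_integral_mul_expo hL hk).summable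

/-- A Fourier series with Hermitian coefficients is real. -/
lemma fser_im_ae_eq_zero {L : ℝ} (hL : 0 < L) {c : (Fin 3 → ℤ) → ℂ}
    (hc : Summable fun n => ‖c n‖ ^ 2) (hsymm : ∀ n, c (-n) = conj (c n)) :
    ∀ᵐ x ∂volume.restrict (box L), ((fser L c x).re : ℂ) = fser L c x := by
  have h := ae_eq_fser hL (memLp_fser hL c).star hc fun n => by
    have : ∫ x in box L, (star (fser L c)) x * expo L (-n) x
        = conj (∫ x in box L, fser L c x * expo L (-(-n)) x) := by
      rw [← integral_conj]
      simp [expo_neg]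
    rw [this, integral_fser_mul_expo hL hc, hsymm, Complex.conj_conj]
  filter_upwards [h] with x hx
  exact Complex.conj_eq_iff_re.1 hx

lemma fser_sub_ae_eq {L : ℝ} (hL : 0 < L) {c d : (Fin 3 → ℤ) → ℂ}
    (hc : Summable fun n => ‖c n‖ ^ 2) (hd : Summable fun n => ‖d n‖ ^ 2) :
    ∀ᵐ x ∂volume.restrict (box L), fser L c x - fser L d x = fser L (fun n => c n - d n) x := by
  refine ae_eq_of_integral_mul_expo_eq hL ((memLp_fser hL c).sub (memLp_fser hL d))
    (memLp_fser hL _) fun n => ?_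
  have hcd : Summable fun n => ‖c n - d n‖ ^ 2 := by
    refine Summable.of_nonneg_of_le (fun _ => by positivity) (fun n => ?_)
      ((hc.add hd).mul_left 2)
    have := norm_sub_le (c n) (d n)
    nlinarith [norm_nonneg (c n - d n), sq_nonneg (‖c n‖ - ‖d n‖)]
  rw [integral_fser_mul_expo hL hcd]
  simp_rw [sub_mul]
  rw [integral_sub, integral_fser_mul_expo hL hc, integral_fser_mul_expo hL hd]
  · exact (memLp_fser hL c).integrable_mul (memLp_expo L _)
  · exact (memLp_fser hL d).integrable_mul (memLp_expo L _)

/-- Multiplication by a plane wave shifts the coefficients, and Parseval's identity does the rest.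
This is the discrete form of the correspondence between a weight in position and a derivative in
momentum. -/
lemma integral_norm_sq_expo_sub_one_mul_fser {L : ℝ} (hL : 0 < L) {c : (Fin 3 → ℤ) → ℂ}
    (hc : Summable fun n => ‖c n‖ ^ 2) (m : Fin 3 → ℤ) :
    HasSum (fun n => ‖c (n - m) - c n‖ ^ 2)
      (L ^ 3 * ∫ x in box L, ‖expo L m x - 1‖ ^ 2 * ‖fser L c x‖ ^ 2) := by
  have hb : MemLp (fun x => (expo L m x - 1) * fser L c x) 2 (volume.restrict (box L)) := by
    refine (memLp_fser hL c).of_le_mul (c := 2) ?_ (Filter.Eventually.of_forall fun x => ?_)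
    · exact ((continuous_expo L m).sub continuous_const).aestronglyMeasurable.mul
        (memLp_fser hL c).aestronglyMeasurable
    · rw [norm_mul]
      gcongr
      calc ‖expo L m x - 1‖ ≤ ‖expo L m x‖ + ‖(1 : ℂ)‖ := norm_sub_le _ _
        _ = 2 := by rw [norm_expo, norm_one]; norm_num
  have h := hasSum_norm_sq_integral_mul_expo hL hb
  simp_rw [norm_mul, mul_pow] at h
  refine h.congr_fun fun n => ?_
  congr 2
  have : ∀ x, (expo L m x - 1) * fser L c x * expo L (-n) x
      = fser L c x * expo L (-(n - m)) x - fser L c x * expo L (-n) x := by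
    intro x
    rw [neg_sub, sub_eq_add_neg m n, expo_add]; ring
  simp_rw [this]
  rw [integral_sub, integral_fser_mul_expo hL hc, integral_fser_mul_expo hL hc]
  · exact (memLp_fser hL c).integrable_mul (memLp_expo L _)
  · exact (memLp_fser hL c).integrable_mul (memLp_expo L _)

/-- The modulus on the right is 2|sin β| with β = πx_j/L. On the box |β| ≤ π/2, where Jordan's
inequality |sin β| ≥ 2|β|/π holds. So the lowest plane waves measure the distance from the origin
across the whole box. -/
lemma sq_coord_le_norm_expo_sub_one {L : ℝ} (hL : 0 < L) {x : E3} (hx : x ∈ box L) (j : Fin 3) :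
    16 / L ^ 2 * x j ^ 2 ≤ ‖expo L (Pi.single j 1) x - 1‖ ^ 2 := by
  have hin : inner ℝ (momentum L (Pi.single j 1)) x = 2 * Real.pi * x j / L := by
    simp only [PiLp.inner_apply, momentum, RCLike.inner_apply, conj_trivial]
    rw [Finset.sum_eq_single j]
    · simp; ring
    · intro i _ hij; simp [hij]
    · simp
  rw [expo, hin, Complex.norm_exp_I_mul_ofReal_sub_one, Real.norm_eq_abs, sq_abs]
  have hxj := hx j
  have h1 : |2 * Real.pi * x j / L / 2| ≤ Real.pi / 2 := by
    have e : 2 * Real.pi * x j / L / 2 = Real.pi * (x j / L) := by ring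
    rw [e, abs_mul, abs_of_pos Real.pi_pos, abs_div, abs_of_pos hL]
    have : |x j| / L ≤ 1 / 2 := by
      rw [div_le_iff₀ hL, abs_le]; constructor <;> linarith [hxj.1, hxj.2]
    nlinarith [Real.pi_pos]
  have h2 := Real.mul_abs_le_abs_sin h1
  have h3 : 2 / Real.pi * |2 * Real.pi * x j / L / 2| = 2 / L * |x j| := by
    have e : 2 * Real.pi * x j / L / 2 = Real.pi * (x j / L) := by ring
    rw [e, abs_mul, abs_of_pos Real.pi_pos, abs_div, abs_of_pos hL]
    field_simp
  rw [h3] at h2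
  have h4 : (2 / L * |x j|) ^ 2 ≤ |Real.sin (2 * Real.pi * x j / L / 2)| ^ 2 := by gcongr
  rw [mul_pow, sq_abs, sq_abs] at h4
  calc 16 / L ^ 2 * x j ^ 2 = 4 * ((2 / L) ^ 2 * x j ^ 2) := by ring
    _ ≤ _ := by rw [mul_pow]; linarith

/-- The tail of a Fourier series is controlled by the differences of its coefficients. -/
lemma integral_tail_fser_le {L : ℝ} (hL : 0 < L) {c : (Fin 3 → ℤ) → ℂ}
    (hc : Summable fun n => ‖c n‖ ^ 2) {r : ℝ} (hr : 0 < r) {S : ℝ}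
    (hS : ∀ j : Fin 3, ∑' n, ‖c (n - Pi.single j 1) - c n‖ ^ 2 ≤ S) :
    ∫ x in box L ∩ {x | r ≤ ‖x‖}, ‖fser L c x‖ ^ 2 ≤ L ^ 2 / r ^ 2 * ((L ^ 3)⁻¹ * S) := by
  have hinteg : Integrable (fun x => ‖fser L c x‖ ^ 2) (volume.restrict (box L)) :=
    (memLp_fser hL c).integrable_norm_pow (by simp)
  have hint2 : ∀ j : Fin 3, Integrable
      (fun x => ‖expo L (Pi.single j 1) x - 1‖ ^ 2 * ‖fser L c x‖ ^ 2)
      (volume.restrict (box L)) := by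
    intro j
    refine (hinteg.const_mul 4).mono' ?_ (Filter.Eventually.of_forall fun x => ?_)
    · exact (((continuous_expo L _).sub continuous_const).norm.pow 2).aestronglyMeasurable.mul
        hinteg.aestronglyMeasurable
    · rw [Real.norm_of_nonneg (by positivity)]
      gcongr
      have : ‖expo L (Pi.single j 1) x - 1‖ ≤ 2 := by
        calc ‖expo L (Pi.single j 1) x - 1‖ ≤ ‖expo L (Pi.single j 1) x‖ + ‖(1 : ℂ)‖ :=
            norm_sub_le _ _
          _ = 2 := by rw [norm_expo, norm_one]; norm_num
      nlinarith [norm_nonneg (expo L (Pi.single j 1) x - 1)]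
  have hmeas : MeasurableSet {x : E3 | r ≤ ‖x‖} := measurableSet_le measurable_const measurable_norm
  have hL2 : 0 < L ^ 2 := by positivity
  have h1 : ∫ x in box L ∩ {x | r ≤ ‖x‖}, ‖fser L c x‖ ^ 2
      ≤ ∫ x in box L, L ^ 2 / (16 * r ^ 2) *
        ∑ j : Fin 3, ‖expo L (Pi.single j 1) x - 1‖ ^ 2 * ‖fser L c x‖ ^ 2 := by
    rw [Set.inter_comm, ← Measure.restrict_restrict hmeas, ← integral_indicator hmeas]
    refine integral_mono_ae (hinteg.indicator hmeas)
      ((integrable_finsetSum _ fun j _ => hint2 j).const_mul _) ?_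
    filter_upwards [ae_restrict_mem (measurableSet_box L)] with x hx
    by_cases hxr : x ∈ {x : E3 | r ≤ ‖x‖}
    · rw [Set.indicator_of_mem hxr, ← Finset.sum_mul, ← mul_assoc]
      have hsum : 16 / L ^ 2 * ‖x‖ ^ 2 ≤ ∑ j : Fin 3, ‖expo L (Pi.single j 1) x - 1‖ ^ 2 := by
        rw [EuclideanSpace.norm_sq_eq, Finset.mul_sum]
        refine Finset.sum_le_sum fun j _ => ?_
        rw [Real.norm_eq_abs, sq_abs]
        exact sq_coord_le_norm_expo_sub_one hL hx j
      have hr2 : r ^ 2 ≤ ‖x‖ ^ 2 := by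
        have : r ≤ ‖x‖ := hxr
        gcongr
      -- Chebyshev's inequality: outside the ball of radius r the three weights add up to at least
      -- 16r²/L².
      have : 1 ≤ L ^ 2 / (16 * r ^ 2) * ∑ j : Fin 3, ‖expo L (Pi.single j 1) x - 1‖ ^ 2 := by
        calc (1 : ℝ) = L ^ 2 / (16 * r ^ 2) * (16 / L ^ 2 * r ^ 2) := by field_simp
          _ ≤ L ^ 2 / (16 * r ^ 2) * (16 / L ^ 2 * ‖x‖ ^ 2) := by gcongr
          _ ≤ _ := by gcongr
      nlinarith [sq_nonneg ‖fser L c x‖]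
    · rw [Set.indicator_of_notMem hxr]
      positivity
  refine h1.trans ?_
  rw [integral_const_mul, integral_finsetSum _ fun j _ => hint2 j]
  have h2 : ∀ j : Fin 3, ∫ x in box L, ‖expo L (Pi.single j 1) x - 1‖ ^ 2 * ‖fser L c x‖ ^ 2
      ≤ (L ^ 3)⁻¹ * S := by
    intro j
    have := (integral_norm_sq_expo_sub_one_mul_fser hL hc (Pi.single j 1)).tsum_eq
    rw [inv_mul_eq_div, le_div_iff₀ (by positivity), mul_comm, ← this]
    exact hS j
  have hS0 : 0 ≤ S := (tsum_nonneg fun n => by positivity).trans (hS 0)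
  have h3 : ∑ j : Fin 3, ∫ x in box L, ‖expo L (Pi.single j 1) x - 1‖ ^ 2 * ‖fser L c x‖ ^ 2
      ≤ 3 * ((L ^ 3)⁻¹ * S) := by
    refine (Finset.sum_le_sum fun j _ => h2 j).trans ?_
    simp
  calc _ ≤ L ^ 2 / (16 * r ^ 2) * (3 * ((L ^ 3)⁻¹ * S)) := by gcongr
    _ = 3 / 16 * (L ^ 2 / r ^ 2 * ((L ^ 3)⁻¹ * S)) := by field_simp
    _ ≤ _ := by
      have : 0 ≤ L ^ 2 / r ^ 2 * ((L ^ 3)⁻¹ * S) := by positivity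
      linarith

lemma summable_sq_of_summable {c : (Fin 3 → ℤ) → ℂ} (hc : Summable fun n => ‖c n‖) :
    Summable fun n => ‖c n‖ ^ 2 := by
  refine Summable.of_norm_bounded_eventually (g := fun n => ‖c n‖) hc ?_
  filter_upwards [hc.tendsto_cofinite_zero.eventually (gt_mem_nhds one_pos)] with n hn
  rw [Real.norm_of_nonneg (by positivity)]
  nlinarith [norm_nonneg (c n)]

/-- With absolutely summable coefficients the pointwise sum is a continuous function obeying the
bound everywhere. It has the same Fourier coefficients as the L² sum, so the two agree almost
everywhere. -/
lemma norm_fser_le_of_summable {L : ℝ} (hL : 0 < L) {c : (Fin 3 → ℤ) → ℂ}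
    (hc : Summable fun n => ‖c n‖) :
    ∀ᵐ x ∂volume.restrict (box L), ‖fser L c x‖ ≤ (L ^ 3)⁻¹ * ∑' n, ‖c n‖ := by
  have hc2 := summable_sq_of_summable hc
  let g : E3 → ℂ := fun x => (((L ^ 3)⁻¹ : ℝ) : ℂ) * ∑' n, c n * expo L n x
  have hg : ∀ x, ‖g x‖ ≤ (L ^ 3)⁻¹ * ∑' n, ‖c n‖ := by
    intro x
    simp only [g]
    rw [norm_mul, Complex.norm_real, Real.norm_of_nonneg (by positivity)]
    gcongr
    refine (norm_tsum_le_tsum_norm ?_).trans (le_of_eq ?_)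
    · simpa using hc
    · simp
  have hgc : Continuous g := by
    refine continuous_const.mul (continuous_tsum (fun n => continuous_const.mul (continuous_expo L n))
      hc fun n x => by simp)
  have hgm : MemLp g 2 (volume.restrict (box L)) :=
    MemLp.of_bound hgc.aestronglyMeasurable _ (Filter.Eventually.of_forall hg)
  have h := ae_eq_fser hL hgm hc2 fun m => by
    have hF : ∀ n, Integrable (fun x => c n * expo L n x * expo L (-m) x)
        (volume.restrict (box L)) := fun n => by
      have := ((memLp_expo L n).integrable_mul (memLp_expo L (-m))).const_mul (c n)
      refine this.congr (Filter.Eventually.of_forall fun x => ?_)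
      simp [mul_assoc]
    have hs := hasSum_integral_of_summable_integral_norm hF (by
      simp only [norm_mul, norm_expo, mul_one, integral_const, smul_eq_mul]
      exact hc.mul_left _)
    have h3 : ((L ^ 3 : ℝ) : ℂ) ≠ 0 := by exact_mod_cast (by positivity : L ^ 3 ≠ 0)
    have hs' := hs.mul_left (((L ^ 3)⁻¹ : ℝ) : ℂ)
    have h' : HasSum (fun n => if n = m then c m else 0)
        ((((L ^ 3)⁻¹ : ℝ) : ℂ) * ∫ x in box L, ∑' n, c n * expo L n x * expo L (-m) x) := by
      refine hs'.congr_fun fun n => ?_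
      simp_rw [mul_assoc, ← expo_add]
      rw [integral_const_mul, integral_expo hL]
      by_cases hn : n = m
      · subst hn
        simp only [add_neg_cancel, if_true]
        rw [Complex.ofReal_inv]
        field_simp
      · have : n + -m ≠ 0 := fun h => hn (by rwa [add_neg_eq_zero] at h)
        simp [this, hn]
    have := h'.unique (hasSum_ite_eq m (c m))
    rw [← this, ← integral_const_mul]
    congr 1
    ext x
    simp only [g]
    rw [tsum_mul_right]
    ring
  filter_upwards [h] with x hx
  rw [← hx]
  exact hg x

end HardSphere

end

/-! ### Sums over the dual lattice and their integrals -/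

noncomputable section

namespace HardSphere

open Filter Topology

/-- The lattice point nearest to `x`. -/
def nearest (x : E3) : Fin 3 → ℤ := fun i => round (x i)

/-- The lattice point `n` as a vector. -/
def latticeVec (n : Fin 3 → ℤ) : E3 := WithLp.toLp 2 fun i => (n i : ℝ)

lemma momentum_eq_smul (L : ℝ) (n : Fin 3 → ℤ) :
    momentum L n = (2 * Real.pi / L) • latticeVec n := by
  ext i; simp [momentum, latticeVec]; ring

lemma norm_momentum {L : ℝ} (hL : 0 < L) (n : Fin 3 → ℤ) :
    ‖momentum L n‖ = 2 * Real.pi / L * ‖latticeVec n‖ := by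
  rw [momentum_eq_smul, norm_smul, Real.norm_of_nonneg (by positivity)]

lemma one_le_norm_latticeVec {n : Fin 3 → ℤ} (hn : n ≠ 0) : 1 ≤ ‖latticeVec n‖ := by
  obtain ⟨i, hi⟩ := Function.ne_iff.mp hn
  have h1 : (1 : ℝ) ≤ |(n i : ℝ)| := by exact_mod_cast Int.one_le_abs hi
  exact h1.trans (PiLp.norm_apply_le (latticeVec n) i)

lemma norm_momentum_pos {L : ℝ} (hL : 0 < L) {n : Fin 3 → ℤ} (hn : n ≠ 0) :
    0 < ‖momentum L n‖ := by
  rw [norm_momentum hL]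
  have := one_le_norm_latticeVec hn
  positivity

lemma le_norm_momentum {L : ℝ} (hL : 0 < L) {n : Fin 3 → ℤ} (hn : n ≠ 0) :
    2 * Real.pi / L ≤ ‖momentum L n‖ := by
  rw [norm_momentum hL]
  have := one_le_norm_latticeVec hn
  have h : 0 < 2 * Real.pi / L := by positivity
  nlinarith

lemma norm_latticeVec_nearest_sub_le (x : E3) : ‖latticeVec (nearest x) - x‖ ≤ 1 := by
  rw [EuclideanSpace.norm_eq]
  apply Real.sqrt_le_iff.mpr
  refine ⟨by norm_num, ?_⟩
  have h : ∀ i, ‖(latticeVec (nearest x) - x) i‖ ^ 2 ≤ (1 / 2) ^ 2 := by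
    intro i
    have := abs_sub_round (x i)
    rw [abs_sub_comm] at this
    have e : ‖(latticeVec (nearest x) - x) i‖ = |(round (x i) : ℝ) - x i| := by
      simp [latticeVec, nearest]
    rw [e]; gcongr
  refine (Finset.sum_le_sum fun i _ => h i).trans ?_
  norm_num

/-- The rounding error is at most 1, and a nonzero lattice point has length at least 1. Hence a
decreasing radial majorant at a lattice point is dominated by the same majorant at half the
continuous variable. -/
lemma norm_le_two_mul_nearest {x : E3} (hx : nearest x ≠ 0) :
    ‖x‖ ≤ 2 * ‖latticeVec (nearest x)‖ := by
  have h1 := norm_latticeVec_nearest_sub_le x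
  have h2 := one_le_norm_latticeVec hx
  have h3 := norm_sub_norm_le x (latticeVec (nearest x))
  rw [norm_sub_rev] at h3
  linarith

lemma measurable_nearest : Measurable nearest := by
  refine measurable_pi_lambda _ fun i => ?_
  have : (fun x : E3 => nearest x i) = fun x => ⌊x i + 1 / 2⌋ := by
    ext x; simp [nearest, round_eq]
  rw [this]
  exact Int.measurable_floor.comp (by fun_prop)

/-- The fibres are half-open unit cubes. Sums over ℤ³ thereby become integrals over ℝ³ of functions
of the nearest lattice point. -/
lemma measurePreserving_nearest : MeasurePreserving nearest volume Measure.count := by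
  refine ⟨measurable_nearest, Measure.ext_of_singleton fun n => ?_⟩
  rw [Measure.map_apply measurable_nearest (measurableSet_singleton n), Measure.count_singleton]
  have e : nearest ⁻¹' {n} = (WithLp.ofLp (p := 2)) ⁻¹'
      (Set.univ.pi fun i => Set.Ico ((n i : ℝ) - 1 / 2) (n i + 1 / 2)) := by
    ext x
    simp only [Set.mem_preimage, Set.mem_singleton_iff, Set.mem_univ_pi, Set.mem_Ico,
      funext_iff, nearest, round_eq, Int.floor_eq_iff]
    refine forall_congr' fun i => ?_
    constructor <;> rintro ⟨h, h'⟩ <;> constructor <;> linarith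
  rw [e, (PiLp.volume_preserving_ofLp (Fin 3)).measure_preimage
    (MeasurableSet.univ_pi fun _ => measurableSet_Ico).nullMeasurableSet, volume_pi_pi]
  simp only [Real.volume_Ico]
  refine Finset.prod_eq_one fun i _ => ?_
  have : (n i : ℝ) + 1 / 2 - (n i - 1 / 2) = 1 := by ring
  rw [this, ENNReal.ofReal_one]

lemma hasSum_of_integrable_nearest {f : (Fin 3 → ℤ) → ℝ}
    (hf : Integrable (fun x => f (nearest x)) volume) :
    HasSum f (∫ x, f (nearest x)) := by
  have hm : AEStronglyMeasurable f (Measure.count : Measure (Fin 3 → ℤ)) :=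
    (measurable_of_countable f).aestronglyMeasurable
  have h1 : Integrable f Measure.count := by
    rw [← measurePreserving_nearest.map_eq] at hm ⊢
    exact (integrable_map_measure hm measurable_nearest.aemeasurable).2 hf
  have h2 := h1
  rw [integrable_count_iff] at h2
  have h3 : ∫ x, f (nearest x) = ∑' n, f n := by
    have := integral_countable h1
    rw [← integral_map (φ := nearest) measurable_nearest.aemeasurable
      (by rw [measurePreserving_nearest.map_eq]; exact hm), measurePreserving_nearest.map_eq, this]
    refine tsum_congr fun n => ?_
    simp [Measure.real]
  rw [h3]
  exact h2.of_norm.hasSum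

/-- A radial profile with different power laws at the origin and at infinity. -/
def profile (α β : ℕ) (r : ℝ) : ℝ := if r < 1 then (r ^ α)⁻¹ else (r ^ β)⁻¹

lemma profile_nonneg (α β : ℕ) {r : ℝ} (hr : 0 ≤ r) : 0 ≤ profile α β r := by
  unfold profile; split_ifs <;> positivity

lemma profile_anti (α β : ℕ) {r r' : ℝ} (hr : 0 < r) (h : r ≤ r') :
    profile α β r' ≤ profile α β r := by
  unfold profile
  have hr' : 0 < r' := hr.trans_le h
  split_ifs with h1 h2 h2
  · gcongr
  · exact absurd (h.trans_lt h1) h2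
  · calc (r' ^ β)⁻¹ ≤ 1 := inv_le_one_of_one_le₀ (one_le_pow₀ (not_lt.1 h1))
      _ ≤ (r ^ α)⁻¹ := (one_le_inv₀ (by positivity)).2 (pow_le_one₀ hr.le h2.le)
  · gcongr

lemma integrable_profile {α β : ℕ} (hα : α < 3) (hβ : 3 < β) :
    Integrable (fun x : E3 => profile α β ‖x‖) volume := by
  rw [integrable_fun_norm_addHaar volume (f := profile α β)]
  simp only [finrank_euclideanSpace, Fintype.card_fin]
  have hmeas : Measurable (fun y : ℝ => y ^ (3 - 1) • profile α β y) := by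
    refine (measurable_id.pow_const _).smul (Measurable.ite measurableSet_Iio ?_ ?_)
    · exact (measurable_id.pow_const _).inv
    · exact (measurable_id.pow_const _).inv
  have hU : Set.Ioi (0 : ℝ) = Set.Ioc 0 1 ∪ Set.Ioi 1 := by
    rw [Set.Ioc_union_Ioi_eq_Ioi zero_le_one]
  rw [hU]
  refine IntegrableOn.union ?_ ?_
  · refine Measure.integrableOn_of_bounded (M := 1) (by simp) hmeas.aestronglyMeasurable ?_
    filter_upwards [ae_restrict_mem measurableSet_Ioc] with y hy
    have hy0 := hy.1
    have hp := profile_nonneg α β hy0.le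
    rw [smul_eq_mul, Real.norm_of_nonneg (by positivity), profile]
    split_ifs with h
    · rw [← div_eq_mul_inv, div_le_one (by positivity)]
      exact pow_le_pow_of_le_one hy0.le hy.2 (by omega)
    · have : y = 1 := le_antisymm hy.2 (not_lt.1 h)
      simp [this]
  · refine Integrable.mono' (integrableOn_Ioi_rpow_of_lt (a := -2) (by norm_num) zero_lt_one)
      hmeas.aestronglyMeasurable ?_
    filter_upwards [ae_restrict_mem measurableSet_Ioi] with y hy
    have hy1 : 1 < y := hy
    have hy0 : 0 < y := by linarith
    have hp := profile_nonneg α β hy0.le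
    rw [smul_eq_mul, Real.norm_of_nonneg (by positivity), profile, if_neg (not_lt.2 hy1.le),
      Real.rpow_neg hy0.le, ← div_eq_mul_inv, ← one_div]
    rw [div_le_div_iff₀ (by positivity) (by positivity)]
    have : y ^ (2 : ℝ) = y ^ 2 := by norm_cast
    rw [this, one_mul, ← pow_add]
    exact pow_le_pow_right₀ hy1.le (by omega)

/-- Lattice sums are bounded by the corresponding integrals, uniformly in the side of the box. -/
lemma exists_lattice_sum_le {α β : ℕ} (hα : α < 3) (hβ : 3 < β) :
    ∃ C : ℝ, 0 < C ∧ ∀ (L : ℝ) (f : (Fin 3 → ℤ) → ℝ) (A B R : ℝ), 0 < L → 0 ≤ A → 0 ≤ B → 0 < R →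
      (∀ n, 0 ≤ f n) → f 0 = 0 → (∀ n, n ≠ 0 → f n ≤ A / ‖momentum L n‖ ^ α) →
      (∀ n, n ≠ 0 → f n ≤ B / ‖momentum L n‖ ^ β) →
      Summable f ∧ (L ^ 3)⁻¹ * ∑' n, f n ≤ C * ((A / R ^ α + B / R ^ β) * R ^ 3) := by
  have hI := integrable_profile hα hβ
  set I := ∫ x : E3, profile α β ‖x‖ with hIdef
  have hI0 : 0 ≤ I := integral_nonneg fun x => profile_nonneg α β (norm_nonneg x)
  refine ⟨I / Real.pi ^ 3 + 1, by positivity, ?_⟩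
  intro L f A B R hL hA hB hR hf0 hz hfa hfb
  set M := A / R ^ α + B / R ^ β with hM
  have hM0 : 0 ≤ M := by positivity
  -- Of the factor 2π/L relating momenta to lattice points one half is given up in
  -- `norm_le_two_mul_nearest`. With this q, |q x| is at most |p|/R for the momentum p of the
  -- lattice point nearest to x, and the constant does not depend on L.
  set q := Real.pi / (L * R) with hq
  have hq0 : 0 < q := by positivity
  have hbound : ∀ x : E3, x ≠ 0 → f (nearest x) ≤ M * profile α β ‖q • x‖ := by
    intro x hx0
    have hx : 0 < ‖x‖ := norm_pos_iff.2 hx0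
    by_cases hn : nearest x = 0
    · rw [hn, hz]; exact mul_nonneg hM0 (profile_nonneg α β (norm_nonneg _))
    · have hp := norm_momentum_pos hL hn
      have h1 : f (nearest x) ≤ M * profile α β (‖momentum L (nearest x)‖ / R) := by
        unfold profile
        split_ifs with h
        · refine (hfa _ hn).trans ?_
          rw [div_pow, inv_div, hM, add_mul]
          have e : A / R ^ α * (R ^ α / ‖momentum L (nearest x)‖ ^ α)
            = A / ‖momentum L (nearest x)‖ ^ α := by field_simp
          rw [e]
          have : 0 ≤ B / R ^ β * (R ^ α / ‖momentum L (nearest x)‖ ^ α) := by positivity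
          linarith
        · refine (hfb _ hn).trans ?_
          rw [div_pow, inv_div, hM, add_mul]
          have e : B / R ^ β * (R ^ β / ‖momentum L (nearest x)‖ ^ β)
            = B / ‖momentum L (nearest x)‖ ^ β := by field_simp
          rw [e]
          have : 0 ≤ A / R ^ α * (R ^ β / ‖momentum L (nearest x)‖ ^ β) := by positivity
          linarith
      refine h1.trans ?_
      refine mul_le_mul_of_nonneg_left (profile_anti α β ?_ ?_) hM0
      · rw [norm_smul, Real.norm_of_nonneg hq0.le]; positivity
      · rw [norm_smul, Real.norm_of_nonneg hq0.le, norm_momentum hL, hq]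
        have := norm_le_two_mul_nearest hn
        calc Real.pi / (L * R) * ‖x‖ ≤ Real.pi / (L * R) * (2 * ‖latticeVec (nearest x)‖) := by gcongr
          _ = _ := by field_simp
  have hg : Integrable (fun x : E3 => M * profile α β ‖q • x‖) volume :=
    ((integrable_comp_smul_iff volume (fun x : E3 => profile α β ‖x‖) hq0.ne').2 hI).const_mul M
  have hae : ∀ᵐ x : E3, x ≠ 0 := by
    simp [ae_iff, measure_singleton]
  have hF : Integrable (fun x : E3 => f (nearest x)) volume := by
    refine hg.mono' ((measurable_of_countable f).comp measurable_nearest).aestronglyMeasurable ?_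
    filter_upwards [hae] with x hx
    rw [Real.norm_of_nonneg (hf0 _)]
    exact hbound x hx
  have hs := hasSum_of_integrable_nearest hF
  refine ⟨hs.summable, ?_⟩
  rw [hs.tsum_eq]
  have h1 : ∫ x : E3, f (nearest x) ≤ ∫ x : E3, M * profile α β ‖q • x‖ := by
    refine integral_mono_ae hF hg ?_
    filter_upwards [hae] with x hx using hbound x hx
  rw [integral_const_mul, Measure.integral_comp_smul volume (fun x : E3 => profile α β ‖x‖)] at h1
  simp only [finrank_euclideanSpace, Fintype.card_fin, smul_eq_mul] at h1
  rw [abs_of_pos (by positivity), ← hIdef] at h1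
  calc (L ^ 3)⁻¹ * ∫ x : E3, f (nearest x) ≤ (L ^ 3)⁻¹ * (M * ((q ^ 3)⁻¹ * I)) := by gcongr
    _ = I / Real.pi ^ 3 * (M * R ^ 3) := by rw [hq]; field_simp
    _ ≤ _ := by
      have : 0 ≤ M * R ^ 3 := by positivity
      nlinarith

/-- Convergence of the lattice sums of a function with an integrable singularity at the origin. -/
lemma tendsto_lattice_sum {α β : ℕ} (hα : α < 3) (hβ : 3 < β) {F : E3 → ℝ}
    (hFc : ∀ x, x ≠ 0 → ContinuousAt F x) {M : ℝ} (hM : 0 ≤ M)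
    (hFb : ∀ x, x ≠ 0 → |F x| ≤ M * profile α β ‖x‖) :
    Tendsto (fun L : ℝ => (L ^ 3)⁻¹ * ∑' n, if n = 0 then 0 else F (momentum L n)) atTop
      (𝓝 (((2 * Real.pi) ^ 3)⁻¹ * ∫ x, F x)) := by
  -- The step function that evaluates F at the dual lattice point nearest to y. Up to (2π)⁻³ its
  -- integral is the lattice sum, it converges to F away from the origin, and the profile at y/2
  -- dominates it for every L > 0.
  let G : ℝ → E3 → ℝ := fun L y =>
    if nearest ((L / (2 * Real.pi)) • y) = 0 then 0
      else F (momentum L (nearest ((L / (2 * Real.pi)) • y)))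
  have hae : ∀ᵐ x : E3, x ≠ 0 := by simp [ae_iff, measure_singleton]
  have hmn : ∀ L : ℝ, Measurable (fun n : Fin 3 → ℤ => if n = 0 then 0 else F (momentum L n)) :=
    fun L => measurable_of_countable _
  have hGm : ∀ L, AEStronglyMeasurable (G L) volume := fun L =>
    ((hmn L).comp (measurable_nearest.comp (measurable_const_smul (L / (2 * Real.pi))))).aestronglyMeasurable
  have hbd : ∀ᶠ L : ℝ in atTop, ∀ᵐ y : E3, ‖G L y‖ ≤ M * profile α β ‖(2⁻¹ : ℝ) • y‖ := by
    filter_upwards [eventually_gt_atTop 0] with L hL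
    filter_upwards [hae] with y hy
    have hy0 : 0 < ‖y‖ := norm_pos_iff.2 hy
    simp only [G]
    split_ifs with h
    · rw [norm_zero]; exact mul_nonneg hM (profile_nonneg α β (norm_nonneg _))
    · have hp := norm_momentum_pos hL h
      refine (hFb _ (norm_pos_iff.1 hp)).trans ?_
      refine mul_le_mul_of_nonneg_left (profile_anti α β ?_ ?_) hM
      · rw [norm_smul, Real.norm_of_nonneg (by norm_num)]; positivity
      · have := norm_le_two_mul_nearest h
        rw [norm_smul, Real.norm_of_nonneg (by positivity)] at this
        rw [norm_momentum hL, norm_smul, Real.norm_of_nonneg (by norm_num)]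
        calc (2 : ℝ)⁻¹ * ‖y‖ = 2 * Real.pi / L * (2⁻¹ * (L / (2 * Real.pi) * ‖y‖)) := by field_simp
          _ ≤ 2 * Real.pi / L * (2⁻¹ * (2 * ‖latticeVec (nearest ((L / (2 * Real.pi)) • y))‖)) := by
            gcongr
          _ = _ := by ring
  have hbi : Integrable (fun y : E3 => M * profile α β ‖(2⁻¹ : ℝ) • y‖) volume :=
    ((integrable_comp_smul_iff volume (fun x : E3 => profile α β ‖x‖) (by norm_num)).2
      (integrable_profile hα hβ)).const_mul M
  have hlim : ∀ᵐ y : E3, Tendsto (fun L => G L y) atTop (𝓝 (F y)) := by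
    filter_upwards [hae] with y hy
    have h1 : Tendsto (fun L : ℝ => momentum L (nearest ((L / (2 * Real.pi)) • y))) atTop (𝓝 y) := by
      rw [tendsto_iff_norm_sub_tendsto_zero]
      have h2 : Tendsto (fun L : ℝ => 2 * Real.pi / L) atTop (𝓝 0) :=
        tendsto_const_nhds.div_atTop tendsto_id
      refine squeeze_zero' (Eventually.of_forall fun _ => norm_nonneg _) ?_ h2
      filter_upwards [eventually_gt_atTop 0] with L hL
      have e : momentum L (nearest ((L / (2 * Real.pi)) • y)) - y = (2 * Real.pi / L) •
          (latticeVec (nearest ((L / (2 * Real.pi)) • y)) - (L / (2 * Real.pi)) • y) := by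
        rw [momentum_eq_smul, smul_sub, smul_smul]
        congr 1
        have : 2 * Real.pi / L * (L / (2 * Real.pi)) = 1 := by field_simp
        rw [this, one_smul]
      rw [e, norm_smul, Real.norm_of_nonneg (by positivity)]
      have := norm_latticeVec_nearest_sub_le ((L / (2 * Real.pi)) • y)
      have hp : 0 ≤ 2 * Real.pi / L := by positivity
      nlinarith
    have h3 := (hFc y hy).tendsto.comp h1
    refine h3.congr' ?_
    filter_upwards [h1.eventually_ne hy] with L hL
    simp only [G, Function.comp_apply]
    rw [if_neg]
    intro h
    rw [h, momentum_zero] at hL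
    exact hL rfl
  have hT := tendsto_integral_filter_of_dominated_convergence _
    (Eventually.of_forall hGm) hbd hbi hlim
  have hT' := hT.const_mul (((2 * Real.pi) ^ 3)⁻¹)
  refine hT'.congr' ?_
  filter_upwards [eventually_gt_atTop 0, hbd] with L hL hb
  have hGi : Integrable (G L) volume := hbi.mono' (hGm L) hb
  have hq0 : L / (2 * Real.pi) ≠ 0 := by positivity
  have hGi' := (integrable_comp_smul_iff volume (fun x : E3 =>
    if nearest x = 0 then 0 else F (momentum L (nearest x))) hq0).1 hGi
  have hs := hasSum_of_integrable_nearest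
    (f := fun n => if n = 0 then 0 else F (momentum L n)) hGi'
  rw [hs.tsum_eq]
  have e : ∫ y, G L y = |((L / (2 * Real.pi)) ^ 3)⁻¹| *
      ∫ x : E3, (if nearest x = 0 then 0 else F (momentum L (nearest x))) := by
    have := Measure.integral_comp_smul volume (fun x : E3 =>
      if nearest x = 0 then 0 else F (momentum L (nearest x))) (L / (2 * Real.pi))
    simp only [finrank_euclideanSpace, Fintype.card_fin, smul_eq_mul] at this
    exact this
  rw [e, abs_of_pos (by positivity)]
  field_simp

end HardSphere

end

/-! ### The symbol ŝ as a function of |p| -/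

noncomputable section

namespace HardSphere

/-- The ratio `ρ₀ V̂_eff(p) / p²` at `|p| = r`. -/
def tRad (a ρ₀ r : ℝ) : ℝ := 8 * Real.pi * ρ₀ * Real.sin (r * a) / r ^ 3

/-- The fourth root of `1 + 2 ρ₀ V̂_eff(p) / p²` at `|p| = r`. -/
def yRad (a ρ₀ r : ℝ) : ℝ := √(√(1 + 2 * tRad a ρ₀ r))

/-- The coefficient `ŝ_p` as a function of `r = |p|`. -/
def sRad (a ρ₀ r : ℝ) : ℝ := (1 / yRad a ρ₀ r - yRad a ρ₀ r) / 2

section Symbol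

variable {a ρ₀ r : ℝ}

lemma abs_tRad_le_cube (hρ : 0 < ρ₀) (hr : 0 < r) : |tRad a ρ₀ r| ≤ 8 * Real.pi * ρ₀ / r ^ 3 := by
  rw [tRad, abs_div, abs_of_pos (by positivity : 0 < r ^ 3)]
  gcongr
  rw [abs_mul, abs_of_pos (by positivity)]
  nlinarith [Real.abs_sin_le_one (r * a), Real.pi_pos, mul_pos Real.pi_pos hρ]

lemma abs_tRad_le_sq (ha : 0 < a) (hρ : 0 < ρ₀) (hr : 0 < r) :
    |tRad a ρ₀ r| ≤ 8 * Real.pi * a * ρ₀ / r ^ 2 := by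
  rw [tRad, abs_div, abs_of_pos (by positivity : 0 < r ^ 3), div_le_div_iff₀ (by positivity)
    (by positivity), abs_mul, abs_of_pos (by positivity)]
  have h : |Real.sin (r * a)| ≤ r * a := by
    have := Real.abs_sin_le_abs (x := r * a)
    rwa [abs_of_pos (mul_pos hr ha)] at this
  calc 8 * Real.pi * ρ₀ * |Real.sin (r * a)| * r ^ 2
      ≤ 8 * Real.pi * ρ₀ * (r * a) * r ^ 2 := by gcongr
    _ = _ := by ring

/-- The sine is nonnegative for ra ≤ π. Beyond that r > 3/a, and |t| ≤ 8πρ₀/r³ is small by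
diluteness. So the sign changes of V̂ are harmless: 1 + 2t stays away from 0. -/
lemma neg_le_tRad (ha : 0 < a) (hρ : 0 < ρ₀) (hs : ρ₀ * a ^ 3 ≤ 1 / 100) (hr : 0 < r) :
    -(1 / 8) ≤ tRad a ρ₀ r := by
  by_cases h : r * a ≤ Real.pi
  · have : 0 ≤ tRad a ρ₀ r := by
      have := Real.sin_nonneg_of_nonneg_of_le_pi (mul_pos hr ha).le h
      unfold tRad; positivity
    linarith
  · have h1 := abs_tRad_le_cube (a := a) hρ hr
    have h2 : 8 * Real.pi * ρ₀ / r ^ 3 ≤ 1 / 8 := by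
      rw [div_le_div_iff₀ (by positivity) (by norm_num)]
      have h3 : 3 < r * a := by linarith [Real.pi_gt_three]
      have h4 : 27 < (r * a) ^ 3 := by
        calc (27 : ℝ) = 3 ^ 3 := by norm_num
          _ < (r * a) ^ 3 := by gcongr
      have h5 : (0 : ℝ) < r ^ 3 := by positivity
      have h6 : ρ₀ * (r * a) ^ 3 ≤ 1 / 100 * r ^ 3 := by
        rw [mul_pow]; nlinarith
      nlinarith [Real.pi_lt_four, mul_pos Real.pi_pos hρ]
    linarith [neg_abs_le (tRad a ρ₀ r)]

/-- For ra ≤ π/2 this is sin x ≥ 2x/π; for larger r the left side is at most 3/4 and t ≥ -1/8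
suffices. The growth of y as r → 0 obtained here tames the derivative of ŝ at low momenta. -/
lemma le_one_add_tRad (ha : 0 < a) (hρ : 0 < ρ₀) (hs : ρ₀ * a ^ 3 ≤ 1 / 100) (hr : 0 < r) :
    8 * Real.pi * a * ρ₀ / (2 * r ^ 2) ≤ 1 + 2 * tRad a ρ₀ r := by
  by_cases h : r * a ≤ Real.pi / 2
  · have h1 := Real.mul_le_sin (mul_pos hr ha).le h
    have h2 : 8 * Real.pi * ρ₀ * (2 / Real.pi * (r * a)) / r ^ 3 ≤ tRad a ρ₀ r := by
      unfold tRad; gcongr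
    have e : 8 * Real.pi * ρ₀ * (2 / Real.pi * (r * a)) / r ^ 3 = 16 * a * ρ₀ / r ^ 2 := by
      field_simp; ring
    rw [e] at h2
    have h3 : 8 * Real.pi * a * ρ₀ / (2 * r ^ 2) ≤ 2 * (16 * a * ρ₀ / r ^ 2) := by
      rw [div_le_iff₀ (by positivity)]
      have : 2 * (16 * a * ρ₀ / r ^ 2) * (2 * r ^ 2) = 64 * (a * ρ₀) := by field_simp; ring
      rw [this]
      nlinarith [Real.pi_lt_four, mul_pos ha hρ]
    linarith
  · have h1 := neg_le_tRad ha hρ hs hr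
    have h2 : 8 * Real.pi * a * ρ₀ / (2 * r ^ 2) ≤ 3 / 4 := by
      rw [div_le_div_iff₀ (by positivity) (by norm_num)]
      have h3 : 1 < r * a := by linarith [Real.pi_gt_three]
      have h4 : 1 < (r * a) ^ 2 := by nlinarith
      have h5 : a * ρ₀ ≤ a * ρ₀ * (r * a) ^ 2 := by nlinarith [mul_pos ha hρ]
      have h6 : a * ρ₀ * (r * a) ^ 2 ≤ 1 / 100 * r ^ 2 := by
        have : a * ρ₀ * (r * a) ^ 2 = ρ₀ * a ^ 3 * r ^ 2 := by ring
        rw [this]; gcongr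
      nlinarith [Real.pi_lt_four, mul_pos ha hρ, sq_nonneg r]
    linarith

lemma yRad_pow (ha : 0 < a) (hρ : 0 < ρ₀) (hs : ρ₀ * a ^ 3 ≤ 1 / 100) (hr : 0 < r) :
    yRad a ρ₀ r ^ 4 = 1 + 2 * tRad a ρ₀ r := by
  have h := neg_le_tRad ha hρ hs hr
  calc yRad a ρ₀ r ^ 4 = (yRad a ρ₀ r ^ 2) ^ 2 := by ring
    _ = _ := by rw [yRad, Real.sq_sqrt (by positivity), Real.sq_sqrt (by linarith)]

lemma le_yRad (ha : 0 < a) (hρ : 0 < ρ₀) (hs : ρ₀ * a ^ 3 ≤ 1 / 100) (hr : 0 < r) :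
    9 / 10 ≤ yRad a ρ₀ r := by
  have h := neg_le_tRad ha hρ hs hr
  have h4 := yRad_pow ha hρ hs hr
  by_contra! hc
  have h0 : 0 ≤ yRad a ρ₀ r := Real.sqrt_nonneg _
  have : yRad a ρ₀ r ^ 4 ≤ (9 / 10) ^ 4 := by gcongr
  norm_num at this
  linarith

/-- In terms of y one has t = -ŝ·y(1+y²), and y ≥ 9/10 makes the last factor at least 1. -/
lemma abs_sRad_le_abs_tRad (ha : 0 < a) (hρ : 0 < ρ₀) (hs : ρ₀ * a ^ 3 ≤ 1 / 100) (hr : 0 < r) :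
    |sRad a ρ₀ r| ≤ |tRad a ρ₀ r| := by
  have h4 := yRad_pow ha hρ hs hr
  have h9 := le_yRad ha hρ hs hr
  rw [sRad]
  set y := yRad a ρ₀ r
  have e1 : tRad a ρ₀ r = (1 / y - y) / 2 * (-(y * (1 + y ^ 2))) := by
    have : y ≠ 0 := by positivity
    field_simp
    linarith
  rw [e1, abs_mul, abs_neg, abs_of_pos (by positivity : 0 < y * (1 + y ^ 2))]
  have : 1 ≤ y * (1 + y ^ 2) := by nlinarith
  exact le_mul_of_one_le_right (abs_nonneg _) this

/-- For large t the modulus of ŝ grows only like y/2, that is like t^(1/4). This is the bound for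
low momenta, where it yields ŝ² ≤ w/|p|. For t ≤ 0 one has |t| ≤ 1 and the linear bound is stronger.
-/
lemma sRad_pow_four_le (ha : 0 < a) (hρ : 0 < ρ₀) (hs : ρ₀ * a ^ 3 ≤ 1 / 100) (hr : 0 < r) :
    sRad a ρ₀ r ^ 4 ≤ |tRad a ρ₀ r| := by
  have ht := neg_le_tRad ha hρ hs hr
  rcases le_total 0 (tRad a ρ₀ r) with h0 | h0
  · have h4 := yRad_pow ha hρ hs hr
    have h9 := le_yRad ha hρ hs hr
    rw [abs_of_nonneg h0, sRad]
    set y := yRad a ρ₀ r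
    have hy1 : 1 ≤ y := by
      by_contra! hc
      have : y ^ 4 < 1 := pow_lt_one₀ (by linarith) hc (by norm_num)
      linarith
    have e : ((1 / y - y) / 2) ^ 4 = (y ^ 2 - 1) ^ 4 / (16 * y ^ 4) := by
      have : y ≠ 0 := by positivity
      field_simp
      ring
    rw [e, div_le_iff₀ (by positivity)]
    have ht' : tRad a ρ₀ r = (y ^ 2 - 1) * (y ^ 2 + 1) / 2 := by linarith
    rw [ht']
    have h1 : 0 ≤ y ^ 2 - 1 := by nlinarith
    have h2 : (y ^ 2 - 1) ^ 3 ≤ (y ^ 2) ^ 2 * (y ^ 2 + 1) := by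
      have : (y ^ 2 - 1) ^ 3 ≤ (y ^ 2) ^ 3 := by gcongr; linarith
      nlinarith [sq_nonneg (y ^ 2)]
    nlinarith [mul_le_mul_of_nonneg_left h2 h1, mul_nonneg h1 (by positivity : 0 ≤ (y ^ 2) ^ 2 * (y ^ 2 + 1))]
  · have h1 := abs_sRad_le_abs_tRad ha hρ hs hr
    have h2 : |tRad a ρ₀ r| ≤ 1 := by rw [abs_of_nonpos h0]; linarith
    calc sRad a ρ₀ r ^ 4 = |sRad a ρ₀ r| ^ 4 := by rw [← abs_pow, abs_of_nonneg (by positivity)]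
      _ ≤ |sRad a ρ₀ r| ^ 1 := pow_le_pow_of_le_one (abs_nonneg _) (h1.trans h2) (by norm_num)
      _ ≤ _ := by rw [pow_one]; exact h1

/-- Both sides have the factor (y-1)², because -t/2 is the first-order expansion of ŝ at y = 1. That
term is minus ρ₀ times the Fourier transform of `om`, so the remainder bounded here is the symbol of
s + ρ₀ω. -/
lemma abs_sRad_add_half_tRad_le (ha : 0 < a) (hρ : 0 < ρ₀) (hs : ρ₀ * a ^ 3 ≤ 1 / 100)
    (hr : 0 < r) : |sRad a ρ₀ r + tRad a ρ₀ r / 2| ≤ 2 * tRad a ρ₀ r ^ 2 := by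
  have h4 := yRad_pow ha hρ hs hr
  have h9 := le_yRad ha hρ hs hr
  rw [sRad]
  set y := yRad a ρ₀ r
  have ht' : tRad a ρ₀ r = (y ^ 2 - 1) * (y ^ 2 + 1) / 2 := by linarith
  have e : (1 / y - y) / 2 + tRad a ρ₀ r / 2
      = (y - 1) ^ 2 * ((y + 1) * (y ^ 2 + y + 2) / (4 * y)) := by
    rw [ht']
    have : y ≠ 0 := by positivity
    field_simp
    ring
  rw [e, ht', abs_of_nonneg (by positivity)]
  have e2 : 2 * ((y ^ 2 - 1) * (y ^ 2 + 1) / 2) ^ 2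
      = (y - 1) ^ 2 * ((y + 1) ^ 2 * (y ^ 2 + 1) ^ 2 / 2) := by ring
  rw [e2]
  refine mul_le_mul_of_nonneg_left ?_ (sq_nonneg _)
  rw [div_le_div_iff₀ (by positivity) (by norm_num)]
  have h1 : y ^ 2 + y + 2 ≤ (y + 1) * (y ^ 2 + 1) ^ 2 * y * 2 := by
    have h2 : 81 / 100 ≤ y ^ 2 := by nlinarith
    have h3 : 3 ≤ (y ^ 2 + 1) ^ 2 := by nlinarith
    have h4 : 0 ≤ (y + 1) * y := by positivity
    nlinarith [mul_le_mul_of_nonneg_left h3 h4]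
  have h0 : 0 ≤ y + 1 := by positivity
  nlinarith [mul_le_mul_of_nonneg_left h1 h0]

variable {w : ℝ}

lemma sRad_sq_le_four (ha : 0 < a) (hρ : 0 < ρ₀) (hs : ρ₀ * a ^ 3 ≤ 1 / 100) (hr : 0 < r)
    (hw : 8 * Real.pi * a * ρ₀ ≤ w ^ 2) : sRad a ρ₀ r ^ 2 ≤ w ^ 4 / r ^ 4 := by
  have h1 := (abs_sRad_le_abs_tRad ha hρ hs hr).trans (abs_tRad_le_sq ha hρ hr)
  have h2 : |sRad a ρ₀ r| ≤ w ^ 2 / r ^ 2 := h1.trans (by gcongr)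
  calc sRad a ρ₀ r ^ 2 = |sRad a ρ₀ r| ^ 2 := (sq_abs _).symm
    _ ≤ (w ^ 2 / r ^ 2) ^ 2 := by gcongr
    _ = _ := by rw [div_pow, ← pow_mul, ← pow_mul]

lemma sRad_sq_le_one (ha : 0 < a) (hρ : 0 < ρ₀) (hs : ρ₀ * a ^ 3 ≤ 1 / 100) (hr : 0 < r)
    (hw0 : 0 < w) (hw : 8 * Real.pi * a * ρ₀ ≤ w ^ 2) : sRad a ρ₀ r ^ 2 ≤ w / r := by
  have h1 := (sRad_pow_four_le ha hρ hs hr).trans (abs_tRad_le_sq ha hρ hr)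
  have h2 : sRad a ρ₀ r ^ 4 ≤ w ^ 2 / r ^ 2 := h1.trans (by gcongr)
  refine le_of_sq_le_sq ?_ (by positivity)
  calc (sRad a ρ₀ r ^ 2) ^ 2 = sRad a ρ₀ r ^ 4 := by ring
    _ ≤ _ := by rw [div_pow]; exact h2

lemma hasDerivAt_tRad (a ρ₀ : ℝ) (hr : 0 < r) : HasDerivAt (tRad a ρ₀)
    (8 * Real.pi * ρ₀ * (a * Real.cos (r * a) / r ^ 3 - 3 * Real.sin (r * a) / r ^ 4)) r := by
  have h1 : HasDerivAt (fun r => Real.sin (r * a)) (Real.cos (r * a) * (1 * a)) r :=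
    ((hasDerivAt_id r).mul_const a).sin
  have h2 := ((h1.const_mul (8 * Real.pi * ρ₀)).div (hasDerivAt_pow 3 r) (by positivity))
  unfold tRad
  convert! h2 using 1
  push_cast
  field_simp

lemma abs_deriv_tRad_le (ha : 0 < a) (hρ : 0 < ρ₀) (hr : 0 < r) :
    |8 * Real.pi * ρ₀ * (a * Real.cos (r * a) / r ^ 3 - 3 * Real.sin (r * a) / r ^ 4)|
      ≤ 4 * (8 * Real.pi * a * ρ₀) / r ^ 3 := by
  have h : |Real.sin (r * a)| ≤ r * a := by
    have := Real.abs_sin_le_abs (x := r * a)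
    rwa [abs_of_pos (mul_pos hr ha)] at this
  have hc := Real.abs_cos_le_one (r * a)
  rw [abs_mul, abs_of_pos (by positivity)]
  have h1 : |a * Real.cos (r * a) / r ^ 3 - 3 * Real.sin (r * a) / r ^ 4|
      ≤ a / r ^ 3 + 3 * (r * a) / r ^ 4 := by
    refine (abs_sub _ _).trans (add_le_add ?_ ?_)
    · rw [abs_div, abs_mul, abs_of_pos ha, abs_of_pos (by positivity : 0 < r ^ 3)]
      gcongr
      nlinarith
    · rw [abs_div, abs_mul, abs_of_pos (by norm_num : (0 : ℝ) < 3),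
        abs_of_pos (by positivity : 0 < r ^ 4)]
      gcongr
  calc 8 * Real.pi * ρ₀ * _ ≤ 8 * Real.pi * ρ₀ * (a / r ^ 3 + 3 * (r * a) / r ^ 4) := by gcongr
    _ = _ := by field_simp; ring

lemma hasDerivAt_sRad (ha : 0 < a) (hρ : 0 < ρ₀) (hs : ρ₀ * a ^ 3 ≤ 1 / 100) (hr : 0 < r) :
    ∃ s', HasDerivAt (sRad a ρ₀) s' r ∧
      |s'| ≤ 4 * (8 * Real.pi * a * ρ₀) / r ^ 3 / yRad a ρ₀ r ^ 3 := by
  have h9 := le_yRad ha hρ hs hr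
  have ht := neg_le_tRad ha hρ hs hr
  set t' := 8 * Real.pi * ρ₀ * (a * Real.cos (r * a) / r ^ 3 - 3 * Real.sin (r * a) / r ^ 4)
    with ht'
  have h1 : HasDerivAt (fun r => 1 + 2 * tRad a ρ₀ r) (2 * t') r :=
    ((hasDerivAt_tRad a ρ₀ hr).const_mul 2).const_add 1
  have h2 := h1.sqrt (by linarith)
  have hz : 0 < √(1 + 2 * tRad a ρ₀ r) := Real.sqrt_pos.2 (by linarith)
  have h3 := h2.sqrt hz.ne'
  have hy0 : 0 < yRad a ρ₀ r := by linarith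
  have h4 : HasDerivAt (yRad a ρ₀) (t' / (2 * yRad a ρ₀ r ^ 3)) r := by
    convert! h3 using 1
    have e : √(1 + 2 * tRad a ρ₀ r) = yRad a ρ₀ r ^ 2 := by
      rw [yRad, Real.sq_sqrt hz.le]
    rw [e]
    have e2 : √(yRad a ρ₀ r ^ 2) = yRad a ρ₀ r := Real.sqrt_sq hy0.le
    rw [e2]
    field_simp
  have h5 := (((h4.inv hy0.ne').sub h4).div_const 2)
  refine ⟨_, h5.congr_of_eventuallyEq (Filter.Eventually.of_forall fun x => ?_), ?_⟩
  · simp [sRad]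
  · set y := yRad a ρ₀ r
    have e : (-(t' / (2 * y ^ 3)) / y ^ 2 - t' / (2 * y ^ 3)) / 2
        = t' * (-((1 + 1 / y ^ 2) / 4 / y ^ 3)) := by
      field_simp
      ring
    rw [e, abs_mul, abs_neg, abs_of_pos (by positivity : 0 < (1 + 1 / y ^ 2) / 4 / y ^ 3)]
    have hb := abs_deriv_tRad_le (r := r) ha hρ hr
    have h6 : (1 + 1 / y ^ 2) / 4 ≤ 1 := by
      have : 1 / y ^ 2 ≤ 3 := by
        rw [div_le_iff₀ (by positivity)]; nlinarith
      linarith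
    calc |t'| * ((1 + 1 / y ^ 2) / 4 / y ^ 3)
        ≤ (4 * (8 * Real.pi * a * ρ₀) / r ^ 3) * (1 / y ^ 3) := by gcongr
      _ = _ := by ring

/-- At high momenta y ≥ 9/10 is enough. At low momenta y⁴ ≥ v/(2r²), with v = 8π𝔞ρ₀, gives (v²/y⁶)²
≤ 8vr⁶, which converts the powers of y in the denominator into powers of r. -/
lemma sq_deriv_bound (ha : 0 < a) (hρ : 0 < ρ₀) (hs : ρ₀ * a ^ 3 ≤ 1 / 100) (hr : 0 < r)
    (hw0 : 0 < w) (hw : 8 * Real.pi * a * ρ₀ ≤ w ^ 2) :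
    (4 * (8 * Real.pi * a * ρ₀) / r ^ 3 / yRad a ρ₀ r ^ 3) ^ 2 ≤ 48 * (w ^ 4 / r ^ 6) ∧
    (4 * (8 * Real.pi * a * ρ₀) / r ^ 3 / yRad a ρ₀ r ^ 3) ^ 2 ≤ 48 * (w / r ^ 3) := by
  have h9 := le_yRad ha hρ hs hr
  have h4 := yRad_pow ha hρ hs hr
  have hk := le_one_add_tRad ha hρ hs hr
  rw [← h4] at hk
  set y := yRad a ρ₀ r
  set v := 8 * Real.pi * a * ρ₀
  have hv : 0 < v := by positivity
  have hy : 0 < y := by linarith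
  have e : (4 * v / r ^ 3 / y ^ 3) ^ 2 = 16 / r ^ 6 * (v ^ 2 / y ^ 6) := by field_simp; ring
  rw [e]
  constructor
  · have h1 : v ^ 2 / y ^ 6 ≤ 3 * w ^ 4 := by
      rw [div_le_iff₀ (by positivity)]
      have h2 : v ^ 2 ≤ w ^ 4 := by
        calc v ^ 2 ≤ (w ^ 2) ^ 2 := by gcongr
          _ = _ := by ring
      have h3 : 1 / 2 ≤ y ^ 6 := by
        calc (1 : ℝ) / 2 ≤ (9 / 10) ^ 6 := by norm_num
          _ ≤ y ^ 6 := by gcongr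
      have : 0 ≤ w ^ 4 := by positivity
      nlinarith
    calc 16 / r ^ 6 * (v ^ 2 / y ^ 6) ≤ 16 / r ^ 6 * (3 * w ^ 4) := by gcongr
      _ = _ := by ring
  · have h1 : v ^ 2 / y ^ 6 ≤ 3 * (w * r ^ 3) := by
      refine le_of_sq_le_sq ?_ (by positivity)
      have h2 : (v / (2 * r ^ 2)) ^ 3 ≤ (y ^ 4) ^ 3 := by gcongr
      have h3 : (v ^ 2 / y ^ 6) ^ 2 = v ^ 4 / (y ^ 4) ^ 3 := by field_simp
      rw [h3]
      calc v ^ 4 / (y ^ 4) ^ 3 ≤ v ^ 4 / (v / (2 * r ^ 2)) ^ 3 := by gcongr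
        _ = 8 * v * r ^ 6 := by field_simp; ring
        _ ≤ 8 * w ^ 2 * r ^ 6 := by gcongr
        _ ≤ (3 * (w * r ^ 3)) ^ 2 := by
          have : 0 ≤ w ^ 2 * r ^ 6 := by positivity
          nlinarith
    calc 16 / r ^ 6 * (v ^ 2 / y ^ 6) ≤ 16 / r ^ 6 * (3 * (w * r ^ 3)) := by gcongr
      _ = _ := by field_simp; ring

lemma sq_sRad_sub_le {r' : ℝ} (ha : 0 < a) (hρ : 0 < ρ₀) (hs : ρ₀ * a ^ 3 ≤ 1 / 100)
    (hw0 : 0 < w) (hw : 8 * Real.pi * a * ρ₀ ≤ w ^ 2) {m : ℝ} (hm : 0 < m) (hr : m ≤ r)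
    (hr' : m ≤ r') :
    (sRad a ρ₀ r - sRad a ρ₀ r') ^ 2 ≤ 48 * (w ^ 4 / m ^ 6) * (r - r') ^ 2 ∧
    (sRad a ρ₀ r - sRad a ρ₀ r') ^ 2 ≤ 48 * (w / m ^ 3) * (r - r') ^ 2 := by
  have key : ∀ K : ℝ, 0 ≤ K → (∀ x, m ≤ x →
      (4 * (8 * Real.pi * a * ρ₀) / x ^ 3 / yRad a ρ₀ x ^ 3) ^ 2 ≤ K) →
      (sRad a ρ₀ r - sRad a ρ₀ r') ^ 2 ≤ K * (r - r') ^ 2 := by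
    intro K hK hb
    -- The mean value inequality on [m, ∞) wants the derivative as a total function; the value 0
    -- below m is a dummy.
    have hd : ∀ x, ∃ s', m ≤ x → HasDerivAt (sRad a ρ₀) s' x ∧
      |s'| ≤ 4 * (8 * Real.pi * a * ρ₀) / x ^ 3 / yRad a ρ₀ x ^ 3 := by
      intro x
      by_cases hx : m ≤ x
      · obtain ⟨s', h⟩ := hasDerivAt_sRad ha hρ hs (hm.trans_le hx)
        exact ⟨s', fun _ => h⟩
      · exact ⟨0, fun h => absurd h hx⟩
    choose s' hs' using hd
    have := (convex_Ici m).norm_image_sub_le_of_norm_hasDerivWithin_le (f := sRad a ρ₀) (f' := s')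
      (C := √K) (fun x hx => (hs' x hx).1.hasDerivWithinAt) (fun x hx => by
        rw [Real.norm_eq_abs]
        refine Real.le_sqrt_of_sq_le ?_
        refine le_trans ?_ (hb x hx)
        have := (hs' x hx).2
        gcongr) (x := r') (y := r) hr' hr
    rw [Real.norm_eq_abs, Real.norm_eq_abs] at this
    calc (sRad a ρ₀ r - sRad a ρ₀ r') ^ 2 = |sRad a ρ₀ r - sRad a ρ₀ r'| ^ 2 := (sq_abs _).symm
      _ ≤ (√K * |r - r'|) ^ 2 := by gcongr
      _ = _ := by rw [mul_pow, Real.sq_sqrt hK, sq_abs]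
  constructor
  · refine key _ (by positivity) fun x hx => ?_
    have hx0 := hm.trans_le hx
    refine (sq_deriv_bound ha hρ hs hx0 hw0 hw).1.trans ?_
    gcongr
  · refine key _ (by positivity) fun x hx => ?_
    have hx0 := hm.trans_le hx
    refine (sq_deriv_bound ha hρ hs hx0 hw0 hw).2.trans ?_
    gcongr

end Symbol

/-- The dispersion is p²y², so D = p²(y²-1)²/2 and, with V = ρ₀V̂, V² - D² = p⁴y²(y²-1)². The sign
of V is that of y² - 1 and removes the absolute value left by the square root. At y = 1 both sides
vanish, since V = 0 and its sign is 0. -/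
lemma sHat_eq_sRad {a ρ₀ L : ℝ} (ha : 0 < a) (hρ : 0 < ρ₀) (hs : ρ₀ * a ^ 3 ≤ 1 / 100)
    (hL : 0 < L) {n : Fin 3 → ℤ} (hn : n ≠ 0) :
    sHat a ρ₀ L n = sRad a ρ₀ ‖momentum L n‖ := by
  have hr := norm_momentum_pos hL hn
  simp only [sHat, if_neg hn]
  have hV : ρ₀ * VeffHat a (momentum L n)
      = ‖momentum L n‖ ^ 2 * tRad a ρ₀ ‖momentum L n‖ := by
    rw [VeffHat, tRad]; field_simp
  simp only [dispersion, hV]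
  have h9 := le_yRad ha hρ hs hr
  have h4 := yRad_pow ha hρ hs hr
  rw [sRad]
  set r := ‖momentum L n‖
  set y := yRad a ρ₀ r
  have hy : 0 < y := by linarith
  have ht' : tRad a ρ₀ r = (y ^ 4 - 1) / 2 := by linarith
  rw [ht']
  have e1 : √(r ^ 4 + 2 * r ^ 2 * (r ^ 2 * ((y ^ 4 - 1) / 2))) = r ^ 2 * y ^ 2 := by
    rw [← Real.sqrt_sq (by positivity : 0 ≤ r ^ 2 * y ^ 2)]
    congr 1; ring
  rw [e1]
  have e2 : r ^ 2 + r ^ 2 * ((y ^ 4 - 1) / 2) - r ^ 2 * y ^ 2 = r ^ 2 * (y ^ 2 - 1) ^ 2 / 2 := by ring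
  rw [e2]
  have e3 : √((r ^ 2 * ((y ^ 4 - 1) / 2)) ^ 2 - (r ^ 2 * (y ^ 2 - 1) ^ 2 / 2) ^ 2)
      = r ^ 2 * |y ^ 2 - 1| * y := by
    rw [← Real.sqrt_sq (by positivity : 0 ≤ r ^ 2 * |y ^ 2 - 1| * y)]
    have e4 : (r ^ 2 * |y ^ 2 - 1| * y) ^ 2 = r ^ 4 * |y ^ 2 - 1| ^ 2 * y ^ 2 := by ring
    rw [e4, sq_abs]
    congr 1; ring
  rw [e3]
  rcases lt_trichotomy (y ^ 2) 1 with h | h | h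
  · have : r ^ 2 * ((y ^ 4 - 1) / 2) < 0 := by
      have : y ^ 4 < 1 := by nlinarith
      have : 0 < r ^ 2 := by positivity
      nlinarith
    rw [Real.sign_of_neg this, abs_of_neg (by linarith)]
    have : y ^ 2 - 1 ≠ 0 := by linarith
    field_simp
    ring
  · have : y = 1 := by nlinarith
    simp [this]
  · have : 0 < r ^ 2 * ((y ^ 4 - 1) / 2) := by
      have : 1 < y ^ 4 := by nlinarith
      have : 0 < r ^ 2 := by positivity
      nlinarith
    rw [Real.sign_of_pos this, abs_of_pos (by linarith)]
    have : y ^ 2 - 1 ≠ 0 := by linarith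
    field_simp
    ring

end HardSphere

end

/-! ### Polar coordinates and spherical averages of plane waves -/

noncomputable section

namespace HardSphere

open Filter Topology

/-- The surface measure on the unit sphere. -/
abbrev sphereMeasure : Measure (Metric.sphere (0 : E3) 1) := (volume : Measure E3).toSphere

/-- Integration in polar coordinates. -/
lemma integral_polar {F : E3 → ℂ} (hF : Integrable F) :
    ∫ x, F x = ∫ e : Metric.sphere (0 : E3) 1, (∫ r in Set.Ioi (0 : ℝ),
      ((r ^ 2 : ℝ) : ℂ) * F (r • (e : E3))) ∂sphereMeasure := by
  let g : Metric.sphere (0 : E3) 1 × Set.Ioi (0 : ℝ) → ℂ := fun z => F (z.2.1 • (z.1 : E3))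
  have hmp := (volume : Measure E3).measurePreserving_homeomorphUnitSphereProd
  have hemb : MeasurableEmbedding (homeomorphUnitSphereProd E3) := Homeomorph.measurableEmbedding _
  have hg : ∀ x : ({(0)}ᶜ : Set E3), g (homeomorphUnitSphereProd E3 x) = F x.1 := by
    intro x
    have hx : ‖x.1‖ ≠ 0 := norm_ne_zero_iff.2 x.2
    simp only [g, homeomorphUnitSphereProd_apply_snd_coe, homeomorphUnitSphereProd_apply_fst_coe]
    rw [smul_smul, mul_inv_cancel₀ hx, one_smul]
  have hgi : Integrable g (sphereMeasure.prod (Measure.volumeIoiPow 2)) := by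
    have h1 := hmp.integrable_comp_emb hemb (g := g)
    simp only [finrank_euclideanSpace, Fintype.card_fin] at h1
    rw [← h1]
    have h2 : (g ∘ homeomorphUnitSphereProd E3) = F ∘ Subtype.val := by
      ext x; exact hg x
    rw [h2, ← integrableOn_iff_comap_subtypeVal (measurableSet_singleton _).compl]
    exact hF.integrableOn
  calc ∫ x, F x = ∫ x : ({(0)}ᶜ : Set E3), F x.1 ∂(volume.comap Subtype.val) := by
        rw [integral_subtype_comap (measurableSet_singleton _).compl fun x ↦ F x,
          restrict_compl_singleton]
    _ = ∫ z, g z ∂(sphereMeasure.prod (Measure.volumeIoiPow 2)) := by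
        have := hmp.integral_comp hemb g
        simp only [finrank_euclideanSpace, Fintype.card_fin] at this
        rw [← this]
        simp_rw [hg]
    _ = ∫ e, ∫ r, g (e, r) ∂(Measure.volumeIoiPow 2) ∂sphereMeasure := integral_prod _ hgi
    _ = _ := by
        refine integral_congr_ae (Eventually.of_forall fun e => ?_)
        simp only [Measure.volumeIoiPow, ENNReal.ofReal]
        rw [integral_withDensity_eq_integral_smul
          (measurable_subtype_coe.pow_const _).real_toNNReal,
          integral_subtype_comap measurableSet_Ioi
            fun r : ℝ ↦ Real.toNNReal (r ^ 2) • F (r • (e : E3))]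
        refine setIntegral_congr_fun measurableSet_Ioi fun r hr => ?_
        simp only [NNReal.smul_def, Real.coe_toNNReal _ (sq_nonneg r), Complex.real_smul]

lemma sphereMeasure_real_univ : sphereMeasure.real Set.univ = 4 * Real.pi := by
  rw [Measure.toSphere_real_apply_univ, Measure.real, EuclideanSpace.volume_ball_fin_three]
  simp only [finrank_euclideanSpace, Fintype.card_fin]
  rw [ENNReal.ofReal_one, one_pow, one_mul, ENNReal.toReal_ofReal (by positivity)]
  push_cast; ring

lemma volume_disc (s : ℝ) : volume {y : Fin 2 → ℝ | y 0 ^ 2 + y 1 ^ 2 < s}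
    = ENNReal.ofReal (Real.pi * s) := by
  rcases le_or_gt s 0 with hs | hs
  · have : {y : Fin 2 → ℝ | y 0 ^ 2 + y 1 ^ 2 < s} = ∅ := by
      ext y
      simp only [Set.mem_ofPred_eq, Set.mem_empty_iff_false, iff_false, not_lt]
      nlinarith [sq_nonneg (y 0), sq_nonneg (y 1)]
    rw [this, measure_empty, ENNReal.ofReal_of_nonpos]
    nlinarith [Real.pi_pos]
  · have hm : MeasurableSet {y : Fin 2 → ℝ | y 0 ^ 2 + y 1 ^ 2 < s} :=
      measurableSet_lt (by fun_prop) measurable_const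
    have h := (PiLp.volume_preserving_ofLp (Fin 2)).measure_preimage hm.nullMeasurableSet
    have e : (WithLp.ofLp (p := 2)) ⁻¹' {y : Fin 2 → ℝ | y 0 ^ 2 + y 1 ^ 2 < s}
        = Metric.ball (0 : EuclideanSpace ℝ (Fin 2)) √s := by
      ext x
      rw [mem_ball_zero_iff, EuclideanSpace.norm_eq]
      simp only [Set.mem_preimage, Set.mem_ofPred_eq, Fin.sum_univ_two, Real.norm_eq_abs, sq_abs]
      rw [Real.sqrt_lt_sqrt_iff (by positivity)]
    rw [← h, e, EuclideanSpace.volume_ball_fin_two, ← ENNReal.ofReal_pow (by positivity),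
      Real.sq_sqrt hs.le, mul_comm Real.pi s, ENNReal.ofReal_mul hs.le]

/-- Fubini along the first coordinate: the slice of the ball at height t is a disc of area π(R²-t²).
-/
lemma integral_ball_coord (k : ℂ) {R : ℝ} (hR : 0 < R) :
    ∫ x in Metric.ball (0 : E3) R, Complex.exp (k * (x 0 : ℝ))
      = ∫ t in (-R)..R, Complex.exp (k * t) * ((Real.pi * (R ^ 2 - t ^ 2) : ℝ) : ℂ) := by
  let e3 := MeasurableEquiv.piFinSuccAbove (fun _ : Fin 3 => ℝ) 0
  have hmp : MeasurePreserving (fun x : E3 => e3 (WithLp.ofLp x)) volume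
      (volume : Measure (ℝ × (Fin 2 → ℝ))) :=
    (volume_preserving_piFinSuccAbove (fun _ : Fin 3 => ℝ) 0).comp
      (PiLp.volume_preserving_ofLp (Fin 3))
  have hemb : MeasurableEmbedding (fun x : E3 => e3 (WithLp.ofLp x)) :=
    e3.measurableEmbedding.comp (MeasurableEquiv.toLp 2 (Fin 3 → ℝ)).symm.measurableEmbedding
  let S : Set (ℝ × (Fin 2 → ℝ)) := {z | z.2 0 ^ 2 + z.2 1 ^ 2 < R ^ 2 - z.1 ^ 2}
  have hS : MeasurableSet S := measurableSet_lt (by fun_prop) (by fun_prop)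
  have hpre : (fun x : E3 => e3 (WithLp.ofLp x)) ⁻¹' S = Metric.ball (0 : E3) R := by
    ext x
    rw [mem_ball_zero_iff, EuclideanSpace.norm_eq, Real.sqrt_lt' hR]
    simp only [S, e3, Set.mem_preimage, Set.mem_ofPred_eq, Fin.sum_univ_three, Real.norm_eq_abs, sq_abs]
    have e1 : (MeasurableEquiv.piFinSuccAbove (fun _ : Fin 3 => ℝ) 0 (WithLp.ofLp x)).2 0 = x 1 := rfl
    have e2 : (MeasurableEquiv.piFinSuccAbove (fun _ : Fin 3 => ℝ) 0 (WithLp.ofLp x)).2 1 = x 2 := rfl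
    have e0 : (MeasurableEquiv.piFinSuccAbove (fun _ : Fin 3 => ℝ) 0 (WithLp.ofLp x)).1 = x 0 := rfl
    rw [e0, e1, e2]
    constructor <;> intro h <;> linarith
  have h1 := hmp.setIntegral_preimage_emb hemb (fun z => Complex.exp (k * (z.1 : ℝ))) S
  rw [hpre] at h1
  have h2 : ∫ x in Metric.ball (0 : E3) R, Complex.exp (k * (x 0 : ℝ))
      = ∫ z in S, Complex.exp (k * (z.1 : ℝ)) := h1
  rw [h2, ← integral_indicator hS]
  have hSfin : volume S < ⊤ := by
    rw [← hmp.measure_preimage hS.nullMeasurableSet, hpre]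
    exact measure_ball_lt_top
  have hinteg : Integrable (S.indicator fun z : ℝ × (Fin 2 → ℝ) => Complex.exp (k * (z.1 : ℝ)))
      (volume.prod volume) := by
    rw [integrable_indicator_iff hS]
    refine Measure.integrableOn_of_bounded (M := Real.exp (‖k‖ * R)) hSfin.ne
      (by fun_prop) ?_
    filter_upwards [ae_restrict_mem hS] with z hz
    have hz' : z.2 0 ^ 2 + z.2 1 ^ 2 < R ^ 2 - z.1 ^ 2 := hz
    have hzR : |z.1| ≤ R := by
      apply abs_le_of_sq_le_sq _ hR.le
      nlinarith [sq_nonneg (z.2 0), sq_nonneg (z.2 1)]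
    rw [Complex.norm_exp]
    refine Real.exp_le_exp.2 ((Complex.re_le_norm _).trans ?_)
    rw [norm_mul, Complex.norm_real, Real.norm_eq_abs]
    gcongr
  rw [Measure.volume_eq_prod, integral_prod _ hinteg]
  rw [intervalIntegral.integral_of_le (by linarith), ← integral_indicator measurableSet_Ioc]
  refine integral_congr_ae (Eventually.of_forall fun t => ?_)
  have e : ∀ y : Fin 2 → ℝ, S.indicator (fun z : ℝ × (Fin 2 → ℝ) => Complex.exp (k * (z.1 : ℝ))) (t, y)
      = {y : Fin 2 → ℝ | y 0 ^ 2 + y 1 ^ 2 < R ^ 2 - t ^ 2}.indicator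
        (fun _ => Complex.exp (k * (t : ℝ))) y := fun y => rfl
  simp only [e]
  rw [integral_indicator (measurableSet_lt (by fun_prop) measurable_const), setIntegral_const,
    Measure.real, volume_disc]
  by_cases ht : t ∈ Set.Ioc (-R) R
  · rw [Set.indicator_of_mem ht, ENNReal.toReal_ofReal, Complex.real_smul, mul_comm]
    have : t ^ 2 ≤ R ^ 2 := by nlinarith [ht.1, ht.2]
    have := Real.pi_pos
    nlinarith
  · rw [Set.indicator_of_notMem ht, ENNReal.ofReal_of_nonpos]
    · simp
    · have : R ^ 2 ≤ t ^ 2 := by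
        rw [Set.mem_Ioc, not_and_or] at ht
        rcases ht with h | h
        · nlinarith
        · nlinarith
      nlinarith [Real.pi_pos]

lemma integral_ball_coord_eq {k : ℝ} (hk : 0 < k) {R : ℝ} (hR : 0 < R) :
    ∫ x in Metric.ball (0 : E3) R, Complex.exp (Complex.I * k * (x 0 : ℝ))
      = ((4 * Real.pi * (Real.sin (k * R) - k * R * Real.cos (k * R)) / k ^ 3 : ℝ) : ℂ) := by
  rw [integral_ball_coord _ hR]
  have hk' : (k : ℂ) ≠ 0 := by exact_mod_cast hk.ne'
  have hI := Complex.I_ne_zero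
  let c : ℂ := Complex.I * k
  have hc : c ≠ 0 := mul_ne_zero hI hk'
  -- A primitive, found by integrating by parts twice.
  let G : ℝ → ℂ := fun t => Real.pi * (Complex.exp (c * t) *
    (((R : ℂ) ^ 2 - t ^ 2) / c + 2 * t / c ^ 2 - 2 / c ^ 3))
  have hG : ∀ t : ℝ, HasDerivAt G
      (Complex.exp (c * t) * ((Real.pi * (R ^ 2 - t ^ 2) : ℝ) : ℂ)) t := by
    intro t
    have h0 : HasDerivAt (fun t : ℝ => (t : ℂ)) 1 t := Complex.ofRealCLM.hasDerivAt
    have h1 : HasDerivAt (fun t : ℝ => Complex.exp (c * t)) (Complex.exp (c * t) * (c * 1)) t :=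
      (h0.const_mul c).cexp
    have h2 : HasDerivAt (fun t : ℝ => ((R : ℂ) ^ 2 - (t : ℂ) ^ 2) / c + 2 * (t : ℂ) / c ^ 2
        - 2 / c ^ 3) ((-(2 * t) / c) + 2 * 1 / c ^ 2) t := by
      have h3 := h0.pow 2
      have h4 := ((h3.const_sub ((R : ℂ) ^ 2)).div_const c).add
        (((h0.const_mul 2)).div_const (c ^ 2))
      have h5 := h4.sub_const (2 / c ^ 3)
      convert! h5 using 1
      simp
    have h6 := (h1.mul h2).const_mul (Real.pi : ℂ)
    convert! h6 using 1
    push_cast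
    field_simp
    ring
  have hcont : Continuous fun t : ℝ =>
      Complex.exp (c * t) * ((Real.pi * (R ^ 2 - t ^ 2) : ℝ) : ℂ) := by fun_prop
  rw [intervalIntegral.integral_eq_sub_of_hasDerivAt (f := G) (fun t _ => hG t)
    (hcont.intervalIntegrable _ _)]
  simp only [G, c]
  have e1 : Complex.exp (Complex.I * k * R) = Complex.cos (k * R) + Complex.sin (k * R) * Complex.I := by
    rw [← Complex.exp_mul_I]; congr 1; ring
  have e2 : Complex.exp (Complex.I * k * (-R : ℝ)) = Complex.cos (k * R) - Complex.sin (k * R) * Complex.I := by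
    have : Complex.I * k * (-R : ℝ) = -(k * R : ℂ) * Complex.I := by push_cast; ring
    rw [this, Complex.exp_mul_I, Complex.cos_neg, Complex.sin_neg]; ring
  rw [e1, e2]
  push_cast
  have i2 : Complex.I ^ 2 = -1 := Complex.I_sq
  have i3 : Complex.I ^ 3 = -Complex.I := by rw [pow_succ, i2]; ring
  simp only [mul_pow, i2, i3]
  field_simp
  ring_nf

lemma continuous_integral_sphere {G : E3 → ℂ} (hG : Continuous G) :
    Continuous fun r : ℝ => ∫ e, G (r • (e : E3)) ∂sphereMeasure := by
  have : Continuous (Function.uncurry fun (r : ℝ) (e : Metric.sphere (0 : E3) 1) =>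
      G (r • (e : E3))) := by
    unfold Function.uncurry
    fun_prop
  have h := continuous_parametric_integral_of_continuous (μ := sphereMeasure) this
    (isCompact_univ)
  simpa using h

lemma integral_ball_polar {G : E3 → ℂ} (hG : Continuous G) {R : ℝ} (hR : 0 < R) :
    ∫ x in Metric.ball (0 : E3) R, G x
      = ∫ r in (0)..R, ((r ^ 2 : ℝ) : ℂ) * ∫ e, G (r • (e : E3)) ∂sphereMeasure := by
  have hGi : IntegrableOn G (Metric.ball (0 : E3) R) :=
    (hG.continuousOn.integrableOn_compact (isCompact_closedBall 0 R)).mono_set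
      Metric.ball_subset_closedBall
  rw [← integral_indicator measurableSet_ball, integral_polar
    (hGi.integrable_indicator measurableSet_ball)]
  have h1 : ∀ e : Metric.sphere (0 : E3) 1, ∫ r in Set.Ioi (0 : ℝ), ((r ^ 2 : ℝ) : ℂ) *
      (Metric.ball (0 : E3) R).indicator G (r • (e : E3))
      = ∫ r in Set.Ioo 0 R, ((r ^ 2 : ℝ) : ℂ) * G (r • (e : E3)) := by
    intro e
    have he : ‖(e : E3)‖ = 1 := by simp
    rw [← integral_indicator measurableSet_Ioi, ← integral_indicator measurableSet_Ioo]
    refine integral_congr_ae (Eventually.of_forall fun r => ?_)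
    simp only [Set.indicator, Set.mem_Ioi, Set.mem_Ioo, mem_ball_zero_iff, norm_smul, he, mul_one]
    by_cases h : 0 < r
    · simp only [h, Real.norm_of_nonneg h.le, if_true, true_and]
      split_ifs <;> simp
    · simp [h]
  simp_rw [h1]
  rw [integral_integral_swap]
  · rw [intervalIntegral.integral_of_le hR.le, ← integral_Ioc_eq_integral_Ioo]
    simp_rw [integral_const_mul]
  · have hc : Continuous (Function.uncurry fun (e : Metric.sphere (0 : E3) 1) (r : ℝ) =>
        ((r ^ 2 : ℝ) : ℂ) * G (r • (e : E3))) := by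
      unfold Function.uncurry
      fun_prop
    rw [← Measure.restrict_univ (μ := sphereMeasure), Measure.prod_restrict]
    refine (hc.continuousOn.integrableOn_compact
      (isCompact_univ.prod (isCompact_Icc (a := (0 : ℝ)) (b := R)))).mono_set ?_
    exact Set.prod_mono_right Set.Ioo_subset_Icc_self

/-- The spherical average of a plane wave. -/
lemma integral_sphere_exp (p : E3) (hp : p ≠ 0) {R : ℝ} (hR : 0 < R) :
    ∫ e, Complex.exp (Complex.I * (inner ℝ p (R • (e : E3)) : ℝ)) ∂sphereMeasure
      = ((4 * Real.pi * Real.sin (‖p‖ * R) / (‖p‖ * R) : ℝ) : ℂ) := by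
  have hk : 0 < ‖p‖ := norm_pos_iff.2 hp
  set k := ‖p‖ with hkdef
  let G : E3 → ℂ := fun x => Complex.exp (Complex.I * (inner ℝ p x : ℝ))
  have hG : Continuous G := by fun_prop
  have hball : ∀ S, 0 < S → ∫ x in Metric.ball (0 : E3) S, G x
      = ((4 * Real.pi * (Real.sin (k * S) - k * S * Real.cos (k * S)) / k ^ 3 : ℝ) : ℂ) := by
    intro S hS
    rw [← integral_ball_coord_eq hk hS]
    let q : E3 := k • EuclideanSpace.single 0 1
    have hq : ‖p‖ = ‖q‖ := by
      simp [q, norm_smul, hkdef]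
    -- A reflection taking p to |p| times the first basis vector preserves the ball and its volume,
    -- which reduces the plane wave to an exponential in one coordinate.
    let U := (ℝ ∙ (p - q))ᗮ.reflection
    have hU : U p = q := Submodule.reflection_sub hq
    have h2 := U.measurePreserving.setIntegral_preimage_emb
      U.toHomeomorph.measurableEmbedding (fun x => Complex.exp (Complex.I * k * (x 0 : ℝ)))
      (Metric.ball (0 : E3) S)
    have h3 : U ⁻¹' (Metric.ball (0 : E3) S) = Metric.ball 0 S := by
      ext x; simp
    rw [h3] at h2
    rw [← h2]
    refine setIntegral_congr_fun measurableSet_ball fun x _ => ?_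
    simp only [G]
    congr 1
    have h4 : inner ℝ p x = k * (U x) 0 := by
      rw [← U.inner_map_map, hU]
      simp [q, inner_smul_left, EuclideanSpace.inner_single_left]
    rw [h4]; push_cast; ring
  let J : ℝ → ℂ := fun r => ∫ e, G (r • (e : E3)) ∂sphereMeasure
  have hJ : Continuous J := continuous_integral_sphere hG
  have hJ2 : Continuous fun r : ℝ => ((r ^ 2 : ℝ) : ℂ) * J r := by fun_prop
  -- The average over the sphere is recovered from the integrals over balls by differentiating in
  -- the radius. Continuity of J makes the value at the single radius R meaningful.
  have hd1 : HasDerivAt (fun S : ℝ => ∫ r in (0)..S, ((r ^ 2 : ℝ) : ℂ) * J r)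
      (((R ^ 2 : ℝ) : ℂ) * J R) R :=
    intervalIntegral.integral_hasDerivAt_right (hJ2.intervalIntegrable _ _)
      (hJ2.stronglyMeasurableAtFilter _ _) hJ2.continuousAt
  have hd2 : HasDerivAt (fun S : ℝ => ((4 * Real.pi * (Real.sin (k * S) - k * S * Real.cos (k * S))
      / k ^ 3 : ℝ) : ℂ)) ((4 * Real.pi * R * Real.sin (k * R) / k : ℝ) : ℂ) R := by
    have h0 : HasDerivAt (fun S : ℝ => k * S) (k * 1) R := (hasDerivAt_id R).const_mul k
    have h1 := (((h0.sin).sub (h0.mul h0.cos)).const_mul (4 * Real.pi)).div_const (k ^ 3)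
    have h2 : HasDerivAt (fun S : ℝ => 4 * Real.pi * (Real.sin (k * S) - k * S * Real.cos (k * S))
      / k ^ 3) (4 * Real.pi * R * Real.sin (k * R) / k) R := by
      convert! h1 using 1
      field_simp
      ring
    exact h2.ofReal_comp
  have heq : (fun S : ℝ => ∫ r in (0)..S, ((r ^ 2 : ℝ) : ℂ) * J r) =ᶠ[𝓝 R]
      fun S : ℝ => ((4 * Real.pi * (Real.sin (k * S) - k * S * Real.cos (k * S)) / k ^ 3 : ℝ) : ℂ) := by
    filter_upwards [lt_mem_nhds hR] with S hS
    rw [← hball S hS, integral_ball_polar hG hS]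
  have hfin := hd1.unique (hd2.congr_of_eventuallyEq heq)
  have hR2 : ((R ^ 2 : ℝ) : ℂ) ≠ 0 := by exact_mod_cast (by positivity : R ^ 2 ≠ 0)
  change J R = _
  have : J R = ((4 * Real.pi * R * Real.sin (k * R) / k : ℝ) : ℂ) / ((R ^ 2 : ℝ) : ℂ) := by
    rw [← hfin]; field_simp
  rw [this, ← Complex.ofReal_div]
  congr 1
  field_simp

end HardSphere

end

/-! ### The scattering solution `om` and its flux through the sphere -/

noncomputable section

namespace HardSphere

open Filter Topology

/-- The function `1 - f`, that is `𝔞 / |x|` outside and `1` inside the sphere of radius `𝔞`. -/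
def om (a : ℝ) (x : E3) : ℝ := a / max a ‖x‖

/-- The gradient of `om`. -/
def gradOm (a : ℝ) (x : E3) : E3 := if a < ‖x‖ then (-(a / ‖x‖ ^ 3)) • x else 0

section Om

variable {a : ℝ}

lemma one_sub_scat (ha : 0 < a) (x : E3) : 1 - scat a x = om a x := by
  unfold scat om
  split_ifs with h
  · rw [max_eq_right h]; ring
  · rw [max_eq_left (not_le.1 h).le, div_self ha.ne']; ring

lemma om_nonneg (ha : 0 < a) (x : E3) : 0 ≤ om a x := by
  have : 0 < max a ‖x‖ := lt_max_of_lt_left ha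
  unfold om; positivity

lemma om_le_one (ha : 0 < a) (x : E3) : om a x ≤ 1 := by
  unfold om
  rw [div_le_one (lt_max_of_lt_left ha)]
  exact le_max_left _ _

lemma om_le_of_le (ha : 0 < a) {r : ℝ} (hr : 0 < r) {x : E3} (hx : r ≤ ‖x‖) : om a x ≤ a / r := by
  unfold om
  have := hx.trans (le_max_right a ‖x‖)
  gcongr

lemma continuous_om (ha : 0 < a) : Continuous (om a) := by
  unfold om
  refine continuous_const.div (continuous_const.max continuous_norm) fun x => ?_
  have : 0 < max a ‖x‖ := lt_max_of_lt_left ha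
  exact this.ne'

/-- The maximum with a constant is 1-Lipschitz and both denominators are at least 𝔞. The Lipschitz
property permits integration by parts across the sphere |x| = 𝔞, where the gradient jumps. -/
lemma lipschitz_om (ha : 0 < a) : LipschitzWith (1 / a).toNNReal (om a) := by
  refine LipschitzWith.of_dist_le_mul fun x y => ?_
  rw [Real.dist_eq, dist_eq_norm, Real.coe_toNNReal _ (by positivity)]
  unfold om
  have hx : a ≤ max a ‖x‖ := le_max_left _ _
  have hy : a ≤ max a ‖y‖ := le_max_left _ _
  have hm : |max a ‖y‖ - max a ‖x‖| ≤ ‖x - y‖ := by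
    refine (abs_max_sub_max_le_abs ‖y‖ ‖x‖ a |> fun h => ?_)
    rw [max_comm a, max_comm a]
    refine h.trans ?_
    rw [norm_sub_rev]
    exact abs_norm_sub_norm_le _ _
  set X := max a ‖x‖
  set Y := max a ‖y‖
  have hX : 0 < X := ha.trans_le hx
  have hY : 0 < Y := ha.trans_le hy
  have e : a / X - a / Y = a / (X * Y) * (Y - X) := by field_simp
  rw [e, abs_mul, abs_of_pos (by positivity)]
  have h1 : a / (X * Y) ≤ 1 / a := by
    rw [div_le_div_iff₀ (by positivity) ha]
    nlinarith
  gcongr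

lemma norm_gradOm_le (ha : 0 < a) (x : E3) : ‖gradOm a x‖ ≤ 1 / a := by
  unfold gradOm
  split_ifs with h
  · have hx : 0 < ‖x‖ := ha.trans h
    rw [norm_smul, norm_neg, Real.norm_of_nonneg (by positivity)]
    have e : a / ‖x‖ ^ 3 * ‖x‖ = a / ‖x‖ ^ 2 := by field_simp
    rw [e, div_le_div_iff₀ (by positivity) ha]
    nlinarith
  · simp; positivity

lemma norm_gradOm_le_of_le (ha : 0 < a) {r : ℝ} (hr : 0 < r) {x : E3} (hx : r ≤ ‖x‖) :
    ‖gradOm a x‖ ≤ a / r ^ 2 := by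
  unfold gradOm
  split_ifs with h
  · have hx0 : 0 < ‖x‖ := ha.trans h
    rw [norm_smul, norm_neg, Real.norm_of_nonneg (by positivity)]
    have e : a / ‖x‖ ^ 3 * ‖x‖ = a / ‖x‖ ^ 2 := by field_simp
    rw [e]
    gcongr
  · simp; positivity

lemma measurable_gradOm (a : ℝ) : Measurable (gradOm a) := by
  unfold gradOm
  refine Measurable.ite (measurableSet_lt measurable_const measurable_norm) ?_ measurable_const
  exact ((measurable_const.div (measurable_norm.pow_const 3)).neg).smul measurable_id

lemma lineDeriv_om (ha : 0 < a) {x : E3} (hx : ‖x‖ ≠ a) (v : E3) :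
    lineDeriv ℝ (om a) x v = inner ℝ (gradOm a x) v := by
  have hline : HasDerivAt (fun t : ℝ => x + t • v) v 0 := by
    simpa using ((hasDerivAt_id (0 : ℝ)).smul_const v).const_add x
  have hnc : ContinuousAt (fun t : ℝ => ‖x + t • v‖) 0 := by fun_prop
  unfold lineDeriv
  rcases lt_or_gt_of_ne hx with h | h
  · have : (fun t : ℝ => om a (x + t • v)) =ᶠ[𝓝 0] fun _ => 1 := by
      have h2 := hnc.tendsto.eventually_lt_const (u := a) (by simpa using h)
      filter_upwards [h2] with t ht
      simp only [om]
      rw [max_eq_left ht.le, div_self ha.ne']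
    rw [this.deriv_eq, deriv_const, gradOm, if_neg (not_lt.2 h.le), inner_zero_left]
  · have hx0 : 0 < ‖x‖ := ha.trans h
    have h1 : HasDerivAt (fun t : ℝ => ‖x + t • v‖ ^ 2) (2 * inner ℝ x v) 0 := by
      simpa using hline.norm_sq
    have h2 : HasDerivAt (fun t : ℝ => √(‖x + t • v‖ ^ 2)) (2 * inner ℝ x v / (2 * √(‖x‖ ^ 2))) 0 := by
      have := h1.sqrt (by simpa using hx0.ne')
      simpa using this
    have h3 : HasDerivAt (fun t : ℝ => ‖x + t • v‖) (inner ℝ x v / ‖x‖) 0 := by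
      convert! h2 using 1
      · ext t; rw [Real.sqrt_sq (norm_nonneg _)]
      · rw [Real.sqrt_sq (norm_nonneg _)]; field_simp
    have h4 := ((h3.inv (by simpa using hx0.ne')).const_mul a)
    have h5 : HasDerivAt (fun t : ℝ => om a (x + t • v))
        (a * (-(inner ℝ x v / ‖x‖) / ‖x + (0 : ℝ) • v‖ ^ 2)) 0 := by
      refine h4.congr_of_eventuallyEq ?_
      have h2 := hnc.tendsto.eventually_const_lt (u := a) (by simpa using h)
      filter_upwards [h2] with t ht
      simp only [om]
      rw [max_eq_right ht.le, div_eq_mul_inv]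
      rfl
    rw [h5.deriv, gradOm, if_pos h, inner_smul_left]
    simp
    field_simp

lemma ae_norm_ne (ha : 0 < a) : ∀ᵐ x : E3, ‖x‖ ≠ a := by
  have h := Measure.addHaar_sphere_of_ne_zero (volume : Measure E3) 0 ha.ne'
  have e : {x : E3 | ¬‖x‖ ≠ a} = Metric.sphere 0 a := by ext x; simp
  rw [ae_iff, e, h]

/-- Integration by parts against `om`. -/
lemma integral_om_mul_fderiv_real (ha : 0 < a) {g : E3 → ℝ} (hg : ContDiff ℝ 1 g)
    (hc : HasCompactSupport g) (v : E3) :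
    ∫ x, inner ℝ (gradOm a x) v * g x = -∫ x, om a x * fderiv ℝ g x v := by
  obtain ⟨D, hD⟩ := hg.lipschitzWith_of_hasCompactSupport hc (by norm_num)
  have h := (lipschitz_om ha).integral_lineDeriv_mul_eq (μ := volume) hD hc v
  have e1 : ∫ x, lineDeriv ℝ (om a) x v * g x = ∫ x, inner ℝ (gradOm a x) v * g x := by
    refine integral_congr_ae ?_
    filter_upwards [ae_norm_ne ha] with x hx
    rw [lineDeriv_om ha hx]
  rw [← e1, h, ← integral_neg]
  refine integral_congr_ae (Eventually.of_forall fun x => ?_)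
  have hd : DifferentiableAt ℝ g x := (hg.differentiable (by norm_num)) x
  simp only
  rw [hd.lineDeriv_eq_fderiv, map_neg]
  ring

lemma continuous_fderiv_apply_of_contDiff {F : Type*} [NormedAddCommGroup F] [NormedSpace ℝ F]
    {g : E3 → F} (hg : ContDiff ℝ 1 g) (v : E3) : Continuous fun x => fderiv ℝ g x v :=
  (hg.continuous_fderiv (by norm_num)).clm_apply continuous_const

lemma integrable_of_continuous_of_bounded_mul {h : E3 → ℝ} (hm : AEStronglyMeasurable h volume)
    {K : ℝ} (hK : ∀ x, |h x| ≤ K) {g : E3 → ℂ} (hg : Integrable g) :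
    Integrable fun x => (h x : ℂ) * g x := by
  refine hg.bdd_mul (c := K) ?_ (Eventually.of_forall fun x => ?_)
  · exact Complex.continuous_ofReal.comp_aestronglyMeasurable hm
  · rw [Complex.norm_real]; exact hK x

lemma integral_om_mul_fderiv (ha : 0 < a) {g : E3 → ℂ} (hg : ContDiff ℝ 1 g)
    (hc : HasCompactSupport g) (v : E3) :
    ∫ x, ((inner ℝ (gradOm a x) v : ℝ) : ℂ) * g x = -∫ x, (om a x : ℂ) * fderiv ℝ g x v := by
  have hre : ContDiff ℝ 1 fun x => (g x).re := Complex.reCLM.contDiff.comp hg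
  have him : ContDiff ℝ 1 fun x => (g x).im := Complex.imCLM.contDiff.comp hg
  have hrec : HasCompactSupport fun x => (g x).re := hc.comp_left (g := Complex.re) rfl
  have himc : HasCompactSupport fun x => (g x).im := hc.comp_left (g := Complex.im) rfl
  have hd : Differentiable ℝ g := hg.differentiable (by norm_num)
  have fre : ∀ x, fderiv ℝ (fun x => (g x).re) x v = (fderiv ℝ g x v).re := fun x => by
    have := (Complex.reCLM.hasFDerivAt.comp x (hd x).hasFDerivAt).fderiv
    exact congrArg (fun T => T v) this
  have fim : ∀ x, fderiv ℝ (fun x => (g x).im) x v = (fderiv ℝ g x v).im := fun x => by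
    have := (Complex.imCLM.hasFDerivAt.comp x (hd x).hasFDerivAt).fderiv
    exact congrArg (fun T => T v) this
  have i1 : Integrable fun x => ((inner ℝ (gradOm a x) v : ℝ) : ℂ) * g x := by
    refine integrable_of_continuous_of_bounded_mul (K := 1 / a * ‖v‖)
      (((measurable_gradOm a).inner measurable_const).aestronglyMeasurable) (fun x => ?_)
      (hg.continuous.integrable_of_hasCompactSupport hc)
    refine (abs_real_inner_le_norm _ _).trans ?_
    gcongr
    exact norm_gradOm_le ha x
  have i2 : Integrable fun x => (om a x : ℂ) * fderiv ℝ g x v := by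
    refine integrable_of_continuous_of_bounded_mul (K := 1)
      (continuous_om ha).aestronglyMeasurable (fun x => ?_)
      ((continuous_fderiv_apply_of_contDiff hg v).integrable_of_hasCompactSupport
        (hc.fderiv_apply (𝕜 := ℝ) v))
    rw [abs_of_nonneg (om_nonneg ha x)]
    exact om_le_one ha x
  apply Complex.ext
  · have h := integral_om_mul_fderiv_real ha hre hrec v
    rw [← Complex.reCLM_apply, ← Complex.reCLM_apply, map_neg,
      ← Complex.reCLM.integral_comp_comm i1, ← Complex.reCLM.integral_comp_comm i2]
    simp only [Complex.reCLM_apply, Complex.re_ofReal_mul]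
    simp_rw [fre] at h
    exact h
  · have h := integral_om_mul_fderiv_real ha him himc v
    rw [← Complex.imCLM_apply, ← Complex.imCLM_apply, map_neg,
      ← Complex.imCLM.integral_comp_comm i1, ← Complex.imCLM.integral_comp_comm i2]
    simp only [Complex.imCLM_apply, Complex.im_ofReal_mul]
    simp_rw [fim] at h
    exact h

/-- The flux of a compactly supported function through the sphere of radius `𝔞`. -/
lemma integral_radial_deriv (ha : 0 < a) {g g' : E3 → ℂ}
    (hd : ∀ e : E3, ‖e‖ = 1 → ∀ r : ℝ, a < r → HasDerivAt (fun r : ℝ => g (r • e)) (g' (r • e)) r)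
    (hcont : ∀ e : E3, ‖e‖ = 1 → ContinuousWithinAt (fun r : ℝ => g (r • e)) (Set.Ici a) a)
    (hcs : HasCompactSupport g)
    (hg'c : ∀ e : E3, ‖e‖ = 1 → ContinuousOn (fun r : ℝ => g' (r • e)) (Set.Ioi a))
    {K : ℝ} (hb : ∀ x, ‖g' x‖ ≤ K) (hg's : ∃ R, ∀ x : E3, R < ‖x‖ → g' x = 0)
    (hi : Integrable fun x : E3 => if a < ‖x‖ then (((-(a / ‖x‖ ^ 2)) : ℝ) : ℂ) * g' x else 0) :
    ∫ x : E3, (if a < ‖x‖ then (((-(a / ‖x‖ ^ 2)) : ℝ) : ℂ) * g' x else 0)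
      = a * ∫ e, g (a • (e : E3)) ∂sphereMeasure := by
  rw [integral_polar hi, ← integral_const_mul]
  refine integral_congr_ae (Eventually.of_forall fun e => ?_)
  have he : ‖(e : E3)‖ = 1 := by simp
  obtain ⟨R, hR⟩ := hg's
  -- The Jacobian r² cancels the factor 1/|x|². On each ray the integral of a derivative from 𝔞 to
  -- infinity is left, which is minus the boundary value at 𝔞.
  have h1 : ∫ r in Set.Ioi (0 : ℝ), ((r ^ 2 : ℝ) : ℂ) *
      (if a < ‖r • (e : E3)‖ then (((-(a / ‖r • (e : E3)‖ ^ 2)) : ℝ) : ℂ) * g' (r • (e : E3)) else 0)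
      = ∫ r in Set.Ioi a, (-a : ℂ) * g' (r • (e : E3)) := by
    rw [← integral_indicator measurableSet_Ioi, ← integral_indicator measurableSet_Ioi]
    refine integral_congr_ae (Eventually.of_forall fun r => ?_)
    simp only [Set.indicator, Set.mem_Ioi, norm_smul, he, mul_one]
    by_cases h0 : 0 < r
    · rw [Real.norm_of_nonneg h0.le]
      by_cases h : a < r
      · simp only [h0, h, if_true]
        have : (r : ℂ) ≠ 0 := by exact_mod_cast h0.ne'
        push_cast
        field_simp
      · simp [h0, h]
    · have : ¬ a < r := fun h => h0 (ha.trans h)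
      simp [h0, this]
  change ∫ r in Set.Ioi (0 : ℝ), ((r ^ 2 : ℝ) : ℂ) * (if a < ‖r • (e : E3)‖ then
    (((-(a / ‖r • (e : E3)‖ ^ 2)) : ℝ) : ℂ) * g' (r • (e : E3)) else 0) = a * g (a • (e : E3))
  rw [h1, integral_const_mul]
  have hinteg : IntegrableOn (fun r : ℝ => g' (r • (e : E3))) (Set.Ioi a) := by
    have hU : Set.Ioi a ⊆ Set.Ioc a (max a R) ∪ Set.Ioi (max a R) := by
      rw [Set.Ioc_union_Ioi_eq_Ioi (le_max_left _ _)]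
    refine IntegrableOn.mono_set (IntegrableOn.union ?_ ?_) hU
    · exact (integrableOn_const (C := K) (by simp)).mono'
        (((hg'c e he).mono Set.Ioc_subset_Ioi_self).aestronglyMeasurable measurableSet_Ioc)
        (Eventually.of_forall fun r => hb _)
    · refine (integrableOn_zero).congr_fun (fun r hr => ?_) measurableSet_Ioi
      have hr' : max a R < r := hr
      have h0 : 0 < r := ha.trans ((le_max_left _ _).trans_lt hr')
      refine (hR _ ?_).symm
      rw [norm_smul, he, mul_one, Real.norm_of_nonneg h0.le]
      exact (le_max_right _ _).trans_lt hr'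
  have hlim : Tendsto (fun r : ℝ => g (r • (e : E3))) atTop (𝓝 0) := by
    obtain ⟨S, hS⟩ := hcs.isCompact.isBounded.subset_closedBall (0 : E3)
    refine tendsto_const_nhds.congr' ?_
    filter_upwards [eventually_gt_atTop S, eventually_gt_atTop 0] with r hr hr0
    refine (image_eq_zero_of_notMem_tsupport fun hmem => ?_).symm
    have := hS hmem
    rw [mem_closedBall_zero_iff, norm_smul, he, mul_one, Real.norm_of_nonneg hr0.le] at this
    linarith
  rw [integral_Ioi_of_hasDerivAt_of_tendsto (hcont e he) (fun r hr => hd e he r hr) hinteg hlim]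
  ring

/-- The distributional Laplacian of `om`: integration against `-Δ om`. -/
lemma integral_fderiv_gradOm (ha : 0 < a) {g : E3 → ℂ} (hg : ContDiff ℝ 1 g)
    (hc : HasCompactSupport g) :
    Integrable (fun x => fderiv ℝ g x (gradOm a x)) ∧
    ∫ x, fderiv ℝ g x (gradOm a x) = a * ∫ e, g (a • (e : E3)) ∂sphereMeasure := by
  have hd : Differentiable ℝ g := hg.differentiable (by norm_num)
  have hfc : Continuous (fderiv ℝ g) := hg.continuous_fderiv (by norm_num)
  -- The gradient of `om` is radial, so only the radial derivative of g enters.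
  let g' : E3 → ℂ := fun x => fderiv ℝ g x (‖x‖⁻¹ • x)
  have hfs : HasCompactSupport (fderiv ℝ g) := hc.fderiv (𝕜 := ℝ)
  obtain ⟨K, hK⟩ := hfs.exists_bound_of_continuous hfc
  have hK0 : 0 ≤ K := (norm_nonneg _).trans (hK 0)
  obtain ⟨S, hS⟩ := hfs.isCompact.isBounded.subset_closedBall (0 : E3)
  have hz : ∀ x : E3, S < ‖x‖ → fderiv ℝ g x = 0 := by
    intro x hx
    refine image_eq_zero_of_notMem_tsupport fun hmem => ?_
    have := hS hmem
    rw [mem_closedBall_zero_iff] at this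
    linarith
  have he : (fun x => fderiv ℝ g x (gradOm a x))
      = fun x : E3 => if a < ‖x‖ then (((-(a / ‖x‖ ^ 2)) : ℝ) : ℂ) * g' x else 0 := by
    ext x
    simp only [gradOm, g']
    split_ifs with h
    · have hx0 : 0 < ‖x‖ := ha.trans h
      rw [← Complex.real_smul, ← map_smul, smul_smul]
      congr 2
      field_simp
    · simp
  have hi : Integrable (fun x => fderiv ℝ g x (gradOm a x)) := by
    have h1 : Integrable (fun x => ‖fderiv ℝ g x‖ * (1 / a)) :=
      ((hfc.norm).integrable_of_hasCompactSupport hfs.norm).mul_const _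
    refine h1.mono' ?_ (Eventually.of_forall fun x => ?_)
    · exact (isBoundedBilinearMap_apply.continuous.measurable.comp
        (hfc.measurable.prodMk (measurable_gradOm a))).aestronglyMeasurable
    · refine (ContinuousLinearMap.le_opNorm _ _).trans ?_
      gcongr
      exact norm_gradOm_le ha x
  refine ⟨hi, ?_⟩
  rw [he] at hi ⊢
  refine integral_radial_deriv (K := K) ha ?_ ?_ hc ?_ ?_ ⟨S, fun x hx => ?_⟩ hi
  · intro e he r hr
    have h0 : 0 < r := ha.trans hr
    have h1 : HasDerivAt (fun r : ℝ => r • e) ((1 : ℝ) • e) r := (hasDerivAt_id r).smul_const e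
    have h2 := (hd (r • e)).hasFDerivAt.comp_hasDerivAt r h1
    convert! h2 using 1
    simp only [g', norm_smul, he, mul_one, Real.norm_of_nonneg h0.le]
    rw [smul_smul, inv_mul_cancel₀ h0.ne']
  · intro e _
    exact (hg.continuous.comp (continuous_id.smul continuous_const)).continuousWithinAt
  · intro e he
    have h1 : ContinuousOn (fun r : ℝ => fderiv ℝ g (r • e) e) (Set.Ioi a) :=
      ((hfc.comp (continuous_id.smul continuous_const)).clm_apply continuous_const).continuousOn
    refine h1.congr fun r hr => ?_
    have h0 : 0 < r := ha.trans hr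
    simp only [g', norm_smul, he, mul_one, Real.norm_of_nonneg h0.le]
    rw [smul_smul, inv_mul_cancel₀ h0.ne', one_smul]
  · intro x
    refine (ContinuousLinearMap.le_opNorm _ _).trans ?_
    have : ‖‖x‖⁻¹ • x‖ ≤ 1 := by
      rw [norm_smul, norm_inv, norm_norm]
      exact inv_mul_le_one
    nlinarith [hK x, norm_nonneg (fderiv ℝ g x), norm_nonneg (‖x‖⁻¹ • x)]
  · simp [g', hz x hx]

/-- The flux of `om` times a cutoff through the sphere of radius `𝔞`. -/
lemma integral_gradOm_cutoff (ha : 0 < a) {η : E3 → ℝ} (hη : ContDiff ℝ 1 η)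
    (hc : HasCompactSupport η) (h1 : ∀ x, ‖x‖ = a → η x = 1) :
    ∫ x, (om a x * fderiv ℝ η x (gradOm a x) + η x * ‖gradOm a x‖ ^ 2) = 4 * Real.pi * a := by
  have hd : Differentiable ℝ η := hη.differentiable (by norm_num)
  have hfc : Continuous (fderiv ℝ η) := hη.continuous_fderiv (by norm_num)
  have hfs : HasCompactSupport (fderiv ℝ η) := hc.fderiv (𝕜 := ℝ)
  obtain ⟨K, hK⟩ := hfs.exists_bound_of_continuous hfc
  obtain ⟨M, hM⟩ := hc.exists_bound_of_continuous hη.continuous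
  have hK0 : 0 ≤ K := (norm_nonneg _).trans (hK 0)
  have hM0 : 0 ≤ M := (norm_nonneg _).trans (hM 0)
  obtain ⟨S, hS⟩ := hfs.isCompact.isBounded.subset_closedBall (0 : E3)
  obtain ⟨S', hS'⟩ := hc.isCompact.isBounded.subset_closedBall (0 : E3)
  have hz : ∀ x : E3, S < ‖x‖ → fderiv ℝ η x = 0 := by
    intro x hx
    refine image_eq_zero_of_notMem_tsupport fun hmem => ?_
    have := hS hmem
    rw [mem_closedBall_zero_iff] at this
    linarith
  have hz' : ∀ x : E3, S' < ‖x‖ → η x = 0 := by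
    intro x hx
    refine image_eq_zero_of_notMem_tsupport fun hmem => ?_
    have := hS' hmem
    rw [mem_closedBall_zero_iff] at this
    linarith
  -- The integrand is ∇ω·∇(ηω). The function ηω is not C¹ across the sphere, so
  -- `integral_fderiv_gradOm` does not apply to it, but `integral_radial_deriv` asks only for
  -- differentiability on rays outside. The value of ηω on the sphere is 1, and the flux is 𝔞 times
  -- the area 4π of the unit sphere.
  let g : E3 → ℂ := fun x => ((η x * om a x : ℝ) : ℂ)
  let d : E3 → ℝ := fun x => fderiv ℝ η x (‖x‖⁻¹ • x) * om a x - η x * (om a x ^ 2 / a)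
  let g' : E3 → ℂ := fun x => (d x : ℂ)
  have hgcs : HasCompactSupport g := by
    have : HasCompactSupport fun x => η x * om a x := hc.mul_right
    exact this.comp_left (g := fun r : ℝ => (r : ℂ)) (by simp)
  have hee : ∀ x : E3, (om a x * fderiv ℝ η x (gradOm a x) + η x * ‖gradOm a x‖ ^ 2)
      = if a < ‖x‖ then (-(a / ‖x‖ ^ 2)) * d x else 0 := by
    intro x
    simp only [gradOm, d]
    split_ifs with h
    · have hx0 : 0 < ‖x‖ := ha.trans h
      rw [norm_smul, norm_neg, Real.norm_of_nonneg (by positivity), map_smul, map_smul, om,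
        max_eq_right h.le]
      simp only [smul_eq_mul]
      field_simp
      ring
    · simp
  have hinteg : Integrable fun x => (om a x * fderiv ℝ η x (gradOm a x) + η x * ‖gradOm a x‖ ^ 2) := by
    refine Integrable.add ?_ ?_
    · have h1 : Integrable (fun x => 1 * (‖fderiv ℝ η x‖ * (1 / a))) :=
        (((hfc.norm).integrable_of_hasCompactSupport hfs.norm).mul_const _).const_mul 1
      refine h1.mono' ?_ (Eventually.of_forall fun x => ?_)
      · exact (continuous_om ha).aestronglyMeasurable.mul
          (isBoundedBilinearMap_apply.continuous.measurable.comp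
          (hfc.measurable.prodMk (measurable_gradOm a))).aestronglyMeasurable
      · rw [norm_mul, Real.norm_of_nonneg (om_nonneg ha x)]
        gcongr
        · exact om_le_one ha x
        · refine (ContinuousLinearMap.le_opNorm _ _).trans ?_
          gcongr
          exact norm_gradOm_le ha x
    · have h1 : Integrable (fun x => ‖η x‖ * (1 / a) ^ 2) :=
        ((hη.continuous.norm).integrable_of_hasCompactSupport hc.norm).mul_const _
      refine h1.mono' ?_ (Eventually.of_forall fun x => ?_)
      · exact hη.continuous.aestronglyMeasurable.mul
          ((measurable_gradOm a).norm.pow_const 2).aestronglyMeasurable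
      · rw [norm_mul, norm_pow, norm_norm]
        gcongr
        exact norm_gradOm_le ha x
  have hcast : ∀ x : E3, (if a < ‖x‖ then (((-(a / ‖x‖ ^ 2)) : ℝ) : ℂ) * g' x else 0)
      = (((om a x * fderiv ℝ η x (gradOm a x) + η x * ‖gradOm a x‖ ^ 2) : ℝ) : ℂ) := by
    intro x
    rw [hee]
    split_ifs <;> simp [g']
  have homr : ∀ e : E3, ‖e‖ = 1 → ∀ r : ℝ, a < r → om a (r • e) = a / r := by
    intro e he r hr
    have h0 : 0 < r := ha.trans hr
    simp only [om, norm_smul, he, mul_one, Real.norm_of_nonneg h0.le]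
    rw [max_eq_right hr.le]
  have hrad : ∀ e : E3, ‖e‖ = 1 → ∀ r : ℝ, a < r →
      d (r • e) = fderiv ℝ η (r • e) e * (a / r) - η (r • e) * (a / r ^ 2) := by
    intro e he r hr
    have h0 : 0 < r := ha.trans hr
    simp only [d, homr e he r hr, norm_smul, he, mul_one, Real.norm_of_nonneg h0.le]
    rw [smul_smul, inv_mul_cancel₀ h0.ne', one_smul]
    congr 2
    field_simp
  have hmain := integral_radial_deriv (a := a) (g := g) (g' := g') (K := K + M / a) ha ?_ ?_ hgcs ?_ ?_
    ⟨max S S', fun x hx => ?_⟩ ?_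
  · simp_rw [hcast] at hmain
    rw [integral_complex_ofReal] at hmain
    have h2 : ∀ e : Metric.sphere (0 : E3) 1, g (a • (e : E3)) = 1 := by
      intro e
      have he : ‖(e : E3)‖ = 1 := by simp
      have hn : ‖a • (e : E3)‖ = a := by rw [norm_smul, he, mul_one, Real.norm_of_nonneg ha.le]
      simp only [g, h1 _ hn, om, hn, max_self, div_self ha.ne']
      simp
    simp_rw [h2] at hmain
    rw [integral_const, sphereMeasure_real_univ, Complex.real_smul, mul_one, ← Complex.ofReal_mul] at hmain
    have := Complex.ofReal_injective hmain
    rw [this]; ring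
  · intro e he r hr
    have h0 : 0 < r := ha.trans hr
    have k1 : HasDerivAt (fun r : ℝ => r • e) ((1 : ℝ) • e) r := (hasDerivAt_id r).smul_const e
    have k2 := (hd (r • e)).hasFDerivAt.comp_hasDerivAt r k1
    rw [one_smul] at k2
    have k3 : HasDerivAt (fun r : ℝ => om a (r • e)) (-(a / r ^ 2)) r := by
      have k4 := (hasDerivAt_inv h0.ne').const_mul a
      have k5 : HasDerivAt (fun r : ℝ => om a (r • e)) (a * -(r ^ 2)⁻¹) r := by
        refine k4.congr_of_eventuallyEq ?_
        filter_upwards [lt_mem_nhds hr] with t ht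
        rw [homr e he t ht, div_eq_mul_inv]
      convert k5 using 1
      ring
    have k6 := (k2.mul k3).ofReal_comp
    convert! k6 using 1
    simp only [g', hrad e he r hr, homr e he r hr]
    push_cast
    simp only [Function.comp_apply]
    ring
  · intro e _
    have : Continuous fun r : ℝ => g (r • e) := by
      refine Complex.continuous_ofReal.comp ?_
      exact (hη.continuous.comp (continuous_id.smul continuous_const)).mul
        ((continuous_om ha).comp (continuous_id.smul continuous_const))
    exact this.continuousWithinAt
  · intro e he
    have k1 : ContinuousOn (fun r : ℝ => fderiv ℝ η (r • e) e * (a / r) - η (r • e) * (a / r ^ 2))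
        (Set.Ioi a) := by
      have k2 : ContinuousOn (fun r : ℝ => fderiv ℝ η (r • e) e) (Set.Ioi a) :=
        ((hfc.comp (continuous_id.smul continuous_const)).clm_apply continuous_const).continuousOn
      have k3 : ContinuousOn (fun r : ℝ => η (r • e)) (Set.Ioi a) :=
        (hη.continuous.comp (continuous_id.smul continuous_const)).continuousOn
      have hne : ∀ r ∈ Set.Ioi a, r ≠ 0 := fun r hr => (ha.trans hr).ne'
      refine (k2.mul (continuousOn_const.div continuousOn_id hne)).sub
        (k3.mul (continuousOn_const.div (continuousOn_id.pow 2) fun r hr => pow_ne_zero _ (hne r hr)))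
    exact Complex.continuous_ofReal.comp_continuousOn (k1.congr fun r hr => hrad e he r hr)
  · intro x
    simp only [g', d]
    rw [Complex.norm_real]
    have hn : ‖‖x‖⁻¹ • x‖ ≤ 1 := by
      rw [norm_smul, norm_inv, norm_norm]
      exact inv_mul_le_one
    have ho := om_nonneg ha x
    have ho1 := om_le_one ha x
    refine (norm_sub_le _ _).trans (add_le_add ?_ ?_)
    · rw [norm_mul, Real.norm_of_nonneg ho]
      calc ‖fderiv ℝ η x (‖x‖⁻¹ • x)‖ * om a x ≤ (K * 1) * 1 := by
            gcongr
            exact (ContinuousLinearMap.le_opNorm _ _).trans (by gcongr; exact hK x)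
        _ = K := by ring
    · rw [norm_mul, Real.norm_of_nonneg (by positivity : 0 ≤ om a x ^ 2 / a)]
      calc ‖η x‖ * (om a x ^ 2 / a) ≤ M * (1 ^ 2 / a) := by gcongr; exact hM x
        _ = M / a := by ring
  · simp [g', d, hz x ((le_max_left _ _).trans_lt hx), hz' x ((le_max_right _ _).trans_lt hx)]
  · simp_rw [hcast]
    exact hinteg.ofReal

end Om

end HardSphere

end

/-! ### Fourier coefficients of s and ∇s -/

noncomputable section

namespace HardSphere

open Filter Topology

/-- The standing assumptions on the parameters. -/
structure Params (a ρ₀ w L : ℝ) : Prop where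
  ha : 0 < a
  hρ : 0 < ρ₀
  hs : ρ₀ * a ^ 3 ≤ 1 / 100
  hw0 : 0 < w
  hw : 8 * Real.pi * a * ρ₀ ≤ w ^ 2
  hL : 0 < L

/-- The complex Fourier coefficients of `s`. -/
def sCoeff (a ρ₀ L : ℝ) (n : Fin 3 → ℤ) : ℂ := (sHat a ρ₀ L n : ℂ)

/-- The Fourier coefficients of the `j`-th derivative of `s`. -/
def dCoeff (a ρ₀ L : ℝ) (j : Fin 3) (n : Fin 3 → ℤ) : ℂ :=
  Complex.I * (momentum L n j : ℝ) * (sHat a ρ₀ L n : ℂ)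

/-- The gradient of `s`. -/
def dFun (a ρ₀ L : ℝ) (x : E3) : E3 := WithLp.toLp 2 fun j => (fser L (dCoeff a ρ₀ L j) x).re

section Coeff

variable {a ρ₀ w L : ℝ}

@[simp] lemma sHat_zero (a ρ₀ L : ℝ) : sHat a ρ₀ L 0 = 0 := by simp [sHat]

lemma sHat_neg (a ρ₀ L : ℝ) (n : Fin 3 → ℤ) : sHat a ρ₀ L (-n) = sHat a ρ₀ L n := by
  simp [sHat, momentum_neg, VeffHat, dispersion]

lemma Params.sHat_eq (h : Params a ρ₀ w L) {n : Fin 3 → ℤ} (hn : n ≠ 0) :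
    sHat a ρ₀ L n = sRad a ρ₀ ‖momentum L n‖ :=
  sHat_eq_sRad h.ha h.hρ h.hs h.hL hn

lemma Params.sHat_sq_le_four (h : Params a ρ₀ w L) {n : Fin 3 → ℤ} (hn : n ≠ 0) :
    sHat a ρ₀ L n ^ 2 ≤ w ^ 4 / ‖momentum L n‖ ^ 4 := by
  rw [h.sHat_eq hn]
  exact sRad_sq_le_four h.ha h.hρ h.hs (norm_momentum_pos h.hL hn) h.hw

lemma Params.sHat_sq_le_one (h : Params a ρ₀ w L) {n : Fin 3 → ℤ} (hn : n ≠ 0) :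
    sHat a ρ₀ L n ^ 2 ≤ w / ‖momentum L n‖ ^ 1 := by
  rw [h.sHat_eq hn, pow_one]
  exact sRad_sq_le_one h.ha h.hρ h.hs (norm_momentum_pos h.hL hn) h.hw0 h.hw

/-- The bounds w/|p| and w⁴/|p|⁴ cross at |p| = w, which is therefore the splitting momentum in
`exists_lattice_sum_le`. The same splitting recurs in the later sums over ŝ. -/
lemma exists_sum_sHat_sq_le : ∃ C : ℝ, 0 < C ∧ ∀ a ρ₀ w L : ℝ, Params a ρ₀ w L →
    Summable (fun n => sHat a ρ₀ L n ^ 2) ∧ (L ^ 3)⁻¹ * ∑' n, sHat a ρ₀ L n ^ 2 ≤ C * w ^ 3 := by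
  obtain ⟨C, hC, hS⟩ := exists_lattice_sum_le (α := 1) (β := 4) (by norm_num) (by norm_num)
  refine ⟨2 * C, by positivity, fun a ρ₀ w L h => ?_⟩
  have hw0 := h.hw0
  obtain ⟨h1, h2⟩ := hS L (fun n => sHat a ρ₀ L n ^ 2) w (w ^ 4) w h.hL hw0.le (by positivity) hw0
    (fun n => sq_nonneg _) (by simp) (fun n hn => h.sHat_sq_le_one hn)
    (fun n hn => h.sHat_sq_le_four hn)
  refine ⟨h1, h2.trans (le_of_eq ?_)⟩
  field_simp
  ring

lemma Params.summable_sHat_sq (h : Params a ρ₀ w L) : Summable fun n => sHat a ρ₀ L n ^ 2 := by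
  obtain ⟨C, _, hC⟩ := exists_sum_sHat_sq_le
  exact (hC a ρ₀ w L h).1

lemma Params.summable_sCoeff (h : Params a ρ₀ w L) : Summable fun n => ‖sCoeff a ρ₀ L n‖ ^ 2 := by
  refine h.summable_sHat_sq.congr fun n => ?_
  simp [sCoeff]

/-- This places s in H¹. The decay at high momenta rests on |sin| ≤ 1, which gives ŝ = O(|p|⁻³).
Only finiteness is claimed, so the splitting momentum 1 is arbitrary. -/
lemma Params.summable_momentum_sHat_sq (h : Params a ρ₀ w L) :
    Summable fun n => ‖momentum L n‖ ^ 2 * sHat a ρ₀ L n ^ 2 := by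
  obtain ⟨C, hC, hS⟩ := exists_lattice_sum_le (α := 2) (β := 4) (by norm_num) (by norm_num)
  refine (hS L _ (w ^ 4) ((8 * Real.pi * ρ₀) ^ 2) 1 h.hL (by have := h.hw0; positivity)
    (by positivity) one_pos (fun n => by positivity) (by simp) (fun n hn => ?_) (fun n hn => ?_)).1
  · have hp := norm_momentum_pos h.hL hn
    calc ‖momentum L n‖ ^ 2 * sHat a ρ₀ L n ^ 2
        ≤ ‖momentum L n‖ ^ 2 * (w ^ 4 / ‖momentum L n‖ ^ 4) := by gcongr; exact h.sHat_sq_le_four hn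
      _ = _ := by field_simp
  · have hp := norm_momentum_pos h.hL hn
    have h1 : |sHat a ρ₀ L n| ≤ 8 * Real.pi * ρ₀ / ‖momentum L n‖ ^ 3 := by
      rw [h.sHat_eq hn]
      exact (abs_sRad_le_abs_tRad h.ha h.hρ h.hs hp).trans (abs_tRad_le_cube h.hρ hp)
    calc ‖momentum L n‖ ^ 2 * sHat a ρ₀ L n ^ 2
        = ‖momentum L n‖ ^ 2 * |sHat a ρ₀ L n| ^ 2 := by rw [sq_abs]
      _ ≤ ‖momentum L n‖ ^ 2 * (8 * Real.pi * ρ₀ / ‖momentum L n‖ ^ 3) ^ 2 := by gcongr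
      _ = _ := by field_simp

lemma abs_momentum_apply_le (L : ℝ) (n : Fin 3 → ℤ) (j : Fin 3) :
    |momentum L n j| ≤ ‖momentum L n‖ := PiLp.norm_apply_le (momentum L n) j

lemma Params.summable_dCoeff (h : Params a ρ₀ w L) (j : Fin 3) :
    Summable fun n => ‖dCoeff a ρ₀ L j n‖ ^ 2 := by
  refine Summable.of_nonneg_of_le (fun n => by positivity) (fun n => ?_) h.summable_momentum_sHat_sq
  have := abs_momentum_apply_le L n j
  simp only [dCoeff, norm_mul, Complex.norm_I, one_mul, Complex.norm_real, Real.norm_eq_abs,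
    mul_pow]
  rw [sq_abs (sHat a ρ₀ L n)]
  gcongr

lemma Params.sFun_ae_eq (h : Params a ρ₀ w L) :
    ∀ᵐ x ∂volume.restrict (box L), (sFun a ρ₀ L x : ℂ) = fser L (sCoeff a ρ₀ L) x := by
  have := fser_im_ae_eq_zero h.hL h.summable_sCoeff (fun n => by simp [sCoeff, sHat_neg])
  filter_upwards [this] with x hx
  rw [sFun, ofCoeff_eq_re]
  exact hx

lemma Params.dFun_ae_eq (h : Params a ρ₀ w L) (j : Fin 3) :
    ∀ᵐ x ∂volume.restrict (box L), (dFun a ρ₀ L x j : ℂ) = fser L (dCoeff a ρ₀ L j) x := by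
  have := fser_im_ae_eq_zero h.hL (h.summable_dCoeff j) (fun n => by
    simp only [dCoeff, sHat_neg, momentum_neg, PiLp.neg_apply, map_mul, Complex.conj_I,
      Complex.conj_ofReal]
    push_cast; ring)
  filter_upwards [this] with x hx
  exact hx

lemma Params.memLp_sFun (h : Params a ρ₀ w L) : MemLp (sFun a ρ₀ L) 2 (volume.restrict (box L)) := by
  have : sFun a ρ₀ L = fun x => (fser L (sCoeff a ρ₀ L) x).re := by
    ext x; exact ofCoeff_eq_re _ _ _
  rw [this]
  exact (memLp_fser h.hL _).re

lemma Params.memLp_dFun_apply (h : Params a ρ₀ w L) (j : Fin 3) :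
    MemLp (fun x => dFun a ρ₀ L x j) 2 (volume.restrict (box L)) :=
  (memLp_fser h.hL _).re

lemma memLp_of_memLp_apply {μ : Measure E3} {f : E3 → E3}
    (hf : ∀ j, MemLp (fun x => f x j) 2 μ) : MemLp f 2 μ := by
  have hm : AEStronglyMeasurable f μ := by
    have h1 : AEMeasurable (fun x => (fun j => f x j : Fin 3 → ℝ)) μ :=
      aemeasurable_pi_iff.2 fun j => (hf j).aestronglyMeasurable.aemeasurable
    exact (PiLp.continuous_toLp 2 _).comp_aestronglyMeasurable h1.aestronglyMeasurable
  refine (memLp_finsetSum Finset.univ fun j _ => (hf j).norm).mono hm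
    (Eventually.of_forall fun x => ?_)
  rw [Real.norm_of_nonneg (Finset.sum_nonneg fun _ _ => norm_nonneg _)]
  rw [EuclideanSpace.norm_eq]
  refine Real.sqrt_le_iff.2 ⟨Finset.sum_nonneg fun _ _ => norm_nonneg _, ?_⟩
  exact Finset.sum_sq_le_sq_sum_of_nonneg (fun i _ => norm_nonneg _)

lemma Params.memLp_dFun (h : Params a ρ₀ w L) : MemLp (dFun a ρ₀ L) 2 (volume.restrict (box L)) :=
  memLp_of_memLp_apply h.memLp_dFun_apply

lemma Params.integral_sFun_sq (h : Params a ρ₀ w L) :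
    ∫ x in box L, sFun a ρ₀ L x ^ 2 = (L ^ 3)⁻¹ * ∑' n, sHat a ρ₀ L n ^ 2 := by
  have h1 := integral_norm_sq_fser h.hL h.summable_sCoeff
  have h2 : ∀ n, ‖sCoeff a ρ₀ L n‖ ^ 2 = sHat a ρ₀ L n ^ 2 := fun n => by simp [sCoeff]
  simp_rw [h2] at h1
  rw [← h1]
  refine integral_congr_ae ?_
  filter_upwards [h.sFun_ae_eq] with x hx
  rw [← hx, Complex.norm_real, Real.norm_eq_abs, sq_abs]

lemma Params.integral_dFun_sq (h : Params a ρ₀ w L) :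
    ∫ x in box L, ‖dFun a ρ₀ L x‖ ^ 2
      = (L ^ 3)⁻¹ * ∑' n, ‖momentum L n‖ ^ 2 * sHat a ρ₀ L n ^ 2 := by
  have h1 : ∀ j, ∫ x in box L, dFun a ρ₀ L x j ^ 2
      = (L ^ 3)⁻¹ * ∑' n, ‖dCoeff a ρ₀ L j n‖ ^ 2 := by
    intro j
    rw [← integral_norm_sq_fser h.hL (h.summable_dCoeff j)]
    refine integral_congr_ae ?_
    filter_upwards [h.dFun_ae_eq j] with x hx
    rw [← hx, Complex.norm_real, Real.norm_eq_abs, sq_abs]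
  simp_rw [EuclideanSpace.norm_sq_eq, Real.norm_eq_abs, sq_abs]
  rw [integral_finsetSum _ fun j _ => (h.memLp_dFun_apply j).integrable_sq]
  simp_rw [h1]
  rw [← Finset.mul_sum, ← Summable.tsum_finsetSum fun j _ => h.summable_dCoeff j]
  congr 2
  ext n
  rw [Finset.sum_mul]
  refine Finset.sum_congr rfl fun j _ => ?_
  simp [dCoeff, mul_pow]

end Coeff

lemma hasFDerivAt_expo (L : ℝ) (n : Fin 3 → ℤ) (x : E3) :
    HasFDerivAt (expo L n) ((Complex.I * expo L n x) •
      (Complex.ofRealCLM.comp (innerSL ℝ (momentum L n)))) x := by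
  have h1 : HasFDerivAt (fun x : E3 => ((inner ℝ (momentum L n) x : ℝ) : ℂ))
      (Complex.ofRealCLM.comp (innerSL ℝ (momentum L n))) x :=
    Complex.ofRealCLM.hasFDerivAt.comp x (innerSL ℝ (momentum L n)).hasFDerivAt
  have h2 := (h1.const_mul Complex.I).cexp
  convert! h2 using 1
  ext v
  simp [expo]; ring

lemma fderiv_expo (L : ℝ) (n : Fin 3 → ℤ) (x v : E3) :
    fderiv ℝ (expo L n) x v = Complex.I * (inner ℝ (momentum L n) v : ℝ) * expo L n x := by
  rw [(hasFDerivAt_expo L n x).fderiv]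
  simp; ring

lemma contDiff_expo (L : ℝ) (n : Fin 3 → ℤ) : ContDiff ℝ ∞ (expo L n) := by
  unfold expo
  have h1 : ContDiff ℝ ∞ (fun x : E3 => ((inner ℝ (momentum L n) x : ℝ) : ℂ)) :=
    Complex.ofRealCLM.contDiff.comp (innerSL ℝ (momentum L n)).contDiff
  exact (contDiff_const.mul h1).cexp

/-- The product of a real function and a plane wave. -/
lemma fderiv_mul_expo {η : E3 → ℝ} (hη : Differentiable ℝ η) (L : ℝ) (n : Fin 3 → ℤ) (x v : E3) :
    fderiv ℝ (fun x => (η x : ℂ) * expo L n x) x v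
      = (fderiv ℝ η x v : ℂ) * expo L n x
        + η x * (Complex.I * (inner ℝ (momentum L n) v : ℝ) * expo L n x) := by
  have h1 : HasFDerivAt (fun x => (η x : ℂ)) (Complex.ofRealCLM.comp (fderiv ℝ η x)) x :=
    Complex.ofRealCLM.hasFDerivAt.comp x (hη x).hasFDerivAt
  have h2 := h1.mul (hasFDerivAt_expo L n x)
  have h3 : fderiv ℝ (fun x => (η x : ℂ) * expo L n x) x = _ := h2.fderiv
  rw [h3]
  simp
  ring

lemma contDiff_mul_expo {η : E3 → ℝ} (hη : ContDiff ℝ 1 η) (L : ℝ)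
    (n : Fin 3 → ℤ) : ContDiff ℝ 1 (fun x => (η x : ℂ) * expo L n x) :=
  (Complex.ofRealCLM.contDiff.comp hη).mul ((contDiff_expo L n).of_le (by norm_cast))

lemma hasCompactSupport_mul_expo {η : E3 → ℝ} (hc : HasCompactSupport η) (L : ℝ)
    (n : Fin 3 → ℤ) : HasCompactSupport (fun x => (η x : ℂ) * expo L n x) :=
  (hc.comp_left (g := fun r : ℝ => (r : ℂ)) (by simp)).mul_right

end HardSphere

end

/-! ### The Fourier transform of the truncated scattering solution -/

noncomputable section

namespace HardSphere

open Filter Topology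

/-- The partial derivative in the `j`-th coordinate direction. -/
def pd (j : Fin 3) (η : E3 → ℝ) (x : E3) : ℝ := fderiv ℝ η x (EuclideanSpace.single j 1)

lemma contDiff_pd {η : E3 → ℝ} (hη : ContDiff ℝ ∞ η) (j : Fin 3) : ContDiff ℝ ∞ (pd j η) :=
  (hη.fderiv_right (m := ∞) (by norm_cast)).clm_apply contDiff_const

lemma hasCompactSupport_pd {η : E3 → ℝ} (hc : HasCompactSupport η) (j : Fin 3) :
    HasCompactSupport (pd j η) := hc.fderiv_apply (𝕜 := ℝ) _

lemma fderiv_eq_sum_pd (η : E3 → ℝ) (x v : E3) : fderiv ℝ η x v = ∑ j, pd j η x * v j := by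
  have hv : v = ∑ j, v j • EuclideanSpace.single j (1 : ℝ) := by
    ext i
    simp [Finset.sum_apply, Pi.single_apply]
  conv_lhs => rw [hv]
  rw [map_sum]
  refine Finset.sum_congr rfl fun j _ => ?_
  rw [map_smul, pd, smul_eq_mul, mul_comm]

lemma gradient_apply {η : E3 → ℝ} (x : E3) (j : Fin 3) : gradient η x j = pd j η x := by
  have h : inner ℝ (gradient η x) (EuclideanSpace.single j (1 : ℝ)) = pd j η x := by
    simp [gradient, pd]
  rw [← h, EuclideanSpace.inner_single_right]
  simp

/-- The commutator of the Laplacian and the cutoff `η`, applied to `om`. -/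
def commOm (a : ℝ) (η : E3 → ℝ) (x : E3) : ℝ :=
  2 * ∑ j, pd j η x * gradOm a x j + om a x * ∑ j, pd j (pd j η) x

lemma smooth_one {η : E3 → ℝ} (hη : ContDiff ℝ ∞ η) : ContDiff ℝ 1 η :=
  hη.of_le (by norm_cast)

section Coeff

variable {a L : ℝ} {η : E3 → ℝ}

lemma integrable_om_mul (ha : 0 < a) {g : E3 → ℂ} (hg : Continuous g) (hc : HasCompactSupport g) :
    Integrable fun x => (om a x : ℂ) * g x := by
  refine integrable_of_continuous_of_bounded_mul (K := 1)
      (continuous_om ha).aestronglyMeasurable (fun x => ?_) (hg.integrable_of_hasCompactSupport hc)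
  rw [abs_of_nonneg (om_nonneg ha x)]
  exact om_le_one ha x

lemma integrable_gradOm_mul (ha : 0 < a) (v : E3) {g : E3 → ℂ} (hg : Continuous g)
    (hc : HasCompactSupport g) : Integrable fun x => ((inner ℝ (gradOm a x) v : ℝ) : ℂ) * g x := by
  refine integrable_of_continuous_of_bounded_mul (K := 1 / a * ‖v‖)
    (((measurable_gradOm a).inner measurable_const).aestronglyMeasurable) (fun x => ?_)
    (hg.integrable_of_hasCompactSupport hc)
  refine (abs_real_inner_le_norm _ _).trans ?_
  gcongr
  exact norm_gradOm_le ha x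

/-- Integration by parts for `η om` against plane waves. -/
lemma integral_gradOm_mul_expo (ha : 0 < a) (hη : ContDiff ℝ 1 η) (hc : HasCompactSupport η)
    (n : Fin 3 → ℤ) (v : E3) :
    ∫ x, ((inner ℝ (gradOm a x) v : ℝ) : ℂ) * ((η x : ℂ) * expo L n x)
      = -(∫ x, (om a x : ℂ) * ((fderiv ℝ η x v : ℝ) * expo L n x))
        - Complex.I * (inner ℝ (momentum L n) v : ℝ) *
          ∫ x, (om a x : ℂ) * ((η x : ℂ) * expo L n x) := by
  have hcs := hasCompactSupport_mul_expo hc L n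
  have h := integral_om_mul_fderiv ha (contDiff_mul_expo hη L n) hcs v
  have hd : Differentiable ℝ η := hη.differentiable (by norm_num)
  simp_rw [fderiv_mul_expo hd L n] at h
  rw [h, ← integral_const_mul]
  have hfv : HasCompactSupport fun x => fderiv ℝ η x v := hc.fderiv_apply (𝕜 := ℝ) v
  have i1 : Integrable fun x => (om a x : ℂ) * ((fderiv ℝ η x v : ℝ) * expo L n x) :=
    integrable_om_mul ha ((Complex.continuous_ofReal.comp
      (continuous_fderiv_apply_of_contDiff hη v)).mul (continuous_expo L n))
      (hasCompactSupport_mul_expo hfv L n)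
  have i2 : Integrable fun x => Complex.I * (inner ℝ (momentum L n) v : ℝ) *
      ((om a x : ℂ) * ((η x : ℂ) * expo L n x)) :=
    (integrable_om_mul ha ((Complex.continuous_ofReal.comp hη.continuous).mul (continuous_expo L n))
      hcs).const_mul _
  have e : ∀ x, (om a x : ℂ) * ((fderiv ℝ η x v : ℝ) * expo L n x
      + η x * (Complex.I * (inner ℝ (momentum L n) v : ℝ) * expo L n x))
      = (om a x : ℂ) * ((fderiv ℝ η x v : ℝ) * expo L n x) +
        Complex.I * (inner ℝ (momentum L n) v : ℝ) * ((om a x : ℂ) * ((η x : ℂ) * expo L n x)) := by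
    intro x; ring
  simp_rw [e]
  rw [integral_add i1 i2]
  ring

/-- The integrand is ∇ω·∇(η exp(ip·x)), so by `integral_fderiv_gradOm` only the plane wave on the
sphere matters. Its integral over directions is 4π sin(|p|𝔞)/(|p|𝔞), and 𝔞 times this is V̂/2. -/
lemma integral_flux_expo (ha : 0 < a) (hL : 0 < L) (hη : ContDiff ℝ 1 η) (hc : HasCompactSupport η)
    (h1 : ∀ x, ‖x‖ = a → η x = 1) {n : Fin 3 → ℤ} (hn : n ≠ 0) :
    Integrable (fun x => (fderiv ℝ η x (gradOm a x) : ℂ) * expo L n x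
      + η x * (Complex.I * (inner ℝ (momentum L n) (gradOm a x) : ℝ) * expo L n x)) ∧
    ∫ x, ((fderiv ℝ η x (gradOm a x) : ℂ) * expo L n x
      + η x * (Complex.I * (inner ℝ (momentum L n) (gradOm a x) : ℝ) * expo L n x))
      = ((VeffHat a (momentum L n) / 2 : ℝ) : ℂ) := by
  have h := integral_fderiv_gradOm ha (contDiff_mul_expo hη L n) (hasCompactSupport_mul_expo hc L n)
  have hd : Differentiable ℝ η := hη.differentiable (by norm_num)
  simp_rw [fderiv_mul_expo hd L n] at h
  refine ⟨h.1, ?_⟩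
  rw [h.2]
  have hp := norm_momentum_pos hL hn
  have e : ∀ e : Metric.sphere (0 : E3) 1, (η (a • (e : E3)) : ℂ) * expo L n (a • (e : E3))
      = Complex.exp (Complex.I * (inner ℝ (momentum L n) (a • (e : E3)) : ℝ)) := by
    intro e
    have he : ‖(e : E3)‖ = 1 := by simp
    have hn : ‖a • (e : E3)‖ = a := by rw [norm_smul, he, mul_one, Real.norm_of_nonneg ha.le]
    rw [h1 _ hn, Complex.ofReal_one, one_mul, expo]
  simp_rw [e]
  rw [integral_sphere_exp _ (norm_pos_iff.1 hp) ha, ← Complex.ofReal_mul]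
  congr 1
  rw [VeffHat]
  field_simp
  ring

/-- The Fourier coefficients of the truncated function `om`. -/
lemma coeff_om (ha : 0 < a) (hL : 0 < L) (hη : ContDiff ℝ ∞ η) (hc : HasCompactSupport η)
    (h1 : ∀ x, ‖x‖ = a → η x = 1) {n : Fin 3 → ℤ} (hn : n ≠ 0) :
    ((‖momentum L n‖ ^ 2 : ℝ) : ℂ) * ∫ x, (om a x : ℂ) * ((η x : ℂ) * expo L n x)
      = ((VeffHat a (momentum L n) / 2 : ℝ) : ℂ) - ∫ x, (commOm a η x : ℂ) * expo L n x := by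
  have hη1 := smooth_one hη
  set p := momentum L n with hp
  set O := ∫ x, (om a x : ℂ) * ((η x : ℂ) * expo L n x) with hO
  have hflux := integral_flux_expo ha hL hη1 hc h1 hn
  -- Integration by parts in the direction p produces p² times the wanted coefficient. The
  -- identities `hB`, with the derivatives of η as cutoffs, eliminate the integrals of ω∂_jη that
  -- this leaves behind.
  have hA := integral_gradOm_mul_expo (L := L) ha hη1 hc n p
  rw [← hp, real_inner_self_eq_norm_sq, ← hO] at hA
  have hpd1 := fun j => smooth_one (contDiff_pd hη j)
  have hpdc := fun j => hasCompactSupport_pd hc j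
  have hB := fun j : Fin 3 => integral_gradOm_mul_expo (L := L) ha (hpd1 j) (hpdc j) n
    (EuclideanSpace.single j (1 : ℝ))
  have hpd2 : ∀ j x, fderiv ℝ (pd j η) x (EuclideanSpace.single j (1 : ℝ)) = pd j (pd j η) x :=
    fun j x => rfl
  have hpj : ∀ j, inner ℝ p (EuclideanSpace.single j (1 : ℝ)) = p j := fun j => by
    rw [EuclideanSpace.inner_single_right]; simp
  have hgj : ∀ j x, inner ℝ (gradOm a x) (EuclideanSpace.single j (1 : ℝ)) = gradOm a x j :=
    fun j x => by rw [EuclideanSpace.inner_single_right]; simp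
  simp only [hpd2, hpj, hgj, ← hp] at hB
  -- integrability
  have iG : ∀ j, Integrable fun x => (gradOm a x j : ℂ) * ((pd j η x : ℂ) * expo L n x) := fun j => by
    have := integrable_gradOm_mul (a := a) ha (EuclideanSpace.single j (1 : ℝ))
      ((contDiff_mul_expo (hpd1 j) L n).continuous) (hasCompactSupport_mul_expo (hpdc j) L n)
    simpa only [hgj] using this
  have iO : ∀ j, Integrable fun x => (om a x : ℂ) * ((pd j η x : ℂ) * expo L n x) := fun j =>
    integrable_om_mul ha ((contDiff_mul_expo (hpd1 j) L n).continuous)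
      (hasCompactSupport_mul_expo (hpdc j) L n)
  have iD : ∀ j, Integrable fun x => (om a x : ℂ) * ((pd j (pd j η) x : ℂ) * expo L n x) := fun j =>
    integrable_om_mul ha ((contDiff_mul_expo (smooth_one (contDiff_pd (contDiff_pd hη j) j)) L n).continuous)
      (hasCompactSupport_mul_expo (hasCompactSupport_pd (hpdc j) j) L n)
  have iH : Integrable fun x => ((inner ℝ (gradOm a x) p : ℝ) : ℂ) * ((η x : ℂ) * expo L n x) :=
    integrable_gradOm_mul ha p ((contDiff_mul_expo hη1 L n).continuous)
      (hasCompactSupport_mul_expo hc L n)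
  -- the flux identity in terms of partial derivatives
  have e1 : ((VeffHat a p / 2 : ℝ) : ℂ)
      = (∑ j, ∫ x, (gradOm a x j : ℂ) * ((pd j η x : ℂ) * expo L n x))
        + Complex.I * ∫ x, ((inner ℝ (gradOm a x) p : ℝ) : ℂ) * ((η x : ℂ) * expo L n x) := by
    rw [← hflux.2, ← integral_const_mul, ← integral_finsetSum _ fun j _ => iG j,
      ← integral_add (integrable_finsetSum _ fun j _ => iG j) (iH.const_mul _)]
    refine integral_congr_ae (Eventually.of_forall fun x => ?_)
    simp only
    rw [fderiv_eq_sum_pd, real_inner_comm]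
    push_cast
    rw [Finset.sum_mul]
    congr 1
    · exact Finset.sum_congr rfl fun j _ => by ring
    · ring
  have e2 : ∫ x, (om a x : ℂ) * ((fderiv ℝ η x p : ℝ) * expo L n x)
      = ∑ j, (p j : ℂ) * ∫ x, (om a x : ℂ) * ((pd j η x : ℂ) * expo L n x) := by
    simp_rw [← integral_const_mul]
    rw [← integral_finsetSum _ fun j _ => (iO j).const_mul _]
    refine integral_congr_ae (Eventually.of_forall fun x => ?_)
    simp only
    rw [fderiv_eq_sum_pd]
    push_cast
    rw [Finset.sum_mul, Finset.mul_sum]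
    exact Finset.sum_congr rfl fun j _ => by ring
  have e3 : ∫ x, (commOm a η x : ℂ) * expo L n x
      = 2 * (∑ j, ∫ x, (gradOm a x j : ℂ) * ((pd j η x : ℂ) * expo L n x))
        + ∑ j, ∫ x, (om a x : ℂ) * ((pd j (pd j η) x : ℂ) * expo L n x) := by
    rw [← integral_finsetSum _ fun j _ => iG j, ← integral_finsetSum _ fun j _ => iD j,
      ← integral_const_mul, ← integral_add ((integrable_finsetSum _ fun j _ => iG j).const_mul _)
        (integrable_finsetSum _ fun j _ => iD j)]
    refine integral_congr_ae (Eventually.of_forall fun x => ?_)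
    simp only [commOm]
    push_cast
    rw [add_mul, Finset.mul_sum, Finset.mul_sum, Finset.mul_sum, Finset.sum_mul, Finset.sum_mul]
    congr 1
    · exact Finset.sum_congr rfl fun j _ => by ring
    · exact Finset.sum_congr rfl fun j _ => by ring
  have e4 : ∑ j, ∫ x, (gradOm a x j : ℂ) * ((pd j η x : ℂ) * expo L n x)
      = -(∑ j, ∫ x, (om a x : ℂ) * ((pd j (pd j η) x : ℂ) * expo L n x))
        - Complex.I * ∑ j, (p j : ℂ) * ∫ x, (om a x : ℂ) * ((pd j η x : ℂ) * expo L n x) := by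
    rw [Finset.mul_sum, ← Finset.sum_neg_distrib, ← Finset.sum_sub_distrib]
    refine Finset.sum_congr rfl fun j _ => ?_
    rw [hB j]; ring
  rw [e1, e3, hA, e2]
  have hI := Complex.I_sq
  linear_combination (1 : ℂ) * e4 + (((‖p‖ ^ 2 : ℝ) : ℂ) * O) * hI

end Coeff

end HardSphere

end

/-! ### Cutoffs and the truncation at the scale of the box -/

noncomputable section

namespace HardSphere

open Filter Topology

section Cutoff

variable {χ : E3 → ℝ} {r : ℝ}

lemma closedBall_subset_box {L r : ℝ} (hr : r ≤ L / 2) : Metric.closedBall (0 : E3) r ⊆ box L := by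
  intro x hx i
  have h1 : |x i| ≤ ‖x‖ := PiLp.norm_apply_le x i
  rw [mem_closedBall_zero_iff] at hx
  exact abs_le.1 (h1.trans (hx.trans hr))

lemma mem_box_of_norm_le {L : ℝ} {x : E3} (hx : ‖x‖ ≤ L / 2) : x ∈ box L :=
  closedBall_subset_box le_rfl (mem_closedBall_zero_iff.2 hx)

lemma setIntegral_box_eq_integral {F : Type*} [NormedAddCommGroup F] [NormedSpace ℝ F]
    {L : ℝ} {f : E3 → F} (hf : ∀ x, L / 2 < ‖x‖ → f x = 0) :
    ∫ x in box L, f x = ∫ x, f x := by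
  refine setIntegral_eq_integral_of_forall_compl_eq_zero fun x hx => hf x ?_
  by_contra h
  exact hx (mem_box_of_norm_le (not_lt.1 h))

lemma norm_inv_smul (hr : 0 < r) (x : E3) : ‖r⁻¹ • x‖ = ‖x‖ / r := by
  rw [norm_smul, norm_inv, Real.norm_of_nonneg hr.le]
  field_simp

lemma hasCompactSupport_of_eq_zero {η : E3 → ℝ} {R : ℝ} (h : ∀ x, R < ‖x‖ → η x = 0) :
    HasCompactSupport η :=
  HasCompactSupport.of_support_subset_isCompact (isCompact_closedBall (0 : E3) R) fun x hx => by
    rw [mem_closedBall_zero_iff]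
    by_contra hR
    exact hx (h x (not_le.1 hR))

lemma contDiff_cutoff (hχ : ContDiff ℝ ∞ χ) (r : ℝ) : ContDiff ℝ ∞ (cutoff χ r) :=
  hχ.comp (contDiff_const_smul r⁻¹)

lemma pd_cutoff (hχ : ContDiff ℝ ∞ χ) (r : ℝ) (j : Fin 3) (x : E3) :
    pd j (cutoff χ r) x = r⁻¹ * cutoff (pd j χ) r x := by
  have h := (hχ.differentiable (by simp) (r⁻¹ • x)).hasFDerivAt.comp x
    ((hasFDerivAt_id x).const_smul r⁻¹)
  have h' : HasFDerivAt (cutoff χ r) _ x := h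
  rw [pd, h'.fderiv]
  simp [cutoff, pd]

lemma cutoff_eq_zero (hr : 0 < r) {R : ℝ} (h : ∀ x, R < ‖x‖ → χ x = 0) {x : E3}
    (hx : R * r < ‖x‖) : cutoff χ r x = 0 := by
  refine h _ ?_
  rw [norm_inv_smul hr, lt_div_iff₀ hr]
  exact hx

lemma IsCutoff.cutoff_eq_one (h : IsCutoff χ) (hr : 0 < r) {x : E3}
    (hx : ‖x‖ ≤ 2 * r) : cutoff χ r x = 1 := by
  refine h.eq_one _ ?_
  rw [norm_inv_smul hr, div_le_iff₀ hr]
  exact hx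

lemma exists_abs_le {η : E3 → ℝ} (hη : Continuous η) (hc : HasCompactSupport η) :
    ∃ K : ℝ, 0 < K ∧ ∀ x, |η x| ≤ K := by
  obtain ⟨K, hK⟩ := hη.bounded_above_of_compact_support hc
  exact ⟨max K 1, by positivity, fun x => (hK x).trans (le_max_left _ _)⟩

lemma IsCutoff.hasCompactSupport (h : IsCutoff χ) : HasCompactSupport χ :=
  hasCompactSupport_of_eq_zero h.eq_zero

lemma pd_eq_zero_of_eqOn {η : E3 → ℝ} {U : Set E3} (hU : IsOpen U) {c : ℝ}
    (h : ∀ x ∈ U, η x = c) (j : Fin 3) {x : E3} (hx : x ∈ U) : pd j η x = 0 := by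
  have : η =ᶠ[𝓝 x] fun _ => c := by
    filter_upwards [hU.mem_nhds hx] with y hy using h y hy
  rw [pd, this.fderiv_eq]
  simp

lemma pd_eq_zero_of_lt {η : E3 → ℝ} {R : ℝ} (h : ∀ x, ‖x‖ < R → η x = 1) (j : Fin 3) {x : E3}
    (hx : ‖x‖ < R) : pd j η x = 0 :=
  pd_eq_zero_of_eqOn (U := {x | ‖x‖ < R}) (isOpen_lt continuous_norm continuous_const) h j hx

lemma pd_eq_zero_of_gt {η : E3 → ℝ} {R : ℝ} (h : ∀ x, R < ‖x‖ → η x = 0) (j : Fin 3) {x : E3}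
    (hx : R < ‖x‖) : pd j η x = 0 :=
  pd_eq_zero_of_eqOn (U := {x | R < ‖x‖}) (isOpen_lt continuous_const continuous_norm) h j hx

/-- A common bound for `χ` and its first and second partial derivatives. -/
lemma exists_derivative_bound (hχ : ContDiff ℝ ∞ χ) (hc : HasCompactSupport χ) : ∃ K : ℝ, 0 < K ∧
    (∀ x, |χ x| ≤ K) ∧ (∀ j x, |pd j χ x| ≤ K) ∧ ∀ j x, |pd j (pd j χ) x| ≤ K := by
  obtain ⟨K₀, h₀, hK₀⟩ := exists_abs_le hχ.continuous hc
  choose K₁ h₁ hK₁ using fun j =>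
    exists_abs_le (contDiff_pd hχ j).continuous (hasCompactSupport_pd hc j)
  choose K₂ h₂ hK₂ using fun j =>
    exists_abs_le (contDiff_pd (contDiff_pd hχ j) j).continuous
      (hasCompactSupport_pd (hasCompactSupport_pd hc j) j)
  have s1 : ∀ j, K₁ j ≤ ∑ i, K₁ i := fun j =>
    Finset.single_le_sum (f := K₁) (fun i _ => (h₁ i).le) (Finset.mem_univ j)
  have s2 : ∀ j, K₂ j ≤ ∑ i, K₂ i := fun j =>
    Finset.single_le_sum (f := K₂) (fun i _ => (h₂ i).le) (Finset.mem_univ j)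
  have p1 : 0 ≤ ∑ i, K₁ i := Finset.sum_nonneg fun i _ => (h₁ i).le
  have p2 : 0 ≤ ∑ i, K₂ i := Finset.sum_nonneg fun i _ => (h₂ i).le
  refine ⟨K₀ + ∑ i, K₁ i + ∑ i, K₂ i, by positivity, fun x => ?_, fun j x => ?_, fun j x => ?_⟩
  · linarith [hK₀ x]
  · linarith [hK₁ j x, s1 j]
  · linarith [hK₂ j x, s2 j]

lemma pd_pd_cutoff (hχ : ContDiff ℝ ∞ χ) (r : ℝ) (j : Fin 3) (x : E3) :
    pd j (pd j (cutoff χ r)) x = r⁻¹ ^ 2 * cutoff (pd j (pd j χ)) r x := by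
  have e : pd j (cutoff χ r) = fun x => r⁻¹ * cutoff (pd j χ) r x := funext (pd_cutoff hχ r j)
  have h := ((contDiff_cutoff (contDiff_pd hχ j) r).differentiable (by simp) x).hasFDerivAt.const_mul
    r⁻¹
  rw [pd, e, h.fderiv, smul_apply, smul_eq_mul, ← pd,
    pd_cutoff (contDiff_pd hχ j)]
  ring

end Cutoff

section LargeCutoff

variable {χ : E3 → ℝ} {a L : ℝ}

/-- The cutoff at a fixed fraction of the side of the box. -/
def boxCut (χ : E3 → ℝ) (L : ℝ) : E3 → ℝ := cutoff χ (L / 10)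

lemma IsCutoff.boxCut_contDiff (h : IsCutoff χ) (L : ℝ) : ContDiff ℝ ∞ (boxCut χ L) :=
  contDiff_cutoff h.smooth _

lemma IsCutoff.boxCut_eq_one (h : IsCutoff χ) (hL : 0 < L) {x : E3} (hx : ‖x‖ ≤ L / 5) :
    boxCut χ L x = 1 := h.cutoff_eq_one (by positivity) (by linarith)

lemma IsCutoff.boxCut_eq_zero (h : IsCutoff χ) (hL : 0 < L) {x : E3} (hx : 2 * L / 5 < ‖x‖) :
    boxCut χ L x = 0 := cutoff_eq_zero (by positivity) h.eq_zero (by linarith)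

lemma IsCutoff.boxCut_hasCompactSupport (h : IsCutoff χ) (hL : 0 < L) :
    HasCompactSupport (boxCut χ L) := hasCompactSupport_of_eq_zero fun _ hx => h.boxCut_eq_zero hL hx

lemma measurable_commOm (ha : 0 < a) {η : E3 → ℝ} (hη : ContDiff ℝ ∞ η) :
    Measurable (commOm a η) := by
  have h1 : ∀ j, Measurable (pd j η) := fun j => (contDiff_pd hη j).continuous.measurable
  have h2 : ∀ j, Measurable (pd j (pd j η)) := fun j =>
    (contDiff_pd (contDiff_pd hη j) j).continuous.measurable
  have h3 : ∀ j, Measurable fun x => gradOm a x j := fun j =>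
    (EuclideanSpace.proj j : E3 →L[ℝ] ℝ).continuous.measurable.comp (measurable_gradOm a)
  have h4 := (continuous_om ha).measurable
  unfold commOm
  exact ((Finset.measurable_sum _ fun j _ => (h1 j).mul (h3 j)).const_mul 2).add
    (h4.mul (Finset.measurable_sum _ fun j _ => h2 j))

lemma IsCutoff.commOm_boxCut_eq_zero (h : IsCutoff χ) (hL : 0 < L) {x : E3}
    (hx : ‖x‖ < L / 5 ∨ 2 * L / 5 < ‖x‖) : commOm a (boxCut χ L) x = 0 := by
  have hU : ∀ j, pd j (boxCut χ L) x = 0 ∧ pd j (pd j (boxCut χ L)) x = 0 := by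
    intro j
    rcases hx with hx | hx
    · have h1 : ∀ y : E3, ‖y‖ < L / 5 → pd j (boxCut χ L) y = 0 := fun y hy =>
        pd_eq_zero_of_lt (fun z hz => h.boxCut_eq_one hL (le_of_lt hz)) j hy
      exact ⟨h1 x hx, pd_eq_zero_of_eqOn (U := {x | ‖x‖ < L / 5})
        (isOpen_lt continuous_norm continuous_const) h1 j hx⟩
    · have h1 : ∀ y : E3, 2 * L / 5 < ‖y‖ → pd j (boxCut χ L) y = 0 := fun y hy =>
        pd_eq_zero_of_gt (fun z hz => h.boxCut_eq_zero hL hz) j hy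
      exact ⟨h1 x hx, pd_eq_zero_of_gt h1 j hx⟩
  simp [commOm, fun j => (hU j).1, fun j => (hU j).2]

/-- The derivatives of the cutoff vanish off the shell L/5 ≤ |x| ≤ 2L/5. There ω = O(𝔞/L) and ∇ω =
O(𝔞/L²), and each derivative of the cutoff costs another factor 1/L. -/
lemma IsCutoff.exists_commOm_le (h : IsCutoff χ) : ∃ K : ℝ, 0 < K ∧ ∀ a L : ℝ, 0 < a → 0 < L →
    ∀ x, |commOm a (boxCut χ L) x| ≤ K * a / L ^ 3 := by
  obtain ⟨K, hK, -, h1, h2⟩ := exists_derivative_bound h.smooth h.hasCompactSupport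
  refine ⟨3000 * K, by positivity, fun a L ha hL x => ?_⟩
  by_cases hx : ‖x‖ < L / 5
  · rw [h.commOm_boxCut_eq_zero hL (Or.inl hx), abs_zero]; positivity
  · rw [not_lt] at hx
    have hg : ∀ j, |gradOm a x j| ≤ 25 * a / L ^ 2 := fun j => by
      refine (PiLp.norm_apply_le (gradOm a x) j).trans
        ((norm_gradOm_le_of_le ha (by positivity) hx).trans (le_of_eq ?_))
      field_simp; norm_num
    have ho : |om a x| ≤ 5 * a / L := by
      rw [abs_of_nonneg (om_nonneg ha x)]
      refine (om_le_of_le ha (by positivity) hx).trans (le_of_eq ?_)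
      field_simp
    have hp : ∀ j, |pd j (boxCut χ L) x| ≤ 10 * K / L := fun j => by
      rw [boxCut, pd_cutoff h.smooth, abs_mul, abs_of_nonneg (by positivity : 0 ≤ (L / 10)⁻¹)]
      calc (L / 10)⁻¹ * |cutoff (pd j χ) (L / 10) x| ≤ (L / 10)⁻¹ * K := by
            gcongr; exact h1 j _
        _ = 10 * K / L := by field_simp
    have hpp : ∀ j, |pd j (pd j (boxCut χ L)) x| ≤ 100 * K / L ^ 2 := fun j => by
      rw [boxCut, pd_pd_cutoff h.smooth, abs_mul,
        abs_of_nonneg (by positivity : 0 ≤ (L / 10)⁻¹ ^ 2)]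
      calc (L / 10)⁻¹ ^ 2 * |cutoff (pd j (pd j χ)) (L / 10) x| ≤ (L / 10)⁻¹ ^ 2 * K := by
            gcongr; exact h2 j _
        _ = 100 * K / L ^ 2 := by field_simp; norm_num
    have s1 : |∑ j, pd j (boxCut χ L) x * gradOm a x j| ≤ 3 * (10 * K / L * (25 * a / L ^ 2)) := by
      refine (Finset.abs_sum_le_sum_abs _ _).trans ?_
      refine (Finset.sum_le_card_nsmul _ _ (10 * K / L * (25 * a / L ^ 2)) fun j _ => ?_).trans
        (by simp)
      rw [abs_mul]
      exact mul_le_mul (hp j) (hg j) (abs_nonneg _) (by positivity)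
    have s2 : |∑ j, pd j (pd j (boxCut χ L)) x| ≤ 3 * (100 * K / L ^ 2) := by
      refine (Finset.abs_sum_le_sum_abs _ _).trans ?_
      exact (Finset.sum_le_card_nsmul _ _ (100 * K / L ^ 2) fun j _ => hpp j).trans (by simp)
    calc |commOm a (boxCut χ L) x|
        ≤ |2 * ∑ j, pd j (boxCut χ L) x * gradOm a x j|
          + |om a x * ∑ j, pd j (pd j (boxCut χ L)) x| := abs_add_le _ _
      _ ≤ 2 * (3 * (10 * K / L * (25 * a / L ^ 2))) + 5 * a / L * (3 * (100 * K / L ^ 2)) := by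
          rw [abs_mul, abs_mul, abs_two]
          gcongr
      _ = 3000 * K * a / L ^ 3 := by field_simp; norm_num

end LargeCutoff

end HardSphere

end

/-! ### Fourier coefficients of s + ρ₀ω -/

noncomputable section

namespace HardSphere

open Filter Topology

/-- The Fourier coefficients of the truncated function `om`. -/
def omCoeff (a : ℝ) (χ : E3 → ℝ) (L : ℝ) (n : Fin 3 → ℤ) : ℂ :=
  ∫ x, (om a x : ℂ) * ((boxCut χ L x : ℂ) * expo L (-n) x)

/-- The Fourier coefficients of the commutator term. -/
def kCoeff (a : ℝ) (χ : E3 → ℝ) (L : ℝ) (n : Fin 3 → ℤ) : ℂ :=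
  ∫ x, (commOm a (boxCut χ L) x : ℂ) * expo L (-n) x

/-- The main part of the Fourier coefficients of `s + ρ₀ om`. -/
def uMain (a ρ₀ L : ℝ) (n : Fin 3 → ℤ) : ℝ :=
  if n = 0 then 0 else sHat a ρ₀ L n + tRad a ρ₀ ‖momentum L n‖ / 2

/-- The part of the Fourier coefficients of `s + ρ₀ om` that is due to the truncation. -/
def uRest (a : ℝ) (χ : E3 → ℝ) (ρ₀ L : ℝ) (n : Fin 3 → ℤ) : ℂ :=
  if n = 0 then ρ₀ * omCoeff a χ L 0 else -(ρ₀ * kCoeff a χ L n / ((‖momentum L n‖ ^ 2 : ℝ) : ℂ))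

section LocalU

variable {a ρ₀ w L : ℝ} {χ : E3 → ℝ}

lemma norm_momentum_neg (L : ℝ) (n : Fin 3 → ℤ) : ‖momentum L (-n)‖ = ‖momentum L n‖ := by
  rw [momentum_neg, norm_neg]

/-- By `coeff_om`, ρ₀ times the coefficient of the truncated `om` is t/2 minus the commutator term
divided by p². The condition on L makes the cutoff equal to 1 on the sphere. Since ŝ₀ = 0, the zero
mode is entirely due to the truncation. -/
lemma sCoeff_add_omCoeff (ha : 0 < a) (hL : 5 * a ≤ L) (hχ : IsCutoff χ) (n : Fin 3 → ℤ) :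
    sCoeff a ρ₀ L n + ρ₀ * omCoeff a χ L n = uMain a ρ₀ L n + uRest a χ ρ₀ L n := by
  have hL0 : 0 < L := by linarith
  by_cases hn : n = 0
  · subst hn; simp [sCoeff, uMain, uRest]
  · have hp := norm_momentum_pos hL0 hn
    have h := coeff_om ha hL0 (hχ.boxCut_contDiff L) (hχ.boxCut_hasCompactSupport hL0)
      (fun x hx => hχ.boxCut_eq_one hL0 (by linarith)) (neg_ne_zero.2 hn)
    rw [norm_momentum_neg] at h
    have hp2 : ((‖momentum L n‖ ^ 2 : ℝ) : ℂ) ≠ 0 := by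
      exact_mod_cast (pow_pos hp 2).ne'
    have hV : ((VeffHat a (momentum L (-n)) / 2 : ℝ) : ℂ) * ρ₀
        = ((‖momentum L n‖ ^ 2 : ℝ) : ℂ) * ((tRad a ρ₀ ‖momentum L n‖ / 2 : ℝ) : ℂ) := by
      norm_cast
      rw [VeffHat, norm_momentum_neg, tRad]
      field_simp
    simp only [uMain, uRest, hn, if_false, sCoeff]
    have e : (ρ₀ : ℂ) * omCoeff a χ L n = ((tRad a ρ₀ ‖momentum L n‖ / 2 : ℝ) : ℂ)
        - ρ₀ * kCoeff a χ L n / ((‖momentum L n‖ ^ 2 : ℝ) : ℂ) := by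
      rw [eq_sub_iff_add_eq, ← mul_right_inj' hp2, mul_add, mul_div_cancel₀ _ hp2, ← hV,
        kCoeff, omCoeff]
      linear_combination (ρ₀ : ℂ) * h
    rw [e]; push_cast; ring

/-- The main coefficient is at most 2|t| and at most 2t², while |t| ≤ w²/p²; the two laws cross at
|p| = w. With the additional factor |p| the quadratic bound would decay only like |p|⁻³, so one of
its factors t is estimated by 8πρ₀/|p|³ instead, which costs 1/𝔞. -/
lemma exists_uMain_sum_le : ∃ C : ℝ, 0 < C ∧ ∀ a ρ₀ w L : ℝ, Params a ρ₀ w L →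
    (Summable (fun n => |uMain a ρ₀ L n|) ∧ (L ^ 3)⁻¹ * ∑' n, |uMain a ρ₀ L n| ≤ C * w ^ 3) ∧
    Summable (fun n => ‖momentum L n‖ * |uMain a ρ₀ L n|) ∧
      (L ^ 3)⁻¹ * ∑' n, ‖momentum L n‖ * |uMain a ρ₀ L n| ≤ C * (w ^ 4 + w ^ 3 / a) := by
  obtain ⟨C, hC, h⟩ := exists_lattice_sum_le (α := 2) (β := 4) (by norm_num) (by norm_num)
  obtain ⟨C', hC', h'⟩ := exists_lattice_sum_le (α := 1) (β := 4) (by norm_num) (by norm_num)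
  refine ⟨4 * C + 2 * C', by positivity, fun a ρ₀ w L hP => ?_⟩
  obtain ⟨ha, hρ, hs, hw0, hw, hL⟩ := hP
  have ht1 : ∀ n : Fin 3 → ℤ, n ≠ 0 → |tRad a ρ₀ ‖momentum L n‖| ≤ w ^ 2 / ‖momentum L n‖ ^ 2 := by
    intro n hn
    refine (abs_tRad_le_sq ha hρ (norm_momentum_pos hL hn)).trans ?_
    gcongr
  have hu1 : ∀ n : Fin 3 → ℤ, n ≠ 0 → |uMain a ρ₀ L n| ≤ 2 * |tRad a ρ₀ ‖momentum L n‖| := by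
    intro n hn
    have hp := norm_momentum_pos hL hn
    rw [uMain, if_neg hn, sHat_eq_sRad ha hρ hs hL hn]
    refine (abs_add_le _ _).trans ?_
    have := abs_sRad_le_abs_tRad ha hρ hs hp
    rw [abs_div, abs_two]
    linarith [abs_nonneg (tRad a ρ₀ ‖momentum L n‖)]
  have hu2 : ∀ n : Fin 3 → ℤ, n ≠ 0 → |uMain a ρ₀ L n| ≤ 2 * |tRad a ρ₀ ‖momentum L n‖| ^ 2 := by
    intro n hn
    have hp := norm_momentum_pos hL hn
    rw [uMain, if_neg hn, sHat_eq_sRad ha hρ hs hL hn, sq_abs]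
    exact abs_sRad_add_half_tRad_le ha hρ hs hp
  constructor
  · have := h L (fun n => |uMain a ρ₀ L n|) (2 * w ^ 2) (2 * w ^ 4) w hL (by positivity)
      (by positivity) hw0 (fun n => abs_nonneg _) (by simp [uMain])
      (fun n hn => (hu1 n hn).trans (by rw [mul_div_assoc]; gcongr; exact ht1 n hn))
      (fun n hn => (hu2 n hn).trans (by
        have hp := norm_momentum_pos hL hn
        calc 2 * |tRad a ρ₀ ‖momentum L n‖| ^ 2 ≤ 2 * (w ^ 2 / ‖momentum L n‖ ^ 2) ^ 2 := by
              gcongr; exact ht1 n hn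
          _ = 2 * w ^ 4 / ‖momentum L n‖ ^ 4 := by field_simp))
    refine ⟨this.1, this.2.trans ?_⟩
    have e : (2 * w ^ 2 / w ^ 2 + 2 * w ^ 4 / w ^ 4) * w ^ 3 = 4 * w ^ 3 := by
      field_simp; norm_num
    rw [e]
    nlinarith [mul_pos hC' (pow_pos hw0 3)]
  · have hρw : 8 * Real.pi * ρ₀ ≤ w ^ 2 / a := by
      rw [le_div_iff₀ ha]; linarith
    have := h' L (fun n => ‖momentum L n‖ * |uMain a ρ₀ L n|) (2 * w ^ 2) (2 * w ^ 4 / a) w hL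
      (by positivity)
      (by positivity) hw0 (fun n => mul_nonneg (norm_nonneg _) (abs_nonneg _)) (by simp [uMain])
      (fun n hn => by
        have hp := norm_momentum_pos hL hn
        calc ‖momentum L n‖ * |uMain a ρ₀ L n|
            ≤ ‖momentum L n‖ * (2 * (w ^ 2 / ‖momentum L n‖ ^ 2)) := by
              gcongr; exact (hu1 n hn).trans (by gcongr; exact ht1 n hn)
          _ = 2 * w ^ 2 / ‖momentum L n‖ ^ 1 := by field_simp)
      (fun n hn => by
        have hp := norm_momentum_pos hL hn
        have ht3 : |tRad a ρ₀ ‖momentum L n‖| ≤ w ^ 2 / a / ‖momentum L n‖ ^ 3 :=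
          (abs_tRad_le_cube hρ hp).trans (by gcongr)
        calc ‖momentum L n‖ * |uMain a ρ₀ L n|
            ≤ ‖momentum L n‖ * (2 * ((w ^ 2 / ‖momentum L n‖ ^ 2) * (w ^ 2 / a / ‖momentum L n‖ ^ 3))) := by
              gcongr
              refine (hu2 n hn).trans ?_
              rw [pow_two]
              gcongr
              exact ht1 n hn
          _ = 2 * w ^ 4 / a / ‖momentum L n‖ ^ 4 := by field_simp)
    refine ⟨this.1, this.2.trans ?_⟩
    have e : (2 * w ^ 2 / w ^ 1 + 2 * w ^ 4 / a / w ^ 4) * w ^ 3 = 2 * (w ^ 4 + w ^ 3 / a) := by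
      field_simp
    rw [e]
    have : 0 < w ^ 4 + w ^ 3 / a := by positivity
    nlinarith [mul_pos hC this]

lemma volume_real_box (hL : 0 < L) : volume.real (box L) = L ^ 3 := by
  have := integral_expo hL 0
  simp only [expo_zero, if_true, integral_const, MeasurableSet.univ, measureReal_restrict_apply,
    Set.univ_inter] at this
  rw [Complex.real_smul, mul_one] at this
  exact_mod_cast this

/-- The commutator is of size 𝔞/L³ on a volume L³, so the powers of L cancel in Parseval's identity.
-/
lemma IsCutoff.exists_kCoeff_sum_le (hχ : IsCutoff χ) : ∃ K : ℝ, 0 < K ∧ ∀ a L : ℝ, 0 < a → 0 < L →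
    Summable (fun n => ‖kCoeff a χ L n‖ ^ 2) ∧ ∑' n, ‖kCoeff a χ L n‖ ^ 2 ≤ K * a ^ 2 := by
  obtain ⟨K, hK, h⟩ := hχ.exists_commOm_le
  refine ⟨K ^ 2, by positivity, fun a L ha hL => ?_⟩
  have hb : ∀ x, ‖(commOm a (boxCut χ L) x : ℂ)‖ ≤ K * a / L ^ 3 := fun x => by
    rw [Complex.norm_real]; exact h a L ha hL x
  have hm : MemLp (fun x => (commOm a (boxCut χ L) x : ℂ)) 2 (volume.restrict (box L)) :=
    MemLp.of_bound (Complex.measurable_ofReal.comp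
      (measurable_commOm ha (hχ.boxCut_contDiff L))).aestronglyMeasurable _ (Eventually.of_forall hb)
  have hP := hasSum_norm_sq_integral_mul_expo hL hm
  have e : ∀ n, ∫ x in box L, (commOm a (boxCut χ L) x : ℂ) * expo L (-n) x = kCoeff a χ L n := by
    intro n
    refine setIntegral_box_eq_integral fun x hx => ?_
    rw [hχ.commOm_boxCut_eq_zero hL (Or.inr (by linarith))]
    simp
  simp_rw [e] at hP
  refine ⟨hP.summable, ?_⟩
  rw [hP.tsum_eq]
  have hi : ∫ x in box L, ‖(commOm a (boxCut χ L) x : ℂ)‖ ^ 2 ≤ (K * a / L ^ 3) ^ 2 * L ^ 3 := by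
    calc ∫ x in box L, ‖(commOm a (boxCut χ L) x : ℂ)‖ ^ 2
        ≤ ∫ x in box L, (K * a / L ^ 3) ^ 2 := by
          refine integral_mono_of_nonneg (Eventually.of_forall fun x => by positivity)
            (integrable_const _) (Eventually.of_forall fun x => ?_)
          exact pow_le_pow_left₀ (norm_nonneg _) (hb x) 2
      _ = _ := by simp [volume_real_box hL, mul_comm]
  calc L ^ 3 * ∫ x in box L, ‖(commOm a (boxCut χ L) x : ℂ)‖ ^ 2
      ≤ L ^ 3 * ((K * a / L ^ 3) ^ 2 * L ^ 3) := by gcongr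
    _ = K ^ 2 * a ^ 2 := by field_simp

lemma inv_norm_momentum_le (hL : 0 < L) {n : Fin 3 → ℤ} (hn : n ≠ 0) :
    1 / ‖momentum L n‖ ≤ L := by
  have h := le_norm_momentum hL hn
  have hp := norm_momentum_pos hL hn
  rw [div_le_iff₀ hp]
  have : 1 ≤ L * (2 * Real.pi / L) := by
    rw [mul_div_cancel₀ _ hL.ne']; linarith [Real.pi_gt_three]
  exact this.trans (by gcongr)

/-- The sums of `|k_p| / p²` and `|k_p|² / p²`. -/
lemma IsCutoff.exists_kCoeff_div_sum_le (hχ : IsCutoff χ) : ∃ K : ℝ, 0 < K ∧ ∀ a L : ℝ, 0 < a →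
    0 < L →
    (Summable (fun n => ‖kCoeff a χ L n‖ / ‖momentum L n‖ ^ 2) ∧
      (L ^ 3)⁻¹ * ∑' n, ‖kCoeff a χ L n‖ / ‖momentum L n‖ ^ 2 ≤ K * (a ^ 2 + 1) / L) ∧
    (Summable (fun n => ‖kCoeff a χ L n‖ ^ 2 / ‖momentum L n‖ ^ 2) ∧
      (L ^ 3)⁻¹ * ∑' n, ‖kCoeff a χ L n‖ ^ 2 / ‖momentum L n‖ ^ 2 ≤ K * a ^ 2 / L) := by
  obtain ⟨C, hC, h⟩ := exists_lattice_sum_le (α := 2) (β := 4) (by norm_num) (by norm_num)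
  obtain ⟨K, hK, hk⟩ := hχ.exists_kCoeff_sum_le
  refine ⟨K + 2 * C, by positivity, fun a L ha hL => ?_⟩
  obtain ⟨hks, hkb⟩ := hk a L ha hL
  have hp4 := h L (fun n => 1 / ‖momentum L n‖ ^ 4) (L ^ 2) 1 (1 / L) hL (by positivity) (by positivity)
    (by positivity) (fun n => by positivity) (by simp) (fun n hn => by
      have hp := norm_momentum_pos hL hn
      calc 1 / ‖momentum L n‖ ^ 4 = (1 / ‖momentum L n‖) ^ 2 / ‖momentum L n‖ ^ 2 := by
            field_simp
        _ ≤ L ^ 2 / ‖momentum L n‖ ^ 2 := by gcongr; exact inv_norm_momentum_le hL hn)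
      (fun n hn => le_rfl)
  have e : (L ^ 2 / (1 / L) ^ 2 + 1 / (1 / L) ^ 4) * (1 / L) ^ 3 = 2 * L := by field_simp; norm_num
  rw [e] at hp4
  constructor
  -- An arithmetic-geometric mean with weight L, for which both sums on the right are of order L².
  -- After division by the volume this leaves 1/L.
  · have hle : ∀ n, ‖kCoeff a χ L n‖ / ‖momentum L n‖ ^ 2
        ≤ L ^ 2 * ‖kCoeff a χ L n‖ ^ 2 + (1 / L ^ 2) * (1 / ‖momentum L n‖ ^ 4) := fun n => by
      have := two_mul_le_add_sq (L * ‖kCoeff a χ L n‖) (1 / L * (1 / ‖momentum L n‖ ^ 2))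
      have h2 : 2 * (L * ‖kCoeff a χ L n‖) * (1 / L * (1 / ‖momentum L n‖ ^ 2))
          = 2 * (‖kCoeff a χ L n‖ / ‖momentum L n‖ ^ 2) := by field_simp
      have h3 : (1 / L * (1 / ‖momentum L n‖ ^ 2)) ^ 2 = (1 / L ^ 2) * (1 / ‖momentum L n‖ ^ 4) := by
        rw [mul_pow, div_pow, div_pow, one_pow, ← pow_mul]
      have h0 : 0 ≤ ‖kCoeff a χ L n‖ / ‖momentum L n‖ ^ 2 := by positivity
      rw [h2, h3, mul_pow] at this
      linarith
    have hs := (hks.mul_left (L ^ 2)).add (hp4.1.mul_left (1 / L ^ 2))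
    have hsum := Summable.of_nonneg_of_le (fun n => by positivity) hle hs
    refine ⟨hsum, ?_⟩
    calc (L ^ 3)⁻¹ * ∑' n, ‖kCoeff a χ L n‖ / ‖momentum L n‖ ^ 2
        ≤ (L ^ 3)⁻¹ * ∑' n, (L ^ 2 * ‖kCoeff a χ L n‖ ^ 2 + (1 / L ^ 2) * (1 / ‖momentum L n‖ ^ 4)) := by
          exact mul_le_mul_of_nonneg_left (hsum.tsum_le_tsum hle hs) (by positivity)
      _ = (L ^ 3)⁻¹ * L ^ 2 * ∑' n, ‖kCoeff a χ L n‖ ^ 2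
          + 1 / L ^ 2 * ((L ^ 3)⁻¹ * ∑' n, 1 / ‖momentum L n‖ ^ 4) := by
          rw [(hks.mul_left (L ^ 2)).tsum_add (hp4.1.mul_left (1 / L ^ 2)), tsum_mul_left,
            tsum_mul_left]
          ring
      _ ≤ (L ^ 3)⁻¹ * L ^ 2 * (K * a ^ 2) + 1 / L ^ 2 * (C * (2 * L)) := by
          exact add_le_add (by gcongr) (mul_le_mul_of_nonneg_left hp4.2 (by positivity))
      _ = (K * a ^ 2 + 2 * C) / L := by field_simp
      _ ≤ (K + 2 * C) * (a ^ 2 + 1) / L := by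
          gcongr
          nlinarith [mul_pos hC (pow_pos ha 2)]
  · have hle : ∀ n, ‖kCoeff a χ L n‖ ^ 2 / ‖momentum L n‖ ^ 2 ≤ L ^ 2 * ‖kCoeff a χ L n‖ ^ 2 := by
      intro n
      by_cases hn : n = 0
      · subst hn; simp; positivity
      · calc ‖kCoeff a χ L n‖ ^ 2 / ‖momentum L n‖ ^ 2
            = (1 / ‖momentum L n‖) ^ 2 * ‖kCoeff a χ L n‖ ^ 2 := by ring
          _ ≤ _ := by gcongr; exact inv_norm_momentum_le hL hn
    have hs := hks.mul_left (L ^ 2)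
    have hsum := Summable.of_nonneg_of_le (fun n => by positivity) hle hs
    refine ⟨hsum, ?_⟩
    calc (L ^ 3)⁻¹ * ∑' n, ‖kCoeff a χ L n‖ ^ 2 / ‖momentum L n‖ ^ 2
        ≤ (L ^ 3)⁻¹ * ∑' n, L ^ 2 * ‖kCoeff a χ L n‖ ^ 2 := by
          exact mul_le_mul_of_nonneg_left (hsum.tsum_le_tsum hle hs) (by positivity)
      _ ≤ (L ^ 3)⁻¹ * (L ^ 2 * (K * a ^ 2)) := by rw [tsum_mul_left]; gcongr
      _ = K * a ^ 2 / L := by field_simp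
      _ ≤ (K + 2 * C) * a ^ 2 / L := by gcongr; linarith

end LocalU

end HardSphere

end

/-! ### Local bounds on s + ρ₀ω and its gradient -/

noncomputable section

namespace HardSphere

open Filter Topology

section LocalU

variable {a ρ₀ w L : ℝ} {χ : E3 → ℝ}

lemma volume_real_closedBall_le {r : ℝ} (hr : 0 ≤ r) :
    volume.real (Metric.closedBall (0 : E3) r) ≤ 5 * r ^ 3 := by
  rw [Measure.real, EuclideanSpace.volume_closedBall_fin_three, ← ENNReal.ofReal_pow hr,
    ← ENNReal.ofReal_mul (by positivity), ENNReal.toReal_ofReal (by positivity)]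
  have := Real.pi_lt_d2
  nlinarith [pow_nonneg hr 3]

/-- The integral is split at |x| = √L: inside, ω ≤ 1 on a volume of order L^(3/2); outside, ω ≤
𝔞/√L. Any rate tending to zero suffices for the zero mode. -/
lemma IsCutoff.exists_omCoeff_zero_le (hχ : IsCutoff χ) : ∃ K : ℝ, 0 < K ∧ ∀ a L : ℝ, 0 < a → 1 ≤ L →
    (L ^ 3)⁻¹ * ‖omCoeff a χ L 0‖ ≤ K * (a + 5) / √L := by
  obtain ⟨K, hK, hb⟩ := exists_abs_le hχ.smooth.continuous hχ.hasCompactSupport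
  refine ⟨K, hK, fun a L ha hL => ?_⟩
  have hL0 : 0 < L := by linarith
  set r := √L with hr
  have hr1 : 1 ≤ r := by rw [hr]; exact Real.one_le_sqrt.2 hL
  have hLr : L = r ^ 2 := (Real.sq_sqrt hL0.le).symm
  have e : omCoeff a χ L 0 = ∫ x in box L, (om a x : ℂ) * (boxCut χ L x : ℂ) := by
    rw [omCoeff, setIntegral_box_eq_integral]
    · simp
    · intro x hx
      rw [hχ.boxCut_eq_zero hL0 (by linarith)]; simp
  have hball : MeasurableSet (Metric.closedBall (0 : E3) r) := Metric.isClosed_closedBall.measurableSet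
  have hinteg : IntegrableOn (fun x : E3 => K * (a / r) +
      (Metric.closedBall (0 : E3) r).indicator (fun _ => K) x) (box L) :=
    (integrable_const _).add ((integrable_const _).indicator hball)
  have h1 : ‖omCoeff a χ L 0‖ ≤ ∫ x in box L, (K * (a / r) +
      (Metric.closedBall (0 : E3) r).indicator (fun _ => K) x) := by
    rw [e]
    refine norm_integral_le_of_norm_le hinteg (Eventually.of_forall fun x => ?_)
    rw [norm_mul, Complex.norm_real, Complex.norm_real, Real.norm_of_nonneg (om_nonneg ha x)]
    have hb' : ‖boxCut χ L x‖ ≤ K := hb _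
    have h0 := om_nonneg ha x
    by_cases hx : ‖x‖ ≤ r
    · rw [Set.indicator_of_mem (mem_closedBall_zero_iff.2 hx)]
      have := om_le_one ha x
      have : 0 ≤ K * (a / r) := by positivity
      nlinarith [norm_nonneg (boxCut χ L x)]
    · rw [Set.indicator_of_notMem (by rwa [mem_closedBall_zero_iff]), add_zero, mul_comm K]
      exact mul_le_mul (om_le_of_le ha (by positivity) (not_le.1 hx).le) hb' (norm_nonneg _)
        (by positivity)
  have h2 : ∫ x in box L, (K * (a / r) + (Metric.closedBall (0 : E3) r).indicator (fun _ => K) x)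
      ≤ K * (a / r) * L ^ 3 + K * (5 * r ^ 3) := by
    rw [integral_add (integrable_const _) ((integrable_const _).indicator hball)]
    refine add_le_add (le_of_eq ?_) ?_
    · simp [volume_real_box hL0, mul_comm]
    · rw [integral_indicator hball, setIntegral_const, smul_eq_mul, mul_comm]
      gcongr
      refine le_trans ?_ (volume_real_closedBall_le (by positivity))
      rw [measureReal_restrict_apply hball]
      exact measureReal_mono Set.inter_subset_left
        (Metric.isBounded_closedBall.measure_lt_top).ne
  calc (L ^ 3)⁻¹ * ‖omCoeff a χ L 0‖ ≤ (L ^ 3)⁻¹ * (K * (a / r) * L ^ 3 + K * (5 * r ^ 3)) := by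
        gcongr; exact h1.trans h2
    _ = K * a / r + K * 5 / r ^ 3 := by rw [hLr]; field_simp
    _ ≤ K * a / r + K * 5 / r := by gcongr; exact le_self_pow₀ hr1 (by norm_num)
    _ = K * (a + 5) / r := by ring

lemma IsCutoff.exists_uRest_sum_le (hχ : IsCutoff χ) : ∃ K : ℝ, 0 < K ∧ ∀ a ρ₀ L : ℝ, 0 < a →
    0 < ρ₀ → 1 ≤ L → Summable (fun n => ‖uRest a χ ρ₀ L n‖) ∧
      (L ^ 3)⁻¹ * ∑' n, ‖uRest a χ ρ₀ L n‖ ≤ ρ₀ * (K * (a ^ 2 + a + 6) / √L) := by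
  obtain ⟨K₁, hK₁, h₁⟩ := hχ.exists_kCoeff_div_sum_le
  obtain ⟨K₂, hK₂, h₂⟩ := hχ.exists_omCoeff_zero_le
  refine ⟨K₁ + K₂, by positivity, fun a ρ₀ L ha hρ hL => ?_⟩
  have hL0 : 0 < L := by linarith
  obtain ⟨⟨hs, hb⟩, -⟩ := h₁ a L ha hL0
  have h0 := h₂ a L ha hL
  have heq : ∀ n, ‖uRest a χ ρ₀ L n‖ ≤ ρ₀ * (‖kCoeff a χ L n‖ / ‖momentum L n‖ ^ 2)
      + (if n = 0 then ρ₀ * ‖omCoeff a χ L 0‖ else 0) := by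
    intro n
    by_cases hn : n = 0
    · subst hn
      simp [uRest, abs_of_pos hρ]
    · simp [uRest, hn, abs_of_pos hρ, mul_div_assoc]
  have hit : HasSum (fun n : Fin 3 → ℤ => if n = 0 then ρ₀ * ‖omCoeff a χ L 0‖ else 0)
      (ρ₀ * ‖omCoeff a χ L 0‖) := hasSum_ite_eq 0 _
  have hS := (hs.mul_left ρ₀).add hit.summable
  have hsum := Summable.of_nonneg_of_le (fun n => norm_nonneg _) heq hS
  refine ⟨hsum, ?_⟩
  have hsq : √L ≤ L := by
    rw [Real.sqrt_le_left hL0.le]; nlinarith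
  have hsq0 : 0 < √L := Real.sqrt_pos.2 hL0
  calc (L ^ 3)⁻¹ * ∑' n, ‖uRest a χ ρ₀ L n‖
      ≤ (L ^ 3)⁻¹ * ∑' n, (ρ₀ * (‖kCoeff a χ L n‖ / ‖momentum L n‖ ^ 2)
        + (if n = 0 then ρ₀ * ‖omCoeff a χ L 0‖ else 0)) :=
        mul_le_mul_of_nonneg_left (hsum.tsum_le_tsum heq hS) (by positivity)
    _ = ρ₀ * ((L ^ 3)⁻¹ * ∑' n, ‖kCoeff a χ L n‖ / ‖momentum L n‖ ^ 2)
        + ρ₀ * ((L ^ 3)⁻¹ * ‖omCoeff a χ L 0‖) := by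
        rw [(hs.mul_left ρ₀).tsum_add hit.summable, hit.tsum_eq, tsum_mul_left]; ring
    _ ≤ ρ₀ * (K₁ * (a ^ 2 + 1) / L) + ρ₀ * (K₂ * (a + 5) / √L) :=
        add_le_add (mul_le_mul_of_nonneg_left hb hρ.le) (mul_le_mul_of_nonneg_left h0 hρ.le)
    _ ≤ ρ₀ * (K₁ * (a ^ 2 + 1) / √L) + ρ₀ * (K₂ * (a + 5) / √L) := by gcongr
    _ = ρ₀ * ((K₁ * (a ^ 2 + 1) + K₂ * (a + 5)) / √L) := by ring
    _ ≤ ρ₀ * ((K₁ + K₂) * (a ^ 2 + a + 6) / √L) := by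
        gcongr
        nlinarith [mul_pos hK₁ ha, mul_pos hK₂ ha, mul_pos hK₂ (pow_pos ha 2)]

lemma integrable_mul_of_memLp {μ : Measure E3} {f g : E3 → ℂ} (hf : MemLp f 2 μ) (hg : MemLp g 2 μ) :
    Integrable (fun x => f x * g x) μ := hf.integrable_mul hg

lemma Params.integral_sFun_mul_expo (h : Params a ρ₀ w L) (n : Fin 3 → ℤ) :
    ∫ x in box L, (sFun a ρ₀ L x : ℂ) * expo L (-n) x = sCoeff a ρ₀ L n := by
  rw [← integral_fser_mul_expo h.hL h.summable_sCoeff n]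
  refine integral_congr_ae ?_
  filter_upwards [h.sFun_ae_eq] with x hx
  rw [hx]

lemma Params.integral_dFun_mul_expo (h : Params a ρ₀ w L) (j : Fin 3) (n : Fin 3 → ℤ) :
    ∫ x in box L, (dFun a ρ₀ L x j : ℂ) * expo L (-n) x = dCoeff a ρ₀ L j n := by
  rw [← integral_fser_mul_expo h.hL (h.summable_dCoeff j) n]
  refine integral_congr_ae ?_
  filter_upwards [h.dFun_ae_eq j] with x hx
  rw [hx]

lemma memLp_of_bounded {F : Type*} [NormedAddCommGroup F] {f : E3 → F}
    (hm : AEStronglyMeasurable f volume) {K : ℝ} (hK : ∀ x, ‖f x‖ ≤ K) (L : ℝ) :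
    MemLp f 2 (volume.restrict (box L)) :=
  MemLp.of_bound hm.restrict K (Eventually.of_forall hK)

/-- The function `s + ρ₀ om`, with `om` truncated at the scale of the box. -/
lemma IsCutoff.sFun_add_om_ae_eq (hχ : IsCutoff χ) (h : Params a ρ₀ w L) (hL : 5 * a ≤ L)
    (hL1 : 1 ≤ L) : ∀ᵐ x ∂volume.restrict (box L),
      ((sFun a ρ₀ L x + ρ₀ * (om a x * boxCut χ L x) : ℝ) : ℂ)
        = fser L (fun n => (uMain a ρ₀ L n : ℂ) + uRest a χ ρ₀ L n) x := by
  obtain ⟨C, hC, hu⟩ := exists_uMain_sum_le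
  obtain ⟨K, hK, hr⟩ := hχ.exists_uRest_sum_le
  obtain ⟨⟨hu1, -⟩, -⟩ := hu a ρ₀ w L h
  have hr1 := (hr a ρ₀ L h.ha h.hρ hL1).1
  obtain ⟨Kχ, hKχ, hb⟩ := exists_abs_le hχ.smooth.continuous hχ.hasCompactSupport
  have hη := (hχ.boxCut_contDiff L).continuous
  have hm2 : MemLp (fun x => ((om a x * boxCut χ L x : ℝ) : ℂ)) 2 (volume.restrict (box L)) := by
    have hcont : Continuous fun x => ((om a x * boxCut χ L x : ℝ) : ℂ) :=
      Complex.continuous_ofReal.comp ((continuous_om h.ha).mul hη)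
    refine memLp_of_bounded (K := Kχ) hcont.aestronglyMeasurable (fun x => ?_) L
    rw [Complex.norm_real, norm_mul, Real.norm_of_nonneg (om_nonneg h.ha x)]
    exact (mul_le_of_le_one_left (norm_nonneg _) (om_le_one h.ha x)).trans (hb _)
  have hm1 : MemLp (fun x => (sFun a ρ₀ L x : ℂ)) 2 (volume.restrict (box L)) := h.memLp_sFun.ofReal
  have hm : MemLp (fun x => ((sFun a ρ₀ L x + ρ₀ * (om a x * boxCut χ L x) : ℝ) : ℂ)) 2
      (volume.restrict (box L)) := by
    refine (hm1.add (hm2.const_mul (ρ₀ : ℂ))).ae_eq (Eventually.of_forall fun x => ?_)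
    simp
  refine ae_eq_fser h.hL hm (summable_sq_of_summable ?_) fun n => ?_
  · refine Summable.of_nonneg_of_le (fun n => norm_nonneg _) (fun n => norm_add_le _ _)
      (Summable.add ?_ hr1)
    simpa using hu1
  · rw [← sCoeff_add_omCoeff h.ha hL hχ n, ← h.integral_sFun_mul_expo n]
    have e : omCoeff a χ L n = ∫ x in box L, ((om a x * boxCut χ L x : ℝ) : ℂ) * expo L (-n) x := by
      rw [setIntegral_box_eq_integral]
      · rw [omCoeff]
        refine integral_congr_ae (Eventually.of_forall fun x => ?_)
        simp only; push_cast; ring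
      · intro x hx
        rw [hχ.boxCut_eq_zero h.hL (by linarith [h.hL])]; simp
    rw [e, ← integral_const_mul, ← integral_add (integrable_mul_of_memLp hm1 (memLp_expo L (-n)))
      ((integrable_mul_of_memLp hm2 (memLp_expo L (-n))).const_mul _)]
    refine integral_congr_ae (Eventually.of_forall fun x => ?_)
    simp only; push_cast; ring

/-- Near the origin `s` is `-ρ₀ om`, up to an error of order `w³`. -/
lemma IsCutoff.exists_sFun_add_om_le (hχ : IsCutoff χ) {a : ℝ} (ha : 0 < a) : ∃ C : ℝ, 0 < C ∧
    ∀ w : ℝ, 0 < w → ∀ᶠ L in atTop, ∀ ρ₀, Params a ρ₀ w L →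
      ∀ᵐ x ∂volume.restrict (box L), ‖x‖ ≤ L / 5 → |sFun a ρ₀ L x + ρ₀ * om a x| ≤ C * w ^ 3 := by
  obtain ⟨C, hC, hu⟩ := exists_uMain_sum_le
  obtain ⟨K, hK, hr⟩ := hχ.exists_uRest_sum_le
  refine ⟨C + 1, by positivity, fun w hw => ?_⟩
  -- The truncation error with ρ₀ replaced by its bound w²/𝔞, so that the threshold in L does not
  -- depend on ρ₀.
  have hlim : Tendsto (fun L : ℝ => w ^ 2 / a * (K * (a ^ 2 + a + 6) / √L)) atTop (𝓝 0) := by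
    have := (tendsto_const_nhds (x := K * (a ^ 2 + a + 6))).div_atTop
      (Real.tendsto_sqrt_atTop)
    simpa using this.const_mul (w ^ 2 / a)
  filter_upwards [eventually_ge_atTop (5 * a), eventually_ge_atTop 1,
    hlim.eventually_le_const (pow_pos hw 3)] with L hL hL1 hsmall ρ₀ h
  obtain ⟨⟨hu1, hu2⟩, -⟩ := hu a ρ₀ w L h
  obtain ⟨hr1, hr2⟩ := hr a ρ₀ L h.ha h.hρ hL1
  have hL0 := h.hL
  have hρ : ρ₀ ≤ w ^ 2 / a := by
    rw [le_div_iff₀ ha]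
    have := h.hw
    have h3 := Real.pi_gt_three
    nlinarith [mul_pos ha h.hρ]
  have hcs : Summable fun n => ‖(uMain a ρ₀ L n : ℂ) + uRest a χ ρ₀ L n‖ := by
    refine Summable.of_nonneg_of_le (fun n => norm_nonneg _) (fun n => norm_add_le _ _)
      (Summable.add ?_ hr1)
    simpa using hu1
  have htot : (L ^ 3)⁻¹ * ∑' n, ‖(uMain a ρ₀ L n : ℂ) + uRest a χ ρ₀ L n‖ ≤ (C + 1) * w ^ 3 := by
    calc (L ^ 3)⁻¹ * ∑' n, ‖(uMain a ρ₀ L n : ℂ) + uRest a χ ρ₀ L n‖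
        ≤ (L ^ 3)⁻¹ * ∑' n, (|uMain a ρ₀ L n| + ‖uRest a χ ρ₀ L n‖) := by
          refine mul_le_mul_of_nonneg_left (hcs.tsum_le_tsum (fun n => ?_) (hu1.add hr1))
            (by positivity)
          refine (norm_add_le _ _).trans (le_of_eq ?_)
          rw [Complex.norm_real, Real.norm_eq_abs]
      _ = (L ^ 3)⁻¹ * ∑' n, |uMain a ρ₀ L n| + (L ^ 3)⁻¹ * ∑' n, ‖uRest a χ ρ₀ L n‖ := by
          rw [hu1.tsum_add hr1, mul_add]
      _ ≤ C * w ^ 3 + w ^ 2 / a * (K * (a ^ 2 + a + 6) / √L) := by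
          refine add_le_add hu2 (hr2.trans ?_)
          gcongr
      _ ≤ (C + 1) * w ^ 3 := by linarith
  filter_upwards [hχ.sFun_add_om_ae_eq h hL hL1, norm_fser_le_of_summable h.hL hcs] with x hx hx2 hxr
  rw [hχ.boxCut_eq_one h.hL hxr, mul_one] at hx
  rw [← Real.norm_eq_abs, ← Complex.norm_real, hx]
  exact hx2.trans htot

/-- The `j`-th derivative of the truncated function `om`. -/
def dOm (a : ℝ) (η : E3 → ℝ) (j : Fin 3) (x : E3) : ℝ := om a x * pd j η x + η x * gradOm a x j

lemma memLp_dOm (ha : 0 < a) {η : E3 → ℝ} (hη : ContDiff ℝ ∞ η) (hc : HasCompactSupport η)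
    (j : Fin 3) (L : ℝ) : MemLp (fun x => (dOm a η j x : ℂ)) 2 (volume.restrict (box L)) := by
  obtain ⟨K, hK, h0, h1, -⟩ := exists_derivative_bound hη hc
  have h3 : Measurable fun x => gradOm a x j :=
    (EuclideanSpace.proj j : E3 →L[ℝ] ℝ).continuous.measurable.comp (measurable_gradOm a)
  refine memLp_of_bounded (K := K + K * (1 / a)) (Complex.measurable_ofReal.comp
    (((continuous_om ha).measurable.mul (contDiff_pd hη j).continuous.measurable).add
      (hη.continuous.measurable.mul h3))).aestronglyMeasurable (fun x => ?_) L
  change ‖((dOm a η j x : ℝ) : ℂ)‖ ≤ _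
  rw [Complex.norm_real]
  refine (norm_add_le _ _).trans (add_le_add ?_ ?_)
  · rw [norm_mul, Real.norm_of_nonneg (om_nonneg ha x)]
    exact (mul_le_of_le_one_left (norm_nonneg _) (om_le_one ha x)).trans (h1 j x)
  · rw [norm_mul]
    exact mul_le_mul (h0 x) ((PiLp.norm_apply_le (gradOm a x) j).trans (norm_gradOm_le ha x))
      (norm_nonneg _) hK.le

lemma integral_dOm_mul_expo (ha : 0 < a) {η : E3 → ℝ} (hη : ContDiff ℝ ∞ η)
    (hc : HasCompactSupport η) (j : Fin 3) (n : Fin 3 → ℤ) :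
    ∫ x, (dOm a η j x : ℂ) * expo L (-n) x = Complex.I * (momentum L n j : ℝ) *
      ∫ x, (om a x : ℂ) * ((η x : ℂ) * expo L (-n) x) := by
  have h := integral_gradOm_mul_expo (L := L) ha (smooth_one hη) hc (-n)
    (EuclideanSpace.single j (1 : ℝ))
  have hgj : ∀ x, inner ℝ (gradOm a x) (EuclideanSpace.single j (1 : ℝ)) = gradOm a x j :=
    fun x => by rw [EuclideanSpace.inner_single_right]; simp
  have hpj : inner ℝ (momentum L (-n)) (EuclideanSpace.single j (1 : ℝ)) = -momentum L n j := by
    rw [EuclideanSpace.inner_single_right, momentum_neg]; simp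
  have hpd : ∀ x, fderiv ℝ η x (EuclideanSpace.single j (1 : ℝ)) = pd j η x := fun x => rfl
  simp only [hgj, hpj, hpd] at h
  have i1 : Integrable fun x => (om a x : ℂ) * ((pd j η x : ℂ) * expo L (-n) x) :=
    integrable_om_mul ha ((contDiff_mul_expo (smooth_one (contDiff_pd hη j)) L (-n)).continuous)
      (hasCompactSupport_mul_expo (hasCompactSupport_pd hc j) L (-n))
  have i2 : Integrable fun x => (gradOm a x j : ℂ) * ((η x : ℂ) * expo L (-n) x) := by
    have := integrable_gradOm_mul (a := a) ha (EuclideanSpace.single j (1 : ℝ))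
      ((contDiff_mul_expo (smooth_one hη) L (-n)).continuous) (hasCompactSupport_mul_expo hc L (-n))
    simpa only [hgj] using this
  have e : ∫ x, (dOm a η j x : ℂ) * expo L (-n) x
      = (∫ x, (om a x : ℂ) * ((pd j η x : ℂ) * expo L (-n) x))
        + ∫ x, (gradOm a x j : ℂ) * ((η x : ℂ) * expo L (-n) x) := by
    rw [← integral_add i1 i2]
    refine integral_congr_ae (Eventually.of_forall fun x => ?_)
    simp only [dOm]; push_cast; ring
  rw [e, h]
  push_cast
  ring

lemma IsCutoff.dFun_add_gradOm_ae_eq (hχ : IsCutoff χ) (h : Params a ρ₀ w L) (hL : 5 * a ≤ L)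
    (j : Fin 3) :
    (Summable fun n => ‖Complex.I * (momentum L n j : ℝ) *
      ((uMain a ρ₀ L n : ℂ) + uRest a χ ρ₀ L n)‖ ^ 2) ∧
    ∀ᵐ x ∂volume.restrict (box L),
      ((dFun a ρ₀ L x j + ρ₀ * dOm a (boxCut χ L) j x : ℝ) : ℂ)
        = fser L (fun n => Complex.I * (momentum L n j : ℝ) *
          ((uMain a ρ₀ L n : ℂ) + uRest a χ ρ₀ L n)) x := by
  have hL0 := h.hL
  have hη := hχ.boxCut_contDiff L
  have hηc := hχ.boxCut_hasCompactSupport h.hL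
  have hm1 : MemLp (fun x => (dFun a ρ₀ L x j : ℂ)) 2 (volume.restrict (box L)) :=
    (h.memLp_dFun_apply j).ofReal
  have hm2 := memLp_dOm h.ha hη hηc j L
  have hm : MemLp (fun x => ((dFun a ρ₀ L x j + ρ₀ * dOm a (boxCut χ L) j x : ℝ) : ℂ)) 2
      (volume.restrict (box L)) := by
    refine (hm1.add (hm2.const_mul (ρ₀ : ℂ))).ae_eq (Eventually.of_forall fun x => ?_)
    simp
  have hcoef : ∀ n, ∫ x in box L, ((dFun a ρ₀ L x j + ρ₀ * dOm a (boxCut χ L) j x : ℝ) : ℂ)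
      * expo L (-n) x = Complex.I * (momentum L n j : ℝ) *
          ((uMain a ρ₀ L n : ℂ) + uRest a χ ρ₀ L n) := by
    intro n
    have e : ∫ x in box L, (dOm a (boxCut χ L) j x : ℂ) * expo L (-n) x
        = Complex.I * (momentum L n j : ℝ) * omCoeff a χ L n := by
      rw [setIntegral_box_eq_integral, integral_dOm_mul_expo h.ha hη hηc, omCoeff]
      intro x hx
      have hx' : 2 * L / 5 < ‖x‖ := by linarith
      rw [dOm, hχ.boxCut_eq_zero h.hL hx',
        pd_eq_zero_of_gt (fun z hz => hχ.boxCut_eq_zero h.hL hz) j hx']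
      simp
    calc ∫ x in box L, ((dFun a ρ₀ L x j + ρ₀ * dOm a (boxCut χ L) j x : ℝ) : ℂ) * expo L (-n) x
        = (∫ x in box L, (dFun a ρ₀ L x j : ℂ) * expo L (-n) x)
          + ρ₀ * ∫ x in box L, (dOm a (boxCut χ L) j x : ℂ) * expo L (-n) x := by
          rw [← integral_const_mul, ← integral_add
            (integrable_mul_of_memLp hm1 (memLp_expo L (-n)))
            ((integrable_mul_of_memLp hm2 (memLp_expo L (-n))).const_mul _)]
          refine integral_congr_ae (Eventually.of_forall fun x => ?_)
          simp only; push_cast; ring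
      _ = _ := by
          rw [h.integral_dFun_mul_expo, e, ← sCoeff_add_omCoeff h.ha hL hχ n, dCoeff, sCoeff]
          ring
  have hs : Summable fun n => ‖Complex.I * (momentum L n j : ℝ) *
      ((uMain a ρ₀ L n : ℂ) + uRest a χ ρ₀ L n)‖ ^ 2 := by
    simpa only [hcoef] using summable_norm_sq_integral_mul_expo h.hL hm
  exact ⟨hs, ae_eq_fser h.hL hm hs hcoef⟩

/-- Near the origin `∇s` is `-ρ₀ ∇om`, up to an error of order `w³`. -/
lemma IsCutoff.exists_dFun_add_gradOm_le (hχ : IsCutoff χ) {a : ℝ} (ha : 0 < a) : ∃ C : ℝ, 0 < C ∧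
    ∀ w : ℝ, 0 < w → w ≤ 1 → ∀ᶠ L in atTop, ∀ ρ₀, Params a ρ₀ w L → ∀ r, a ≤ r → r < L / 5 →
      ∫ x in Metric.closedBall 0 r, ‖dFun a ρ₀ L x + ρ₀ • gradOm a x‖ ^ 2 ≤ C * (w ^ 6 * r ^ 3) := by
  obtain ⟨C, hC, hu⟩ := exists_uMain_sum_le
  obtain ⟨K, hK, hk⟩ := hχ.exists_kCoeff_div_sum_le
  refine ⟨3 * (2 * (C * (1 + 1 / a)) ^ 2 * 5 + 2), by positivity, fun w hw hw1 => ?_⟩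
  have hlim : Tendsto (fun L : ℝ => (w ^ 2 / a) ^ 2 * (K * a ^ 2 / L)) atTop (𝓝 0) := by
    have := (tendsto_const_nhds (x := K * a ^ 2)).div_atTop (tendsto_id (α := ℝ))
    simpa using this.const_mul ((w ^ 2 / a) ^ 2)
  filter_upwards [eventually_ge_atTop (5 * a), hlim.eventually_le_const
    (show 0 < w ^ 6 * a ^ 3 by positivity)] with L hL hsmall ρ₀ h r har hr
  have hL0 := h.hL
  obtain ⟨-, hu1, hu2⟩ := hu a ρ₀ w L h
  obtain ⟨-, hk1, hk2⟩ := hk a L ha hL0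
  have hρ0 := h.hρ
  have hρ : ρ₀ ≤ w ^ 2 / a := by
    rw [le_div_iff₀ ha]
    have := h.hw
    have h3 := Real.pi_gt_three
    nlinarith [mul_pos ha h.hρ]
  have hr0 : 0 < r := by linarith
  set B := Metric.closedBall (0 : E3) r with hB
  have hBbox : B ⊆ box L := closedBall_subset_box (by linarith)
  have hBm : MeasurableSet B := Metric.isClosed_closedBall.measurableSet
  have hBfin : volume B ≠ ⊤ := (Metric.isBounded_closedBall.measure_lt_top).ne
  have hj : ∀ j, IntegrableOn (fun x => (dFun a ρ₀ L x j + ρ₀ * gradOm a x j) ^ 2) B ∧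
      ∫ x in B, (dFun a ρ₀ L x j + ρ₀ * gradOm a x j) ^ 2
        ≤ (2 * (C * (1 + 1 / a)) ^ 2 * 5 + 2) * (w ^ 6 * r ^ 3) := by
    intro j
    obtain ⟨hs, hae⟩ := hχ.dFun_add_gradOm_ae_eq h hL j
    set c : (Fin 3 → ℤ) → ℂ := fun n => Complex.I * (momentum L n j : ℝ) *
      ((uMain a ρ₀ L n : ℂ) + uRest a χ ρ₀ L n) with hc
    -- The main part has absolutely summable coefficients and is bounded pointwise. The truncation
    -- part `c₂` is controlled only in mean square, which is why the gradient is estimated in L² on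
    -- a ball.
    set c₁ : (Fin 3 → ℤ) → ℂ := fun n => Complex.I * (momentum L n j : ℝ) * (uMain a ρ₀ L n : ℂ)
    set c₂ : (Fin 3 → ℤ) → ℂ := fun n => Complex.I * (momentum L n j : ℝ) * uRest a χ ρ₀ L n
    have hc₁le : ∀ n, ‖c₁ n‖ ≤ ‖momentum L n‖ * |uMain a ρ₀ L n| := fun n => by
      simp only [c₁, norm_mul, Complex.norm_I, one_mul, Complex.norm_real, Real.norm_eq_abs]
      gcongr
      exact abs_momentum_apply_le L n j
    have hc₁s : Summable fun n => ‖c₁ n‖ :=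
      Summable.of_nonneg_of_le (fun n => norm_nonneg _) hc₁le hu1
    have hc₂le : ∀ n, ‖c₂ n‖ ^ 2 ≤ ρ₀ ^ 2 * (‖kCoeff a χ L n‖ ^ 2 / ‖momentum L n‖ ^ 2) := by
      intro n
      by_cases hn : n = 0
      · subst hn; simp [c₂]
      · have hp := norm_momentum_pos h.hL hn
        have : ‖c₂ n‖ ≤ ‖momentum L n‖ * (ρ₀ * ‖kCoeff a χ L n‖ / ‖momentum L n‖ ^ 2) := by
          simp only [c₂, uRest, hn, if_false, norm_mul, Complex.norm_I, one_mul, Complex.norm_real,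
            Real.norm_eq_abs, norm_neg, norm_div, abs_of_pos hρ0, abs_pow, abs_norm]
          gcongr
          exact abs_momentum_apply_le L n j
        calc ‖c₂ n‖ ^ 2 ≤ (‖momentum L n‖ * (ρ₀ * ‖kCoeff a χ L n‖ / ‖momentum L n‖ ^ 2)) ^ 2 := by
              gcongr
          _ = _ := by field_simp
    have hc₂s : Summable fun n => ‖c₂ n‖ ^ 2 :=
      Summable.of_nonneg_of_le (fun n => by positivity) hc₂le (hk1.mul_left _)
    have hsub := fser_sub_ae_eq h.hL hs hc₂s
    have hcc : (fun n => c n - c₂ n) = c₁ := by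
      funext n; simp only [c, c₁, c₂]; ring
    rw [hcc] at hsub
    have hbd := norm_fser_le_of_summable h.hL hc₁s
    have hM : (L ^ 3)⁻¹ * ∑' n, ‖c₁ n‖ ≤ C * (1 + 1 / a) * w ^ 3 := by
      calc (L ^ 3)⁻¹ * ∑' n, ‖c₁ n‖ ≤ (L ^ 3)⁻¹ * ∑' n, ‖momentum L n‖ * |uMain a ρ₀ L n| :=
            mul_le_mul_of_nonneg_left (hc₁s.tsum_le_tsum hc₁le hu1) (by positivity)
        _ ≤ C * (w ^ 4 + w ^ 3 / a) := hu2
        _ ≤ C * (w ^ 3 + w ^ 3 / a) := by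
            gcongr C * (?_ + _)
            exact pow_le_pow_of_le_one hw.le hw1 (by norm_num)
        _ = _ := by ring
    have h2i : IntegrableOn (fun x => ‖fser L c₂ x‖ ^ 2) (box L) :=
      (memLp_fser h.hL c₂).norm.integrable_sq
    have hpt : ∀ᵐ x ∂volume.restrict B, (dFun a ρ₀ L x j + ρ₀ * gradOm a x j) ^ 2
        ≤ 2 * (C * (1 + 1 / a) * w ^ 3) ^ 2 + 2 * ‖fser L c₂ x‖ ^ 2 := by
      filter_upwards [ae_restrict_of_ae_restrict_of_subset hBbox hae,
        ae_restrict_of_ae_restrict_of_subset hBbox hsub,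
        ae_restrict_of_ae_restrict_of_subset hBbox hbd, ae_restrict_mem hBm] with x h1 h2 h3 h4
      rw [hB, mem_closedBall_zero_iff] at h4
      have h5 : dOm a (boxCut χ L) j x = gradOm a x j := by
        rw [dOm, hχ.boxCut_eq_one h.hL (by linarith),
          pd_eq_zero_of_lt (fun z hz => hχ.boxCut_eq_one h.hL hz.le) j (lt_of_le_of_lt h4 hr)]
        ring
      rw [h5] at h1
      have h6 : |dFun a ρ₀ L x j + ρ₀ * gradOm a x j| = ‖fser L c x‖ := by
        rw [← h1, Complex.norm_real, Real.norm_eq_abs]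
      have h7 : ‖fser L c x‖ ≤ C * (1 + 1 / a) * w ^ 3 + ‖fser L c₂ x‖ := by
        have : fser L c x = fser L c₁ x + fser L c₂ x := by rw [← h2]; ring
        rw [this]
        exact (norm_add_le _ _).trans (add_le_add (h3.trans hM) le_rfl)
      rw [← sq_abs, h6]
      calc ‖fser L c x‖ ^ 2 ≤ (C * (1 + 1 / a) * w ^ 3 + ‖fser L c₂ x‖) ^ 2 := by gcongr
        _ ≤ _ := by nlinarith [sq_nonneg (C * (1 + 1 / a) * w ^ 3 - ‖fser L c₂ x‖)]
    have hgi : IntegrableOn (fun x => 2 * (C * (1 + 1 / a) * w ^ 3) ^ 2 + 2 * ‖fser L c₂ x‖ ^ 2) B :=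
      (integrableOn_const hBfin).add ((h2i.mono_set hBbox).const_mul 2)
    have hfm : AEStronglyMeasurable (fun x => (dFun a ρ₀ L x j + ρ₀ * gradOm a x j) ^ 2)
        (volume.restrict B) := by
      have h3 : Measurable fun x => gradOm a x j :=
        (EuclideanSpace.proj j : E3 →L[ℝ] ℝ).continuous.measurable.comp (measurable_gradOm a)
      exact (((h.memLp_dFun_apply j).aestronglyMeasurable.mono_measure
        (Measure.restrict_mono hBbox le_rfl)).add (h3.const_mul ρ₀).aestronglyMeasurable).pow 2
    refine ⟨hgi.mono' hfm ?_, ?_⟩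
    · filter_upwards [hpt] with x hx
      rwa [Real.norm_of_nonneg (sq_nonneg _)]
    · have h2b : ∫ x in box L, ‖fser L c₂ x‖ ^ 2 ≤ w ^ 6 * r ^ 3 := by
        rw [integral_norm_sq_fser h.hL hc₂s]
        calc (L ^ 3)⁻¹ * ∑' n, ‖c₂ n‖ ^ 2
            ≤ (L ^ 3)⁻¹ * ∑' n, ρ₀ ^ 2 * (‖kCoeff a χ L n‖ ^ 2 / ‖momentum L n‖ ^ 2) :=
              mul_le_mul_of_nonneg_left (hc₂s.tsum_le_tsum hc₂le (hk1.mul_left _)) (by positivity)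
          _ = ρ₀ ^ 2 * ((L ^ 3)⁻¹ * ∑' n, ‖kCoeff a χ L n‖ ^ 2 / ‖momentum L n‖ ^ 2) := by
              rw [tsum_mul_left]; ring
          _ ≤ (w ^ 2 / a) ^ 2 * (K * a ^ 2 / L) := by gcongr
          _ ≤ w ^ 6 * a ^ 3 := hsmall
          _ ≤ w ^ 6 * r ^ 3 := by gcongr
      calc ∫ x in B, (dFun a ρ₀ L x j + ρ₀ * gradOm a x j) ^ 2
          ≤ ∫ x in B, (2 * (C * (1 + 1 / a) * w ^ 3) ^ 2 + 2 * ‖fser L c₂ x‖ ^ 2) :=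
            integral_mono_of_nonneg (Eventually.of_forall fun x => sq_nonneg _) hgi hpt
        _ = volume.real B * (2 * (C * (1 + 1 / a) * w ^ 3) ^ 2)
            + 2 * ∫ x in B, ‖fser L c₂ x‖ ^ 2 := by
            have hci : Integrable (fun _ : E3 => 2 * (C * (1 + 1 / a) * w ^ 3) ^ 2)
              (volume.restrict B) := integrableOn_const hBfin
            rw [integral_add hci ((h2i.mono_set hBbox).const_mul 2), setIntegral_const, smul_eq_mul,
              integral_const_mul]
        _ ≤ 5 * r ^ 3 * (2 * (C * (1 + 1 / a) * w ^ 3) ^ 2) + 2 * (w ^ 6 * r ^ 3) := by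
            gcongr
            · exact volume_real_closedBall_le hr0.le
            · exact (setIntegral_mono_set h2i (Eventually.of_forall fun x => by positivity)
                hBbox.eventuallyLE).trans h2b
        _ = _ := by ring
  have hexp : ∀ x, ‖dFun a ρ₀ L x + ρ₀ • gradOm a x‖ ^ 2
      = ∑ j, (dFun a ρ₀ L x j + ρ₀ * gradOm a x j) ^ 2 := fun x => by
    rw [EuclideanSpace.norm_sq_eq]
    simp
  simp_rw [hexp]
  rw [integral_finsetSum _ fun j _ => (hj j).1]
  refine (Finset.sum_le_card_nsmul _ _ _ fun j _ => (hj j).2).trans (le_of_eq ?_)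
  simp
  ring

end LocalU

end HardSphere

end

/-! ### Decay of ∇s -/

noncomputable section

namespace HardSphere

open Filter Topology

section Tails

variable {a ρ₀ w L : ℝ}

lemma norm_momentum_single (hL : 0 < L) (j : Fin 3) :
    ‖momentum L (Pi.single j 1)‖ = 2 * Real.pi / L := by
  have : latticeVec (Pi.single j 1) = EuclideanSpace.single j (1 : ℝ) := by
    ext i
    by_cases h : i = j
    · subst h; simp [latticeVec]
    · simp [latticeVec, h]
  rw [norm_momentum hL, this]
  simp

lemma norm_momentum_sub_single (hL : 0 < L) (j : Fin 3) (n : Fin 3 → ℤ) :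
    ‖momentum L (n - Pi.single j 1) - momentum L n‖ = 2 * Real.pi / L := by
  rw [sub_eq_add_neg n, momentum_add, momentum_neg, add_sub_cancel_left, norm_neg,
    norm_momentum_single hL]

lemma abs_norm_momentum_sub_le (hL : 0 < L) (j : Fin 3) (n : Fin 3 → ℤ) :
    |‖momentum L (n - Pi.single j 1)‖ - ‖momentum L n‖| ≤ 2 * Real.pi / L :=
  (abs_norm_sub_norm_le _ _).trans (norm_momentum_sub_single hL j n).le

/-- Differences of neighbouring coefficients need not vanish at n = 0, where power bounds in |p| say
nothing. The zero mode is therefore carried as a separate term. -/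
lemma exists_lattice_sum_le_add {α β : ℕ} (hα : α < 3) (hβ : 3 < β) :
    ∃ C : ℝ, 0 < C ∧ ∀ (L : ℝ) (f : (Fin 3 → ℤ) → ℝ) (A B R : ℝ), 0 < L → 0 ≤ A → 0 ≤ B → 0 < R →
      (∀ n, 0 ≤ f n) → (∀ n, n ≠ 0 → f n ≤ A / ‖momentum L n‖ ^ α) →
      (∀ n, n ≠ 0 → f n ≤ B / ‖momentum L n‖ ^ β) →
      Summable f ∧ (L ^ 3)⁻¹ * ∑' n, f n
        ≤ C * ((A / R ^ α + B / R ^ β) * R ^ 3) + (L ^ 3)⁻¹ * f 0 := by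
  obtain ⟨C, hC, h⟩ := exists_lattice_sum_le hα hβ
  refine ⟨C, hC, fun L f A B R hL hA hB hR hf h1 h2 => ?_⟩
  obtain ⟨hs, hb⟩ := h L (fun n => if n = 0 then 0 else f n) A B R hL hA hB hR
    (fun n => by split_ifs; exacts [le_rfl, hf n]) (by simp)
    (fun n hn => by simpa [hn] using h1 n hn) (fun n hn => by simpa [hn] using h2 n hn)
  have h0 : HasSum (fun n : Fin 3 → ℤ => if n = 0 then f 0 else 0) (f 0) := hasSum_ite_eq 0 _
  have e : f = fun n => (if n = 0 then 0 else f n) + (if n = 0 then f 0 else 0) := by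
    funext n
    by_cases hn : n = 0
    · subst hn; simp
    · simp [hn]
  have hsum : Summable f := by rw [e]; exact hs.add h0.summable
  refine ⟨hsum, ?_⟩
  have : ∑' n, f n = ∑' n, (if n = 0 then 0 else f n) + f 0 := by
    conv_lhs => rw [e]
    rw [hs.tsum_add h0.summable, h0.tsum_eq]
  rw [this, mul_add]
  linarith

/-- The decay of `∇s`. -/
lemma exists_tail_dFun_le : ∃ C : ℝ, 0 < C ∧ ∀ a ρ₀ w L r : ℝ, Params a ρ₀ w L → 1 ≤ w * L →
    0 < r → ∫ x in box L ∩ {x | r ≤ ‖x‖}, ‖dFun a ρ₀ L x‖ ^ 2 ≤ C * (w ^ 3 / r ^ 2) := by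
  obtain ⟨C, hC, hS⟩ := exists_lattice_sum_le_add (α := 1) (β := 4) (by norm_num) (by norm_num)
  set κ : ℝ := 2 * Real.pi with hκ
  have hκ0 : 0 < κ := by positivity
  refine ⟨3 * (C * (2 * 7000 * κ ^ 2) + κ), by positivity, fun a ρ₀ w L r h hwL hr => ?_⟩
  have hL := h.hL
  have hw0 := h.hw0
  have hq0 : 0 < κ / L := by positivity
  -- the differences of the coefficients
  have key : ∀ j i : Fin 3, ∀ n, n ≠ 0 →
      ‖dCoeff a ρ₀ L i (n - Pi.single j 1) - dCoeff a ρ₀ L i n‖ ^ 2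
        ≤ 7000 * (κ / L) ^ 2 * w / ‖momentum L n‖ ^ 1 ∧
      ‖dCoeff a ρ₀ L i (n - Pi.single j 1) - dCoeff a ρ₀ L i n‖ ^ 2
        ≤ 7000 * (κ / L) ^ 2 * w ^ 4 / ‖momentum L n‖ ^ 4 := by
    intro j i n hn
    have hp := norm_momentum_pos hL hn
    set n' := n - Pi.single j 1 with hn'
    have hnorm : ‖dCoeff a ρ₀ L i n' - dCoeff a ρ₀ L i n‖ ^ 2
        = (momentum L n' i * sHat a ρ₀ L n' - momentum L n i * sHat a ρ₀ L n) ^ 2 := by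
      have : dCoeff a ρ₀ L i n' - dCoeff a ρ₀ L i n = Complex.I *
          ((momentum L n' i * sHat a ρ₀ L n' - momentum L n i * sHat a ρ₀ L n : ℝ) : ℂ) := by
        simp only [dCoeff]; push_cast; ring
      rw [this, norm_mul, Complex.norm_I, one_mul, Complex.norm_real, Real.norm_eq_abs, sq_abs]
    rw [hnorm]
    have h1 := h.sHat_sq_le_one hn
    have h4 := h.sHat_sq_le_four hn
    -- The neighbour may be the origin, where the coefficient is 0 by definition and not given by
    -- the symbol. Then |p| = 2π/L exactly and the size of the single remaining term suffices.
    by_cases hz : n' = 0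
    · have hpe : ‖momentum L n‖ = κ / L := by
        have := norm_momentum_sub_single hL j n
        rw [← hn', hz, momentum_zero, zero_sub, norm_neg] at this
        exact this
      have hle : (momentum L n' i * sHat a ρ₀ L n' - momentum L n i * sHat a ρ₀ L n) ^ 2
          ≤ (κ / L) ^ 2 * sHat a ρ₀ L n ^ 2 := by
        rw [hz]
        simp only [sHat_zero, mul_zero, zero_sub, neg_sq, mul_pow]
        gcongr ?_ * _
        rw [← sq_abs (momentum L n i)]
        gcongr
        exact (abs_momentum_apply_le L n i).trans hpe.le
      constructor
      · refine hle.trans ?_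
        calc (κ / L) ^ 2 * sHat a ρ₀ L n ^ 2 ≤ (κ / L) ^ 2 * (w / ‖momentum L n‖ ^ 1) := by gcongr
          _ ≤ 7000 * ((κ / L) ^ 2 * (w / ‖momentum L n‖ ^ 1)) :=
            le_mul_of_one_le_left (by positivity) (by norm_num)
          _ = _ := by ring
      · refine hle.trans ?_
        calc (κ / L) ^ 2 * sHat a ρ₀ L n ^ 2 ≤ (κ / L) ^ 2 * (w ^ 4 / ‖momentum L n‖ ^ 4) := by gcongr
          _ ≤ 7000 * ((κ / L) ^ 2 * (w ^ 4 / ‖momentum L n‖ ^ 4)) :=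
            le_mul_of_one_le_left (by positivity) (by norm_num)
          _ = _ := by ring
    · have hp' := norm_momentum_pos hL hz
      have hq' := le_norm_momentum hL hz
      have habs := abs_norm_momentum_sub_le hL j n
      rw [← hn', ← hκ] at habs
      rw [← hκ] at hq'
      set P := ‖momentum L n‖
      set P' := ‖momentum L n'‖
      -- A nonzero neighbour has |p'| ≥ 2π/L, which is at least the difference of the two lengths.
      -- So |p|/2 lies below both, as the mean value bound requires.
      have hPP : P ≤ 2 * P' := by
        have := (abs_le.1 habs).1
        linarith
      set m := P / 2
      have hm0 : 0 < m := by positivity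
      have hmP : m ≤ P := by simp only [m]; linarith
      have hmP' : m ≤ P' := by simp only [m]; linarith
      have hds := sq_sRad_sub_le h.ha h.hρ h.hs h.hw0 h.hw hm0 hmP' hmP
      rw [← h.sHat_eq hn, ← h.sHat_eq hz] at hds
      have hd2 : (P' - P) ^ 2 ≤ (κ / L) ^ 2 := by
        rw [← sq_abs]; gcongr
      have hi2 : (momentum L n' i - momentum L n i) ^ 2 ≤ (κ / L) ^ 2 := by
        rw [← sq_abs]
        gcongr
        have := PiLp.norm_apply_le (momentum L n' - momentum L n) i
        rw [norm_momentum_sub_single hL j n] at this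
        exact this
      have hpi2 : momentum L n i ^ 2 ≤ P ^ 2 := by
        rw [← sq_abs]; gcongr; exact abs_momentum_apply_le L n i
      have hle : (momentum L n' i * sHat a ρ₀ L n' - momentum L n i * sHat a ρ₀ L n) ^ 2
          ≤ 2 * ((κ / L) ^ 2 * sHat a ρ₀ L n' ^ 2)
            + 2 * (P ^ 2 * (sHat a ρ₀ L n' - sHat a ρ₀ L n) ^ 2) := by
        have e : momentum L n' i * sHat a ρ₀ L n' - momentum L n i * sHat a ρ₀ L n
            = (momentum L n' i - momentum L n i) * sHat a ρ₀ L n'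
              + momentum L n i * (sHat a ρ₀ L n' - sHat a ρ₀ L n) := by ring
        rw [e]
        refine (add_sq_le (a := _) (b := _)).trans ?_
        rw [mul_add, mul_pow, mul_pow]
        gcongr
      have h1' := h.sHat_sq_le_one hz
      have h4' := h.sHat_sq_le_four hz
      constructor
      · refine hle.trans ?_
        calc 2 * ((κ / L) ^ 2 * sHat a ρ₀ L n' ^ 2) + 2 * (P ^ 2 * (sHat a ρ₀ L n' - sHat a ρ₀ L n) ^ 2)
            ≤ 2 * ((κ / L) ^ 2 * (w / m ^ 1)) + 2 * (P ^ 2 * (48 * (w / m ^ 3) * (κ / L) ^ 2)) := by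
              gcongr
              · exact h1'.trans (by gcongr)
              · exact hds.2.trans (by gcongr)
          _ = 772 * ((κ / L) ^ 2 * w / P ^ 1) := by simp only [m]; field_simp; norm_num
          _ ≤ 7000 * ((κ / L) ^ 2 * w / P ^ 1) := by gcongr; norm_num
          _ = _ := by ring
      · refine hle.trans ?_
        calc 2 * ((κ / L) ^ 2 * sHat a ρ₀ L n' ^ 2) + 2 * (P ^ 2 * (sHat a ρ₀ L n' - sHat a ρ₀ L n) ^ 2)
            ≤ 2 * ((κ / L) ^ 2 * (w ^ 4 / m ^ 4)) + 2 * (P ^ 2 * (48 * (w ^ 4 / m ^ 6) * (κ / L) ^ 2)) := by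
              gcongr
              · exact h4'.trans (by gcongr)
              · exact hds.1.trans (by gcongr)
          _ = 6176 * ((κ / L) ^ 2 * w ^ 4 / P ^ 4) := by simp only [m]; field_simp; norm_num
          _ ≤ 7000 * ((κ / L) ^ 2 * w ^ 4 / P ^ 4) := by gcongr; norm_num
          _ = _ := by ring
  have hzero : ∀ j i : Fin 3, ‖dCoeff a ρ₀ L i (0 - Pi.single j 1) - dCoeff a ρ₀ L i 0‖ ^ 2
      ≤ κ / L * w := by
    intro j i
    set n : Fin 3 → ℤ := 0 - Pi.single j 1 with hn
    have hne : n ≠ 0 := by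
      rw [hn, zero_sub, neg_ne_zero]
      intro h0
      have := congrFun h0 j
      simp at this
    have hpe : ‖momentum L n‖ = κ / L := by
      have := norm_momentum_sub_single hL j 0
      rw [← hn, momentum_zero, sub_zero] at this
      exact this
    have h1 := h.sHat_sq_le_one hne
    have : ‖dCoeff a ρ₀ L i n - dCoeff a ρ₀ L i 0‖ ^ 2 = (momentum L n i) ^ 2 * sHat a ρ₀ L n ^ 2 := by
      simp [dCoeff, mul_pow]
    rw [this]
    calc momentum L n i ^ 2 * sHat a ρ₀ L n ^ 2 ≤ (κ / L) ^ 2 * (w / (κ / L) ^ 1) := by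
          rw [← sq_abs (momentum L n i), ← hpe]
          gcongr
          exact abs_momentum_apply_le L n i
      _ = κ / L * w := by field_simp
  have hcomp : ∀ i, ∫ x in box L ∩ {x | r ≤ ‖x‖}, ‖fser L (dCoeff a ρ₀ L i) x‖ ^ 2
      ≤ (C * (2 * 7000 * κ ^ 2) + κ) * (w ^ 3 / r ^ 2) := by
    intro i
    have hb : ∀ j : Fin 3, ∑' n, ‖dCoeff a ρ₀ L i (n - Pi.single j 1) - dCoeff a ρ₀ L i n‖ ^ 2
        ≤ L ^ 3 * ((C * (2 * 7000 * κ ^ 2) + κ) * w ^ 3 / L ^ 2) := by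
      intro j
      have hs := (hS L (fun n => ‖dCoeff a ρ₀ L i (n - Pi.single j 1) - dCoeff a ρ₀ L i n‖ ^ 2)
        (7000 * (κ / L) ^ 2 * w) (7000 * (κ / L) ^ 2 * w ^ 4) w hL (by positivity) (by positivity) hw0
        (fun n => by positivity) (fun n hn => (key j i n hn).1) (fun n hn => (key j i n hn).2)).2
      rw [← inv_mul_le_iff₀ (by positivity)]
      refine hs.trans ?_
      have e1 : C * ((7000 * (κ / L) ^ 2 * w / w ^ 1 + 7000 * (κ / L) ^ 2 * w ^ 4 / w ^ 4) * w ^ 3)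
          = C * (2 * 7000 * κ ^ 2) * w ^ 3 / L ^ 2 := by field_simp; norm_num
      have e2 : (L ^ 3)⁻¹ * ‖dCoeff a ρ₀ L i (0 - Pi.single j 1) - dCoeff a ρ₀ L i 0‖ ^ 2
          ≤ κ * w ^ 3 / L ^ 2 := by
        calc (L ^ 3)⁻¹ * ‖dCoeff a ρ₀ L i (0 - Pi.single j 1) - dCoeff a ρ₀ L i 0‖ ^ 2
            ≤ (L ^ 3)⁻¹ * (κ / L * w) := by gcongr; exact hzero j i
          _ = κ * w * 1 ^ 2 / L ^ 4 := by field_simp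
          _ ≤ κ * w * (w * L) ^ 2 / L ^ 4 := by gcongr
          _ = κ * w ^ 3 / L ^ 2 := by field_simp
      calc _ ≤ C * (2 * 7000 * κ ^ 2) * w ^ 3 / L ^ 2 + κ * w ^ 3 / L ^ 2 := add_le_add e1.le e2
        _ = _ := by ring
    refine (integral_tail_fser_le hL (h.summable_dCoeff i) hr hb).trans (le_of_eq ?_)
    field_simp
  have hsub : box L ∩ {x | r ≤ ‖x‖} ⊆ box L := Set.inter_subset_left
  have hexp : ∫ x in box L ∩ {x | r ≤ ‖x‖}, ‖dFun a ρ₀ L x‖ ^ 2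
      = ∑ i, ∫ x in box L ∩ {x | r ≤ ‖x‖}, ‖fser L (dCoeff a ρ₀ L i) x‖ ^ 2 := by
    rw [← integral_finsetSum]
    · refine integral_congr_ae ?_
      have := fun i => ae_restrict_of_ae_restrict_of_subset hsub (h.dFun_ae_eq i)
      filter_upwards [this 0, this 1, this 2] with x h0 h1 h2
      rw [EuclideanSpace.norm_sq_eq]
      simp only [Fin.sum_univ_three, ← h0, ← h1, ← h2, Complex.norm_real]
    · intro i _
      have : IntegrableOn (fun x => ‖fser L (dCoeff a ρ₀ L i) x‖ ^ 2) (box L) :=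
        (memLp_fser h.hL (dCoeff a ρ₀ L i)).norm.integrable_sq
      exact this.mono_set hsub
  rw [hexp]
  refine (Finset.sum_le_card_nsmul _ _ _ fun i _ => hcomp i).trans (le_of_eq ?_)
  simp
  ring

end Tails

end HardSphere

end

/-! ### Decay and averages of s -/

noncomputable section

namespace HardSphere

open Filter Topology

section TailS

variable {a ρ₀ w L : ℝ}

/-- The part of `s` with momenta effectively above `τ`. -/
def sHigh (a ρ₀ L τ : ℝ) (n : Fin 3 → ℤ) : ℂ := (sRad a ρ₀ (max ‖momentum L n‖ τ) : ℝ)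

lemma Params.sRad_sq_le_one (h : Params a ρ₀ w L) {r : ℝ} (hr : 0 < r) :
    sRad a ρ₀ r ^ 2 ≤ w / r := HardSphere.sRad_sq_le_one h.ha h.hρ h.hs hr h.hw0 h.hw

lemma Params.sRad_sq_le_four (h : Params a ρ₀ w L) {r : ℝ} (hr : 0 < r) :
    sRad a ρ₀ r ^ 2 ≤ w ^ 4 / r ^ 4 := HardSphere.sRad_sq_le_four h.ha h.hρ h.hs hr h.hw

/-- The difference vanishes for nonzero momenta with |p| ≥ τ, and its square is at most 4w/|p|
below. The bound by 4wτ³/|p|⁴ holds because |p| < τ and serves only to fit the lattice sum lemma.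
The condition τL ≥ 1 absorbs the zero mode. -/
lemma exists_low_le : ∃ C : ℝ, 0 < C ∧ ∀ a ρ₀ w L τ : ℝ, Params a ρ₀ w L → 0 < τ →
    1 ≤ τ * L → Summable (fun n => ‖sCoeff a ρ₀ L n - sHigh a ρ₀ L τ n‖ ^ 2) ∧
      (L ^ 3)⁻¹ * ∑' n, ‖sCoeff a ρ₀ L n - sHigh a ρ₀ L τ n‖ ^ 2 ≤ C * (w * τ ^ 2) := by
  obtain ⟨C, hC, hS⟩ := exists_lattice_sum_le_add (α := 1) (β := 4) (by norm_num) (by norm_num)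
  refine ⟨8 * C + 1, by positivity, fun a ρ₀ w L τ h hτ hτL => ?_⟩
  have hL := h.hL
  have hw0 := h.hw0
  have hn : ∀ n, ‖sCoeff a ρ₀ L n - sHigh a ρ₀ L τ n‖ ^ 2
      = (sHat a ρ₀ L n - sRad a ρ₀ (max ‖momentum L n‖ τ)) ^ 2 := fun n => by
    rw [sCoeff, sHigh, ← Complex.ofReal_sub, Complex.norm_real, Real.norm_eq_abs, sq_abs]
  have key : ∀ n, n ≠ 0 → (sHat a ρ₀ L n - sRad a ρ₀ (max ‖momentum L n‖ τ)) ^ 2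
        ≤ 4 * w / ‖momentum L n‖ ^ 1 ∧
      (sHat a ρ₀ L n - sRad a ρ₀ (max ‖momentum L n‖ τ)) ^ 2
        ≤ 4 * w * τ ^ 3 / ‖momentum L n‖ ^ 4 := by
    intro n hn
    have hp := norm_momentum_pos hL hn
    rw [h.sHat_eq hn]
    rcases le_or_gt τ ‖momentum L n‖ with hle | hlt
    · rw [max_eq_left hle]
      simp only [sub_self]
      constructor <;> · norm_num; positivity
    · rw [max_eq_right hlt.le]
      have h1 := h.sRad_sq_le_one hp
      have h2 := h.sRad_sq_le_one hτ
      have h3 : w / τ ≤ w / ‖momentum L n‖ := by gcongr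
      have h4 : (sRad a ρ₀ ‖momentum L n‖ - sRad a ρ₀ τ) ^ 2 ≤ 4 * (w / ‖momentum L n‖) := by
        nlinarith [sq_nonneg (sRad a ρ₀ ‖momentum L n‖ + sRad a ρ₀ τ)]
      constructor
      · refine h4.trans (le_of_eq ?_); ring
      · refine h4.trans ?_
        calc 4 * (w / ‖momentum L n‖) = 4 * w * ‖momentum L n‖ ^ 3 / ‖momentum L n‖ ^ 4 := by
              field_simp
          _ ≤ 4 * w * τ ^ 3 / ‖momentum L n‖ ^ 4 := by gcongr
  obtain ⟨h1, h2⟩ := hS L (fun n => (sHat a ρ₀ L n - sRad a ρ₀ (max ‖momentum L n‖ τ)) ^ 2)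
    (4 * w) (4 * w * τ ^ 3) τ hL (by positivity) (by positivity) hτ (fun n => sq_nonneg _)
    (fun n hn => (key n hn).1) (fun n hn => (key n hn).2)
  simp_rw [hn]
  refine ⟨h1, h2.trans ?_⟩
  have h0 : (L ^ 3)⁻¹ * (sHat a ρ₀ L 0 - sRad a ρ₀ (max ‖momentum L 0‖ τ)) ^ 2 ≤ w * τ ^ 2 := by
    rw [sHat_zero, momentum_zero, norm_zero, max_eq_right hτ.le, zero_sub, neg_sq]
    calc (L ^ 3)⁻¹ * sRad a ρ₀ τ ^ 2 ≤ (L ^ 3)⁻¹ * (w / τ) := by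
          gcongr; exact h.sRad_sq_le_one hτ
      _ = w * 1 ^ 3 / (τ * L ^ 3) := by field_simp
      _ ≤ w * (τ * L) ^ 3 / (τ * L ^ 3) := by gcongr
      _ = w * τ ^ 2 := by field_simp
  have e : C * ((4 * w / τ ^ 1 + 4 * w * τ ^ 3 / τ ^ 4) * τ ^ 3) = 8 * C * (w * τ ^ 2) := by
    field_simp; norm_num
  linarith

/-- The bound w/|p|³ on the squared derivative of ŝ is not integrable at the origin of ℝ³. Freezing
the symbol below τ improves it to w/(τp²), which is integrable, and the tail then follows from
`integral_tail_fser_le`. -/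
lemma exists_high_le : ∃ C : ℝ, 0 < C ∧ ∀ a ρ₀ w L τ r : ℝ, Params a ρ₀ w L → 0 < τ → τ ≤ w →
    2 * Real.pi ≤ τ * L → 0 < r → Summable (fun n => ‖sHigh a ρ₀ L τ n‖ ^ 2) ∧
      ∫ x in box L ∩ {x | r ≤ ‖x‖}, ‖fser L (sHigh a ρ₀ L τ) x‖ ^ 2
        ≤ C * (w ^ 2 / (τ * r ^ 2)) := by
  obtain ⟨C, hC, hS⟩ := exists_lattice_sum_le_add (α := 2) (β := 6) (by norm_num) (by norm_num)
  obtain ⟨C', hC', hS'⟩ := exists_lattice_sum_le_add (α := 1) (β := 4) (by norm_num) (by norm_num)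
  set κ : ℝ := 2 * Real.pi with hκ
  have hκ0 : 0 < κ := by positivity
  refine ⟨C * (6400 * κ ^ 2) + 48 * κ ^ 2, by positivity, fun a ρ₀ w L τ r h hτ hτw hτL hr => ?_⟩
  have hL := h.hL
  have hw0 := h.hw0
  have hnorm : ∀ n, ‖sHigh a ρ₀ L τ n‖ ^ 2 = sRad a ρ₀ (max ‖momentum L n‖ τ) ^ 2 := fun n => by
    rw [sHigh, Complex.norm_real, Real.norm_eq_abs, sq_abs]
  have hsum : Summable (fun n => ‖sHigh a ρ₀ L τ n‖ ^ 2) := by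
    refine (hS' L _ w (w ^ 4) 1 hL hw0.le (by positivity) one_pos (fun n => by positivity)
      (fun n hn => ?_) (fun n hn => ?_)).1
    · have hp := norm_momentum_pos hL hn
      rw [hnorm, pow_one]
      exact (h.sRad_sq_le_one (lt_max_of_lt_right hτ)).trans (by gcongr; exact le_max_left _ _)
    · have hp := norm_momentum_pos hL hn
      rw [hnorm]
      exact (h.sRad_sq_le_four (lt_max_of_lt_right hτ)).trans (by gcongr; exact le_max_left _ _)
  refine ⟨hsum, ?_⟩
  have hqτ : κ / L ≤ τ := by rw [div_le_iff₀ hL]; exact hτL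
  have hdiff : ∀ (j : Fin 3) n, ‖sHigh a ρ₀ L τ (n - Pi.single j 1) - sHigh a ρ₀ L τ n‖ ^ 2
      = (sRad a ρ₀ (max ‖momentum L (n - Pi.single j 1)‖ τ)
        - sRad a ρ₀ (max ‖momentum L n‖ τ)) ^ 2 := fun j n => by
    rw [sHigh, sHigh, ← Complex.ofReal_sub, Complex.norm_real, Real.norm_eq_abs, sq_abs]
  have hmax : ∀ (j : Fin 3) n, (max ‖momentum L (n - Pi.single j 1)‖ τ - max ‖momentum L n‖ τ) ^ 2
      ≤ (κ / L) ^ 2 := fun j n => by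
    rw [← sq_abs]
    gcongr
    exact (abs_max_sub_max_le_abs _ _ _).trans (abs_norm_momentum_sub_le hL j n)
  have hb : ∀ j : Fin 3, ∑' n, ‖sHigh a ρ₀ L τ (n - Pi.single j 1) - sHigh a ρ₀ L τ n‖ ^ 2
      ≤ L ^ 3 * ((C * (6400 * κ ^ 2) + 48 * κ ^ 2) * (w ^ 2 / τ) / L ^ 2) := by
    intro j
    simp_rw [hdiff]
    have key : ∀ n, n ≠ 0 → (sRad a ρ₀ (max ‖momentum L (n - Pi.single j 1)‖ τ)
        - sRad a ρ₀ (max ‖momentum L n‖ τ)) ^ 2 ≤ 192 * (κ / L) ^ 2 * (w / τ) / ‖momentum L n‖ ^ 2 ∧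
        (sRad a ρ₀ (max ‖momentum L (n - Pi.single j 1)‖ τ)
        - sRad a ρ₀ (max ‖momentum L n‖ τ)) ^ 2 ≤ 3072 * (κ / L) ^ 2 * w ^ 4 / ‖momentum L n‖ ^ 6 := by
      intro n hn
      have hp := norm_momentum_pos hL hn
      have habs := abs_norm_momentum_sub_le hL j n
      rw [← hκ] at habs
      have hge := (abs_le.1 habs).1
      set P := ‖momentum L n‖
      set P' := ‖momentum L (n - Pi.single j 1)‖
      set m := max (P / 2) τ
      have hm0 : 0 < m := lt_max_of_lt_right hτ
      have hm1 : m ≤ max P τ := max_le_max (by linarith) le_rfl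
      have hm2 : m ≤ max P' τ := by
        refine max_le ?_ (le_max_right _ _)
        rcases le_or_gt P' (P / 2) with h1 | h1
        · exact le_max_of_le_right (by linarith)
        · exact le_max_of_le_left h1.le
      have hmP : P / 2 ≤ m := le_max_left _ _
      have hmτ : τ ≤ m := le_max_right _ _
      have hds := sq_sRad_sub_le h.ha h.hρ h.hs h.hw0 h.hw hm0 hm2 hm1
      constructor
      · refine hds.2.trans ?_
        calc 48 * (w / m ^ 3) * (max P' τ - max P τ) ^ 2
            ≤ 48 * (w / (τ * (P / 2) ^ 2)) * (κ / L) ^ 2 := by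
              refine mul_le_mul ?_ (hmax j n) (sq_nonneg _) (by positivity)
              gcongr
              calc τ * (P / 2) ^ 2 ≤ m * m ^ 2 := by gcongr
                _ = m ^ 3 := by ring
          _ = _ := by field_simp; norm_num
      · refine hds.1.trans ?_
        calc 48 * (w ^ 4 / m ^ 6) * (max P' τ - max P τ) ^ 2
            ≤ 48 * (w ^ 4 / (P / 2) ^ 6) * (κ / L) ^ 2 := by
              refine mul_le_mul ?_ (hmax j n) (sq_nonneg _) (by positivity)
              gcongr
          _ = _ := by field_simp; norm_num
    have hs := (hS L (fun n => (sRad a ρ₀ (max ‖momentum L (n - Pi.single j 1)‖ τ)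
        - sRad a ρ₀ (max ‖momentum L n‖ τ)) ^ 2) (192 * (κ / L) ^ 2 * (w / τ))
        (3072 * (κ / L) ^ 2 * w ^ 4) w hL (by positivity) (by positivity) hw0
        (fun n => sq_nonneg _) (fun n hn => (key n hn).1) (fun n hn => (key n hn).2)).2
    rw [← inv_mul_le_iff₀ (by positivity)]
    refine hs.trans ?_
    have e1 : C * ((192 * (κ / L) ^ 2 * (w / τ) / w ^ 2 + 3072 * (κ / L) ^ 2 * w ^ 4 / w ^ 6) * w ^ 3)
        ≤ C * (6400 * κ ^ 2) * (w ^ 2 / τ) / L ^ 2 := by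
      calc _ = C * κ ^ 2 / L ^ 2 * (192 * (w ^ 2 / τ) + 3072 * w) := by field_simp
        _ ≤ C * κ ^ 2 / L ^ 2 * (192 * (w ^ 2 / τ) + 3072 * (w ^ 2 / τ)) := by
            gcongr
            rw [le_div_iff₀ hτ]
            nlinarith
        _ ≤ C * κ ^ 2 / L ^ 2 * (6400 * (w ^ 2 / τ)) := by
            gcongr
            have : 0 < w ^ 2 / τ := by positivity
            linarith
        _ = _ := by ring
    have e2 : (L ^ 3)⁻¹ * (sRad a ρ₀ (max ‖momentum L (0 - Pi.single j 1)‖ τ)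
        - sRad a ρ₀ (max ‖momentum L 0‖ τ)) ^ 2 ≤ 48 * κ ^ 2 * (w ^ 2 / τ) / L ^ 2 := by
      have hds := (sq_sRad_sub_le h.ha h.hρ h.hs h.hw0 h.hw hτ
        (le_max_right ‖momentum L (0 - Pi.single j 1)‖ τ) (le_max_right ‖momentum L 0‖ τ)).2
      have hτL1 : 1 ≤ τ * L := by linarith [Real.pi_gt_three]
      calc (L ^ 3)⁻¹ * (sRad a ρ₀ (max ‖momentum L (0 - Pi.single j 1)‖ τ)
            - sRad a ρ₀ (max ‖momentum L 0‖ τ)) ^ 2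
          ≤ (L ^ 3)⁻¹ * (48 * (w / τ ^ 3) * (κ / L) ^ 2) := by
            gcongr
            exact hds.trans (mul_le_mul_of_nonneg_left (hmax j 0) (by positivity))
        _ = 48 * κ ^ 2 * w * 1 ^ 3 / (τ ^ 3 * L ^ 5) := by field_simp
        _ ≤ 48 * κ ^ 2 * w * (τ * L) ^ 3 / (τ ^ 3 * L ^ 5) := by gcongr
        _ = 48 * κ ^ 2 * w / L ^ 2 := by field_simp
        _ ≤ 48 * κ ^ 2 * (w ^ 2 / τ) / L ^ 2 := by
            gcongr
            rw [le_div_iff₀ hτ]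
            nlinarith
    calc _ ≤ C * (6400 * κ ^ 2) * (w ^ 2 / τ) / L ^ 2 + 48 * κ ^ 2 * (w ^ 2 / τ) / L ^ 2 :=
          add_le_add e1 e2
      _ = _ := by ring
  refine (integral_tail_fser_le hL hsum hr hb).trans (le_of_eq ?_)
  field_simp

/-- The decay of `s`. -/
lemma exists_tail_sFun_le : ∃ C : ℝ, 0 < C ∧ ∀ a ρ₀ w L r : ℝ, Params a ρ₀ w L → 0 < r →
    1 ≤ w * r → 2 * Real.pi ≤ √(w / r) * L →
    ∫ x in box L ∩ {x | r ≤ ‖x‖}, sFun a ρ₀ L x ^ 2 ≤ C * (w ^ 2 / r) := by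
  obtain ⟨C₁, hC₁, h₁⟩ := exists_low_le
  obtain ⟨C₂, hC₂, h₂⟩ := exists_high_le
  refine ⟨2 * C₁ + 2 * C₂, by positivity, fun a ρ₀ w L r h hr hwr hL' => ?_⟩
  have hL := h.hL
  have hw0 := h.hw0
  -- With this choice the low part wτ² equals w²/r. From wr ≥ 1 one gets τr ≥ 1, so that the high
  -- part w²/(τr²) is no larger.
  set τ := √(w / r) with hτ
  have hτ0 : 0 < τ := Real.sqrt_pos.2 (by positivity)
  have hτ2 : τ ^ 2 = w / r := Real.sq_sqrt (by positivity)
  have hτw : τ ≤ w := by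
    rw [hτ, Real.sqrt_le_left hw0.le, div_le_iff₀ hr]
    nlinarith
  have hτr : 1 ≤ τ * r := by
    have : 1 ≤ (τ * r) ^ 2 := by
      rw [mul_pow, hτ2]
      calc 1 ≤ w * r := hwr
        _ = w / r * r ^ 2 := by field_simp
    nlinarith [mul_pos hτ0 hr]
  obtain ⟨hl1, hl2⟩ := h₁ a ρ₀ w L τ h hτ0 (by linarith [Real.pi_gt_three])
  obtain ⟨hh1, hh2⟩ := h₂ a ρ₀ w L τ r h hτ0 hτw hL' hr
  have hsub : box L ∩ {x | r ≤ ‖x‖} ⊆ box L := Set.inter_subset_left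
  set S := box L ∩ {x | r ≤ ‖x‖}
  set l : (Fin 3 → ℤ) → ℂ := fun n => sCoeff a ρ₀ L n - sHigh a ρ₀ L τ n
  have il : IntegrableOn (fun x => ‖fser L l x‖ ^ 2) (box L) :=
    (memLp_fser hL l).norm.integrable_sq
  have ih : IntegrableOn (fun x => ‖fser L (sHigh a ρ₀ L τ) x‖ ^ 2) (box L) :=
    (memLp_fser hL (sHigh a ρ₀ L τ)).norm.integrable_sq
  have hpt : ∀ᵐ x ∂volume.restrict S, sFun a ρ₀ L x ^ 2
      ≤ 2 * ‖fser L l x‖ ^ 2 + 2 * ‖fser L (sHigh a ρ₀ L τ) x‖ ^ 2 := by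
    filter_upwards [ae_restrict_of_ae_restrict_of_subset hsub h.sFun_ae_eq,
      ae_restrict_of_ae_restrict_of_subset hsub (fser_sub_ae_eq hL h.summable_sCoeff hh1)]
      with x h1 h2
    have h3 : (sFun a ρ₀ L x : ℂ) = fser L l x + fser L (sHigh a ρ₀ L τ) x := by
      rw [h1, ← h2]; ring
    have h4 : |sFun a ρ₀ L x| ≤ ‖fser L l x‖ + ‖fser L (sHigh a ρ₀ L τ) x‖ := by
      rw [← Real.norm_eq_abs, ← Complex.norm_real, h3]; exact norm_add_le _ _
    rw [← sq_abs]
    calc |sFun a ρ₀ L x| ^ 2 ≤ (‖fser L l x‖ + ‖fser L (sHigh a ρ₀ L τ) x‖) ^ 2 := by gcongr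
      _ ≤ _ := by nlinarith [sq_nonneg (‖fser L l x‖ - ‖fser L (sHigh a ρ₀ L τ) x‖)]
  have ilS := (il.mono_set hsub).const_mul 2
  have ihS := (ih.mono_set hsub).const_mul 2
  calc ∫ x in S, sFun a ρ₀ L x ^ 2
      ≤ ∫ x in S, (2 * ‖fser L l x‖ ^ 2 + 2 * ‖fser L (sHigh a ρ₀ L τ) x‖ ^ 2) :=
        integral_mono_of_nonneg (Eventually.of_forall fun x => sq_nonneg _) (ilS.add ihS) hpt
    _ = 2 * (∫ x in S, ‖fser L l x‖ ^ 2) + 2 * ∫ x in S, ‖fser L (sHigh a ρ₀ L τ) x‖ ^ 2 := by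
        rw [integral_add ilS ihS, integral_const_mul, integral_const_mul]
    _ ≤ 2 * (C₁ * (w * τ ^ 2)) + 2 * (C₂ * (w ^ 2 / (τ * r ^ 2))) := by
        gcongr
        refine (setIntegral_mono_set il (Eventually.of_forall fun x => by positivity)
          hsub.eventuallyLE).trans ?_
        rw [integral_norm_sq_fser hL hl1]
        exact hl2
    _ ≤ 2 * (C₁ * (w ^ 2 / r)) + 2 * (C₂ * (w ^ 2 / r)) := by
        rw [hτ2]
        gcongr
        · exact le_of_eq (by ring)
        · nlinarith
    _ = _ := by ring

end TailS

section Mean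

variable {a ρ₀ w L : ℝ}

lemma integral_pd_mul_expo {η : E3 → ℝ} (hη : ContDiff ℝ 1 η) (hc : HasCompactSupport η) (L : ℝ)
    (n : Fin 3 → ℤ) (j : Fin 3) :
    ∫ x, (pd j η x : ℂ) * expo L n x
      = -(Complex.I * (momentum L n j : ℝ) * ∫ x, (η x : ℂ) * expo L n x) := by
  set v : E3 := EuclideanSpace.single j (1 : ℝ)
  have hd : Differentiable ℝ η := hη.differentiable (by norm_num)
  have hfd : ∀ x, fderiv ℝ (fun x => (η x : ℂ)) x v = (pd j η x : ℂ) := fun x => by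
    have : HasFDerivAt (fun x => (η x : ℂ)) _ x :=
      Complex.ofRealCLM.hasFDerivAt.comp x (hd x).hasFDerivAt
    rw [this.fderiv]; rfl
  have hpj : inner ℝ (momentum L n) v = momentum L n j := by
    simp only [v]; rw [EuclideanSpace.inner_single_right]; simp
  have hge : ∀ x, fderiv ℝ (expo L n) x v = Complex.I * (momentum L n j : ℝ) * expo L n x := fun x => by
    rw [fderiv_expo, hpj]
  have hηi : Integrable fun x => (η x : ℂ) * expo L n x :=
    (contDiff_mul_expo hη L n).continuous.integrable_of_hasCompactSupport
      (hasCompactSupport_mul_expo hc L n)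
  have hpi : Integrable fun x => (pd j η x : ℂ) * expo L n x :=
    ((Complex.continuous_ofReal.comp (continuous_fderiv_apply_of_contDiff hη v)).mul
      (continuous_expo L n)).integrable_of_hasCompactSupport
      (hasCompactSupport_mul_expo (hasCompactSupport_pd hc j) L n)
  have h := integral_mul_fderiv_eq_neg_fderiv_mul_of_integrable (μ := volume) (v := v)
    (f := fun x => (η x : ℂ)) (g := expo L n) (by simpa only [hfd] using hpi)
    (by
      simp only [hge]
      refine (hηi.const_mul (Complex.I * (momentum L n j : ℝ))).congr
        (Eventually.of_forall fun x => ?_)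
      simp only; ring) hηi
    (fun x _ => Complex.ofRealCLM.differentiableAt.comp x (hd x))
    (fun x _ => (contDiff_expo L n).differentiable (by simp) x)
  simp only [hfd, hge] at h
  rw [← neg_eq_iff_eq_neg.2 h, ← integral_const_mul]
  congr 1
  refine integral_congr_ae (Eventually.of_forall fun x => ?_)
  simp only; ring

lemma hasSum_norm_sq_integral_mul_expo' (hL : 0 < L) {k : E3 → ℂ}
    (hk : MemLp k 2 (volume.restrict (box L))) :
    HasSum (fun n => ‖∫ x in box L, k x * expo L n x‖ ^ 2) (L ^ 3 * ∫ x in box L, ‖k x‖ ^ 2) := by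
  have h := hasSum_norm_sq_integral_mul_expo hL hk
  rw [← (Equiv.neg (Fin 3 → ℤ)).hasSum_iff] at h
  simpa [Function.comp_def] using h

lemma integral_box_sq_le {f : E3 → ℝ} {M R : ℝ} (hM : ∀ x, |f x| ≤ M) (hR : 0 ≤ R)
    (hf : ∀ x, R < ‖x‖ → f x = 0) (L : ℝ) : ∫ x in box L, f x ^ 2 ≤ M ^ 2 * (5 * R ^ 3) := by
  have hM0 : 0 ≤ M := (abs_nonneg _).trans (hM 0)
  have hBm : MeasurableSet (Metric.closedBall (0 : E3) R) := Metric.isClosed_closedBall.measurableSet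
  calc ∫ x in box L, f x ^ 2
      ≤ ∫ x in box L, (Metric.closedBall (0 : E3) R).indicator (fun _ => M ^ 2) x := by
        refine integral_mono_of_nonneg (Eventually.of_forall fun x => sq_nonneg _)
          ((integrable_const _).indicator hBm) (Eventually.of_forall fun x => ?_)
        by_cases hx : ‖x‖ ≤ R
        · simp only [Set.indicator_of_mem (mem_closedBall_zero_iff.2 hx)]
          rw [← sq_abs]; gcongr; exact hM x
        · simp [hf x (not_le.1 hx), hx]
    _ = (volume.restrict (box L)).real (Metric.closedBall (0 : E3) R) * M ^ 2 := by
        rw [integral_indicator hBm, setIntegral_const, smul_eq_mul]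
    _ ≤ 5 * R ^ 3 * M ^ 2 := by
        gcongr
        rw [measureReal_restrict_apply hBm]
        exact (measureReal_mono Set.inter_subset_left
          (Metric.isBounded_closedBall.measure_lt_top).ne).trans (volume_real_closedBall_le hR)
    _ = _ := mul_comm _ _

/-- The averages of `s` at scale `r`. -/
lemma exists_integral_cutoff_mul_sFun_le {k : E3 → ℝ} (hk : ContDiff ℝ ∞ k) {R : ℝ} (hR : 0 < R)
    (hkR : ∀ x, R < ‖x‖ → k x = 0) : ∃ C : ℝ, 0 < C ∧ ∀ a ρ₀ w L r : ℝ, Params a ρ₀ w L → 0 < r →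
      R * r ≤ L / 2 → |∫ x in box L, cutoff k r x * sFun a ρ₀ L x| ≤ C * (w * r) := by
  obtain ⟨M, hM, hM0, hM1, -⟩ := exists_derivative_bound hk (hasCompactSupport_of_eq_zero hkR)
  obtain ⟨C, hC, hS⟩ := exists_lattice_sum_le (α := 2) (β := 5) (by norm_num) (by norm_num)
  refine ⟨20 * M ^ 2 * R ^ 3 + 2 * C, by positivity, fun a ρ₀ w L r h hr hRL => ?_⟩
  have hL := h.hL
  have hw0 := h.hw0
  set K := cutoff k r with hK
  have hKs : ContDiff ℝ ∞ K := contDiff_cutoff hk r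
  have hK0 : ∀ x, R * r < ‖x‖ → K x = 0 := fun x hx => cutoff_eq_zero hr hkR hx
  have hKc : HasCompactSupport K := hasCompactSupport_of_eq_zero hK0
  have hKb : ∀ x, |K x| ≤ M := fun x => hM0 _
  have hKp : ∀ j x, |pd j K x| ≤ M / r := fun j x => by
    rw [hK, pd_cutoff hk, abs_mul, abs_of_pos (inv_pos.2 hr), div_eq_inv_mul]
    gcongr
    exact hM1 j _
  have hKp0 : ∀ j x, R * r < ‖x‖ → pd j K x = 0 := fun j x hx => pd_eq_zero_of_gt hK0 j hx
  have hKm : MemLp (fun x => (K x : ℂ)) 2 (volume.restrict (box L)) :=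
    memLp_of_bounded (K := M) (Complex.continuous_ofReal.comp hKs.continuous).aestronglyMeasurable
      (fun x => by simpa using hKb x) L
  have hKpm : ∀ j, MemLp (fun x => (pd j K x : ℂ)) 2 (volume.restrict (box L)) := fun j =>
    memLp_of_bounded (K := M / r) (Complex.continuous_ofReal.comp
      (contDiff_pd hKs j).continuous).aestronglyMeasurable (fun x => by simpa using hKp j x) L
  set F : (Fin 3 → ℤ) → ℂ := fun n => ∫ x in box L, (K x : ℂ) * expo L n x with hF
  have hpF : ∀ j n, ∫ x in box L, (pd j K x : ℂ) * expo L n x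
      = -(Complex.I * (momentum L n j : ℝ) * F n) := by
    intro j n
    have e1 : F n = ∫ x, (K x : ℂ) * expo L n x := setIntegral_box_eq_integral fun x hx => by
      rw [hK0 x (by linarith)]; simp
    rw [setIntegral_box_eq_integral (fun x hx => by rw [hKp0 j x (by linarith)]; simp),
      integral_pd_mul_expo (smooth_one hKs) hKc, e1]
  have hP0 := hasSum_norm_sq_integral_mul_expo' hL hKm
  have hPj : ∀ j, HasSum (fun n => momentum L n j ^ 2 * ‖F n‖ ^ 2)
      (L ^ 3 * ∫ x in box L, ‖(pd j K x : ℂ)‖ ^ 2) := fun j => by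
    have := hasSum_norm_sq_integral_mul_expo' hL (hKpm j)
    simp only [hpF, norm_neg, norm_mul, Complex.norm_I, one_mul, Complex.norm_real, mul_pow,
      Real.norm_eq_abs] at this
    simpa only [sq_abs, Complex.norm_real, Real.norm_eq_abs] using this
  -- The square of the H¹ norm of the rescaled cutoff, adapted to the scale r. It is of order r: a
  -- volume r³ times r⁻².
  have hPsum : HasSum (fun n => ((r ^ 2)⁻¹ + ‖momentum L n‖ ^ 2) * ‖F n‖ ^ 2)
      ((r ^ 2)⁻¹ * (L ^ 3 * ∫ x in box L, ‖(K x : ℂ)‖ ^ 2)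
        + ∑ j, L ^ 3 * ∫ x in box L, ‖(pd j K x : ℂ)‖ ^ 2) := by
    refine ((hP0.mul_left ((r ^ 2)⁻¹)).add (hasSum_sum fun j _ => hPj j)).congr_fun ?_
    intro n
    rw [EuclideanSpace.norm_sq_eq, add_mul, Finset.sum_mul]
    simp only [Real.norm_eq_abs, sq_abs]
    rfl
  have hPb : (L ^ 3)⁻¹ * ∑' n, ((r ^ 2)⁻¹ + ‖momentum L n‖ ^ 2) * ‖F n‖ ^ 2
      ≤ 20 * M ^ 2 * R ^ 3 * r := by
    rw [hPsum.tsum_eq]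
    simp only [Complex.norm_real, Real.norm_eq_abs, sq_abs, Fin.sum_univ_three]
    have hRr : 0 ≤ R * r := by positivity
    have b0 := integral_box_sq_le hKb hRr hK0 L
    have b1 := fun j => integral_box_sq_le (hKp j) hRr (hKp0 j) L
    calc _ = (r ^ 2)⁻¹ * (∫ x in box L, K x ^ 2) + (∫ x in box L, pd 0 K x ^ 2)
          + (∫ x in box L, pd 1 K x ^ 2) + ∫ x in box L, pd 2 K x ^ 2 := by
            field_simp; ring
      _ ≤ (r ^ 2)⁻¹ * (M ^ 2 * (5 * (R * r) ^ 3)) + (M / r) ^ 2 * (5 * (R * r) ^ 3)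
          + (M / r) ^ 2 * (5 * (R * r) ^ 3) + (M / r) ^ 2 * (5 * (R * r) ^ 3) := by
            gcongr
            · exact b1 0
            · exact b1 1
            · exact b1 2
      _ = _ := by field_simp; norm_num
  obtain ⟨hs1, hs2⟩ := hS L (fun n => sHat a ρ₀ L n ^ 2 / ((r ^ 2)⁻¹ + ‖momentum L n‖ ^ 2))
    (w * r) (w ^ 4 * r) w hL (by positivity) (by positivity) hw0 (fun n => by positivity) (by simp)
    (fun n hn => by
      have hp := norm_momentum_pos hL hn
      have h1 := h.sHat_sq_le_one hn
      have h2 : ‖momentum L n‖ / r ≤ (r ^ 2)⁻¹ + ‖momentum L n‖ ^ 2 := by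
        have e : ‖momentum L n‖ / r = ‖momentum L n‖ * r⁻¹ := div_eq_mul_inv _ _
        rw [e, ← inv_pow]
        nlinarith [sq_nonneg (‖momentum L n‖ - r⁻¹), mul_pos hp (inv_pos.2 hr)]
      calc sHat a ρ₀ L n ^ 2 / ((r ^ 2)⁻¹ + ‖momentum L n‖ ^ 2)
          ≤ (w / ‖momentum L n‖ ^ 1) / (‖momentum L n‖ / r) := by gcongr
        _ = _ := by field_simp)
    (fun n hn => by
      have hp := norm_momentum_pos hL hn
      have h1 := h.sHat_sq_le_four hn
      have h2 : ‖momentum L n‖ / r ≤ (r ^ 2)⁻¹ + ‖momentum L n‖ ^ 2 := by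
        have e : ‖momentum L n‖ / r = ‖momentum L n‖ * r⁻¹ := div_eq_mul_inv _ _
        rw [e, ← inv_pow]
        nlinarith [sq_nonneg (‖momentum L n‖ - r⁻¹), mul_pos hp (inv_pos.2 hr)]
      calc sHat a ρ₀ L n ^ 2 / ((r ^ 2)⁻¹ + ‖momentum L n‖ ^ 2)
          ≤ (w ^ 4 / ‖momentum L n‖ ^ 4) / (‖momentum L n‖ / r) := by gcongr
        _ = _ := by field_simp)
  have hpair := hasSum_integral_mul_fser hL h.summable_sCoeff hKm
  have hIe : ∫ x in box L, (K x : ℂ) * fser L (sCoeff a ρ₀ L) x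
      = ((∫ x in box L, K x * sFun a ρ₀ L x : ℝ) : ℂ) := by
    rw [← integral_complex_ofReal]
    refine integral_congr_ae ?_
    filter_upwards [h.sFun_ae_eq] with x hx
    rw [← hx]; push_cast; ring
  rw [hIe] at hpair
  -- A weighted arithmetic-geometric mean. The two sums are of order r and w²r, so the weights w and
  -- w⁻¹ make both contributions wr.
  set g : (Fin 3 → ℤ) → ℝ := fun n => w * (((r ^ 2)⁻¹ + ‖momentum L n‖ ^ 2) * ‖F n‖ ^ 2)
    + w⁻¹ * (sHat a ρ₀ L n ^ 2 / ((r ^ 2)⁻¹ + ‖momentum L n‖ ^ 2)) with hg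
  have hgs : Summable g := (hPsum.summable.mul_left w).add (hs1.mul_left w⁻¹)
  have hle : ∀ n, ‖(((L ^ 3)⁻¹ : ℝ) : ℂ) * (sCoeff a ρ₀ L n * F n)‖ ≤ (L ^ 3)⁻¹ * g n := by
    intro n
    rw [norm_mul, Complex.norm_real, Real.norm_of_nonneg (by positivity), norm_mul, sCoeff,
      Complex.norm_real, Real.norm_eq_abs]
    refine mul_le_mul_of_nonneg_left ?_ (by positivity)
    set W := (r ^ 2)⁻¹ + ‖momentum L n‖ ^ 2
    have hW : 0 < W := by positivity
    have hwW : 0 < w * W := by positivity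
    have e : g n = w * W * ‖F n‖ ^ 2 + sHat a ρ₀ L n ^ 2 / (w * W) := by
      simp only [hg, W]; field_simp
    rw [e, ← sq_abs (sHat a ρ₀ L n)]
    have h3 : |sHat a ρ₀ L n| ^ 2 / (w * W) = w * W * (|sHat a ρ₀ L n| / (w * W)) ^ 2 := by
      field_simp
    have h4 : |sHat a ρ₀ L n| * ‖F n‖ = w * W * (‖F n‖ * (|sHat a ρ₀ L n| / (w * W))) := by
      field_simp
    rw [h3, h4, ← mul_add]
    refine mul_le_mul_of_nonneg_left ?_ hwW.le
    have h5 : 0 ≤ ‖F n‖ * (|sHat a ρ₀ L n| / (w * W)) := by positivity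
    nlinarith [sq_nonneg (‖F n‖ - |sHat a ρ₀ L n| / (w * W))]
  have hfin := hpair.norm_le_of_bounded (hgs.mul_left ((L ^ 3)⁻¹)).hasSum hle
  rw [Complex.norm_real, Real.norm_eq_abs] at hfin
  refine hfin.trans ?_
  have hgt : ∑' n, (L ^ 3)⁻¹ * g n
      = w * ((L ^ 3)⁻¹ * ∑' n, ((r ^ 2)⁻¹ + ‖momentum L n‖ ^ 2) * ‖F n‖ ^ 2)
        + w⁻¹ * ((L ^ 3)⁻¹ * ∑' n, sHat a ρ₀ L n ^ 2 / ((r ^ 2)⁻¹ + ‖momentum L n‖ ^ 2)) := by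
    rw [tsum_mul_left, hg, (hPsum.summable.mul_left w).tsum_add (hs1.mul_left w⁻¹), tsum_mul_left,
      tsum_mul_left]
    ring
  rw [hgt]
  calc _ ≤ w * (20 * M ^ 2 * R ^ 3 * r)
        + w⁻¹ * (C * ((w * r / w ^ 2 + w ^ 4 * r / w ^ 5) * w ^ 3)) := by gcongr
    _ = _ := by field_simp; norm_num

end Mean

end HardSphere

end

/-! ### The weak gradient of the trial function and the flux pairing -/

noncomputable section

namespace HardSphere

open Filter Topology

section WeakGradient

variable {a ρ₀ w L : ℝ}

lemma memLp_bdd_mul {g f : E3 → ℝ} (hg : AEStronglyMeasurable g volume) {K : ℝ}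
    (hK : ∀ x, |g x| ≤ K) (hf : MemLp f 2 (volume.restrict (box L))) :
    MemLp (fun x => g x * f x) 2 (volume.restrict (box L)) :=
  hf.of_le_mul (c := K) (hg.restrict.mul hf.aestronglyMeasurable) (Eventually.of_forall fun x => by
    rw [norm_mul]
    exact mul_le_mul_of_nonneg_right (hK x) (norm_nonneg _))

lemma memLp_cont_mul {g f : E3 → ℝ} (hg : Continuous g) (hc : HasCompactSupport g)
    (hf : MemLp f 2 (volume.restrict (box L))) :
    MemLp (fun x => g x * f x) 2 (volume.restrict (box L)) := by
  obtain ⟨K, -, hK⟩ := exists_abs_le hg hc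
  exact memLp_bdd_mul hg.aestronglyMeasurable hK hf

lemma integrableOn_box_of_memLp {f : E3 → ℝ} (hf : MemLp f 2 (volume.restrict (box L))) :
    Integrable f (volume.restrict (box L)) := hf.integrable (by norm_num)

lemma memLp_one_box (L : ℝ) : MemLp (fun _ : E3 => (1 : ℝ)) 2 (volume.restrict (box L)) :=
  memLp_const 1

lemma pd_mul {η ψ : E3 → ℝ} (hη : ContDiff ℝ ∞ η) (hψ : ContDiff ℝ ∞ ψ) (j : Fin 3) (x : E3) :
    pd j (fun x => η x * ψ x) x = pd j η x * ψ x + η x * pd j ψ x := by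
  have h := (hη.differentiable (by simp) x).hasFDerivAt.mul (hψ.differentiable (by simp) x).hasFDerivAt
  have h' : HasFDerivAt (fun x => η x * ψ x) _ x := h
  rw [pd, h'.fderiv]
  simp [pd]; ring

/-- Integration by parts for `s` against test functions supported in the box. -/
lemma Params.integral_pd_mul_sFun (h : Params a ρ₀ w L) {ζ : E3 → ℝ} (hζ : ContDiff ℝ ∞ ζ)
    (hs : ∀ x, L / 2 < ‖x‖ → ζ x = 0) (j : Fin 3) :
    ∫ x in box L, pd j ζ x * sFun a ρ₀ L x = -∫ x in box L, ζ x * dFun a ρ₀ L x j := by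
  have hc := hasCompactSupport_of_eq_zero hs
  have hm0 : MemLp (fun x => (ζ x : ℂ)) 2 (volume.restrict (box L)) := by
    have := memLp_cont_mul hζ.continuous hc (memLp_one_box L)
    simpa using this.ofReal (K := ℂ)
  have hm1 : MemLp (fun x => (pd j ζ x : ℂ)) 2 (volume.restrict (box L)) := by
    have := memLp_cont_mul (contDiff_pd hζ j).continuous (hasCompactSupport_pd hc j) (memLp_one_box L)
    simpa using this.ofReal (K := ℂ)
  have p1 := hasSum_integral_mul_fser h.hL h.summable_sCoeff hm1
  have p2 := hasSum_integral_mul_fser h.hL (h.summable_dCoeff j) hm0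
  -- Integration by parts is done one mode at a time, where it is classical; the two pairings are
  -- then compared as sums over modes.
  have e : ∀ n, ∫ x in box L, (pd j ζ x : ℂ) * expo L n x
      = -(Complex.I * (momentum L n j : ℝ) * ∫ x in box L, (ζ x : ℂ) * expo L n x) := by
    intro n
    rw [setIntegral_box_eq_integral (fun x hx => by rw [pd_eq_zero_of_gt hs j hx]; simp),
      setIntegral_box_eq_integral (fun x hx => by rw [hs x hx]; simp),
      integral_pd_mul_expo (smooth_one hζ) hc]
  simp only [e] at p1
  have p3 : ∫ x in box L, (pd j ζ x : ℂ) * fser L (sCoeff a ρ₀ L) x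
      = -∫ x in box L, (ζ x : ℂ) * fser L (dCoeff a ρ₀ L j) x := by
    refine p1.unique (p2.neg.congr_fun fun n => ?_)
    simp only [sCoeff, dCoeff]; ring
  have q1 : ∫ x in box L, (pd j ζ x : ℂ) * fser L (sCoeff a ρ₀ L) x
      = ((∫ x in box L, pd j ζ x * sFun a ρ₀ L x : ℝ) : ℂ) := by
    rw [← integral_complex_ofReal]
    refine integral_congr_ae ?_
    filter_upwards [h.sFun_ae_eq] with x hx
    rw [← hx]; push_cast; ring
  have q2 : ∫ x in box L, (ζ x : ℂ) * fser L (dCoeff a ρ₀ L j) x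
      = ((∫ x in box L, ζ x * dFun a ρ₀ L x j : ℝ) : ℂ) := by
    rw [← integral_complex_ofReal]
    refine integral_congr_ae ?_
    filter_upwards [h.dFun_ae_eq j] with x hx
    rw [← hx]; push_cast; ring
  rw [q1, q2] at p3
  exact_mod_cast p3

/-- The gradient of `η s - ρ₀ η₁ om`. -/
def gradCut (a ρ₀ L : ℝ) (η η₁ : E3 → ℝ) (x : E3) : E3 :=
  WithLp.toLp 2 fun j => η x * dFun a ρ₀ L x j + pd j η x * sFun a ρ₀ L x - ρ₀ * dOm a η₁ j x

lemma measurable_gradOm_apply (a : ℝ) (j : Fin 3) : Measurable fun x => gradOm a x j :=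
  (EuclideanSpace.proj j : E3 →L[ℝ] ℝ).continuous.measurable.comp (measurable_gradOm a)

lemma abs_gradOm_apply_le (ha : 0 < a) (j : Fin 3) (x : E3) : |gradOm a x j| ≤ 1 / a :=
  (PiLp.norm_apply_le (gradOm a x) j).trans (norm_gradOm_le ha x)

lemma abs_om_le (ha : 0 < a) (x : E3) : |om a x| ≤ 1 := by
  rw [abs_of_nonneg (om_nonneg ha x)]; exact om_le_one ha x

variable {η η₁ : E3 → ℝ}

lemma Params.memLp_gradCut_apply (h : Params a ρ₀ w L) (hη : ContDiff ℝ ∞ η)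
    (hη₁ : ContDiff ℝ ∞ η₁) (hc : HasCompactSupport η) (hc₁ : HasCompactSupport η₁) (j : Fin 3) :
    MemLp (fun x => gradCut a ρ₀ L η η₁ x j) 2 (volume.restrict (box L)) := by
  have h1 := memLp_cont_mul hη.continuous hc (h.memLp_dFun_apply j)
  have h2 := memLp_cont_mul (contDiff_pd hη j).continuous (hasCompactSupport_pd hc j) h.memLp_sFun
  have h3 : MemLp (fun x => dOm a η₁ j x) 2 (volume.restrict (box L)) :=
    (memLp_dOm h.ha hη₁ hc₁ j L).re
  exact (h1.add h2).sub (h3.const_mul ρ₀)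

lemma Params.memLp_cut (h : Params a ρ₀ w L) (hη : ContDiff ℝ ∞ η)
    (hη₁ : ContDiff ℝ ∞ η₁) (hc : HasCompactSupport η) (hc₁ : HasCompactSupport η₁) :
    MemLp (fun x => η x * sFun a ρ₀ L x - ρ₀ * (η₁ x * om a x)) 2 (volume.restrict (box L)) := by
  have h1 := memLp_cont_mul hη.continuous hc h.memLp_sFun
  have h2 : MemLp (om a) 2 (volume.restrict (box L)) :=
    memLp_of_bounded (continuous_om h.ha).aestronglyMeasurable (abs_om_le h.ha) L
  exact h1.sub ((memLp_cont_mul hη₁.continuous hc₁ h2).const_mul ρ₀)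

lemma exists_bound_on_box {F : Type*} [NormedAddCommGroup F] {f : E3 → F} (hf : Continuous f) (L : ℝ) :
    MemLp f ⊤ (volume.restrict (box L)) := by
  obtain ⟨K, hK⟩ := (isCompact_closedBall (0 : E3) (2 * |L|)).exists_bound_of_continuousOn
    hf.continuousOn
  refine MemLp.of_bound hf.aestronglyMeasurable K ?_
  filter_upwards [ae_restrict_mem (measurableSet_box L)] with x hx
  exact hK x (box_subset_closedBall L hx)

/-- The cutoffs are moved onto the test function, which is thereby localised inside the box.
Integration by parts then takes place separately against s, through its Fourier series, and against
`om`, as a Lipschitz function. -/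
lemma Params.isWeakGradient_gradCut (h : Params a ρ₀ w L) (hη : ContDiff ℝ ∞ η)
    (hη₁ : ContDiff ℝ ∞ η₁) (hs : ∀ x, L / 2 < ‖x‖ → η x = 0) (hs₁ : ∀ x, L / 2 < ‖x‖ → η₁ x = 0) :
    IsWeakGradient L (fun x => η x * sFun a ρ₀ L x - ρ₀ * (η₁ x * om a x))
      (gradCut a ρ₀ L η η₁) := by
  have ha := h.ha
  have hc := hasCompactSupport_of_eq_zero hs
  have hc₁ := hasCompactSupport_of_eq_zero hs₁
  have hG := memLp_of_memLp_apply (h.memLp_gradCut_apply hη hη₁ hc hc₁)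
  have hu := h.memLp_cut hη hη₁ hc hc₁
  refine ⟨hu, hG, fun ψ hψ _ => ?_⟩
  have hgrad : Continuous (gradient ψ) :=
    ((InnerProductSpace.toDual ℝ E3).symm.continuous).comp (hψ.continuous_fderiv (by simp))
  have hi1 : Integrable (fun x => (η x * sFun a ρ₀ L x - ρ₀ * (η₁ x * om a x)) • gradient ψ x)
      (volume.restrict (box L)) :=
    ((exists_bound_on_box hgrad L).smul (r := 2) hu).integrable (by norm_num)
  have hi2 : Integrable (fun x => ψ x • gradCut a ρ₀ L η η₁ x) (volume.restrict (box L)) :=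
    (hG.smul (r := 2) (exists_bound_on_box hψ.continuous L)).integrable (by norm_num)
  ext j
  have c1 := (EuclideanSpace.proj j : E3 →L[ℝ] ℝ).integral_comp_comm hi1
  have c2 := (EuclideanSpace.proj j : E3 →L[ℝ] ℝ).integral_comp_comm hi2
  simp only [PiLp.proj_apply] at c1 c2
  rw [PiLp.neg_apply, ← c1, ← c2]
  simp only [PiLp.smul_apply, gradient_apply, smul_eq_mul, gradCut]
  -- the two products with the test function
  have hζ : ContDiff ℝ ∞ fun x => η x * ψ x := hη.mul hψ
  have hζs : ∀ x, L / 2 < ‖x‖ → η x * ψ x = 0 := fun x hx => by rw [hs x hx, zero_mul]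
  have hζ₁ : ContDiff ℝ ∞ fun x => η₁ x * ψ x := hη₁.mul hψ
  have hζ₁s : ∀ x, L / 2 < ‖x‖ → η₁ x * ψ x = 0 := fun x hx => by rw [hs₁ x hx, zero_mul]
  have hζc := hasCompactSupport_of_eq_zero hζs
  have hζ₁c := hasCompactSupport_of_eq_zero hζ₁s
  have k1 := h.integral_pd_mul_sFun hζ hζs j
  have k2 := integral_om_mul_fderiv_real ha (smooth_one hζ₁) hζ₁c (EuclideanSpace.single j (1 : ℝ))
  have hgj : ∀ x, inner ℝ (gradOm a x) (EuclideanSpace.single j (1 : ℝ)) = gradOm a x j :=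
    fun x => by rw [EuclideanSpace.inner_single_right]; simp
  simp only [hgj] at k2
  have k2' : ∫ x in box L, gradOm a x j * (η₁ x * ψ x)
      = -∫ x in box L, om a x * pd j (fun x => η₁ x * ψ x) x := by
    rw [setIntegral_box_eq_integral (fun x hx => by rw [hζ₁s x hx, mul_zero]),
      setIntegral_box_eq_integral (fun x hx => by rw [pd_eq_zero_of_gt hζ₁s j hx, mul_zero])]
    exact k2
  have hpη : HasCompactSupport fun x => pd j η x * ψ x := (hasCompactSupport_pd hc j).mul_right
  have hpη₁ : HasCompactSupport fun x => pd j η₁ x * ψ x := (hasCompactSupport_pd hc₁ j).mul_right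
  have hom : MemLp (om a) 2 (volume.restrict (box L)) :=
    memLp_of_bounded (continuous_om ha).aestronglyMeasurable (abs_om_le ha) L
  have hgo : MemLp (fun x => gradOm a x j) 2 (volume.restrict (box L)) :=
    memLp_of_bounded (measurable_gradOm_apply a j).aestronglyMeasurable (abs_gradOm_apply_le ha j) L
  have i1 := integrableOn_box_of_memLp (memLp_cont_mul (contDiff_pd hζ j).continuous
    (hasCompactSupport_pd hζc j) h.memLp_sFun)
  have i2 := integrableOn_box_of_memLp (memLp_cont_mul ((contDiff_pd hη j).continuous.mul
    hψ.continuous) hpη h.memLp_sFun)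
  have i3 := integrableOn_box_of_memLp (memLp_cont_mul (contDiff_pd hζ₁ j).continuous
    (hasCompactSupport_pd hζ₁c j) hom)
  have i4 := integrableOn_box_of_memLp (memLp_cont_mul ((contDiff_pd hη₁ j).continuous.mul
    hψ.continuous) hpη₁ hom)
  have i5 := integrableOn_box_of_memLp (memLp_cont_mul hζ.continuous hζc (h.memLp_dFun_apply j))
  have i6 := integrableOn_box_of_memLp (memLp_cont_mul hζ₁.continuous hζ₁c hgo)
  simp only [Pi.mul_apply] at i2 i4
  have l1 : ∫ x in box L, (η x * sFun a ρ₀ L x - ρ₀ * (η₁ x * om a x)) * pd j ψ x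
      = ((∫ x in box L, pd j (fun x => η x * ψ x) x * sFun a ρ₀ L x)
        - ∫ x in box L, pd j η x * ψ x * sFun a ρ₀ L x)
        - ρ₀ * ((∫ x in box L, pd j (fun x => η₁ x * ψ x) x * om a x)
        - ∫ x in box L, pd j η₁ x * ψ x * om a x) := by
    rw [← integral_sub i1 i2, ← integral_sub i3 i4, ← integral_const_mul,
      ← integral_sub (i1.sub' i2) ((i3.sub' i4).const_mul ρ₀)]
    refine integral_congr_ae (Eventually.of_forall fun x => ?_)
    simp only [pd_mul hη hψ, pd_mul hη₁ hψ]; ring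
  have l2 : ∫ x in box L, ψ x * (η x * dFun a ρ₀ L x j + pd j η x * sFun a ρ₀ L x
        - ρ₀ * dOm a η₁ j x)
      = ((∫ x in box L, η x * ψ x * dFun a ρ₀ L x j) + ∫ x in box L, pd j η x * ψ x * sFun a ρ₀ L x)
        - ρ₀ * ((∫ x in box L, pd j η₁ x * ψ x * om a x)
        + ∫ x in box L, η₁ x * ψ x * gradOm a x j) := by
    rw [← integral_add i5 i2, ← integral_add i4 i6, ← integral_const_mul,
      ← integral_sub (i5.fun_add i2) ((i4.fun_add i6).const_mul ρ₀)]
    refine integral_congr_ae (Eventually.of_forall fun x => ?_)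
    simp only [dOm]; ring
  have c3 : ∫ x in box L, pd j (fun x => η₁ x * ψ x) x * om a x
      = ∫ x in box L, om a x * pd j (fun x => η₁ x * ψ x) x :=
    integral_congr_ae (Eventually.of_forall fun x => mul_comm _ _)
  have c4 : ∫ x in box L, η₁ x * ψ x * gradOm a x j
      = ∫ x in box L, gradOm a x j * (η₁ x * ψ x) :=
    integral_congr_ae (Eventually.of_forall fun x => mul_comm _ _)
  rw [l1, l2, k1, c3, c4, k2']
  ring

/-- An infimum is at most any of its entries: for an upper bound on the energy, exhibiting one weak
gradient is enough, and it also gives finiteness. -/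
lemma gradNormSq_le {u : E3 → ℝ} {G : E3 → E3} (h : IsWeakGradient L u G) :
    gradNormSq L u ≤ ENNReal.ofReal (∫ x in box L, ‖G x‖ ^ 2) := by
  refine (iInf₂_le G h).trans (le_of_eq ?_)
  rw [ofReal_integral_eq_lintegral_ofReal h.memLp_grad.norm.integrable_sq
    (Eventually.of_forall fun x => by positivity)]
  refine lintegral_congr fun x => ?_
  rw [ENNReal.ofReal_pow (norm_nonneg _), ofReal_norm]

/-- The flux pairing of `∇om` with `∇(η₁ s)`. -/
lemma Params.hasSum_flux (h : Params a ρ₀ w L) (hη₁ : ContDiff ℝ ∞ η₁)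
    (hs₁ : ∀ x, L / 2 < ‖x‖ → η₁ x = 0) (h1 : ∀ x, ‖x‖ = a → η₁ x = 1) :
    HasSum (fun n => (L ^ 3)⁻¹ * (sHat a ρ₀ L n * (VeffHat a (momentum L n) / 2)))
      (∫ x in box L, ∑ j, gradOm a x j * (η₁ x * dFun a ρ₀ L x j + pd j η₁ x * sFun a ρ₀ L x)) := by
  have ha := h.ha
  have hc₁ := hasCompactSupport_of_eq_zero hs₁
  have hgo : ∀ j, MemLp (fun x => gradOm a x j) 2 (volume.restrict (box L)) := fun j =>
    memLp_of_bounded (measurable_gradOm_apply a j).aestronglyMeasurable (abs_gradOm_apply_le ha j) L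
  have m1 : ∀ j, MemLp (fun x => ((η₁ x * gradOm a x j : ℝ) : ℂ)) 2 (volume.restrict (box L)) :=
    fun j => (memLp_cont_mul hη₁.continuous hc₁ (hgo j)).ofReal
  have m2 : ∀ j, MemLp (fun x => ((pd j η₁ x * gradOm a x j : ℝ) : ℂ)) 2 (volume.restrict (box L)) :=
    fun j => (memLp_cont_mul (contDiff_pd hη₁ j).continuous (hasCompactSupport_pd hc₁ j) (hgo j)).ofReal
  have p1 := fun j => hasSum_integral_mul_fser h.hL (h.summable_dCoeff j) (m1 j)
  have p2 := fun j => hasSum_integral_mul_fser h.hL h.summable_sCoeff (m2 j)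
  have p := hasSum_sum (s := Finset.univ) fun j _ => (p1 j).add (p2 j)
  have i1 : ∀ n j, Integrable (fun x => ((η₁ x * gradOm a x j : ℝ) : ℂ) * expo L n x)
      (volume.restrict (box L)) := fun n j => integrable_mul_of_memLp (m1 j) (memLp_expo L n)
  have i2 : ∀ n j, Integrable (fun x => ((pd j η₁ x * gradOm a x j : ℝ) : ℂ) * expo L n x)
      (volume.restrict (box L)) := fun n j => integrable_mul_of_memLp (m2 j) (memLp_expo L n)
  -- In each mode the derivatives of s and of the cutoff combine to the gradient of η₁ exp(ip·x), so
  -- the pairing with ∇ω is the flux V̂/2.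
  have lhs : ∀ n, ∑ j, ((((L ^ 3)⁻¹ : ℝ) : ℂ) * (dCoeff a ρ₀ L j n *
        ∫ x in box L, ((η₁ x * gradOm a x j : ℝ) : ℂ) * expo L n x)
      + (((L ^ 3)⁻¹ : ℝ) : ℂ) * (sCoeff a ρ₀ L n *
        ∫ x in box L, ((pd j η₁ x * gradOm a x j : ℝ) : ℂ) * expo L n x))
      = (((L ^ 3)⁻¹ * (sHat a ρ₀ L n * (VeffHat a (momentum L n) / 2)) : ℝ) : ℂ) := by
    intro n
    by_cases hn : n = 0
    · subst hn; simp [dCoeff, sCoeff]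
    · have hf := (integral_flux_expo ha h.hL (smooth_one hη₁) hc₁ h1 hn).2
      have e : ∫ x in box L, ((fderiv ℝ η₁ x (gradOm a x) : ℂ) * expo L n x
          + η₁ x * (Complex.I * (inner ℝ (momentum L n) (gradOm a x) : ℝ) * expo L n x))
          = ((VeffHat a (momentum L n) / 2 : ℝ) : ℂ) := by
        rw [← hf]
        refine setIntegral_box_eq_integral fun x hx => ?_
        rw [fderiv_eq_sum_pd, hs₁ x hx]
        simp [fun j => pd_eq_zero_of_gt hs₁ j hx]
      have e2 : ∀ x, ((fderiv ℝ η₁ x (gradOm a x) : ℂ) * expo L n x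
          + η₁ x * (Complex.I * (inner ℝ (momentum L n) (gradOm a x) : ℝ) * expo L n x))
          = ∑ j, (Complex.I * (momentum L n j : ℝ) * (((η₁ x * gradOm a x j : ℝ) : ℂ) * expo L n x)
            + ((pd j η₁ x * gradOm a x j : ℝ) : ℂ) * expo L n x) := by
        intro x
        rw [fderiv_eq_sum_pd, PiLp.inner_apply]
        simp only [Fin.sum_univ_three, RCLike.inner_apply, conj_trivial]
        push_cast; ring
      simp_rw [e2] at e
      rw [integral_finsetSum _ fun j _ => ((i1 n j).const_mul _).fun_add (i2 n j)] at e
      rw [Complex.ofReal_mul, Complex.ofReal_mul, ← e, Finset.mul_sum, Finset.mul_sum]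
      refine Finset.sum_congr rfl fun j _ => ?_
      rw [integral_add ((i1 n j).const_mul _) (i2 n j), integral_const_mul, dCoeff, sCoeff]
      ring
  simp only [lhs] at p
  have rhs : ∑ j, ((∫ x in box L, ((η₁ x * gradOm a x j : ℝ) : ℂ) * fser L (dCoeff a ρ₀ L j) x)
      + ∫ x in box L, ((pd j η₁ x * gradOm a x j : ℝ) : ℂ) * fser L (sCoeff a ρ₀ L) x)
      = ((∫ x in box L, ∑ j, gradOm a x j *
        (η₁ x * dFun a ρ₀ L x j + pd j η₁ x * sFun a ρ₀ L x) : ℝ) : ℂ) := by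
    rw [← integral_complex_ofReal]
    have j1 : ∀ j, Integrable (fun x => ((η₁ x * gradOm a x j : ℝ) : ℂ) * fser L (dCoeff a ρ₀ L j) x)
      (volume.restrict (box L)) := fun j => integrable_mul_of_memLp (m1 j) (memLp_fser h.hL _)
    have j2 : ∀ j, Integrable (fun x => ((pd j η₁ x * gradOm a x j : ℝ) : ℂ) *
      fser L (sCoeff a ρ₀ L) x) (volume.restrict (box L)) := fun j =>
        integrable_mul_of_memLp (m2 j) (memLp_fser h.hL _)
    simp_rw [← fun j => integral_add (j1 j) (j2 j)]
    rw [← integral_finsetSum _ fun j _ => (j1 j).fun_add (j2 j)]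
    refine integral_congr_ae ?_
    filter_upwards [h.sFun_ae_eq, h.dFun_ae_eq 0, h.dFun_ae_eq 1, h.dFun_ae_eq 2] with x hx h0 h1 h2
    simp only [Fin.sum_univ_three, ← hx, ← h0, ← h1, ← h2]
    push_cast; ring
  rw [rhs] at p
  exact_mod_cast p

end WeakGradient

end HardSphere

end

/-! ### The gradient energy of the trial function -/

noncomputable section

namespace HardSphere

open Filter Topology

section Energy

variable {a ρ₀ w L : ℝ} {χ : E3 → ℝ}

lemma abs_pd_cutoff_le (hχ : ContDiff ℝ ∞ χ) {K : ℝ} (hK : ∀ j x, |pd j χ x| ≤ K) {r : ℝ}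
    (hr : 0 < r) (j : Fin 3) (x : E3) : |pd j (cutoff χ r) x| ≤ K / r := by
  rw [pd_cutoff hχ, abs_mul, abs_of_pos (inv_pos.2 hr), div_eq_inv_mul]
  gcongr
  exact hK j _

lemma pd_sub {η η₁ : E3 → ℝ} (hη : ContDiff ℝ ∞ η) (hη₁ : ContDiff ℝ ∞ η₁) (j : Fin 3) (x : E3) :
    pd j (fun x => η x - η₁ x) x = pd j η x - pd j η₁ x := by
  have h : HasFDerivAt (fun x => η x - η₁ x) _ x :=
    (hη.differentiable (by simp) x).hasFDerivAt.sub (hη₁.differentiable (by simp) x).hasFDerivAt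
  rw [pd, h.fderiv]
  rfl

/-- Write b = eD + up, so that G = d - b and d = D - ρg. Then |G|² = |d|² + 2ρ g·b - 2D·b + |b|²,
where the last two terms are at most |D|² + 2|b|². The term 2ρ g·b is kept because it contributes to
leading order. -/
lemma norm_sq_inner_le {d g D G : E3} {ρ e u K k : ℝ} {p : Fin 3 → ℝ} (hd : D = d + ρ • g)
    (hG : ∀ j, G j = d j - (e * D j + u * p j)) (he : |e| ≤ K) (hp : ∀ j, |p j| ≤ k) :
    ‖G‖ ^ 2 ≤ ‖d‖ ^ 2 + 2 * ρ * ∑ j, g j * (e * D j + u * p j)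
      + ((1 + 4 * K ^ 2) * ‖D‖ ^ 2 + 12 * k ^ 2 * u ^ 2) := by
  have hj : ∀ j, G j ^ 2 ≤ d j ^ 2 + 2 * ρ * (g j * (e * D j + u * p j))
      + ((1 + 4 * K ^ 2) * D j ^ 2 + 4 * k ^ 2 * u ^ 2) := by
    intro j
    have hD : d j = D j - ρ * g j := by simp [hd]
    have e1 : (e * D j) ^ 2 ≤ K ^ 2 * D j ^ 2 := by
      rw [mul_pow, ← sq_abs e]; gcongr
    have e2 : (u * p j) ^ 2 ≤ k ^ 2 * u ^ 2 := by
      rw [mul_pow, ← sq_abs (p j), mul_comm]; gcongr; exact hp j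
    have e3 := add_sq_le (a := e * D j) (b := u * p j)
    rw [hG, hD]
    set b := e * D j + u * p j
    nlinarith [sq_nonneg (D j + b)]
  have hsum := Finset.sum_le_sum fun j (_ : j ∈ Finset.univ) => hj j
  rw [EuclideanSpace.norm_sq_eq, EuclideanSpace.norm_sq_eq, EuclideanSpace.norm_sq_eq]
  simp only [Fin.sum_univ_three, Real.norm_eq_abs, sq_abs] at hsum ⊢
  linarith

lemma norm_sq_outer_le {d G : E3} {e s K k : ℝ} {p : Fin 3 → ℝ}
    (hG : ∀ j, G j = e * d j + p j * s) (he : |e| ≤ K) (hp : ∀ j, |p j| ≤ k) :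
    ‖G‖ ^ 2 ≤ 2 * K ^ 2 * ‖d‖ ^ 2 + 6 * k ^ 2 * s ^ 2 := by
  have hj : ∀ j, G j ^ 2 ≤ 2 * K ^ 2 * d j ^ 2 + 2 * k ^ 2 * s ^ 2 := by
    intro j
    have e1 : (e * d j) ^ 2 ≤ K ^ 2 * d j ^ 2 := by
      rw [mul_pow, ← sq_abs e]; gcongr
    have e2 : (p j * s) ^ 2 ≤ k ^ 2 * s ^ 2 := by
      rw [mul_pow, ← sq_abs (p j)]; gcongr; exact hp j
    have e3 := add_sq_le (a := e * d j) (b := p j * s)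
    rw [hG]
    linarith
  have hsum := Finset.sum_le_sum fun j (_ : j ∈ Finset.univ) => hj j
  rw [EuclideanSpace.norm_sq_eq, EuclideanSpace.norm_sq_eq]
  simp only [Fin.sum_univ_three, Real.norm_eq_abs, sq_abs] at hsum ⊢
  linarith

/-- The cross term of `∇om` with the gradient of the truncated function `s + ρ₀ om`. -/
lemma Params.integral_cross (h : Params a ρ₀ w L) {η₁ : E3 → ℝ} (hη₁ : ContDiff ℝ ∞ η₁)
    (hs₁ : ∀ x, L / 2 < ‖x‖ → η₁ x = 0) (h1 : ∀ x, ‖x‖ = a → η₁ x = 1) :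
    Integrable (fun x => ∑ j, gradOm a x j * (η₁ x * (dFun a ρ₀ L x j + ρ₀ * gradOm a x j)
      + (sFun a ρ₀ L x + ρ₀ * om a x) * pd j η₁ x)) (volume.restrict (box L)) ∧
    ∫ x in box L, ∑ j, gradOm a x j * (η₁ x * (dFun a ρ₀ L x j + ρ₀ * gradOm a x j)
      + (sFun a ρ₀ L x + ρ₀ * om a x) * pd j η₁ x)
      = ∑' n, (L ^ 3)⁻¹ * (sHat a ρ₀ L n * (VeffHat a (momentum L n) / 2))
        + ρ₀ * (4 * Real.pi * a) := by
  have ha := h.ha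
  have hc₁ := hasCompactSupport_of_eq_zero hs₁
  have hgm := fun j => (measurable_gradOm_apply a j).aestronglyMeasurable (μ := volume)
  have hgb := fun j => abs_gradOm_apply_le ha j
  have hom : MemLp (om a) 2 (volume.restrict (box L)) :=
    memLp_of_bounded (continuous_om ha).aestronglyMeasurable (abs_om_le ha) L
  have hgo : ∀ j, MemLp (fun x => gradOm a x j) 2 (volume.restrict (box L)) := fun j =>
    memLp_of_bounded (hgm j) (hgb j) L
  have i1 : Integrable (fun x => ∑ j, gradOm a x j *
      (η₁ x * dFun a ρ₀ L x j + pd j η₁ x * sFun a ρ₀ L x)) (volume.restrict (box L)) :=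
    integrable_finsetSum _ fun j _ => integrableOn_box_of_memLp (memLp_bdd_mul (hgm j) (hgb j)
      ((memLp_cont_mul hη₁.continuous hc₁ (h.memLp_dFun_apply j)).add
        (memLp_cont_mul (contDiff_pd hη₁ j).continuous (hasCompactSupport_pd hc₁ j) h.memLp_sFun)))
  have i2 : Integrable (fun x => ∑ j, gradOm a x j *
      (η₁ x * gradOm a x j + pd j η₁ x * om a x)) (volume.restrict (box L)) :=
    integrable_finsetSum _ fun j _ => integrableOn_box_of_memLp (memLp_bdd_mul (hgm j) (hgb j)
      ((memLp_cont_mul hη₁.continuous hc₁ (hgo j)).add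
        (memLp_cont_mul (contDiff_pd hη₁ j).continuous (hasCompactSupport_pd hc₁ j) hom)))
  have e2 : ∫ x in box L, ∑ j, gradOm a x j * (η₁ x * gradOm a x j + pd j η₁ x * om a x)
      = 4 * Real.pi * a := by
    rw [← integral_gradOm_cutoff ha (smooth_one hη₁) hc₁ h1, setIntegral_box_eq_integral]
    · refine integral_congr_ae (Eventually.of_forall fun x => ?_)
      simp only
      rw [fderiv_eq_sum_pd, EuclideanSpace.norm_sq_eq]
      simp only [Fin.sum_univ_three, Real.norm_eq_abs, sq_abs]
      ring
    · intro x hx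
      simp [hs₁ x hx, fun j => pd_eq_zero_of_gt hs₁ j hx]
  have e : ∀ x, ∑ j, gradOm a x j * (η₁ x * (dFun a ρ₀ L x j + ρ₀ * gradOm a x j)
      + (sFun a ρ₀ L x + ρ₀ * om a x) * pd j η₁ x)
      = (∑ j, gradOm a x j * (η₁ x * dFun a ρ₀ L x j + pd j η₁ x * sFun a ρ₀ L x))
        + ρ₀ * ∑ j, gradOm a x j * (η₁ x * gradOm a x j + pd j η₁ x * om a x) := fun x => by
    simp only [Fin.sum_univ_three]; ring
  simp_rw [e]
  refine ⟨i1.fun_add (i2.const_mul ρ₀), ?_⟩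
  rw [integral_add i1 (i2.const_mul ρ₀), integral_const_mul, e2, (h.hasSum_flux hη₁ hs₁ h1).tsum_eq]

/-- The gradient energy of the trial function. -/
lemma IsCutoff.exists_energy_le (hχ : IsCutoff χ) {a : ℝ} (ha : 0 < a) : ∃ C : ℝ, 0 < C ∧
    ∀ w l l₀ : ℝ, 0 < w → w ≤ 1 → a ≤ l → 4 * l ≤ l₀ → ∀ᶠ L in atTop, ∀ ρ₀, Params a ρ₀ w L →
      ∫ x in box L, ‖gradCut a ρ₀ L (fun x => cutoff χ (l₀ / 2) x - cutoff χ (l / 2) x)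
          (cutoff χ (l / 2)) x‖ ^ 2
        ≤ (L ^ 3)⁻¹ * (∑' n, ‖momentum L n‖ ^ 2 * sHat a ρ₀ L n ^ 2)
          + 2 * ρ₀ * (∑' n, (L ^ 3)⁻¹ * (sHat a ρ₀ L n * (VeffHat a (momentum L n) / 2)))
          + 8 * Real.pi * a * ρ₀ ^ 2 + C * (w ^ 6 * l ^ 3 + w ^ 3 / l₀ ^ 2) := by
  obtain ⟨K, hK, hK0, hK1, -⟩ := exists_derivative_bound hχ.smooth hχ.hasCompactSupport
  obtain ⟨C₁, hC₁, hu⟩ := hχ.exists_sFun_add_om_le ha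
  obtain ⟨C₂, hC₂, hdu⟩ := hχ.exists_dFun_add_gradOm_le ha
  obtain ⟨C₃, hC₃, htail⟩ := exists_tail_dFun_le
  obtain ⟨C₄, hC₄, hs2⟩ := exists_sum_sHat_sq_le
  refine ⟨(1 + 4 * K ^ 2) * C₂ * 8 + 48 * K ^ 2 * (C₁ ^ 2 * 40) / a ^ 2 + 2 * K ^ 2 * C₃
    + 24 * K ^ 2 * C₄, by positivity, fun w l l₀ hw hw1 hal hl => ?_⟩
  have hl0 : 0 < l := by linarith
  have hl₀ : 0 < l₀ := by linarith
  filter_upwards [hu w hw, hdu w hw hw1, eventually_ge_atTop (1 / w), eventually_ge_atTop (10 * l₀)]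
    with L hu hdu hLw hLl ρ₀ h
  have hu := hu ρ₀ h
  have hdu := hdu ρ₀ h (2 * l) (by linarith) (by linarith)
  have hwL : 1 ≤ w * L := by rw [div_le_iff₀ hw] at hLw; linarith
  have htail := htail a ρ₀ w L l₀ h hwL hl₀
  have hs2 := (hs2 a ρ₀ w L h).2
  have hL := h.hL
  set η₀ := cutoff χ (l₀ / 2) with hη₀d
  set η₁ := cutoff χ (l / 2) with hη₁d
  have hη₀ : ContDiff ℝ ∞ η₀ := contDiff_cutoff hχ.smooth _
  have hη₁ : ContDiff ℝ ∞ η₁ := contDiff_cutoff hχ.smooth _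
  have z₁ : ∀ x, 2 * l < ‖x‖ → η₁ x = 0 := fun x hx =>
    cutoff_eq_zero (by positivity) hχ.eq_zero (by linarith)
  have o₀ : ∀ x, ‖x‖ < l₀ → η₀ x = 1 := fun x hx => hχ.cutoff_eq_one (by positivity) (by linarith)
  have pz₁ : ∀ j x, 2 * l < ‖x‖ → pd j η₁ x = 0 := fun j x hx => pd_eq_zero_of_gt z₁ j hx
  have pz₀ : ∀ j x, ‖x‖ < l₀ → pd j η₀ x = 0 := fun j x hx => pd_eq_zero_of_lt o₀ j hx
  have b₀ : ∀ x, |η₀ x| ≤ K := fun x => hK0 _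
  have b₁ : ∀ x, |η₁ x| ≤ K := fun x => hK0 _
  have pb₀ : ∀ j x, |pd j η₀ x| ≤ 2 * K / l₀ := fun j x =>
    (abs_pd_cutoff_le hχ.smooth hK1 (by positivity) j x).trans (le_of_eq (by field_simp))
  have pb₁ : ∀ j x, |pd j η₁ x| ≤ 2 * K / l := fun j x =>
    (abs_pd_cutoff_le hχ.smooth hK1 (by positivity) j x).trans (le_of_eq (by field_simp))
  have hs₁ : ∀ x, L / 2 < ‖x‖ → η₁ x = 0 := fun x hx => z₁ x (by linarith)
  have h1 : ∀ x, ‖x‖ = a → η₁ x = 1 := fun x hx =>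
    hχ.cutoff_eq_one (by positivity) (by linarith)
  obtain ⟨hcri, hcr⟩ := h.integral_cross hη₁ hs₁ h1
  set A := Metric.closedBall (0 : E3) (2 * l)
  set T := {x : E3 | l₀ ≤ ‖x‖}
  have hA : MeasurableSet A := Metric.isClosed_closedBall.measurableSet
  have hT : MeasurableSet T := measurableSet_le measurable_const measurable_norm
  have hAbox : A ⊆ box L := closedBall_subset_box (by linarith)
  set cr : E3 → ℝ := fun x => ∑ j, gradOm a x j * (η₁ x * (dFun a ρ₀ L x j + ρ₀ * gradOm a x j)
      + (sFun a ρ₀ L x + ρ₀ * om a x) * pd j η₁ x) with hcrd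
  set D : E3 → E3 := fun x => dFun a ρ₀ L x + ρ₀ • gradOm a x with hD
  set u : E3 → ℝ := fun x => sFun a ρ₀ L x + ρ₀ * om a x with hud
  -- There are three regions. For |x| ≤ 2l the gradient is ∇s - ∇(η₁u); between 2l and l₀ it is ∇s
  -- exactly; beyond l₀ only the outer cutoff acts, and the decay of ∇s is used.
  have hpt : ∀ x, ‖gradCut a ρ₀ L (fun x => η₀ x - η₁ x) η₁ x‖ ^ 2
      ≤ ‖dFun a ρ₀ L x‖ ^ 2 + 2 * ρ₀ * cr x
        + A.indicator (fun x => (1 + 4 * K ^ 2) * ‖D x‖ ^ 2 + 12 * (2 * K / l) ^ 2 * u x ^ 2) x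
        + T.indicator (fun x => 2 * K ^ 2 * ‖dFun a ρ₀ L x‖ ^ 2) x
        + 6 * (2 * K / l₀) ^ 2 * sFun a ρ₀ L x ^ 2 := by
    intro x
    have hG : ∀ j, gradCut a ρ₀ L (fun x => η₀ x - η₁ x) η₁ x j
        = η₀ x * dFun a ρ₀ L x j + pd j η₀ x * sFun a ρ₀ L x
          - (η₁ x * D x j + u x * pd j η₁ x) := fun j => by
      simp only [gradCut, pd_sub hη₀ hη₁, dOm, hD, hud, PiLp.add_apply, PiLp.smul_apply, smul_eq_mul]
      ring
    rcases lt_or_ge ‖x‖ l₀ with hx | hx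
    · have hxT : x ∉ T := by simpa [T] using hx
      rw [Set.indicator_of_notMem hxT]
      rcases le_or_gt ‖x‖ (2 * l) with hx2 | hx2
      · rw [Set.indicator_of_mem (show x ∈ A from mem_closedBall_zero_iff.2 hx2), add_zero]
        have hj := norm_sq_inner_le (d := dFun a ρ₀ L x) (g := gradOm a x) (D := D x) (ρ := ρ₀)
          (u := u x) (p := fun j => pd j η₁ x) rfl (fun j => by
            rw [hG j, o₀ x hx, pz₀ j x hx, one_mul, zero_mul, add_zero]) (b₁ x) (fun j => pb₁ j x)
        exact hj.trans (le_add_of_nonneg_right (by positivity))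
      · have hxA : x ∉ A := by simpa [A] using hx2
        rw [Set.indicator_of_notMem hxA]
        have hc0 : cr x = 0 := by simp [hcrd, z₁ x hx2, fun j => pz₁ j x hx2]
        have hGx : gradCut a ρ₀ L (fun x => η₀ x - η₁ x) η₁ x = dFun a ρ₀ L x := by
          ext j
          rw [hG, o₀ x hx, pz₀ j x hx, z₁ x hx2, pz₁ j x hx2]; ring
        rw [hGx, hc0]
        rw [mul_zero, add_zero, add_zero, add_zero]
        exact le_add_of_nonneg_right (by positivity)
    · have hx2 : 2 * l < ‖x‖ := by linarith
      have hxA : x ∉ A := by simpa [A] using hx2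
      have hc0 : cr x = 0 := by simp [hcrd, z₁ x hx2, fun j => pz₁ j x hx2]
      rw [Set.indicator_of_notMem hxA, Set.indicator_of_mem (show x ∈ T from hx), hc0]
      have hj := norm_sq_outer_le (d := dFun a ρ₀ L x) (s := sFun a ρ₀ L x)
        (p := fun j => pd j η₀ x) (fun j => by
          rw [hG j, z₁ x hx2, pz₁ j x hx2, zero_mul, mul_zero, add_zero, sub_zero]) (b₀ x)
        (fun j => pb₀ j x)
      rw [mul_zero, add_zero, add_zero, add_assoc]
      exact hj.trans (le_add_of_nonneg_left (by positivity))
  have iD : IntegrableOn (fun x => ‖D x‖ ^ 2) (box L) := by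
    have : MemLp (gradOm a) 2 (volume.restrict (box L)) :=
      memLp_of_bounded (measurable_gradOm a).aestronglyMeasurable (norm_gradOm_le ha) L
    exact (h.memLp_dFun.add (this.const_smul ρ₀)).norm.integrable_sq
  have iu : IntegrableOn (fun x => u x ^ 2) (box L) := by
    have hom : MemLp (om a) 2 (volume.restrict (box L)) :=
      memLp_of_bounded (continuous_om ha).aestronglyMeasurable (abs_om_le ha) L
    exact (h.memLp_sFun.add (hom.const_mul ρ₀)).integrable_sq
  have id : IntegrableOn (fun x => ‖dFun a ρ₀ L x‖ ^ 2) (box L) := h.memLp_dFun.norm.integrable_sq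
  have is : IntegrableOn (fun x => sFun a ρ₀ L x ^ 2) (box L) := h.memLp_sFun.integrable_sq
  have j1 := Integrable.fun_add id (hcri.const_mul (2 * ρ₀))
  have iA := (iD.const_mul (1 + 4 * K ^ 2)).fun_add (iu.const_mul (12 * (2 * K / l) ^ 2))
  have j2 := j1.fun_add (iA.indicator hA)
  have iT := (id.const_mul (2 * K ^ 2)).indicator hT
  have j3 := j2.fun_add iT
  have j4 := is.const_mul (6 * (2 * K / l₀) ^ 2)
  have hAu : ∫ x in A, u x ^ 2 ≤ C₁ ^ 2 * 40 * (w ^ 6 * l ^ 3) := by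
    have hfin : volume A ≠ ⊤ := (Metric.isBounded_closedBall.measure_lt_top).ne
    calc ∫ x in A, u x ^ 2 ≤ ∫ x in A, (C₁ * w ^ 3) ^ 2 := by
          refine integral_mono_of_nonneg (Eventually.of_forall fun x => sq_nonneg _)
            (integrableOn_const hfin) ?_
          filter_upwards [ae_restrict_of_ae_restrict_of_subset hAbox hu, ae_restrict_mem hA]
            with x hx hxA
          rw [mem_closedBall_zero_iff] at hxA
          rw [← sq_abs]
          gcongr
          exact hx (by linarith)
      _ = volume.real A * (C₁ * w ^ 3) ^ 2 := by rw [setIntegral_const, smul_eq_mul]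
      _ ≤ 5 * (2 * l) ^ 3 * (C₁ * w ^ 3) ^ 2 := by
          gcongr
          exact volume_real_closedBall_le (by positivity)
      _ = _ := by ring
  calc ∫ x in box L, ‖gradCut a ρ₀ L (fun x => η₀ x - η₁ x) η₁ x‖ ^ 2
      ≤ ∫ x in box L, (‖dFun a ρ₀ L x‖ ^ 2 + 2 * ρ₀ * cr x
        + A.indicator (fun x => (1 + 4 * K ^ 2) * ‖D x‖ ^ 2 + 12 * (2 * K / l) ^ 2 * u x ^ 2) x
        + T.indicator (fun x => 2 * K ^ 2 * ‖dFun a ρ₀ L x‖ ^ 2) x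
        + 6 * (2 * K / l₀) ^ 2 * sFun a ρ₀ L x ^ 2) :=
        integral_mono_of_nonneg (Eventually.of_forall fun x => by positivity) (j3.fun_add j4)
          (Eventually.of_forall hpt)
    _ = (∫ x in box L, ‖dFun a ρ₀ L x‖ ^ 2) + 2 * ρ₀ * (∫ x in box L, cr x)
        + ((1 + 4 * K ^ 2) * (∫ x in A, ‖D x‖ ^ 2) + 12 * (2 * K / l) ^ 2 * ∫ x in A, u x ^ 2)
        + 2 * K ^ 2 * (∫ x in box L ∩ T, ‖dFun a ρ₀ L x‖ ^ 2)
        + 6 * (2 * K / l₀) ^ 2 * ∫ x in box L, sFun a ρ₀ L x ^ 2 := by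
        rw [integral_add j3 j4, integral_add j2 iT, integral_add j1 (iA.indicator hA),
          integral_add id (hcri.const_mul (2 * ρ₀)), setIntegral_indicator hA,
          setIntegral_indicator hT, Set.inter_eq_right.2 hAbox,
          integral_add ((iD.mono_set hAbox).const_mul _) ((iu.mono_set hAbox).const_mul _)]
        simp only [integral_const_mul]
    -- The factor 1/l² in front of u² is crudely replaced by 1/𝔞², using l ≥ 𝔞. The flux of the part
    -- ρ₀ω of u is the origin of 8π𝔞ρ₀².
    _ ≤ (L ^ 3)⁻¹ * (∑' n, ‖momentum L n‖ ^ 2 * sHat a ρ₀ L n ^ 2)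
        + 2 * ρ₀ * (∑' n, (L ^ 3)⁻¹ * (sHat a ρ₀ L n * (VeffHat a (momentum L n) / 2))
          + ρ₀ * (4 * Real.pi * a))
        + ((1 + 4 * K ^ 2) * (C₂ * (w ^ 6 * (2 * l) ^ 3))
          + 12 * (2 * K / a) ^ 2 * (C₁ ^ 2 * 40 * (w ^ 6 * l ^ 3)))
        + 2 * K ^ 2 * (C₃ * (w ^ 3 / l₀ ^ 2)) + 6 * (2 * K / l₀) ^ 2 * (C₄ * w ^ 3) := by
        rw [h.integral_dFun_sq, hcr, h.integral_sFun_sq]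
        gcongr
    _ ≤ _ := by
        have hX : 0 ≤ w ^ 6 * l ^ 3 := by positivity
        have hY : 0 ≤ w ^ 3 / l₀ ^ 2 := by positivity
        have e : (1 + 4 * K ^ 2) * (C₂ * (w ^ 6 * (2 * l) ^ 3))
          + 12 * (2 * K / a) ^ 2 * (C₁ ^ 2 * 40 * (w ^ 6 * l ^ 3))
          = ((1 + 4 * K ^ 2) * C₂ * 8 + 48 * K ^ 2 * (C₁ ^ 2 * 40) / a ^ 2) * (w ^ 6 * l ^ 3) := by
          ring
        have e' : 2 * K ^ 2 * (C₃ * (w ^ 3 / l₀ ^ 2)) + 6 * (2 * K / l₀) ^ 2 * (C₄ * w ^ 3)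
          = (2 * K ^ 2 * C₃ + 24 * K ^ 2 * C₄) * (w ^ 3 / l₀ ^ 2) := by ring
        have p1 : 0 ≤ (2 * K ^ 2 * C₃ + 24 * K ^ 2 * C₄) * (w ^ 6 * l ^ 3) := by positivity
        have p2 : 0 ≤ ((1 + 4 * K ^ 2) * C₂ * 8 + 48 * K ^ 2 * (C₁ ^ 2 * 40) / a ^ 2)
          * (w ^ 3 / l₀ ^ 2) := by positivity
        linarith

end Energy

end HardSphere

end

/-! ### Comparison of the norms of s and σ -/

noncomputable section

namespace HardSphere

open Filter Topology

section Sigma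

variable {a ρ₀ w L l l₀ : ℝ} {χ φ : E3 → ℝ}

lemma cutoff_two_smul (χ : E3 → ℝ) (r : ℝ) (x : E3) :
    cutoff χ r ((2 : ℝ) • x) = cutoff χ (r / 2) x := by
  rw [cutoff, cutoff, smul_smul, inv_div, div_eq_mul_inv, mul_comm]

lemma omegaCut_eq (ha : 0 < a) (χ : E3 → ℝ) (l : ℝ) (x : E3) :
    omegaCut a χ l x = cutoff χ l x * om a x := by
  rw [omegaCut, fCut, ← one_sub_scat ha]; ring

lemma fCut_eq (ha : 0 < a) (χ : E3 → ℝ) (l : ℝ) (x : E3) :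
    fCut a χ l x = 1 - cutoff χ l x * om a x := by
  rw [← omegaCut_eq ha, omegaCut]; ring

/-- The multiplier in `σ̃`. -/
def mult (a : ℝ) (χ : E3 → ℝ) (l l₀ : ℝ) (x : E3) : ℝ :=
  cutoff χ (l₀ / 2) x * (1 - cutoff χ (l / 2) x) / fCut a χ l x

lemma sigmaTilde_eq (ha : 0 < a) (x : E3) : sigmaTilde a χ l l₀ ρ₀ L x
    = mult a χ l l₀ x * (ρ₀ * (cutoff χ l x * om a x) + sFun a ρ₀ L x) := by
  rw [sigmaTilde, mult, cutoff_two_smul, cutoff_two_smul, omegaCut_eq ha]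

/-- Where the inner cutoff differs from 1 one has |x| ≥ l, so χ_lω ≤ K𝔞/l ≤ 1/2. The bound K appears
because χ is not assumed to take values in [0,1]. Division by f_ℓ is thus harmless wherever the
numerator of σ̃ can be nonzero. -/
lemma IsCutoff.half_le_fCut (hχ : IsCutoff χ) (ha : 0 < a) {K : ℝ} (hK : ∀ x, |χ x| ≤ K)
    (hl : 2 * K * a ≤ l) (hl0 : 0 < l) {x : E3} (hx : cutoff χ (l / 2) x ≠ 1) :
    1 / 2 ≤ fCut a χ l x := by
  have hxl : l ≤ ‖x‖ := by
    by_contra hlt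
    exact hx (hχ.cutoff_eq_one (by positivity) (by linarith))
  have h1 := om_le_of_le ha hl0 hxl
  have h0 := om_nonneg ha x
  have h2 : cutoff χ l x * om a x ≤ K * (a / l) :=
    (mul_le_mul_of_nonneg_right ((le_abs_self _).trans (hK _)) h0).trans
      (mul_le_mul_of_nonneg_left h1 ((abs_nonneg _).trans (hK 0)))
  have h3 : K * (a / l) ≤ 1 / 2 := by
    rw [← mul_div_assoc, div_le_div_iff₀ hl0 two_pos]; linarith
  rw [fCut_eq ha]; linarith

lemma IsCutoff.abs_mult_le (hχ : IsCutoff χ) (ha : 0 < a) {K : ℝ} (hK : ∀ x, |χ x| ≤ K)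
    (hl : 2 * K * a ≤ l) (hl0 : 0 < l) (x : E3) : |mult a χ l l₀ x| ≤ 2 * K * (1 + K) := by
  have hK0 : 0 ≤ K := (abs_nonneg _).trans (hK 0)
  by_cases hx : cutoff χ (l / 2) x = 1
  · rw [mult, hx]; simp; positivity
  · have hf := hχ.half_le_fCut ha hK hl hl0 hx
    rw [mult, abs_div, abs_mul, abs_of_pos (by linarith : 0 < fCut a χ l x),
      div_le_iff₀ (by linarith)]
    have h1 : |1 - cutoff χ (l / 2) x| ≤ 1 + K := by
      refine (abs_sub _ _).trans ?_
      rw [abs_one]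
      exact add_le_add le_rfl (hK _)
    calc |cutoff χ (l₀ / 2) x| * |1 - cutoff χ (l / 2) x| ≤ K * (1 + K) :=
          mul_le_mul (hK _) h1 (abs_nonneg _) hK0
      _ = 2 * K * (1 + K) * (1 / 2) := by ring
      _ ≤ _ := by gcongr

lemma measurable_mult (hχ : IsCutoff χ) (ha : 0 < a) (l l₀ : ℝ) : Measurable (mult a χ l l₀) := by
  have h := fun r => (contDiff_cutoff hχ.smooth r).continuous.measurable
  have hf : Measurable (fCut a χ l) := by
    have : fCut a χ l = fun x => 1 - cutoff χ l x * om a x := funext (fCut_eq ha χ l)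
    rw [this]
    exact measurable_const.sub ((h l).mul (continuous_om ha).measurable)
  exact ((h _).mul (measurable_const.sub (h _))).div hf

/-- The trial function in terms of the cutoffs. -/
lemma IsCutoff.theta_eq (hχ : IsCutoff χ) (ha : 0 < a) {K : ℝ} (hK : ∀ x, |χ x| ≤ K)
    (hl : 2 * K * a ≤ l) (hl0 : 0 < l) (hll : 4 * l ≤ l₀) : theta a χ l l₀ ρ₀ L
      = fun x => (cutoff χ (l₀ / 2) x - cutoff χ (l / 2) x) * sFun a ρ₀ L x
        - ρ₀ * (cutoff χ (l / 2) x * om a x) := by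
  funext x
  have hmul : fCut a χ l x * mult a χ l l₀ x = cutoff χ (l₀ / 2) x * (1 - cutoff χ (l / 2) x) := by
    by_cases hx : cutoff χ (l / 2) x = 1
    · rw [mult, hx]; simp
    · have hf := hχ.half_le_fCut ha hK hl hl0 hx
      rw [mult, mul_div_cancel₀ _ (by linarith)]
  rw [theta, sigmaTilde_eq ha, omegaCut_eq ha, ← mul_assoc (fCut a χ l x), hmul]
  -- Within 2l both χ_l and the outer cutoff are 1. Beyond 2l the inner cutoff is gone: up to l₀ the
  -- two terms with χ_lω cancel, and beyond l₀ ≥ 4l the function χ_l itself vanishes.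
  rcases le_or_gt ‖x‖ l₀ with hx | hx
  · rw [hχ.cutoff_eq_one (r := l₀ / 2) (by linarith) (by linarith)]
    rcases le_or_gt ‖x‖ (2 * l) with hx2 | hx2
    · rw [hχ.cutoff_eq_one (r := l) hl0 hx2]; ring
    · rw [cutoff_eq_zero (r := l / 2) (by linarith) hχ.eq_zero (by linarith)]; ring
  · rw [cutoff_eq_zero (r := l / 2) (by linarith) hχ.eq_zero (by linarith),
      cutoff_eq_zero (r := l) hl0 hχ.eq_zero (by linarith)]
    ring

lemma IsProfile.hasCompactSupport (hφ : IsProfile φ) : HasCompactSupport φ :=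
  hasCompactSupport_of_eq_zero hφ.eq_zero

set_option maxHeartbeats 1000000 in
/-- The norm of `σ` is at least that of `s`, up to a small error. -/
lemma IsCutoff.exists_normSq_sFun_le (hχ : IsCutoff χ) (hφ : IsProfile φ) {a : ℝ} (ha : 0 < a) :
    ∃ C M : ℝ, 0 < C ∧ ∀ w l l₀ : ℝ, 0 < w → w ≤ 1 → a ≤ l → M ≤ l → 4 * l ≤ l₀ → 1 ≤ w * l₀ →
      ∀ᶠ L in atTop, ∀ ρ₀, Params a ρ₀ w L → normSq L (sFun a ρ₀ L)
        ≤ normSq L (sigma a χ φ l l₀ ρ₀ L)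
          + C * (w ^ 2 / l₀ + w ^ 4 * l ^ 3 + w ^ 3 * l ^ 3 / l₀ ^ 2) := by
  obtain ⟨K, hK0, hK⟩ := exists_abs_le hχ.smooth.continuous hχ.hasCompactSupport
  obtain ⟨C₁, hC₁, hu⟩ := hχ.exists_sFun_add_om_le ha
  obtain ⟨C₂, hC₂, htail⟩ := exists_tail_sFun_le
  obtain ⟨C₃, hC₃, hm₁⟩ := exists_integral_cutoff_mul_sFun_le hχ.smooth four_pos hχ.eq_zero
  obtain ⟨C₄, hC₄, hm₂⟩ := exists_integral_cutoff_mul_sFun_le hφ.smooth two_pos hφ.eq_zero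
  set Cs := C₁ + 1 / a with hCs
  have hCs0 : 0 < Cs := by positivity
  set Cb := 2 * K * (1 + K) * (K / a + Cs) + K * Cs with hCb
  have hCb0 : 0 < Cb := by positivity
  refine ⟨2 * ((1 + K) * C₂ + 320 * (Cs * Cb) + (C₃ + 320 * Cb) * C₄), 2 * K * a, by positivity,
    fun w l l₀ hw hw1 hal hMl hll hwl₀ => ?_⟩
  have hl0 : 0 < l := by linarith
  have hl₀ : 0 < l₀ := by linarith
  have hτ : 0 < √(w / l₀) := Real.sqrt_pos.2 (by positivity)
  filter_upwards [hu w hw, eventually_ge_atTop (2 * Real.pi / √(w / l₀)),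
    eventually_ge_atTop (25 * l₀)] with L hu hLτ hLl ρ₀ h
  have hu := hu ρ₀ h
  have hL := h.hL
  have hρ0 := h.hρ
  have htail := htail a ρ₀ w L l₀ h hl₀ hwl₀ (by rw [div_le_iff₀ hτ] at hLτ; linarith)
  have hm₁ := hm₁ a ρ₀ w L (l₀ / 2) h (by positivity) (by linarith)
  have hm₂ := hm₂ a ρ₀ w L l₀ h hl₀ (by linarith)
  have hρ : ρ₀ ≤ w ^ 2 / a := by
    rw [le_div_iff₀ ha]
    have := h.hw
    have h3 := Real.pi_gt_three
    nlinarith [mul_pos ha h.hρ]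
  set s := sFun a ρ₀ L with hs
  set η₀ := cutoff χ (l₀ / 2) with hη₀
  set φ₀ := cutoff φ l₀ with hφ₀
  set σ' := sigmaTilde a χ l l₀ ρ₀ L with hσ'
  -- The short-distance part of σ̃. It lives within 4l, where s and ρ₀ω are both O(w²), so B is too.
  set B : E3 → ℝ := fun x => σ' x - η₀ x * s x with hB
  set A := Metric.closedBall (0 : E3) (4 * l)
  have hA : MeasurableSet A := Metric.isClosed_closedBall.measurableSet
  have hAbox : A ⊆ box L := closedBall_subset_box (by linarith)
  have hAfin : volume A ≠ ⊤ := (Metric.isBounded_closedBall.measure_lt_top).ne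
  have hAvol : volume.real A ≤ 320 * l ^ 3 :=
    (volume_real_closedBall_le (by positivity)).trans (le_of_eq (by ring))
  have η₀c : Continuous η₀ := (contDiff_cutoff hχ.smooth _).continuous
  have φ₀c : Continuous φ₀ := (contDiff_cutoff hφ.smooth _).continuous
  have η₀b : ∀ x, |η₀ x| ≤ K := fun x => hK _
  have ms : MemLp s 2 (volume.restrict (box L)) := h.memLp_sFun
  have mη : MemLp (fun x => η₀ x * s x) 2 (volume.restrict (box L)) :=
    memLp_bdd_mul η₀c.aestronglyMeasurable η₀b ms
  have mφ : MemLp φ₀ 2 (volume.restrict (box L)) := by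
    obtain ⟨K', -, hK'⟩ := exists_abs_le hφ.smooth.continuous hφ.hasCompactSupport
    exact memLp_of_bounded φ₀c.aestronglyMeasurable (fun x => hK' _) L
  have mσ' : MemLp σ' 2 (volume.restrict (box L)) := by
    have h1 : MemLp (fun x => cutoff χ l x * om a x) 2 (volume.restrict (box L)) :=
      memLp_bdd_mul (contDiff_cutoff hχ.smooth _).continuous.aestronglyMeasurable (fun x => hK _)
        (memLp_of_bounded (continuous_om ha).aestronglyMeasurable (abs_om_le ha) L)
    have h2 := memLp_bdd_mul (measurable_mult hχ ha l l₀).aestronglyMeasurable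
      (hχ.abs_mult_le ha hK hMl hl0) ((h1.const_mul ρ₀).add ms)
    refine h2.ae_eq (Eventually.of_forall fun x => ?_)
    rw [hσ', sigmaTilde_eq ha]
    rfl
  have mB : MemLp B 2 (volume.restrict (box L)) := mσ'.sub mη
  have hB0 : ∀ x, x ∉ A → B x = 0 := by
    intro x hx
    rw [mem_closedBall_zero_iff, not_le] at hx
    simp only [hB, hσ']
    rw [sigmaTilde_eq ha, mult, fCut_eq ha,
      cutoff_eq_zero (r := l / 2) (by linarith) hχ.eq_zero (by linarith),
      cutoff_eq_zero (r := l) hl0 hχ.eq_zero (by linarith)]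
    ring
  have hsb : ∀ᵐ x ∂volume.restrict (box L), x ∈ A → |s x| ≤ Cs * w ^ 2 := by
    filter_upwards [hu] with x hx hxA
    rw [mem_closedBall_zero_iff] at hxA
    have h1 := hx (by linarith)
    have h2 : |s x| ≤ |s x + ρ₀ * om a x| + ρ₀ * om a x := by
      have := abs_sub (s x + ρ₀ * om a x) (ρ₀ * om a x)
      rwa [add_sub_cancel_right, abs_of_nonneg (mul_nonneg hρ0.le (om_nonneg ha x))] at this
    have h3 : ρ₀ * om a x ≤ w ^ 2 / a := (mul_le_of_le_one_right hρ0.le (om_le_one ha x)).trans hρ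
    have h4 : C₁ * w ^ 3 ≤ C₁ * w ^ 2 := by
      gcongr C₁ * ?_
      exact pow_le_pow_of_le_one hw.le hw1 (by norm_num)
    calc |s x| ≤ C₁ * w ^ 2 + w ^ 2 / a := h2.trans (add_le_add (h1.trans h4) h3)
      _ = Cs * w ^ 2 := by rw [hCs]; ring
  have hBb : ∀ᵐ x ∂volume.restrict (box L), x ∈ A → |B x| ≤ Cb * w ^ 2 := by
    filter_upwards [hsb] with x hx hxA
    have h1 := hx hxA
    have h2 : |σ' x| ≤ 2 * K * (1 + K) * (K / a + Cs) * w ^ 2 := by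
      rw [hσ', sigmaTilde_eq ha, abs_mul, mul_assoc (2 * K * (1 + K))]
      refine mul_le_mul (hχ.abs_mult_le ha hK hMl hl0 x) ?_ (abs_nonneg _) (by positivity)
      refine (abs_add_le _ _).trans ?_
      rw [add_mul]
      refine add_le_add ?_ h1
      rw [abs_mul, abs_of_pos hρ0, abs_mul]
      calc ρ₀ * (|cutoff χ l x| * |om a x|) ≤ w ^ 2 / a * (K * 1) := by
            gcongr
            · exact hK _
            · exact abs_om_le ha x
        _ = K / a * w ^ 2 := by ring
    have h3 : |η₀ x * s x| ≤ K * Cs * w ^ 2 := by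
      rw [abs_mul, mul_assoc]
      exact mul_le_mul (η₀b x) h1 (abs_nonneg _) hK0.le
    calc |B x| ≤ |σ' x| + |η₀ x * s x| := abs_sub _ _
      _ ≤ Cb * w ^ 2 := by rw [hCb, add_mul]; exact add_le_add h2 h3
  have hintA : ∀ {f : E3 → ℝ} {c : ℝ}, (∀ x, x ∉ A → f x = 0) →
      (∀ᵐ x ∂volume.restrict (box L), x ∈ A → |f x| ≤ c) → 0 ≤ c →
      |∫ x in box L, f x| ≤ c * (320 * l ^ 3) := by
    intro f c hf hb hc
    have e : ∫ x in box L, f x = ∫ x in A, f x :=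
      setIntegral_eq_of_subset_of_forall_sdiff_eq_zero (measurableSet_box L) hAbox
        (fun x hx => hf x hx.2)
    rw [e, ← Real.norm_eq_abs]
    refine (norm_setIntegral_le_of_norm_le_const_ae (C := c) hAfin.lt_top ?_).trans ?_
    · filter_upwards [ae_restrict_of_ae_restrict_of_subset hAbox hb, ae_restrict_mem hA]
        with x hx hxA using hx hxA
    · gcongr
  have hIB : |∫ x in box L, B x| ≤ Cb * w ^ 2 * (320 * l ^ 3) :=
    hintA hB0 hBb (by positivity)
  have hIsB : |∫ x in box L, s x * B x| ≤ Cs * w ^ 2 * (Cb * w ^ 2) * (320 * l ^ 3) := by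
    refine hintA (fun x hx => by rw [hB0 x hx, mul_zero]) ?_ (by positivity)
    filter_upwards [hsb, hBb] with x h1 h2 hxA
    rw [abs_mul]
    exact mul_le_mul (h1 hxA) (h2 hxA) (abs_nonneg _) (by positivity)
  have iη := integrableOn_box_of_memLp mη
  have iB := integrableOn_box_of_memLp mB
  have hIσ : ∫ x in box L, σ' x = (∫ x in box L, η₀ x * s x) + ∫ x in box L, B x := by
    rw [← integral_add iη iB]
    refine integral_congr_ae (Eventually.of_forall fun x => ?_)
    simp only [hB]; ring
  -- The average of s against a cutoff at scale l₀ is O(wl₀). As wl₀ ≥ 1, this is better than the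
  -- order (wl₀)^(3/2) that the norm of s alone would give.
  set κ := (l₀ ^ 3)⁻¹ * ∫ x in box L, σ' x with hκ
  have hκb : |κ| ≤ (l₀ ^ 3)⁻¹ * (C₃ * (w * l₀) + Cb * w ^ 2 * (320 * l ^ 3)) := by
    rw [hκ, abs_mul, abs_of_pos (by positivity : 0 < (l₀ ^ 3)⁻¹), hIσ]
    gcongr
    refine (abs_add_le _ _).trans (add_le_add (hm₁.trans ?_) hIB)
    gcongr
    linarith
  set σ := sigma a χ φ l l₀ ρ₀ L with hσ
  have hσe : ∀ x, σ x = η₀ x * s x + B x - κ * φ₀ x := fun x => by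
    simp only [hσ, sigma, hB, hκ, hσ', hφ₀, cutoff]; ring
  have mσ : MemLp σ 2 (volume.restrict (box L)) := by
    refine ((mη.add mB).sub (mφ.const_mul κ)).ae_eq (Eventually.of_forall fun x => ?_)
    rw [hσe]; rfl
  have i1 : Integrable (fun x => s x ^ 2) (volume.restrict (box L)) := ms.integrable_sq
  have i2 : Integrable (fun x => (1 - η₀ x) * s x ^ 2) (volume.restrict (box L)) := by
    have : Integrable (fun x => s x * (s x - η₀ x * s x)) (volume.restrict (box L)) :=
      ms.integrable_mul (ms.sub mη)
    refine this.congr (Eventually.of_forall fun x => ?_)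
    simp only; ring
  have i3 : Integrable (fun x => s x * B x) (volume.restrict (box L)) := ms.integrable_mul mB
  have i4 : Integrable (fun x => φ₀ x * s x) (volume.restrict (box L)) := mφ.integrable_mul ms
  -- This is σ² ≥ 2σs - s², that is (σ - s)² ≥ 0. The corrections to s enter only through their
  -- pairings with s, so the norms of B and of κφ₀ are not needed.
  have hmain : ∫ x in box L, (s x ^ 2 + 2 * (s x * B x) - 2 * ((1 - η₀ x) * s x ^ 2)
      - 2 * κ * (φ₀ x * s x)) ≤ ∫ x in box L, σ x ^ 2 := by
    refine integral_mono (((i1.fun_add (i3.const_mul 2)).sub (i2.const_mul 2)).sub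
      (i4.const_mul (2 * κ))) mσ.integrable_sq fun x => ?_
    simp only [hσe]
    nlinarith [sq_nonneg (η₀ x * s x + B x - κ * φ₀ x - s x)]
  rw [integral_sub ((i1.fun_add (i3.const_mul 2)).sub' (i2.const_mul 2)) (i4.const_mul (2 * κ)),
    integral_sub (i1.fun_add (i3.const_mul 2)) (i2.const_mul 2),
    integral_add i1 (i3.const_mul 2), integral_const_mul, integral_const_mul, integral_const_mul]
    at hmain
  have hT : MeasurableSet {x : E3 | l₀ ≤ ‖x‖} := measurableSet_le measurable_const measurable_norm
  have hI2 : ∫ x in box L, (1 - η₀ x) * s x ^ 2 ≤ (1 + K) * (C₂ * (w ^ 2 / l₀)) := by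
    calc ∫ x in box L, (1 - η₀ x) * s x ^ 2
        ≤ ∫ x in box L, {x : E3 | l₀ ≤ ‖x‖}.indicator (fun x => (1 + K) * s x ^ 2) x := by
          refine integral_mono i2 ((i1.const_mul (1 + K)).indicator hT) fun x => ?_
          by_cases hx : l₀ ≤ ‖x‖
          · rw [Set.indicator_of_mem (show x ∈ {x : E3 | l₀ ≤ ‖x‖} from hx)]
            have := (abs_le.1 (η₀b x)).1
            gcongr
            linarith
          · rw [Set.indicator_of_notMem (show x ∉ {x : E3 | l₀ ≤ ‖x‖} from hx)]
            have : η₀ x = 1 := hχ.cutoff_eq_one (by positivity) (by linarith)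
            simp [this]
      _ = (1 + K) * ∫ x in box L ∩ {x | l₀ ≤ ‖x‖}, s x ^ 2 := by
          rw [setIntegral_indicator hT, integral_const_mul]
      _ ≤ _ := by gcongr
  have hI4 : κ * ∫ x in box L, φ₀ x * s x
      ≤ (C₃ + 320 * Cb) * C₄ * (w ^ 2 / l₀ + w ^ 3 * l ^ 3 / l₀ ^ 2) := by
    calc κ * ∫ x in box L, φ₀ x * s x ≤ |κ| * |∫ x in box L, φ₀ x * s x| := by
          rw [← abs_mul]; exact le_abs_self _
      _ ≤ ((l₀ ^ 3)⁻¹ * (C₃ * (w * l₀) + Cb * w ^ 2 * (320 * l ^ 3))) * (C₄ * (w * l₀)) := by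
          gcongr
      _ = C₃ * C₄ * (w ^ 2 / l₀) + 320 * Cb * C₄ * (w ^ 3 * l ^ 3 / l₀ ^ 2) := by
          field_simp
      _ ≤ (C₃ + 320 * Cb) * C₄ * (w ^ 2 / l₀) + (C₃ + 320 * Cb) * C₄ * (w ^ 3 * l ^ 3 / l₀ ^ 2) := by
          gcongr
          · linarith
          · linarith
      _ = _ := by ring
  have hI3 := (abs_le.1 hIsB).1
  have e3 : Cs * w ^ 2 * (Cb * w ^ 2) * (320 * l ^ 3) = 320 * (Cs * Cb) * (w ^ 4 * l ^ 3) := by ring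
  rw [e3] at hI3
  rw [normSq, normSq]
  have q1 : 0 ≤ w ^ 2 / l₀ := by positivity
  have q2 : 0 ≤ w ^ 4 * l ^ 3 := by positivity
  have q3 : 0 ≤ w ^ 3 * l ^ 3 / l₀ ^ 2 := by positivity
  generalize w ^ 2 / l₀ = X at *
  generalize w ^ 4 * l ^ 3 = Y at *
  generalize w ^ 3 * l ^ 3 / l₀ ^ 2 = Z at *
  have r1 : 0 ≤ (1 + K) * C₂ * (Y + Z) := by positivity
  have r2 : 0 ≤ 320 * (Cs * Cb) * (X + Z) := by positivity
  have r3 : 0 ≤ (C₃ + 320 * Cb) * C₄ * Y := by positivity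
  linarith

end Sigma

end HardSphere

end

/-! ### The energy of a single mode and the convolution term -/

noncomputable section

namespace HardSphere

open Filter Topology

/-- The summand of the Lee-Huang-Yang sum. -/
def hRad (v r : ℝ) : ℝ := r ^ 2 / 16 * ((√(1 + 2 * v / r ^ 2) - 1) ^ 3 * (√(1 + 2 * v / r ^ 2) + 3))

section Modes

variable {a ρ₀ w L r : ℝ}

/-- The difference of the two sides is y - x times a manifestly nonnegative polynomial. It makes
`hRad` monotone in the coupling. -/
lemma cube_mul_mono {x y : ℝ} (hx : 0 ≤ x) (hxy : x ≤ y) :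
    (x - 1) ^ 3 * (x + 3) ≤ (y - 1) ^ 3 * (y + 3) := by
  have h : (y - 1) ^ 3 * (y + 3) - (x - 1) ^ 3 * (x + 3)
      = (y - x) * ((x + y) * ((x - 1) ^ 2 + (y - 1) ^ 2) + 2 * (x + y - 2) ^ 2) := by ring
  have hy : 0 ≤ y := hx.trans hxy
  have : 0 ≤ (y - x) * ((x + y) * ((x - 1) ^ 2 + (y - 1) ^ 2) + 2 * (x + y - 2) ^ 2) :=
    mul_nonneg (sub_nonneg.2 hxy) (by positivity)
  linarith

lemma sqrt_one_add_sq_sub_one_le (s : ℝ) : 0 ≤ √(1 + s ^ 2) - 1 ∧ √(1 + s ^ 2) - 1 ≤ |s| := by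
  constructor
  · have : 1 ≤ √(1 + s ^ 2) := Real.one_le_sqrt.2 (by nlinarith [sq_nonneg s])
    linarith
  · have : √(1 + s ^ 2) ≤ 1 + |s| := by
      rw [Real.sqrt_le_left (by positivity)]
      nlinarith [abs_nonneg s, sq_abs s]
    linarith

lemma sq_mul_tRad_le (ha : 0 < a) (hρ : 0 < ρ₀) (hr : 0 < r) :
    r ^ 2 * tRad a ρ₀ r ≤ 8 * Real.pi * a * ρ₀ := by
  have h := (le_abs_self _).trans (abs_tRad_le_sq (a := a) ha hρ hr)
  rwa [le_div_iff₀ (by positivity), mul_comm] at h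

/-- The energy of one mode. -/
lemma mode_le (ha : 0 < a) (hρ : 0 < ρ₀) (hs : ρ₀ * a ^ 3 ≤ 1 / 100) (hr : 0 < r) :
    r ^ 2 * sRad a ρ₀ r ^ 2 + r ^ 2 * tRad a ρ₀ r * sRad a ρ₀ r
      + 2 * (8 * Real.pi * a * ρ₀) * sRad a ρ₀ r ^ 2
      + 8 * Real.pi * a * ρ₀ * ((√(1 + sRad a ρ₀ r ^ 2) - 1) * sRad a ρ₀ r)
      ≤ hRad (8 * Real.pi * a * ρ₀) r - r ^ 2 * tRad a ρ₀ r ^ 2 / 4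
        + 8 * Real.pi * a * ρ₀ * sRad a ρ₀ r ^ 2
        + 2 * (8 * Real.pi * a * ρ₀ - r ^ 2 * tRad a ρ₀ r) * sRad a ρ₀ r ^ 2 := by
  have hy0 : 0 < yRad a ρ₀ r := lt_of_lt_of_le (by norm_num) (le_yRad ha hρ hs hr)
  have hy4 := yRad_pow ha hρ hs hr
  have hvt := sq_mul_tRad_le ha hρ hr
  set v := 8 * Real.pi * a * ρ₀
  set t := tRad a ρ₀ r
  set s := sRad a ρ₀ r with hsd
  set y := yRad a ρ₀ r with hy
  have hsy : s = (1 / y - y) / 2 := rfl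
  have hg : √(1 + s ^ 2) = (1 / y + y) / 2 := by
    rw [show 1 + s ^ 2 = ((1 / y + y) / 2) ^ 2 by rw [hsy]; field_simp; ring]
    exact Real.sqrt_sq (by positivity)
  obtain ⟨hg0, hg1⟩ := sqrt_one_add_sq_sub_one_le s
  have hgs : (√(1 + s ^ 2) - 1) * s ≤ s ^ 2 := by
    calc (√(1 + s ^ 2) - 1) * s ≤ (√(1 + s ^ 2) - 1) * |s| :=
          mul_le_mul_of_nonneg_left (le_abs_self s) hg0
      _ ≤ |s| * |s| := mul_le_mul_of_nonneg_right hg1 (abs_nonneg s)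
      _ = s ^ 2 := by rw [← sq_abs, sq]
  -- the exact identity at the coupling of the mode
  have ht : t = (y ^ 4 - 1) / 2 := by linarith
  have hid : r ^ 2 * s ^ 2 + r ^ 2 * t * s + 2 * (r ^ 2 * t) * s ^ 2
      + r ^ 2 * t * ((√(1 + s ^ 2) - 1) * s)
      = r ^ 2 / 16 * ((y ^ 2 - 1) ^ 3 * (y ^ 2 + 3)) - r ^ 2 * t ^ 2 / 4 + r ^ 2 * t * s ^ 2 := by
    rw [hg, ht, hsy]
    field_simp
    ring
  -- The coupling r²t = ρ₀V̂ of the mode is at most v, so monotonicity replaces it by v inside the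
  -- Lee-Huang-Yang term.
  have hH : r ^ 2 / 16 * ((y ^ 2 - 1) ^ 3 * (y ^ 2 + 3)) ≤ hRad v r := by
    rw [hRad]
    refine mul_le_mul_of_nonneg_left (cube_mul_mono (by positivity) ?_) (by positivity)
    refine Real.le_sqrt_of_sq_le ?_
    have : t ≤ v / r ^ 2 := by rw [le_div_iff₀ (by positivity)]; linarith
    calc (y ^ 2) ^ 2 = 1 + 2 * t := by rw [← hy4]; ring
      _ ≤ 1 + 2 * (v / r ^ 2) := by linarith
      _ = 1 + 2 * v / r ^ 2 := by ring
  -- The surplus coupling in the last term costs at most (v - r²t)s², which is what raises r²t s² in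
  -- the identity to vs².
  have hdiff : (v - r ^ 2 * t) * ((√(1 + s ^ 2) - 1) * s) ≤ (v - r ^ 2 * t) * s ^ 2 :=
    mul_le_mul_of_nonneg_left hgs (by linarith)
  nlinarith

/-- With x = |p|𝔞, v - ρ₀V̂ = v(1 - sin x/x) is at most 2v min(1, x²), and ŝ² ≤ w⁴/|p|⁴. The regimes
meet at |p| = 1/𝔞. -/
lemma exists_sum_defect_le : ∃ C : ℝ, 0 < C ∧ ∀ a ρ₀ w L : ℝ, Params a ρ₀ w L →
    Summable (fun n => 2 * (8 * Real.pi * a * ρ₀ - ρ₀ * VeffHat a (momentum L n)) * sHat a ρ₀ L n ^ 2) ∧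
    (L ^ 3)⁻¹ * ∑' n, 2 * (8 * Real.pi * a * ρ₀ - ρ₀ * VeffHat a (momentum L n)) * sHat a ρ₀ L n ^ 2
      ≤ C * (a * w ^ 6) := by
  obtain ⟨C, hC, hS⟩ := exists_lattice_sum_le (α := 2) (β := 4) (by norm_num) (by norm_num)
  refine ⟨8 * C, by positivity, fun a ρ₀ w L h => ?_⟩
  have ha := h.ha
  have hρ := h.hρ
  have hw0 := h.hw0
  have key : ∀ n, n ≠ 0 → 0 ≤ 8 * Real.pi * a * ρ₀ - ρ₀ * VeffHat a (momentum L n) ∧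
      8 * Real.pi * a * ρ₀ - ρ₀ * VeffHat a (momentum L n) ≤ 2 * w ^ 2 ∧
      8 * Real.pi * a * ρ₀ - ρ₀ * VeffHat a (momentum L n) ≤ 2 * w ^ 2 * (‖momentum L n‖ * a) ^ 2 := by
    intro n hn
    have hp := norm_momentum_pos h.hL hn
    set r := ‖momentum L n‖
    set x := r * a with hx
    have hx0 : 0 < x := by positivity
    have e : 8 * Real.pi * a * ρ₀ - ρ₀ * VeffHat a (momentum L n)
        = 8 * Real.pi * a * ρ₀ * (1 - Real.sin x / x) := by
      have : VeffHat a (momentum L n) = 8 * Real.pi * Real.sin x / r := rfl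
      rw [this, hx]
      field_simp
    have h1 : 0 ≤ 1 - Real.sin x / x := by
      rw [sub_nonneg, div_le_one hx0]; exact Real.sin_le hx0.le
    have h2 : 1 - Real.sin x / x ≤ 2 * x ^ 2 := by
      rcases le_or_gt x 1 with hx1 | hx1
      · have := Real.sin_gt_sub_cube hx0
        have h3 : 1 - x ^ 2 / 6 ≤ Real.sin x / x := by
          rw [le_div_iff₀ hx0]; linarith
        nlinarith [sq_nonneg x]
      · have h3 : -1 ≤ Real.sin x / x := by
          rw [le_div_iff₀ hx0]; linarith [Real.neg_one_le_sin x]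
        nlinarith
    have h3 : 1 - Real.sin x / x ≤ 2 := by
      rcases le_or_gt x 1 with hx1 | hx1
      · have : 0 ≤ Real.sin x / x :=
          div_nonneg (Real.sin_nonneg_of_nonneg_of_le_pi hx0.le (by linarith [Real.pi_gt_three])) hx0.le
        linarith
      · have h3 : -1 ≤ Real.sin x / x := by
          rw [le_div_iff₀ hx0]; linarith [Real.neg_one_le_sin x]
        linarith
    rw [e]
    have hw := h.hw
    have hv : 0 ≤ 8 * Real.pi * a * ρ₀ := by positivity
    refine ⟨by positivity, ?_, ?_⟩
    · calc _ ≤ w ^ 2 * 2 := mul_le_mul hw h3 h1 (by positivity)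
        _ = _ := by ring
    · calc _ ≤ w ^ 2 * (2 * x ^ 2) := mul_le_mul hw h2 h1 (by positivity)
        _ = _ := by ring
  obtain ⟨h1, h2⟩ := hS L
    (fun n => 2 * (8 * Real.pi * a * ρ₀ - ρ₀ * VeffHat a (momentum L n)) * sHat a ρ₀ L n ^ 2)
    (4 * w ^ 6 * a ^ 2) (4 * w ^ 6) (1 / a) h.hL (by positivity) (by positivity) (by positivity)
    (fun n => by
      by_cases hn : n = 0
      · subst hn; simp
      · have := (key n hn).1; positivity) (by simp)
    (fun n hn => by
      have hp := norm_momentum_pos h.hL hn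
      calc _ ≤ 2 * (2 * w ^ 2 * (‖momentum L n‖ * a) ^ 2) * (w ^ 4 / ‖momentum L n‖ ^ 4) := by
            gcongr
            · exact (key n hn).2.2
            · exact h.sHat_sq_le_four hn
        _ = _ := by field_simp; norm_num)
    (fun n hn => by
      have hp := norm_momentum_pos h.hL hn
      calc _ ≤ 2 * (2 * w ^ 2) * (w ^ 4 / ‖momentum L n‖ ^ 4) := by
            gcongr
            · exact (key n hn).2.1
            · exact h.sHat_sq_le_four hn
        _ = _ := by ring)
  refine ⟨h1, h2.trans (le_of_eq ?_)⟩
  field_simp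
  norm_num

lemma Params.summable_gSubOne_mul (h : Params a ρ₀ w L) :
    Summable fun n => (√(1 + sHat a ρ₀ L n ^ 2) - 1) * sHat a ρ₀ L n := by
  refine Summable.of_norm_bounded h.summable_sHat_sq fun n => ?_
  obtain ⟨h0, h1⟩ := sqrt_one_add_sq_sub_one_le (sHat a ρ₀ L n)
  calc ‖(√(1 + sHat a ρ₀ L n ^ 2) - 1) * sHat a ρ₀ L n‖
      = (√(1 + sHat a ρ₀ L n ^ 2) - 1) * |sHat a ρ₀ L n| := by
        rw [norm_mul, Real.norm_of_nonneg h0, Real.norm_eq_abs]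
    _ ≤ |sHat a ρ₀ L n| * |sHat a ρ₀ L n| := mul_le_mul_of_nonneg_right h1 (abs_nonneg _)
    _ = sHat a ρ₀ L n ^ 2 := by rw [abs_mul_abs_self, sq]

lemma Params.summable_gSubOne (h : Params a ρ₀ w L) :
    Summable fun n => ‖((√(1 + sHat a ρ₀ L n ^ 2) - 1 : ℝ) : ℂ)‖ ^ 2 := by
  refine Summable.of_nonneg_of_le (fun n => by positivity) (fun n => ?_) h.summable_sHat_sq
  obtain ⟨h0, h1⟩ := sqrt_one_add_sq_sub_one_le (sHat a ρ₀ L n)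
  rw [Complex.norm_real, Real.norm_of_nonneg h0]
  exact sq_le_sq.2 ((abs_of_nonneg h0).trans_le h1)

lemma measurePreserving_neg_box (L : ℝ) : MeasurePreserving (fun x : E3 => -x)
    (volume.restrict (box L)) (volume.restrict (box L)) := by
  have h := (Measure.measurePreserving_neg (volume : Measure E3)).restrict_preimage
    (measurableSet_box L)
  have e : (Neg.neg : E3 → E3) ⁻¹' box L = box L := by
    ext x
    simp only [box, Set.mem_preimage, Set.mem_ofPred_eq, PiLp.neg_apply, Set.mem_Icc]
    refine forall_congr' fun i => ?_
    constructor <;> rintro ⟨h1, h2⟩ <;> constructor <;> linarith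
  rw [e] at h
  exact h

/-- The convolution at the origin as a sum over modes. -/
lemma Params.conv_eq (h : Params a ρ₀ w L) : conv L (gSubOne a ρ₀ L) (sFun a ρ₀ L) 0
    = (L ^ 3)⁻¹ * ∑' n, (√(1 + sHat a ρ₀ L n ^ 2) - 1) * sHat a ρ₀ L n := by
  set c : (Fin 3 → ℤ) → ℂ := fun n => ((√(1 + sHat a ρ₀ L n ^ 2) - 1 : ℝ) : ℂ) with hc
  have hcs : Summable fun n => ‖c n‖ ^ 2 := h.summable_gSubOne
  have hmp := measurePreserving_neg_box L
  have hemb : MeasurableEmbedding (fun x : E3 => -x) := (MeasurableEquiv.neg E3).measurableEmbedding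
  -- The reflection x ↦ -x maps the box to itself and turns the convolution at 0 into a bilinear
  -- pairing of g - 𝟙 with the reflected s.
  have hk : MemLp (fun x => (sFun a ρ₀ L (-x) : ℂ)) 2 (volume.restrict (box L)) :=
    (h.memLp_sFun.comp_measurePreserving hmp).ofReal
  have hp := hasSum_integral_mul_fser h.hL hcs hk
  have e1 : ∀ n, ∫ x in box L, (sFun a ρ₀ L (-x) : ℂ) * expo L n x = sCoeff a ρ₀ L n := fun n => by
    rw [← h.integral_sFun_mul_expo n,
      ← hmp.integral_comp hemb (fun x => (sFun a ρ₀ L x : ℂ) * expo L (-n) x)]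
    refine integral_congr_ae (Eventually.of_forall fun x => ?_)
    simp only
    rw [expo_neg_apply, neg_neg]
  simp only [e1] at hp
  have e2 : ∫ x in box L, (sFun a ρ₀ L (-x) : ℂ) * fser L c x
      = ((conv L (gSubOne a ρ₀ L) (sFun a ρ₀ L) 0 : ℝ) : ℂ) := by
    rw [conv, ← hmp.integral_comp hemb (fun y => gSubOne a ρ₀ L (0 - y) * sFun a ρ₀ L y),
      ← integral_complex_ofReal]
    refine integral_congr_ae ?_
    have := fser_im_ae_eq_zero h.hL hcs (fun n => by simp [hc, sHat_neg])
    filter_upwards [this] with x hx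
    rw [← hx, zero_sub, neg_neg, gSubOne, ofCoeff_eq_re]
    rw [Complex.ofReal_mul, mul_comm]
  rw [e2] at hp
  have hp' : HasSum (fun n => (L ^ 3)⁻¹ * ((√(1 + sHat a ρ₀ L n ^ 2) - 1) * sHat a ρ₀ L n))
      (conv L (gSubOne a ρ₀ L) (sFun a ρ₀ L) 0) := by
    rw [← Complex.hasSum_ofReal]
    refine hp.congr_fun fun n => ?_
    simp only [hc, sCoeff]; push_cast; ring
  rw [← hp'.tsum_eq, tsum_mul_left]

end Modes

end HardSphere

end

/-! ### The lattice sum of V̂²/(4p²) -/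

noncomputable section

namespace HardSphere

open Filter Topology

section FluxSum

variable {a L : ℝ} {χ : E3 → ℝ}

lemma abs_VeffHat_le (ha : 0 < a) (p : E3) : |VeffHat a p| ≤ 8 * Real.pi * a := by
  rw [VeffHat, abs_div, abs_mul, abs_norm, abs_of_nonneg (by positivity : 0 ≤ 8 * Real.pi)]
  refine div_le_of_le_mul₀ (norm_nonneg p) (by positivity) ?_
  calc 8 * Real.pi * |Real.sin (‖p‖ * a)| ≤ 8 * Real.pi * |‖p‖ * a| :=
        mul_le_mul_of_nonneg_left Real.abs_sin_le_abs (by positivity)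
    _ = 8 * Real.pi * a * ‖p‖ := by rw [abs_of_nonneg (by positivity)]; ring

lemma abs_VeffHat_le_div (a : ℝ) (p : E3) : |VeffHat a p| ≤ 8 * Real.pi / ‖p‖ := by
  rw [VeffHat, abs_div, abs_mul, abs_norm, abs_of_nonneg (by positivity : 0 ≤ 8 * Real.pi)]
  exact div_le_div_of_nonneg_right
    (mul_le_of_le_one_right (by positivity) (Real.abs_sin_le_one _)) (norm_nonneg p)

lemma summable_VeffHat_sq (ha : 0 < a) (hL : 0 < L) :
    Summable fun n => VeffHat a (momentum L n) ^ 2 / (4 * ‖momentum L n‖ ^ 2) := by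
  obtain ⟨C, -, hS⟩ := exists_lattice_sum_le (α := 2) (β := 4) (by norm_num) (by norm_num)
  refine (hS L _ (16 * Real.pi ^ 2 * a ^ 2) (16 * Real.pi ^ 2) 1 hL (by positivity) (by positivity)
    one_pos (fun n => by positivity) (by simp [VeffHat]) (fun n hn => ?_)
    (fun n hn => ?_)).1
  · have hp := norm_momentum_pos hL hn
    calc VeffHat a (momentum L n) ^ 2 / (4 * ‖momentum L n‖ ^ 2)
        ≤ (8 * Real.pi * a) ^ 2 / (4 * ‖momentum L n‖ ^ 2) := by
          gcongr ?_ / _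
          exact sq_le_sq.2 ((abs_VeffHat_le ha _).trans (le_abs_self _))
      _ = _ := by field_simp; norm_num
  · have hp := norm_momentum_pos hL hn
    calc VeffHat a (momentum L n) ^ 2 / (4 * ‖momentum L n‖ ^ 2)
        ≤ (8 * Real.pi / ‖momentum L n‖) ^ 2 / (4 * ‖momentum L n‖ ^ 2) := by
          gcongr ?_ / _
          exact sq_le_sq.2 ((abs_VeffHat_le_div a _).trans (le_abs_self _))
      _ = _ := by field_simp; norm_num

/-- The integral of ∇ω·∇(ηω) is exactly 4π𝔞. Inside |x| < L/5 its integrand coincides with |∇(ηω)|²,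
and farther out it is O(𝔞²/L⁴) on a volume L³. The constant is 4375 = 3750 + 625, from the two terms
of the integrand. -/
lemma IsCutoff.exists_integral_dOm_sq_ge (hχ : IsCutoff χ) (ha : 0 < a) : ∃ C : ℝ, ∀ L, 5 * a ≤ L →
    4 * Real.pi * a - C / L ≤ ∑ j, ∫ x in box L, dOm a (boxCut χ L) j x ^ 2 := by
  obtain ⟨K, hK, h0, h1, -⟩ := exists_derivative_bound hχ.smooth hχ.hasCompactSupport
  refine ⟨4375 * K * a ^ 2, fun L h5 => ?_⟩
  have hL : 0 < L := by linarith
  have hη := hχ.boxCut_contDiff L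
  have hc := hχ.boxCut_hasCompactSupport hL
  set η := boxCut χ L with hηd
  set G : E3 → ℝ := fun x => om a x * fderiv ℝ η x (gradOm a x) + η x * ‖gradOm a x‖ ^ 2 with hG
  have hinteg : ∫ x, G x = 4 * Real.pi * a :=
    integral_gradOm_cutoff ha (smooth_one hη) hc fun x hx => hχ.boxCut_eq_one hL (by linarith)
  have hGi : Integrable G := by
    by_contra h
    rw [integral_undef h] at hinteg
    have : 0 < 4 * Real.pi * a := by positivity
    linarith
  have hpd0 : ∀ x : E3, 2 * L / 5 < ‖x‖ → ∀ j, pd j η x = 0 := fun x hx j =>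
    pd_eq_zero_of_gt (fun z hz => hχ.boxCut_eq_zero hL hz) j hx
  have hGbox : ∫ x in box L, G x = 4 * Real.pi * a := by
    rw [← hinteg]
    refine setIntegral_box_eq_integral fun x hx => ?_
    have hx' : 2 * L / 5 < ‖x‖ := by linarith
    have e : η x = 0 := hχ.boxCut_eq_zero hL hx'
    simp [hG, fderiv_eq_sum_pd, hpd0 x hx', e]
  have hHi : ∀ j, Integrable (fun x => dOm a η j x ^ 2) (volume.restrict (box L)) := fun j => by
    have := (memLp_dOm ha hη hc j L).integrable_norm_pow (by norm_num)
    simpa using this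
  have hle : ∀ x, G x ≤ (∑ j, dOm a η j x ^ 2) + 4375 * K * a ^ 2 / L ^ 4 := by
    intro x
    have hn : ‖gradOm a x‖ ^ 2 = ∑ j, gradOm a x j ^ 2 := EuclideanSpace.real_norm_sq_eq _
    rcases lt_or_ge ‖x‖ (L / 5) with hx | hx
    · have e : η x = 1 := hχ.boxCut_eq_one hL hx.le
      have e' : ∀ j, pd j η x = 0 := fun j =>
        pd_eq_zero_of_lt (fun z hz => hχ.boxCut_eq_one hL (le_of_lt hz)) j hx
      have : 0 ≤ 4375 * K * a ^ 2 / L ^ 4 := by positivity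
      simp only [hG, fderiv_eq_sum_pd, e', e, dOm, hn]
      simpa using this
    · have hg : ‖gradOm a x‖ ≤ 25 * a / L ^ 2 :=
        (norm_gradOm_le_of_le ha (by positivity) hx).trans (le_of_eq (by field_simp; norm_num))
      have ho : om a x ≤ 5 * a / L :=
        (om_le_of_le ha (by positivity) hx).trans (le_of_eq (by field_simp))
      have hp : ∀ j, |pd j η x| ≤ 10 * K / L := fun j => by
        rw [hηd, boxCut, pd_cutoff hχ.smooth, abs_mul, abs_of_nonneg (by positivity : 0 ≤ (L / 10)⁻¹)]
        calc (L / 10)⁻¹ * |cutoff (pd j χ) (L / 10) x| ≤ (L / 10)⁻¹ * K := by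
              gcongr; exact h1 j _
          _ = 10 * K / L := by field_simp
      have hs : fderiv ℝ η x (gradOm a x) ≤ 3 * (10 * K / L * (25 * a / L ^ 2)) := by
        rw [fderiv_eq_sum_pd]
        refine (Finset.sum_le_card_nsmul _ _ (10 * K / L * (25 * a / L ^ 2)) fun j _ => ?_).trans
          (by simp)
        refine (le_abs_self _).trans ?_
        rw [abs_mul]
        exact mul_le_mul (hp j) ((PiLp.norm_apply_le (gradOm a x) j).trans hg) (abs_nonneg _)
          (by positivity)
      have hH : 0 ≤ ∑ j, dOm a η j x ^ 2 := Finset.sum_nonneg fun j _ => sq_nonneg _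
      calc G x ≤ 5 * a / L * (3 * (10 * K / L * (25 * a / L ^ 2))) + K * (25 * a / L ^ 2) ^ 2 := by
            refine add_le_add (mul_le_mul_of_nonneg ho hs (om_nonneg ha x) (by positivity)) ?_
            have : η x ≤ K := (le_abs_self _).trans (h0 _)
            gcongr
        _ = 4375 * K * a ^ 2 / L ^ 4 := by field_simp; norm_num
        _ ≤ _ := by linarith
  have hfin : volume (box L) ≠ ⊤ := by
    have h := volume_real_box hL
    intro ht
    rw [measureReal_def, ht] at h
    rw [ENNReal.toReal_top] at h
    exact (pow_pos hL 3).ne h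
  have hci : Integrable (fun _ : E3 => 4375 * K * a ^ 2 / L ^ 4) (volume.restrict (box L)) :=
    integrableOn_const hfin
  have hSi : Integrable (fun x => ∑ j, dOm a η j x ^ 2) (volume.restrict (box L)) :=
    integrable_finsetSum _ fun j _ => hHi j
  have := integral_mono hGi.restrict (hSi.fun_add hci) hle
  rw [hGbox, integral_add hSi hci, integral_finsetSum _ fun j _ => hHi j, setIntegral_const,
    volume_real_box hL, smul_eq_mul] at this
  have e : L ^ 3 * (4375 * K * a ^ 2 / L ^ 4) = 4375 * K * a ^ 2 / L := by field_simp
  linarith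

/-- The sum of `V̂² / (4 p²)` over the dual lattice is the energy of the scattering solution, up to
terms that vanish in a large box. -/
lemma IsCutoff.exists_sum_VeffHat_sq_ge (hχ : IsCutoff χ) (ha : 0 < a) : ∃ C : ℝ, ∀ L, 5 * a ≤ L →
    4 * Real.pi * a - C / L
      ≤ (L ^ 3)⁻¹ * ∑' n, VeffHat a (momentum L n) ^ 2 / (4 * ‖momentum L n‖ ^ 2) := by
  obtain ⟨C, hC⟩ := hχ.exists_integral_dOm_sq_ge ha
  obtain ⟨K, hK, hk⟩ := hχ.exists_kCoeff_div_sum_le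
  refine ⟨C + 8 * Real.pi * a * (K * (a ^ 2 + 1)) + K * a ^ 2, fun L h5 => ?_⟩
  have hL : 0 < L := by linarith
  obtain ⟨⟨hk1, hk1'⟩, hk2, hk2'⟩ := hk a L ha hL
  have hη := hχ.boxCut_contDiff L
  have hc := hχ.boxCut_hasCompactSupport hL
  have hj : ∀ j, HasSum (fun n => momentum L n j ^ 2 * ‖omCoeff a χ L n‖ ^ 2)
      (L ^ 3 * ∫ x in box L, dOm a (boxCut χ L) j x ^ 2) := fun j => by
    have h := hasSum_norm_sq_integral_mul_expo hL (memLp_dOm ha hη hc j L)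
    have e : ∀ n, ‖∫ x in box L, (dOm a (boxCut χ L) j x : ℂ) * expo L (-n) x‖ ^ 2
        = momentum L n j ^ 2 * ‖omCoeff a χ L n‖ ^ 2 := fun n => by
      rw [setIntegral_box_eq_integral, integral_dOm_mul_expo ha hη hc, norm_mul, mul_pow, omCoeff]
      · simp
      · intro x hx
        have hx' : 2 * L / 5 < ‖x‖ := by linarith
        rw [dOm, hχ.boxCut_eq_zero hL hx', pd_eq_zero_of_gt (fun z hz => hχ.boxCut_eq_zero hL hz) j hx']
        simp
    simp only [e] at h
    simpa using h
  have hs := hasSum_sum (s := Finset.univ) fun j _ => hj j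
  have e1 : ∀ n, ∑ j, momentum L n j ^ 2 * ‖omCoeff a χ L n‖ ^ 2
      = ‖momentum L n‖ ^ 2 * ‖omCoeff a χ L n‖ ^ 2 := fun n => by
    rw [← Finset.sum_mul, EuclideanSpace.real_norm_sq_eq]
  simp only [e1, ← Finset.mul_sum] at hs
  have hV := summable_VeffHat_sq ha hL
  -- By `coeff_om`, p² times the coefficient of the truncated `om` is at most |V̂|/2 plus a
  -- commutator term. Squaring and dividing by p² leaves two error sums of order 1/L. A lower bound
  -- is all that is wanted, as this sum enters the energy with a minus sign.
  have hle : ∀ n, ‖momentum L n‖ ^ 2 * ‖omCoeff a χ L n‖ ^ 2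
      ≤ VeffHat a (momentum L n) ^ 2 / (4 * ‖momentum L n‖ ^ 2)
        + (8 * Real.pi * a * (‖kCoeff a χ L n‖ / ‖momentum L n‖ ^ 2)
          + ‖kCoeff a χ L n‖ ^ 2 / ‖momentum L n‖ ^ 2) := by
    intro n
    by_cases hn : n = 0
    · subst hn
      simp
    have hp := norm_momentum_pos hL hn
    have h := coeff_om ha hL hη hc
      (fun x hx => hχ.boxCut_eq_one hL (by linarith)) (neg_ne_zero.2 hn)
    rw [norm_momentum_neg] at h
    have h' : ‖momentum L n‖ ^ 2 * ‖omCoeff a χ L n‖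
        ≤ |VeffHat a (momentum L n)| / 2 + ‖kCoeff a χ L n‖ := by
      have h2 : ‖((‖momentum L n‖ ^ 2 : ℝ) : ℂ) * omCoeff a χ L n‖
          ≤ ‖((VeffHat a (momentum L (-n)) / 2 : ℝ) : ℂ)‖ + ‖kCoeff a χ L n‖ := by
        rw [omCoeff, h]; exact norm_sub_le _ _
      have e : VeffHat a (momentum L (-n)) = VeffHat a (momentum L n) := by
        rw [VeffHat, norm_momentum_neg, VeffHat]
      rw [norm_mul, Complex.norm_real, Complex.norm_real, e, Real.norm_of_nonneg (by positivity),
        Real.norm_eq_abs, abs_div, abs_two] at h2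
      exact h2
    have hVb := abs_VeffHat_le ha (momentum L n)
    have e2 : ‖momentum L n‖ ^ 2 * ‖omCoeff a χ L n‖ ^ 2
        = (‖momentum L n‖ ^ 2 * ‖omCoeff a χ L n‖) ^ 2 / ‖momentum L n‖ ^ 2 := by field_simp
    rw [e2]
    calc (‖momentum L n‖ ^ 2 * ‖omCoeff a χ L n‖) ^ 2 / ‖momentum L n‖ ^ 2
        ≤ (|VeffHat a (momentum L n)| / 2 + ‖kCoeff a χ L n‖) ^ 2 / ‖momentum L n‖ ^ 2 := by gcongr
      _ = VeffHat a (momentum L n) ^ 2 / (4 * ‖momentum L n‖ ^ 2)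
        + (|VeffHat a (momentum L n)| * (‖kCoeff a χ L n‖ / ‖momentum L n‖ ^ 2)
          + ‖kCoeff a χ L n‖ ^ 2 / ‖momentum L n‖ ^ 2) := by
          rw [← sq_abs (VeffHat a (momentum L n))]; field_simp; ring
      _ ≤ _ := by gcongr
  have hR := (hV.hasSum.add ((hk1.hasSum.mul_left (8 * Real.pi * a)).add hk2.hasSum))
  have hm := hasSum_le hle hs hR
  have hCL := hC L h5
  have hm2 := mul_le_mul_of_nonneg_left hm (by positivity : 0 ≤ (L ^ 3)⁻¹)
  rw [inv_mul_cancel_left₀ (by positivity)] at hm2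
  have hk3 := mul_le_mul_of_nonneg_left hk1' (by positivity : 0 ≤ 8 * Real.pi * a)
  have e4 : (C + 8 * Real.pi * a * (K * (a ^ 2 + 1)) + K * a ^ 2) / L
      = C / L + 8 * Real.pi * a * (K * (a ^ 2 + 1) / L) + K * a ^ 2 / L := by ring
  rw [e4]
  linarith

end FluxSum

end HardSphere

end

/-! ### The Lee-Huang-Yang sum -/

noncomputable section

namespace HardSphere

open Filter Topology

section LeeHuangYang

variable {a ρ₀ v r w L : ℝ} {χ : E3 → ℝ}

lemma hRad_aux (hv : 0 ≤ v) (hr : 0 < r) : 1 ≤ √(1 + 2 * v / r ^ 2) ∧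
    √(1 + 2 * v / r ^ 2) ^ 2 = 1 + 2 * (v / r ^ 2) := by
  have h : 0 ≤ 2 * v / r ^ 2 := by positivity
  refine ⟨Real.one_le_sqrt.2 (by linarith), ?_⟩
  rw [Real.sq_sqrt (by linarith), mul_div_assoc]

lemma hRad_nonneg (hv : 0 ≤ v) (hr : 0 < r) : 0 ≤ hRad v r := by
  obtain ⟨h1, -⟩ := hRad_aux hv hr
  rw [hRad]
  have : 0 ≤ √(1 + 2 * v / r ^ 2) - 1 := by linarith
  positivity

/-- Here (z-1)(z+3) ≤ 6u, while (z-1)² is at most 2u and at most u². The two cases become integrable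
majorants of `hRad` at the origin and at infinity. -/
lemma cube_mul_le {z u : ℝ} (hz : 1 ≤ z) (hu : z ^ 2 = 1 + 2 * u) :
    (z - 1) ^ 3 * (z + 3) ≤ 16 * u ^ 2 ∧ (z - 1) ^ 3 * (z + 3) ≤ 16 * u ^ 3 := by
  have hz0 : 0 ≤ z - 1 := by linarith
  have hu0 : 0 ≤ u := by nlinarith
  have h1 : (z - 1) * (z + 3) ≤ 6 * u := by nlinarith
  have h2 : (z - 1) ^ 2 ≤ 2 * u := by nlinarith
  have h3 : z - 1 ≤ u := by nlinarith
  have h4 : (z - 1) ^ 2 ≤ u ^ 2 := by gcongr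
  constructor
  · calc (z - 1) ^ 3 * (z + 3) = (z - 1) ^ 2 * ((z - 1) * (z + 3)) := by ring
      _ ≤ 2 * u * (6 * u) := by gcongr
      _ ≤ 16 * u ^ 2 := by nlinarith [sq_nonneg u]
  · calc (z - 1) ^ 3 * (z + 3) = (z - 1) ^ 2 * ((z - 1) * (z + 3)) := by ring
      _ ≤ u ^ 2 * (6 * u) := by gcongr
      _ ≤ 16 * u ^ 3 := by nlinarith [pow_nonneg hu0 3]

lemma hRad_le_two (hv : 0 ≤ v) (hr : 0 < r) : hRad v r ≤ v ^ 2 / r ^ 2 := by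
  obtain ⟨h1, h2⟩ := hRad_aux hv hr
  calc hRad v r ≤ r ^ 2 / 16 * (16 * (v / r ^ 2) ^ 2) := by
        exact mul_le_mul_of_nonneg_left (cube_mul_le h1 h2).1 (by positivity)
    _ = v ^ 2 / r ^ 2 := by field_simp

lemma hRad_le_four (hv : 0 ≤ v) (hr : 0 < r) : hRad v r ≤ v ^ 3 / r ^ 4 := by
  obtain ⟨h1, h2⟩ := hRad_aux hv hr
  calc hRad v r ≤ r ^ 2 / 16 * (16 * (v / r ^ 2) ^ 3) := by
        exact mul_le_mul_of_nonneg_left (cube_mul_le h1 h2).2 (by positivity)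
    _ = v ^ 3 / r ^ 4 := by field_simp

/-- The terms of the Lee-Huang-Yang sum. -/
def hMode (v L : ℝ) (n : Fin 3 → ℤ) : ℝ := if n = 0 then 0 else hRad v ‖momentum L n‖

lemma exists_sum_hMode_le : ∃ C : ℝ, 0 < C ∧ ∀ v L : ℝ, 0 < v → 0 < L →
    Summable (hMode v L) ∧ (v = 1 → (L ^ 3)⁻¹ * ∑' n, hMode v L n ≤ C) := by
  obtain ⟨C, hC, hS⟩ := exists_lattice_sum_le (α := 2) (β := 4) (by norm_num) (by norm_num)
  refine ⟨2 * C, by positivity, fun v L hv hL => ?_⟩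
  obtain ⟨h1, h2⟩ := hS L (hMode v L) (v ^ 2) (v ^ 3) 1 hL (by positivity) (by positivity) one_pos
    (fun n => by
      unfold hMode
      split_ifs with hn
      · exact le_rfl
      · exact hRad_nonneg hv.le (norm_momentum_pos hL hn)) (by simp [hMode])
    (fun n hn => by
      rw [hMode, if_neg hn]; exact hRad_le_two hv.le (norm_momentum_pos hL hn))
    (fun n hn => by
      rw [hMode, if_neg hn]; exact hRad_le_four hv.le (norm_momentum_pos hL hn))
  refine ⟨h1, ?_⟩
  rintro rfl
  exact h2.trans (le_of_eq (by ring))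

/-- The energy of all modes. -/
lemma IsCutoff.exists_sum_energy_le (hχ : IsCutoff χ) (ha : 0 < a) : ∃ C : ℝ, 0 < C ∧
    ∀ ρ₀ w L : ℝ, Params a ρ₀ w L → 5 * a ≤ L →
      (L ^ 3)⁻¹ * (∑' n, ‖momentum L n‖ ^ 2 * sHat a ρ₀ L n ^ 2)
        + 2 * ρ₀ * (∑' n, (L ^ 3)⁻¹ * (sHat a ρ₀ L n * (VeffHat a (momentum L n) / 2)))
        + 16 * Real.pi * a * ρ₀ * ((L ^ 3)⁻¹ * ∑' n, sHat a ρ₀ L n ^ 2)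
        + 8 * Real.pi * a * ρ₀ *
          ((L ^ 3)⁻¹ * ∑' n, (√(1 + sHat a ρ₀ L n ^ 2) - 1) * sHat a ρ₀ L n)
      ≤ (L ^ 3)⁻¹ * (∑' n, hMode (8 * Real.pi * a * ρ₀) L n) - 4 * Real.pi * a * ρ₀ ^ 2
        + 8 * Real.pi * a * ρ₀ * ((L ^ 3)⁻¹ * ∑' n, sHat a ρ₀ L n ^ 2)
        + C * (w ^ 6 + ρ₀ ^ 2 / L) := by
  obtain ⟨C, hC⟩ := hχ.exists_sum_VeffHat_sq_ge ha
  obtain ⟨K, hK, hd⟩ := exists_sum_defect_le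
  obtain ⟨M, -, hM⟩ := exists_sum_hMode_le
  refine ⟨|C| + K * a, by positivity, fun ρ₀ w L h h5 => ?_⟩
  have hL := h.hL
  have hρ := h.hρ
  obtain ⟨hd1, hd2⟩ := hd a ρ₀ w L h
  have hV := summable_VeffHat_sq ha hL
  have hCL := hC L h5
  have hs1 := h.summable_momentum_sHat_sq
  have hs0 := h.summable_sHat_sq
  have hsV : Summable fun n => sHat a ρ₀ L n * (VeffHat a (momentum L n) / 2) := by
    refine Summable.of_norm_bounded (hs1.add hV) fun n => ?_
    by_cases hn : n = 0
    · subst hn; simp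
    have hp := norm_momentum_pos hL hn
    rw [Real.norm_eq_abs]
    have e : VeffHat a (momentum L n) ^ 2 / (4 * ‖momentum L n‖ ^ 2)
        = (VeffHat a (momentum L n) / (2 * ‖momentum L n‖)) ^ 2 := by field_simp; norm_num
    have e' : sHat a ρ₀ L n * (VeffHat a (momentum L n) / 2) = ‖momentum L n‖ * sHat a ρ₀ L n
        * (VeffHat a (momentum L n) / (2 * ‖momentum L n‖)) := by field_simp
    rw [e, e', ← mul_pow, abs_le]
    set A := ‖momentum L n‖ * sHat a ρ₀ L n
    set B := VeffHat a (momentum L n) / (2 * ‖momentum L n‖)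
    constructor <;> nlinarith [sq_nonneg (A + B), sq_nonneg (A - B), sq_nonneg A, sq_nonneg B]
  have hg := h.summable_gSubOne_mul
  have hv : 0 < 8 * Real.pi * a * ρ₀ := by positivity
  have hH := (hM _ L hv hL).1
  have hle : ∀ n, ‖momentum L n‖ ^ 2 * sHat a ρ₀ L n ^ 2
      + 2 * ρ₀ * (sHat a ρ₀ L n * (VeffHat a (momentum L n) / 2))
      + 16 * Real.pi * a * ρ₀ * sHat a ρ₀ L n ^ 2
      + 8 * Real.pi * a * ρ₀ * ((√(1 + sHat a ρ₀ L n ^ 2) - 1) * sHat a ρ₀ L n)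
      ≤ hMode (8 * Real.pi * a * ρ₀) L n
        + -ρ₀ ^ 2 * (VeffHat a (momentum L n) ^ 2 / (4 * ‖momentum L n‖ ^ 2))
        + 8 * Real.pi * a * ρ₀ * sHat a ρ₀ L n ^ 2
        + 2 * (8 * Real.pi * a * ρ₀ - ρ₀ * VeffHat a (momentum L n)) * sHat a ρ₀ L n ^ 2 := by
    intro n
    by_cases hn : n = 0
    · subst hn; simp [hMode]
    have hp := norm_momentum_pos hL hn
    have hm := mode_le ha hρ h.hs hp
    rw [hMode, if_neg hn, h.sHat_eq hn]
    have et : ‖momentum L n‖ ^ 2 * tRad a ρ₀ ‖momentum L n‖ = ρ₀ * VeffHat a (momentum L n) := by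
      rw [tRad, VeffHat]; field_simp
    have et2 : ‖momentum L n‖ ^ 2 * tRad a ρ₀ ‖momentum L n‖ ^ 2 / 4
        = ρ₀ ^ 2 * (VeffHat a (momentum L n) ^ 2 / (4 * ‖momentum L n‖ ^ 2)) := by
      rw [tRad, VeffHat]; field_simp
    rw [et2, et] at hm
    linarith
  have hm := hasSum_le hle
    (((hs1.hasSum.add (hsV.hasSum.mul_left (2 * ρ₀))).add
      (hs0.hasSum.mul_left (16 * Real.pi * a * ρ₀))).add (hg.hasSum.mul_left (8 * Real.pi * a * ρ₀)))
    (((hH.hasSum.add (hV.hasSum.mul_left (-ρ₀ ^ 2))).add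
      (hs0.hasSum.mul_left (8 * Real.pi * a * ρ₀))).add hd1.hasSum)
  have hm2 := mul_le_mul_of_nonneg_left hm (by positivity : 0 ≤ (L ^ 3)⁻¹)
  have hCL2 := mul_le_mul_of_nonneg_left hCL (sq_nonneg ρ₀)
  rw [tsum_mul_left]
  have hCabs : ρ₀ ^ 2 * (C / L) ≤ |C| * (ρ₀ ^ 2 / L) := by
    calc ρ₀ ^ 2 * (C / L) = C * (ρ₀ ^ 2 / L) := by ring
      _ ≤ _ := by gcongr; exact le_abs_self C
  have p1 : 0 ≤ |C| * w ^ 6 := by have := h.hw0; positivity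
  have p2 : 0 ≤ K * a * (ρ₀ ^ 2 / L) := by positivity
  have e5 : (|C| + K * a) * (w ^ 6 + ρ₀ ^ 2 / L)
      = |C| * w ^ 6 + |C| * (ρ₀ ^ 2 / L) + K * (a * w ^ 6) + K * a * (ρ₀ ^ 2 / L) := by ring
  rw [e5]
  linarith

lemma hRad_eq_mul (hv : 0 < v) (hr : 0 < r) : hRad v r = v * hRad 1 (r / √v) := by
  have h : (r / √v) ^ 2 = r ^ 2 / v := by rw [div_pow, Real.sq_sqrt hv.le]
  rw [hRad, hRad, h, show 2 * 1 / (r ^ 2 / v) = 2 * v / r ^ 2 by field_simp]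
  field_simp

/-- Momenta are measured in units of √v. This reduces every coupling to v = 1 in a box of side √v L;
one factor v and the density v^(3/2) of modes combine to √v⁵. -/
lemma sum_hMode_eq (hv : 0 < v) (hL : 0 < L) : (L ^ 3)⁻¹ * ∑' n, hMode v L n
    = √v ^ 5 * (((√v * L) ^ 3)⁻¹ * ∑' n, hMode 1 (√v * L) n) := by
  have hs : 0 < √v := Real.sqrt_pos.2 hv
  have e : ∀ n, hMode v L n = v * hMode 1 (√v * L) n := fun n => by
    unfold hMode
    split_ifs with hn
    · simp
    · rw [hRad_eq_mul hv (norm_momentum_pos hL hn), norm_momentum hL, norm_momentum (by positivity)]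
      congr 2
      field_simp
  simp only [e, tsum_mul_left]
  have : v = √v ^ 2 := (Real.sq_sqrt hv.le).symm
  nth_rewrite 1 [this]
  field_simp

lemma continuousAt_hRad_norm {x : E3} (hx : x ≠ 0) : ContinuousAt (fun x : E3 => hRad 1 ‖x‖) x := by
  have h1 : ContinuousAt (fun x : E3 => √(1 + 2 * 1 / ‖x‖ ^ 2)) x :=
    (continuousAt_const.add (continuousAt_const.div (continuous_norm.pow 2).continuousAt
      (pow_ne_zero 2 (norm_ne_zero_iff.2 hx)))).sqrt
  unfold hRad
  fun_prop

/-- In this form the integrand extends smoothly to q = 0 and has an elementary primitive; the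
polynomial cancels the leading terms of the root at infinity. -/
lemma sq_mul_hRad {q : ℝ} (hq : 0 < q) : q ^ 2 * hRad 1 q
    = (q ^ 3 * √(q ^ 2 + 2) - q ^ 4 - q ^ 2 + 1 / 2) / 2 := by
  have hz : √(1 + 2 * 1 / q ^ 2) = √(q ^ 2 + 2) / q := by
    rw [show 1 + 2 * 1 / q ^ 2 = (q ^ 2 + 2) / q ^ 2 by field_simp, Real.sqrt_div (by positivity),
      Real.sqrt_sq hq.le]
  have hQ : √(q ^ 2 + 2) ^ 2 = q ^ 2 + 2 := Real.sq_sqrt (by positivity)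
  rw [hRad, hz]
  set Q := √(q ^ 2 + 2)
  field_simp
  linear_combination 4 * (Q ^ 2 - 5 * q ^ 2 + 2) * hQ

/-- A primitive of `q² hRad 1 q`. -/
def hPrim (q : ℝ) : ℝ :=
  (√(q ^ 2 + 2) ^ 5 / 5 - 2 * √(q ^ 2 + 2) ^ 3 / 3 - q ^ 5 / 5 - q ^ 3 / 3 + q / 2) / 2

lemma hasDerivAt_hPrim (q : ℝ) : HasDerivAt hPrim
    ((q ^ 3 * √(q ^ 2 + 2) - q ^ 4 - q ^ 2 + 1 / 2) / 2) q := by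
  have hpos : 0 < q ^ 2 + 2 := by positivity
  have hQ : √(q ^ 2 + 2) ^ 2 = q ^ 2 + 2 := Real.sq_sqrt hpos.le
  have hQ0 : 0 < √(q ^ 2 + 2) := Real.sqrt_pos.2 hpos
  have h1 : HasDerivAt (fun q : ℝ => √(q ^ 2 + 2)) (2 * q / (2 * √(q ^ 2 + 2))) q := by
    have := ((hasDerivAt_pow 2 q).add_const (2 : ℝ)).sqrt hpos.ne'
    simpa using this
  have h := ((((((h1.fun_pow 5).div_const 5).sub (((h1.fun_pow 3).const_mul 2).div_const 3)).sub
    ((hasDerivAt_pow 5 q).div_const 5)).sub ((hasDerivAt_pow 3 q).div_const 3)).add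
    ((hasDerivAt_id q).div_const 2)).div_const 2
  refine HasDerivAt.congr_deriv (f := hPrim) h ?_
  set Q := √(q ^ 2 + 2)
  push_cast
  field_simp
  linear_combination (2 * q * Q) * hQ

lemma hPrim_zero : hPrim 0 = -(4 * √2 / 15) := by
  have h2 : √2 ^ 2 = (2 : ℝ) := Real.sq_sqrt (by norm_num)
  have e : √((0 : ℝ) ^ 2 + 2) = √2 := by norm_num
  rw [hPrim, e, show √2 ^ 5 = √2 ^ 2 * √2 ^ 2 * √2 by ring, show √2 ^ 3 = √2 ^ 2 * √2 by ring, h2]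
  ring

/-- Squaring removes the root and leaves a polynomial inequality in q². The sign at large q is
enough, since only an upper bound for the integral is needed. -/
lemma hPrim_nonpos {q : ℝ} (hq : 2 ≤ q) : hPrim q ≤ 0 := by
  have hQ : √(q ^ 2 + 2) ^ 2 = q ^ 2 + 2 := Real.sq_sqrt (by positivity)
  have hq2 : 4 ≤ q ^ 2 := by nlinarith
  set Q := √(q ^ 2 + 2) with hQd
  have hQ0 : 0 ≤ Q := Real.sqrt_nonneg _
  have hR : 0 ≤ q * (3 * (q ^ 2) ^ 2 + 5 * q ^ 2 - 15 / 2) :=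
    mul_nonneg (by linarith) (by nlinarith)
  have hle : Q ^ 3 * (3 * q ^ 2 - 4) ≤ q * (3 * (q ^ 2) ^ 2 + 5 * q ^ 2 - 15 / 2) := by
    refine (pow_le_pow_iff_left₀ (mul_nonneg (by positivity) (by linarith)) hR two_ne_zero).1 ?_
    have e1 : (Q ^ 3 * (3 * q ^ 2 - 4)) ^ 2 = (q ^ 2 + 2) ^ 3 * (3 * q ^ 2 - 4) ^ 2 := by
      rw [← hQ]; ring
    rw [e1]
    nlinarith
  have e : hPrim q = (Q ^ 3 * (3 * q ^ 2 - 4) - q * (3 * (q ^ 2) ^ 2 + 5 * q ^ 2 - 15 / 2)) / 30 := by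
    rw [hPrim, ← hQd, show Q ^ 5 = Q ^ 2 * Q ^ 3 by ring, hQ]
    ring
  rw [e]; linarith

lemma integral_sq_mul_hRad_le : ∫ q in Set.Ioi (0 : ℝ), q ^ 2 * hRad 1 q ≤ 4 * √2 / 15 := by
  by_cases hi : IntegrableOn (fun q : ℝ => q ^ 2 * hRad 1 q) (Set.Ioi 0)
  · have ht := intervalIntegral_tendsto_integral_Ioi 0 hi tendsto_id
    refine le_of_tendsto ht ?_
    filter_upwards [eventually_ge_atTop 2] with R hR
    have e : ∫ q in (0 : ℝ)..R, q ^ 2 * hRad 1 q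
        = ∫ q in (0 : ℝ)..R, (q ^ 3 * √(q ^ 2 + 2) - q ^ 4 - q ^ 2 + 1 / 2) / 2 := by
      rw [intervalIntegral.integral_of_le (by linarith), intervalIntegral.integral_of_le (by linarith)]
      exact setIntegral_congr_fun measurableSet_Ioc fun q hq => sq_mul_hRad hq.1
    rw [id, e, intervalIntegral.integral_eq_sub_of_hasDerivAt (fun q _ => hasDerivAt_hPrim q)
      (Continuous.intervalIntegrable (by fun_prop) _ _), hPrim_zero]
    linarith [hPrim_nonpos hR]
  -- Without integrability the integral would be 0 by convention, and the bound would hold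
  -- trivially.
  · rw [integral_undef hi]; positivity

lemma integral_hRad_norm_le :
    ((2 * Real.pi) ^ 3)⁻¹ * ∫ x : E3, hRad 1 ‖x‖ ≤ 2 * √2 / (15 * Real.pi ^ 2) := by
  have h := integral_fun_norm_addHaar (volume : Measure E3) (fun q => hRad 1 q)
  have hv : volume.real (Metric.ball (0 : E3) 1) = 4 * Real.pi / 3 := by
    rw [measureReal_def, EuclideanSpace.volume_ball_fin_three]
    simp only [ENNReal.ofReal_one, one_pow, one_mul]
    rw [ENNReal.toReal_ofReal (by positivity)]
    ring
  rw [h, hv]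
  simp only [finrank_euclideanSpace, Fintype.card_fin, smul_eq_mul, nsmul_eq_mul]
  have hI := integral_sq_mul_hRad_le
  calc _ = (2 * Real.pi ^ 2)⁻¹ * ∫ q in Set.Ioi (0 : ℝ), q ^ 2 * hRad 1 q := by
        norm_num; field_simp; norm_num
    _ ≤ (2 * Real.pi ^ 2)⁻¹ * (4 * √2 / 15) := by gcongr
    _ = _ := by field_simp; norm_num

/-- The Lee-Huang-Yang sum in large boxes. -/
lemma eventually_sum_hMode_le (hw : 0 < w) {ε : ℝ} (hε : 0 < ε) : ∀ᶠ L in atTop, ∀ v, 0 < v →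
    v ≤ w ^ 2 → (L ^ 3)⁻¹ * ∑' n, hMode v L n ≤ w ^ 5 * (2 * √2 / (15 * Real.pi ^ 2)) + ε := by
  obtain ⟨B, hB, hS⟩ := exists_sum_hMode_le
  have ht : Tendsto (fun L : ℝ => (L ^ 3)⁻¹ * ∑' n, hMode 1 L n) atTop
      (𝓝 (((2 * Real.pi) ^ 3)⁻¹ * ∫ x : E3, hRad 1 ‖x‖)) := by
    refine tendsto_lattice_sum (α := 2) (β := 4) (by norm_num) (by norm_num)
      (fun x hx => continuousAt_hRad_norm hx) zero_le_one fun x hx => ?_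
    have hx' := norm_pos_iff.2 hx
    rw [abs_of_nonneg (hRad_nonneg zero_le_one hx'), one_mul, profile]
    split_ifs
    · simpa using hRad_le_two zero_le_one hx'
    · simpa using hRad_le_four zero_le_one hx'
  have hJ := integral_hRad_norm_le
  set J := ((2 * Real.pi) ^ 3)⁻¹ * ∫ x : E3, hRad 1 ‖x‖
  obtain ⟨R, hR⟩ := eventually_atTop.1
    (ht.eventually_le_const (show J < J + ε / w ^ 5 by have : 0 < ε / w ^ 5 := by positivity
                                                       linarith))
  have ht2 : Tendsto (fun L : ℝ => (|R| / L) ^ 5 * B) atTop (𝓝 0) := by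
    have := ((tendsto_const_nhds (x := |R|)).div_atTop (tendsto_id (α := ℝ) (x := atTop))).pow 5
    simpa using this.mul_const B
  filter_upwards [ht2.eventually_le_const hε, eventually_gt_atTop 0] with L hLε hL v hv hvw
  have hs : 0 < √v := Real.sqrt_pos.2 hv
  have hsw : √v ≤ w := Real.sqrt_le_iff.2 ⟨hw.le, hvw⟩
  have hpos : 0 ≤ 2 * √2 / (15 * Real.pi ^ 2) := by positivity
  rw [sum_hMode_eq hv hL]
  -- The coupling may be arbitrarily small compared with L, so the rescaled side √v L need not be
  -- large. If it is not, then √v ≤ |R|/L, and a bound uniform in the side makes the sum small.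
  rcases le_or_gt R (√v * L) with hRL | hRL
  · have hJb : J + ε / w ^ 5 ≤ 2 * √2 / (15 * Real.pi ^ 2) + ε / w ^ 5 := by linarith
    calc √v ^ 5 * (((√v * L) ^ 3)⁻¹ * ∑' n, hMode 1 (√v * L) n)
        ≤ √v ^ 5 * (2 * √2 / (15 * Real.pi ^ 2) + ε / w ^ 5) := by
          gcongr; exact (hR _ hRL).trans hJb
      _ ≤ w ^ 5 * (2 * √2 / (15 * Real.pi ^ 2) + ε / w ^ 5) := by gcongr
      _ = _ := by field_simp
  · have hsR : √v ≤ |R| / L := by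
      rw [le_div_iff₀ hL]; exact hRL.le.trans (le_abs_self R)
    calc √v ^ 5 * (((√v * L) ^ 3)⁻¹ * ∑' n, hMode 1 (√v * L) n)
        ≤ √v ^ 5 * B := by
          gcongr; exact (hS 1 (√v * L) one_pos (by positivity)).2 rfl
      _ ≤ (|R| / L) ^ 5 * B := by gcongr
      _ ≤ ε := hLε
      _ ≤ _ := by
          have : 0 ≤ w ^ 5 * (2 * √2 / (15 * Real.pi ^ 2)) := by positivity
          linarith

end LeeHuangYang

end HardSphere

end

/-! ### Assembly and the choice of scales -/

noncomputable section

namespace HardSphere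

open Filter Topology

section Assembly

variable {a : ℝ} {χ φ : E3 → ℝ}

/-- The energy bound in terms of the length scales, in large boxes. -/
lemma IsCutoff.exists_reducedEnergy_le (hχ : IsCutoff χ) (hφ : IsProfile φ) (ha : 0 < a) :
    ∃ C M : ℝ, 0 < C ∧ 0 < M ∧ ∀ w l l₀ ε : ℝ, 0 < w → w ≤ 1 → M ≤ l → 4 * l ≤ l₀ → 1 ≤ w * l₀ →
      0 < ε → ∀ᶠ L in atTop, ∀ ρ₀, Params a ρ₀ w L →
        gradNormSq L (theta a χ l l₀ ρ₀ L) ≠ ⊤ ∧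
        reducedEnergy a χ l l₀ ρ₀ L
          ≤ 4 * Real.pi * a * ρ₀ ^ 2
            + 8 * Real.pi * a * ρ₀ * normSq L (sigma a χ φ l l₀ ρ₀ L)
            + w ^ 5 * (2 * √2 / (15 * Real.pi ^ 2))
            + C * (w ^ 6 * l ^ 3 + w ^ 3 / l₀ ^ 2 + w ^ 4 / l₀ + w ^ 5 * l ^ 3 / l₀ ^ 2) + ε := by
  obtain ⟨K, hK0, hK⟩ := exists_abs_le hχ.smooth.continuous hχ.hasCompactSupport
  obtain ⟨C₁, hC₁, hE⟩ := hχ.exists_energy_le ha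
  obtain ⟨C₂, hC₂, hS⟩ := hχ.exists_sum_energy_le ha
  obtain ⟨C₃, M, hC₃, hN⟩ := hχ.exists_normSq_sFun_le hφ ha
  -- The threshold on l ensures l ≥ 𝔞, the threshold of the norm comparison, and f_ℓ ≥ 1/2 off the
  -- region where the inner cutoff is 1. The factor 1/𝔞³ turns the bare error w⁶ into w⁶l³.
  refine ⟨C₁ + C₂ / a ^ 3 + C₃, a + |M| + 2 * |K| * a, by positivity, by positivity,
    fun w l l₀ ε hw hw1 hMl hll hwl hε => ?_⟩
  have hKa : 0 ≤ 2 * |K| * a := by positivity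
  have hal : a ≤ l := by linarith [abs_nonneg M]
  have hMl' : M ≤ l := by linarith [le_abs_self M]
  have hKl : 2 * K * a ≤ l := by
    have : 2 * K * a ≤ 2 * |K| * a := by gcongr; exact le_abs_self K
    linarith [abs_nonneg M]
  have hl0 : 0 < l := by linarith
  have hl₀ : 0 < l₀ := by linarith
  have ht : Tendsto (fun L : ℝ => C₂ * ((w ^ 2 / a) ^ 2 / L)) atTop (𝓝 0) := by
    simpa using ((tendsto_const_nhds (x := (w ^ 2 / a) ^ 2)).div_atTop
      (tendsto_id (α := ℝ) (x := atTop))).const_mul C₂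
  filter_upwards [hE w l l₀ hw hw1 hal hll, hN w l l₀ hw hw1 hal hMl' hll hwl,
    eventually_sum_hMode_le hw (half_pos hε), ht.eventually_le_const (half_pos hε),
    eventually_ge_atTop (5 * a), eventually_ge_atTop (4 * l₀)] with L hEL hNL hHL hLε h5 hLl ρ₀ h
  have hρ := h.hρ
  have hL := h.hL
  have hη₁ : ContDiff ℝ ∞ (cutoff χ (l / 2)) := contDiff_cutoff hχ.smooth _
  have hη : ContDiff ℝ ∞ fun x => cutoff χ (l₀ / 2) x - cutoff χ (l / 2) x :=
    (contDiff_cutoff hχ.smooth _).sub hη₁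
  have hz₁ : ∀ x : E3, L / 2 < ‖x‖ → cutoff χ (l / 2) x = 0 := fun x hx =>
    cutoff_eq_zero (by positivity) hχ.eq_zero (by linarith)
  have hz : ∀ x : E3, L / 2 < ‖x‖ → cutoff χ (l₀ / 2) x - cutoff χ (l / 2) x = 0 := fun x hx => by
    rw [hz₁ x hx, cutoff_eq_zero (by positivity) hχ.eq_zero (by linarith), sub_zero]
  have hg := gradNormSq_le (h.isWeakGradient_gradCut hη hη₁ hz hz₁)
  rw [← hχ.theta_eq ha hK hKl hl0 hll] at hg
  refine ⟨ne_top_of_le_ne_top ENNReal.ofReal_ne_top hg, ?_⟩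
  have hg' := ENNReal.toReal_le_of_le_ofReal (by positivity) hg
  have hE' := hEL ρ₀ h
  have hS' := hS ρ₀ w L h h5
  have hH' := hHL (8 * Real.pi * a * ρ₀) (by positivity) h.hw
  -- After the mode sum a term 8π𝔞ρ₀‖s‖² remains; here it is exchanged for 8π𝔞ρ₀‖σ‖².
  have hN' := mul_le_mul_of_nonneg_left (hNL ρ₀ h) (by positivity : 0 ≤ 8 * Real.pi * a * ρ₀)
  have hns : normSq L (sFun a ρ₀ L) = (L ^ 3)⁻¹ * ∑' n, sHat a ρ₀ L n ^ 2 := h.integral_sFun_sq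
  rw [hns] at hN'
  rw [reducedEnergy, hns, h.conv_eq]
  have b1 : 8 * Real.pi * a * ρ₀ * (C₃ * (w ^ 2 / l₀ + w ^ 4 * l ^ 3 + w ^ 3 * l ^ 3 / l₀ ^ 2))
      ≤ C₃ * (w ^ 4 / l₀ + w ^ 6 * l ^ 3 + w ^ 5 * l ^ 3 / l₀ ^ 2) := by
    calc _ ≤ w ^ 2 * (C₃ * (w ^ 2 / l₀ + w ^ 4 * l ^ 3 + w ^ 3 * l ^ 3 / l₀ ^ 2)) := by
          gcongr; exact h.hw
      _ = _ := by ring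
  have b2 : C₂ * w ^ 6 ≤ C₂ / a ^ 3 * (w ^ 6 * l ^ 3) := by
    calc C₂ * w ^ 6 = C₂ / a ^ 3 * (w ^ 6 * a ^ 3) := by field_simp
      _ ≤ _ := by gcongr
  have b3 : C₂ * (ρ₀ ^ 2 / L) ≤ ε / 2 := by
    refine le_trans ?_ hLε
    gcongr
    rw [le_div_iff₀ ha]
    have := h.hw
    nlinarith [Real.pi_gt_three, mul_pos ha hρ]
  have q1 : 0 ≤ w ^ 6 * l ^ 3 := by positivity
  have q2 : 0 ≤ w ^ 3 / l₀ ^ 2 := by positivity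
  have q3 : 0 ≤ w ^ 4 / l₀ := by positivity
  have q4 : 0 ≤ w ^ 5 * l ^ 3 / l₀ ^ 2 := by positivity
  have q5 : 0 ≤ C₂ / a ^ 3 := by positivity
  have f1 := mul_nonneg hC₁.le (add_nonneg q3 q4)
  have f2 := mul_nonneg q5 (add_nonneg (add_nonneg q2 q3) q4)
  have f3 := mul_nonneg hC₃.le q2
  rw [mul_add] at hS'
  have e : (C₁ + C₂ / a ^ 3 + C₃)
      * (w ^ 6 * l ^ 3 + w ^ 3 / l₀ ^ 2 + w ^ 4 / l₀ + w ^ 5 * l ^ 3 / l₀ ^ 2)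
      = C₁ * (w ^ 6 * l ^ 3 + w ^ 3 / l₀ ^ 2) + C₁ * (w ^ 4 / l₀ + w ^ 5 * l ^ 3 / l₀ ^ 2)
        + C₂ / a ^ 3 * (w ^ 6 * l ^ 3)
        + C₂ / a ^ 3 * (w ^ 3 / l₀ ^ 2 + w ^ 4 / l₀ + w ^ 5 * l ^ 3 / l₀ ^ 2)
        + C₃ * (w ^ 4 / l₀ + w ^ 6 * l ^ 3 + w ^ 5 * l ^ 3 / l₀ ^ 2)
        + C₃ * (w ^ 3 / l₀ ^ 2) := by ring
  rw [e]
  linarith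

/-- The leading terms of the energy in terms of the density. -/
lemma leeHuangYang_eq (ha : 0 < a) {ρ : ℝ} (hρ : 0 < ρ) :
    √(8 * Real.pi * a * ρ) ^ 5 * (2 * √2 / (15 * Real.pi ^ 2))
      = 4 * Real.pi * a * ρ ^ 2 * (128 / (15 * √Real.pi) * (ρ * a ^ 3) ^ (1 / 2 : ℝ)) := by
  have hp := Real.pi_pos
  have e1 : (ρ * a ^ 3) ^ (1 / 2 : ℝ) = a * √(ρ * a) := by
    rw [← Real.sqrt_eq_rpow, show ρ * a ^ 3 = a ^ 2 * (ρ * a) by ring, Real.sqrt_mul (by positivity),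
      Real.sqrt_sq ha.le]
  have e2 : √(8 * Real.pi * a * ρ) = 2 * √2 * √Real.pi * √(ρ * a) := by
    rw [show 8 * Real.pi * a * ρ = 2 ^ 2 * 2 * Real.pi * (ρ * a) by ring, Real.sqrt_mul (by positivity),
      Real.sqrt_mul (by positivity), Real.sqrt_mul (by positivity), Real.sqrt_sq (by norm_num)]
  have h2 : √2 ^ 2 = (2 : ℝ) := Real.sq_sqrt (by norm_num)
  have hpi : √Real.pi ^ 2 = Real.pi := Real.sq_sqrt hp.le
  have hra : √(ρ * a) ^ 2 = ρ * a := Real.sq_sqrt (by positivity)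
  have hs : 0 < √Real.pi := Real.sqrt_pos.2 hp
  rw [e1, e2]
  set s := √Real.pi
  set t := √(ρ * a)
  have e3 : (2 * √2 * s * t) ^ 5 * (2 * √2 / (15 * Real.pi ^ 2))
      = 64 * (√2 ^ 2) ^ 3 * (s ^ 2) ^ 2 * s * (t ^ 2) ^ 2 * t / (15 * Real.pi ^ 2) := by ring
  rw [e3, h2, hpi, hra]
  rw [← hpi]
  field_simp
  ring

lemma eventually_rpow_le {x c : ℝ} (hx : 0 < x) (hc : 0 < c) : ∀ᶠ ρ : ℝ in 𝓝[>] 0, ρ ^ x ≤ c := by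
  have h : Tendsto (fun ρ : ℝ => ρ ^ x) (𝓝[>] 0) (𝓝 0) := by
    have := (Real.continuousAt_rpow_const 0 x (Or.inr hx.le)).tendsto
    rw [Real.zero_rpow hx.ne'] at this
    exact this.mono_left nhdsWithin_le_nhds
  exact h.eventually_le_const hc

lemma rpow_mul_pow {ρ : ℝ} (hρ : 0 < ρ) (x : ℝ) (n : ℕ) : (ρ ^ x) ^ n = ρ ^ (x * n) := by
  rw [Real.rpow_mul hρ.le, Real.rpow_natCast]

lemma ell_eq (ha : 0 < a) {ρ : ℝ} (hρ : 0 < ρ) (δ : ℝ) :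
    ell a ρ δ = a * (a ^ 3) ^ (-δ) * ρ ^ (-δ) := by
  rw [ell, Real.mul_rpow hρ.le (by positivity)]; ring

lemma ell0_eq (ha : 0 < a) {ρ : ℝ} (hρ : 0 < ρ) (ε : ℝ) :
    ell0 a ρ ε = a ^ (-(1 / 2) : ℝ) * (a ^ 3) ^ (-ε) / ρ ^ (1 / 2 + ε) := by
  have e : (ρ ^ (1 / 2 + ε))⁻¹ = ρ ^ (-(1 / 2) : ℝ) * ρ ^ (-ε) := by
    rw [← Real.rpow_neg hρ.le, neg_add, Real.rpow_add hρ]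
  rw [ell0, Real.mul_rpow hρ.le ha.le, Real.mul_rpow hρ.le (by positivity), div_eq_mul_inv (_ * _), e]
  ring

lemma sqrt_coupling_eq (ha : 0 < a) {ρ : ℝ} :
    √(8 * Real.pi * a * ρ) = √(8 * Real.pi * a) * ρ ^ (1 / 2 : ℝ) := by
  rw [Real.sqrt_mul (by positivity), Real.sqrt_eq_rpow ρ]

/-- The four errors have the exponents 3 - 3δ, 5/2 + 2ε, 5/2 + ε and 7/2 + 2ε - 3δ in ρ. The third,
from the tail and the mean of s at scale ℓ₀, is the one that fixes the final rate. -/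
lemma exists_scales_le {A B D ε δ : ℝ} (hA : 0 < A) (hB : 0 < B) (hD : 0 < D) (hε : 0 < ε)
    (hε' : ε < 1 / 100) (hδ' : δ < 1 / 100) : ∃ K : ℝ, 0 < K ∧ ∀ ρ w l l₀ : ℝ, 0 < ρ →
      ρ ≤ 1 → w = D * ρ ^ (1 / 2 : ℝ) → l = A * ρ ^ (-δ) → l₀ = B / ρ ^ (1 / 2 + ε) →
      w ^ 6 * l ^ 3 + w ^ 3 / l₀ ^ 2 + w ^ 4 / l₀ + w ^ 5 * l ^ 3 / l₀ ^ 2 ≤ K * ρ ^ (5 / 2 + ε) := by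
  refine ⟨D ^ 6 * A ^ 3 + D ^ 3 / B ^ 2 + D ^ 4 / B + D ^ 5 * A ^ 3 / B ^ 2, by positivity,
    fun ρ w l l₀ hρ hρ1 hw hl hl₀ => ?_⟩
  have key : ∀ k y : ℝ, 0 ≤ k → 5 / 2 + ε ≤ y → k * ρ ^ y ≤ k * ρ ^ (5 / 2 + ε) := fun k y hk hy =>
    mul_le_mul_of_nonneg_left (Real.rpow_le_rpow_of_exponent_ge hρ hρ1 hy) hk
  have hq : ∀ y : ℝ, 0 < ρ ^ y := fun y => Real.rpow_pos_of_pos hρ y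
  have e1 : w ^ 6 * l ^ 3 = D ^ 6 * A ^ 3 * ρ ^ (3 - 3 * δ) := by
    rw [hw, hl, mul_pow, mul_pow, rpow_mul_pow hρ, rpow_mul_pow hρ,
      show 3 - 3 * δ = 1 / 2 * (6 : ℕ) + -δ * (3 : ℕ) by push_cast; ring, Real.rpow_add hρ]
    ring
  have e2 : w ^ 3 / l₀ ^ 2 = D ^ 3 / B ^ 2 * ρ ^ (5 / 2 + 2 * ε) := by
    rw [hw, hl₀, mul_pow, div_pow, rpow_mul_pow hρ, rpow_mul_pow hρ,
      show 5 / 2 + 2 * ε = 1 / 2 * (3 : ℕ) + (1 / 2 + ε) * (2 : ℕ) by push_cast; ring,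
      Real.rpow_add hρ]
    field_simp
  have e3 : w ^ 4 / l₀ = D ^ 4 / B * ρ ^ (5 / 2 + ε) := by
    rw [hw, hl₀, mul_pow, rpow_mul_pow hρ,
      show 5 / 2 + ε = 1 / 2 * (4 : ℕ) + (1 / 2 + ε) by push_cast; ring,
      Real.rpow_add hρ (1 / 2 * (4 : ℕ))]
    have := hq (1 / 2 + ε)
    field_simp
  have e4 : w ^ 5 * l ^ 3 / l₀ ^ 2 = D ^ 5 * A ^ 3 / B ^ 2 * ρ ^ (7 / 2 + 2 * ε - 3 * δ) := by
    rw [hw, hl, hl₀, mul_pow, mul_pow, div_pow, rpow_mul_pow hρ, rpow_mul_pow hρ, rpow_mul_pow hρ,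
      show 7 / 2 + 2 * ε - 3 * δ = 1 / 2 * (5 : ℕ) + (1 / 2 + ε) * (2 : ℕ) + -δ * (3 : ℕ) by
        push_cast; ring,
      Real.rpow_add hρ, Real.rpow_add hρ]
    have := hq (1 / 2 + ε)
    field_simp
  have k1 := key (D ^ 6 * A ^ 3) (3 - 3 * δ) (by positivity) (by linarith)
  have k2 := key (D ^ 3 / B ^ 2) (5 / 2 + 2 * ε) (by positivity) (by linarith)
  have k4 := key (D ^ 5 * A ^ 3 / B ^ 2) (7 / 2 + 2 * ε - 3 * δ) (by positivity) (by linarith)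
  rw [e1, e2, e3, e4]
  linarith

lemma eventually_scales {A B D M ε δ : ℝ} (hA : 0 < A) (hB : 0 < B) (hD : 0 < D) (hM : 0 < M)
    (hε : 0 < ε) (hδ : 0 < δ) (hδ' : δ < 1 / 100) : ∀ᶠ ρ : ℝ in 𝓝[>] 0, D * ρ ^ (1 / 2 : ℝ) ≤ 1 ∧
      M ≤ A * ρ ^ (-δ) ∧ 4 * (A * ρ ^ (-δ)) ≤ B / ρ ^ (1 / 2 + ε) ∧
      1 ≤ D * ρ ^ (1 / 2 : ℝ) * (B / ρ ^ (1 / 2 + ε)) := by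
  filter_upwards [eventually_rpow_le (x := 1 / 2) (c := 1 / D) (by norm_num) (by positivity),
    eventually_rpow_le (c := A / M) hδ (by positivity),
    eventually_rpow_le (x := 1 / 2 + ε - δ) (c := B / (4 * A)) (by linarith) (by positivity),
    eventually_rpow_le (c := D * B) hε (by positivity), self_mem_nhdsWithin] with ρ h1 h2 h3 h4 hρ
  rw [Set.mem_Ioi] at hρ
  have hq : ∀ y : ℝ, 0 < ρ ^ y := fun y => Real.rpow_pos_of_pos hρ y
  have p1 := hq (1 / 2)
  have p2 := hq δ
  have p3 := hq (1 / 2 + ε)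
  have p4 := hq ε
  refine ⟨?_, ?_, ?_, ?_⟩
  · rw [le_div_iff₀ hD] at h1; linarith
  · rw [Real.rpow_neg hρ.le, ← div_eq_mul_inv, le_div_iff₀ p2]
    rw [le_div_iff₀ hM] at h2; linarith
  · rw [le_div_iff₀ p3]
    rw [le_div_iff₀ (by positivity), sub_eq_add_neg, Real.rpow_add hρ] at h3
    linarith
  · rw [Real.rpow_add hρ]
    have : D * ρ ^ (1 / 2 : ℝ) * (B / (ρ ^ (1 / 2 : ℝ) * ρ ^ ε)) = D * B / ρ ^ ε := by field_simp
    rwa [this, le_div_iff₀ p4, one_mul]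

/-- Completing the square, ρ₀² + 2ρ₀N ≤ (ρ₀+N)². The excess density contributes ρ^(11/4 - 11ε - δ)
to first order, which is within the error because 12ε + δ ≤ 1/4. -/
lemma condensate_energy_le (ha : 0 < a) {ρ ρ₀ N ε δ C : ℝ} (hρ : 0 < ρ) (hρ1 : ρ ≤ 1) (hρ₀ : 0 ≤ ρ₀)
    (hN : 0 ≤ N) (hC : 0 ≤ C) (hε' : ε < 1 / 100) (hδ' : δ < 1 / 100)
    (h : ρ₀ + N ≤ ρ + C * ρ ^ (7 / 4 - 11 * ε - δ)) :
    4 * Real.pi * a * ρ₀ ^ 2 + 8 * Real.pi * a * ρ₀ * N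
      ≤ 4 * Real.pi * a * ρ ^ 2 + 4 * Real.pi * a * (2 * C + C ^ 2) * ρ ^ (5 / 2 + ε) := by
  set g := ρ ^ (7 / 4 - 11 * ε - δ) with hg
  have h1 : ρ * g ≤ ρ ^ (5 / 2 + ε) := by
    rw [hg]
    nth_rewrite 1 [← Real.rpow_one ρ]
    rw [← Real.rpow_add hρ]
    exact Real.rpow_le_rpow_of_exponent_ge hρ hρ1 (by linarith)
  have h2 : g ^ 2 ≤ ρ ^ (5 / 2 + ε) := by
    rw [hg, rpow_mul_pow hρ]
    exact Real.rpow_le_rpow_of_exponent_ge hρ hρ1 (by push_cast; linarith)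
  have hsq : (ρ₀ + N) ^ 2 ≤ (ρ + C * g) ^ 2 := by gcongr
  have h3 : ρ₀ ^ 2 + 2 * ρ₀ * N ≤ ρ ^ 2 + (2 * C + C ^ 2) * ρ ^ (5 / 2 + ε) := by
    have i1 := mul_le_mul_of_nonneg_left h1 hC
    have i2 := mul_le_mul_of_nonneg_left h2 (sq_nonneg C)
    nlinarith [sq_nonneg N]
  have := mul_le_mul_of_nonneg_left h3 (by positivity : 0 ≤ 4 * Real.pi * a)
  linarith

end Assembly

end HardSphere

end

open HardSphere in
theorem lemma3p2 :
    ∃ κ : ℝ, 0 < κ ∧ ∀ (a : ℝ) (χ φ : E3 → ℝ), 0 < a → IsCutoff χ → IsProfile φ →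
      ∀ ε δ : ℝ, 0 < ε → ε < κ → 0 < δ → δ < κ →
      ∀ C₁ C₂ : ℝ, 0 < C₁ → C₁ < C₂ →
      ∃ C ρmax : ℝ, 0 < C ∧ 0 < ρmax ∧ ∀ ρ : ℝ, 0 < ρ → ρ < ρmax →
      ∃ Lmin : ℝ, 0 < Lmin ∧ ∀ L : ℝ, Lmin ≤ L → ∀ ρ₀ : ℝ, 0 < ρ₀ → ρ₀ < ρ →
        ρ + C₁ * ρ ^ (7 / 4 - 11 * ε - δ) ≤
          ρ₀ + normSq L (sigma a χ φ (ell a ρ δ) (ell0 a ρ ε) ρ₀ L) →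
        ρ₀ + normSq L (sigma a χ φ (ell a ρ δ) (ell0 a ρ ε) ρ₀ L) ≤
          ρ + C₂ * ρ ^ (7 / 4 - 11 * ε - δ) →
        gradNormSq L (theta a χ (ell a ρ δ) (ell0 a ρ ε) ρ₀ L) ≠ ⊤ ∧
        reducedEnergy a χ (ell a ρ δ) (ell0 a ρ ε) ρ₀ L ≤
          4 * Real.pi * a * ρ ^ 2 *
              (1 + 128 / (15 * √Real.pi) * (ρ * a ^ 3) ^ (1 / 2 : ℝ))
            + C * ρ ^ (5 / 2 + ε) := by
  refine ⟨1 / 100, by norm_num, fun a χ φ ha hχ hφ ε δ hε hε' hδ hδ' C₁ C₂ hC₁ hC₁₂ => ?_⟩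
  have hC₂ : 0 < C₂ := hC₁.trans hC₁₂
  obtain ⟨C, M, hC, hM, hE⟩ := hχ.exists_reducedEnergy_le hφ ha
  have hA : 0 < a * (a ^ 3) ^ (-δ) := by positivity
  have hB : 0 < a ^ (-(1 / 2) : ℝ) * (a ^ 3) ^ (-ε) := by positivity
  have hD : 0 < √(8 * Real.pi * a) := Real.sqrt_pos.2 (by positivity)
  obtain ⟨K, hK, hsc⟩ := exists_scales_le hA hB hD hε hε' hδ'
  obtain ⟨ρmax, hmax, hev⟩ := mem_nhdsGT_iff_exists_Ioo_subset.1
    (eventually_scales hA hB hD hM hε hδ hδ')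
  -- The three summands pay for the scale errors, for the excess density and for the large-box
  -- error, which is taken to be ρ^(5/2+ε) itself. The last bound on ρ is the diluteness condition
  -- in `Params`.
  refine ⟨C * K + 4 * Real.pi * a * (2 * C₂ + C₂ ^ 2) + 1, min ρmax (min 1 (1 / (100 * a ^ 3))),
    by positivity, lt_min hmax (lt_min one_pos (by positivity)), fun ρ hρ hlt => ?_⟩
  rw [lt_min_iff, lt_min_iff] at hlt
  obtain ⟨hρm, hρ1, hρa⟩ := hlt
  obtain ⟨h1, h2, h3, h4⟩ := hev ⟨hρ, hρm⟩
  -- The momentum scale w is built from ρ and not from ρ₀, so that the threshold on L can be fixed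
  -- before ρ₀ is given; ρ₀ < ρ ensures 8π𝔞ρ₀ ≤ w².
  have hw0 : 0 < √(8 * Real.pi * a * ρ) := Real.sqrt_pos.2 (by positivity)
  have hr : 0 < ρ ^ (5 / 2 + ε) := Real.rpow_pos_of_pos hρ _
  have herr := hsc ρ _ _ _ hρ hρ1.le (sqrt_coupling_eq ha) (ell_eq ha hρ δ) (ell0_eq ha hρ ε)
  rw [← sqrt_coupling_eq ha] at h1
  rw [← ell_eq ha hρ] at h2
  rw [← ell_eq ha hρ, ← ell0_eq ha hρ] at h3
  rw [← sqrt_coupling_eq ha, ← ell0_eq ha hρ] at h4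
  obtain ⟨L₀, hL₀⟩ := Filter.eventually_atTop.1 (hE _ _ _ _ hw0 h1 h2 h3 h4 hr)
  refine ⟨max L₀ 1, by positivity, fun L hL ρ₀ hρ₀ hρ₀' _ hub => ?_⟩
  have hP : Params a ρ₀ √(8 * Real.pi * a * ρ) L :=
    { ha := ha
      hρ := hρ₀
      hs := by
        rw [lt_div_iff₀ (by positivity)] at hρa
        nlinarith [pow_pos ha 3]
      hw0 := hw0
      hw := by
        rw [Real.sq_sqrt (by positivity)]
        gcongr
      hL := by linarith [le_max_right L₀ 1] }
  obtain ⟨hfin, hle⟩ := hL₀ L ((le_max_left _ _).trans hL) ρ₀ hP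
  refine ⟨hfin, hle.trans ?_⟩
  have hN : 0 ≤ normSq L (sigma a χ φ (ell a ρ δ) (ell0 a ρ ε) ρ₀ L) :=
    integral_nonneg fun x => sq_nonneg _
  have hcond := condensate_energy_le ha hρ hρ1.le hρ₀.le hN hC₂.le hε' hδ' hub
  have herr' := mul_le_mul_of_nonneg_left herr hC.le
  rw [leeHuangYang_eq ha hρ]
  linarith
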